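/- **Definitions.** For a circle $C=\{x\in\mathbb R^2: \|x-a\|=r\}$, $a=(a_1,a_2)$, $r>0$, the points $(a_1\pm r,a_2)$ (where the tangent line is vertical) are called its *vertical poles* and the points $(a_1,a_2\pm r)$ its *horizontal poles*. An *MBC arrangement* is a pair $(\mathcal S,D)$ of a finite set $\mathcal S$ of circles in $\mathbb R^2$ and a bounded connected component $D$ of $\mathbb R^2\setminus\bigcup_{C\in\mathcal S}C$ such that $\overline D\cap C\ne\emptyset$ for all $C\in\mathcal S$ and, in $\overline D$, distinct circles of $\mathcal S$ intersect transversally, no three distinct circles of $\mathcal S$ have a common point, and no point lying on two distinct circles of $\mathcal S$ (a *crossing point*) is a vertical or horizontal pole of a circle of $\mathcal S$. The *Poincaré–Reeb V-digraph* $W_{D,1}$ is the quotient space of $\overline D$ in which two points are identified if they lie in the same connected component of $\overline D\cap\{x_1=t\}$ for some $t$. Let $q:\overline D\to W_{D,1}$ be the quotient map and $m:W_{D,1}\to\mathbb R$ the function induced by $x_1$. The vertices are the images under $q$ of the vertical poles of circles of $\mathcal S$ and of the crossing points contained in $\overline D$; each vertex $v$ is labelled by $m(v)$, and each edge is oriented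 in the direction in which $m$ increases. $W_{D,2}$ is defined in the same way with $x_2$ and horizontal poles instead of $x_1$ and vertical poles. An isomorphism of V-digraphs is an isomorphism of directed (multi-)graphs that preserves the order of the labels of the vertices. **Theorem 2.** Let $(\mathcal S,D)$ be an MBC arrangement and let $p=(p_1,p_2)\in\overline D$ lie on exactly one circle $C$ of $\mathcal S$. For $r>0$ let $\mathcal S'$ be $\mathcal S$ together with the circle of radius $r$ centred at $p$, and let $D'=D\setminus\{x:\|x-p\|\le r\}$. Then $W_{D,1}$ is a finite graph, and for all sufficiently small $r$ the pair $(\mathcal S',D')$ is an MBC arrangement, $W_{D',1}$ is a finite graph, and $W_{D',1}$ is isomorphic, as a V-digraph, to the V-digraph obtained from $W_{D,1}$ as follows. All new labels, written $i(\cdot)$, are arbitrary real numbers sufficiently close to $p_1$ that satisfy the stated inequalities; "sufficiently close" and "sufficiently small" depend only on $(\mathcal S,D)$ and $p$. 1. *$p$ is neither a vertical nor a horizontal pole of $C$.* - (1.1) If $q(p)$ is not a vertex, then it lies in the interior of an edge $e_0$. Add two vertices $v_1,v_2$ in the interior of $e_0$, a further new vertex $v$, and a new edge $e$ joining $v_1$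 and $v$, such that one of the following holds: $e$ and the part of $e_0$ between $v_1$ and $v_2$ both depart from $v_1$, and $i(v_1)<i(v)<p_1<i(v_2)$; or both enter $v_1$, and $i(v_2)<p_1<i(v)<i(v_1)$. - (1.2) If $v_0=q(p)$ is a vertex, then for suitable edges $e_{0,1}$ entering $v_0$ and $e_{0,2}$ departing from $v_0$ add a vertex $v_1$ in the interior of $e_{0,1}$, a vertex $v_2$ in the interior of $e_{0,2}$, a further new vertex $v$ and a new edge $e$ such that one of the following holds: $e$ departs from $v_1$ and enters $v$, and $i(v_1)<i(v)<p_1=m(v_0)<i(v_2)$; or $e$ departs from $v$ and enters $v_2$, and $i(v_1)<p_1=m(v_0)<i(v)<i(v_2)$. 2. *$p$ is a vertical pole of $C$, and the connected component of $\overline D\cap\{x_1=p_1\}$ containing $p$ contains no vertical pole of a circle of $\mathcal S$ other than $p$ and no crossing point.* Then $v_0=q(p)$ is a vertex with $m(v_0)=p_1$ and one of the following holds. - (2.1) $v_0$ has degree 1, with an edge $e_0$ entering (resp. departing from) $v_0$. Add two vertices $v_1,v_2$ and two edges $e_1,e_2$, where $e_k$ departs from (resp. enters) $v_0$ and enters (resp.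 departs from) $v_k$, and replace the label of $v_0$ by $i(v_0)$, with $i(v_0)<i(v_1)=i(v_2)<p_1$ (resp. $p_1<i(v_1)=i(v_2)<i(v_0)$). - (2.2) $v_0$ has degree 3, with one edge $e_0$ entering (resp. departing from) $v_0$ and two edges $e_{0,1},e_{0,2}$ departing from (resp. entering) $v_0$. Add a vertex $v_k$ in the interior of $e_{0,k}$ ($k=1,2$) and replace the label of $v_0$ by $i(v_0)$, with $i(v_0)<p_1<i(v_1)=i(v_2)$ (resp. $i(v_1)=i(v_2)<p_1<i(v_0)$). 3. *$p$ is a horizontal pole of $C$.* If $q(p)$ is not a vertex, then (3.1) or (3.2) holds, where $e_0$ is the edge with $q(p)$ in its interior, departing from $v_{0,1}$ and entering $v_{0,2}$, so that $m(v_{0,1})<p_1<m(v_{0,2})$. If $v_0=q(p)$ is a vertex, then (3.3) or (3.4) holds, for suitable edges $e_{0,1}$ entering $v_0$ and $e_{0,2}$ departing from $v_0$. - (3.1) Add two vertices $v_1,v_2$ in the interior of $e_0$, with $m(v_{0,1})<i(v_1)<p_1<i(v_2)<m(v_{0,2})$. - (3.2) Do the same as in (3.1), and add a new vertex $v_3$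 with an edge from $v_1$ to $v_3$ and a new vertex $v_4$ with an edge from $v_4$ to $v_2$, with $i(v_1)<i(v_3)<p_1<i(v_4)<i(v_2)$. - (3.3) Add a vertex $v_1$ in the interior of $e_{0,1}$ and a vertex $v_2$ in the interior of $e_{0,2}$, with $i(v_1)<p_1=m(v_0)<i(v_2)$. - (3.4) Do the same as in (3.3), and add a new vertex $v_3$ with an edge from $v_1$ to $v_3$ and a new vertex $v_4$ with an edge from $v_4$ to $v_2$, with $i(v_1)<i(v_3)<p_1=m(v_0)<i(v_4)<i(v_2)$. Labels and orientations that are not mentioned are kept. The same holds for $W_{D,2}$ and $W_{D',2}$ with the two coordinates, and with them vertical and horizontal poles and lines, interchanged. -/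

import Mathlib

/-- The Euclidean plane. The coordinates of `x` are `x 0` (called `x_1` in prose) and `x 1`
(called `x_2`). -/
abbrev Plane : Type := EuclideanSpace ℝ (Fin 2)

/-- A circle in the plane, given by its centre and its positive radius. -/
@[ext]
structure PlaneCircle where
  center : Plane
  radius : ℝ
  radius_pos : 0 < radius

namespace PlaneCircle

/-- The set of points of a circle. -/
def carrier (c : PlaneCircle) : Set Plane := Metric.sphere c.center c.radius

/-- The two points of the circle at which the `i`-th coordinate is extremal.
For `i = 0` these are `(a ± r, b)`, the points with vertical tangent line: the *vertical poles*.
For `i = 1` these are `(a, b ± r)`, the points with horizontal tangent line: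
the *horizontal poles*. -/
def IsPole (c : PlaneCircle) (i : Fin 2) (x : Plane) : Prop :=
  x = c.center + c.radius • EuclideanSpace.single i (1 : ℝ) ∨
    x = c.center - c.radius • EuclideanSpace.single i (1 : ℝ)

/-- The tangent vector space of a circle at one of its points `x`, as a linear subspace of the
plane: the vectors orthogonal to the radius. -/
noncomputable def tangentSpace (c : PlaneCircle) (x : Plane) : Submodule ℝ Plane :=
  (Submodule.span ℝ {x - c.center})ᗮ

end PlaneCircle

/-- `x` lies on (at least) two distinct circles of the family. -/
def IsCrossing (S : Set PlaneCircle) (x : Plane) : Prop :=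
  ∃ c ∈ S, ∃ d ∈ S, c ≠ d ∧ x ∈ c.carrier ∧ x ∈ d.carrier

/-- `(S, D)` is an arrangement of circles for Morse-Bott functions (MBC arrangement). -/
structure IsMBC (S : Set PlaneCircle) (D : Set Plane) : Prop where
  finite : S.Finite
  /-- `D` is a connected component of the complement of the union of the circles. -/
  component : ∃ x ∈ (⋃ c ∈ S, c.carrier)ᶜ, D = connectedComponentIn (⋃ c ∈ S, c.carrier)ᶜ x
  bounded : Bornology.IsBounded D
  meets : ∀ c ∈ S, (closure D ∩ c.carrier).Nonempty
  /-- In the closure of `D`, distinct circles intersect transversally. -/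
  transversal : ∀ c ∈ S, ∀ d ∈ S, c ≠ d → ∀ x ∈ closure D, x ∈ c.carrier → x ∈ d.carrier →
    c.tangentSpace x ⊔ d.tangentSpace x = ⊤
  /-- In the closure of `D`, three distinct circles have no common point. -/
  no_triple : ∀ c ∈ S, ∀ d ∈ S, ∀ e ∈ S, c ≠ d → c ≠ e → d ≠ e → ∀ x ∈ closure D,
    ¬ (x ∈ c.carrier ∧ x ∈ d.carrier ∧ x ∈ e.carrier)
  /-- The crossing points in the closure of `D` are not poles. -/
  no_pole : ∀ x ∈ closure D, IsCrossing S x → ∀ c ∈ S, ∀ k : Fin 2, ¬ c.IsPole k x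

/-! ### The Poincaré-Reeb space -/

/-- The preimage of `t` under the `i`-th coordinate function restricted to the closure of `D`. -/
def levelSet (D : Set Plane) (i : Fin 2) (t : ℝ) : Set Plane := {z | z ∈ closure D ∧ z i = t}

/-- The connected component containing `x` of the level set through `x`. -/
def levelComponent (D : Set Plane) (i : Fin 2) (x : Plane) : Set Plane :=
  connectedComponentIn (levelSet D i (x i)) x

/-- Two points of the closure of `D` are identified if and only if they lie in the same connected
component of the same level set. -/
def prSetoid (D : Set Plane) (i : Fin 2) : Setoid (closure D) :=
  Setoid.ker fun x : closure D => levelComponent D i (x : Plane)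

/-- The quotient space of the closure of `D`, with the quotient topology. -/
abbrev PRSpace (D : Set Plane) (i : Fin 2) : Type := Quotient (prSetoid D i)

/-- The quotient map. -/
def prMk (D : Set Plane) (i : Fin 2) (x : closure D) : PRSpace D i := Quotient.mk (prSetoid D i) x

theorem prSetoid_coord {D : Set Plane} {i : Fin 2} (x y : closure D)
    (h : (prSetoid D i) x y) : (x : Plane) i = (y : Plane) i := by
  have h1 : levelComponent D i (x : Plane) = levelComponent D i (y : Plane) := h
  have h2 : (x : Plane) ∈ levelComponent D i (x : Plane) :=
    mem_connectedComponentIn ⟨x.2, rfl⟩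
  rw [h1] at h2
  exact (connectedComponentIn_subset _ _ h2).2

/-- The function on the quotient space induced by the `i`-th coordinate. -/
def prHeight (D : Set Plane) (i : Fin 2) : PRSpace D i → ℝ :=
  Quotient.lift (fun x : closure D => (x : Plane) i) prSetoid_coord

/-- The vertices: the points of the quotient space whose preimage contains a pole for the `i`-th
coordinate (a point of a circle at which the `i`-th coordinate is extremal), or a point on
two distinct circles. -/
def prVertices (S : Set PlaneCircle) (D : Set Plane) (i : Fin 2) : Set (PRSpace D i) :=
  {v | ∃ x : closure D, prMk D i x = v ∧
    ((∃ c ∈ S, c.IsPole i (x : Plane)) ∨ IsCrossing S (x : Plane))}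

/-! ### Labelled digraphs -/

/-- A directed graph (multiple edges allowed) whose vertices are labelled by real numbers.
It is an oriented V-graph if the label increases along each edge; this holds for all
Poincaré-Reeb graphs below, and therefore for every labelled digraph isomorphic to one. -/
structure LabelledDigraph where
  V : Type
  E : Type
  src : E → V
  tgt : E → V
  label : V → ℝ

namespace LabelledDigraph

/-- An isomorphism of V-digraphs: an isomorphism of directed graphs that preserves the order of
the labels of the vertices. -/
structure Iso (G H : LabelledDigraph) where
  onV : G.V ≃ H.V
  onE : G.E ≃ H.E
  src_comm : ∀ e, H.src (onE e) = onV (G.src e)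
  tgt_comm : ∀ e, H.tgt (onE e) = onV (G.tgt e)
  label_lt_iff : ∀ v w, H.label (onV v) < H.label (onV w) ↔ G.label v < G.label w

/-- The graphs are isomorphic as V-digraphs. -/
def Isomorphic (G H : LabelledDigraph) : Prop := Nonempty (Iso G H)

/-- The number of edges containing a vertex. -/
noncomputable def degree (G : LabelledDigraph) (v : G.V) : ℕ := {e | G.src e = v ∨ G.tgt e = v}.ncard

open Classical in
/-- Add a new vertex with label `a` in the interior of the edge `e`. The old vertices are
`some v`, the new vertex is `none`; the edge `some e` now runs from the source of `e` to the new
vertex, the edge `none` from the new vertex to the target of `e`; the other edges `some f` are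
unchanged. -/
noncomputable def subdivide (G : LabelledDigraph) (e : G.E) (a : ℝ) : LabelledDigraph where
  V := Option G.V
  E := Option G.E
  src f := f.elim none fun g => some (G.src g)
  tgt f := f.elim (some (G.tgt e)) fun g => if g = e then none else some (G.tgt g)
  label w := w.elim a G.label

/-- Add a new vertex `none` with label `a` and a new edge `none` from `v` to it. -/
def addOut (G : LabelledDigraph) (v : G.V) (a : ℝ) : LabelledDigraph where
  V := Option G.V
  E := Option G.E
  src f := f.elim (some v) fun g => some (G.src g)
  tgt f := f.elim none fun g => some (G.tgt g)
  label w := w.elim a G.label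

/-- Add a new vertex `none` with label `a` and a new edge `none` from it to `v`. -/
def addIn (G : LabelledDigraph) (v : G.V) (a : ℝ) : LabelledDigraph where
  V := Option G.V
  E := Option G.E
  src f := f.elim none fun g => some (G.src g)
  tgt f := f.elim (some v) fun g => some (G.tgt g)
  label w := w.elim a G.label

open Classical in
/-- Replace the label of the vertex `v` by `a`. -/
noncomputable def relabel (G : LabelledDigraph) (v : G.V) (a : ℝ) : LabelledDigraph where
  V := G.V
  E := G.E
  src := G.src
  tgt := G.tgt
  label := Function.update G.label v a

/-- Add two vertices in the interior of the edge `e`: first the vertex `some none` with label `a`,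
then, between it and the target of `e`, the vertex `none` with label `b`. -/
noncomputable def subdivideTwice (G : LabelledDigraph) (e : G.E) (a b : ℝ) : LabelledDigraph :=
  (G.subdivide e a).subdivide (none : Option G.E) b

/-- For two distinct edges `e` and `f`, add a vertex `some none` with label `a` in the interior of
`e` and a vertex `none` with label `b` in the interior of `f`. -/
noncomputable def subdividePair (G : LabelledDigraph) (e f : G.E) (a b : ℝ) : LabelledDigraph :=
  (G.subdivide e a).subdivide (some f : Option G.E) b

end LabelledDigraph

/-! ### The Poincaré-Reeb V-digraph -/

/-- A structure of a finite graph (a finite one-dimensional CW complex) on the quotient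
space whose `0`-cells are exactly the points of `prVertices S D i` and whose edges are
oriented, and whose vertices are labelled, by the function `prHeight D i`.
The underlying labelled digraph is the Poincaré-Reeb V-digraph of `(S, D)` for the `i`-th
coordinate. -/
structure PoincareReebGraph (S : Set PlaneCircle) (D : Set Plane) (i : Fin 2)
    extends LabelledDigraph where
  t2 : T2Space (PRSpace D i)
  finite_V : Finite V
  finite_E : Finite E
  /-- The point of the quotient space that is the given vertex. -/
  pt : V → PRSpace D i
  pt_injective : Function.Injective pt
  range_pt : Set.range pt = prVertices S D i
  label_eq : ∀ v, label v = prHeight D i (pt v)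
  /-- The characteristic map of an edge. -/
  path : E → unitInterval → PRSpace D i
  path_continuous : ∀ e, Continuous (path e)
  path_zero : ∀ e, path e 0 = pt (src e)
  path_one : ∀ e, path e 1 = pt (tgt e)
  /-- Edges are oriented by the height function. -/
  path_strictMono : ∀ e, StrictMono fun s => prHeight D i (path e s)
  /-- Open edges contain no vertex. -/
  path_not_vertex : ∀ e s, 0 < s → s < 1 → path e s ∉ prVertices S D i
  /-- The points that are not vertices are covered by the open edges, exactly once. -/
  path_cover : ∀ z, z ∉ prVertices S D i →
    ∃! es : E × unitInterval, 0 < es.2 ∧ es.2 < 1 ∧ path es.1 es.2 = z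

namespace PoincareReebGraph

variable {S : Set PlaneCircle} {D : Set Plane} {i : Fin 2}

/-- The point `z` lies in the interior of the edge `e`. -/
def InEdge (W : PoincareReebGraph S D i) (e : W.E) (z : PRSpace D i) : Prop :=
  ∃ s : unitInterval, 0 < s ∧ s < 1 ∧ W.path e s = z

/-! In the following, `H` is the V-digraph after the change, `z` is the image in the quotient space
of the centre of the new circle, `t = prHeight D i z` is the value there, and a real number is
sufficiently close to `t` if its distance from `t` is less than `δ`. -/

/-- The centre is not a pole, and is not mapped to a vertex. -/
def ChangeGenericEdge (W : PoincareReebGraph S D i) (z : PRSpace D i) (δ : ℝ)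
    (H : LabelledDigraph) : Prop :=
  ∃ e₀ : W.E, W.InEdge e₀ z ∧
    ((∀ a₁ a a₂ : ℝ, prHeight D i z - δ < a₁ → a₁ < a → a < prHeight D i z →
        prHeight D i z < a₂ → a₂ < prHeight D i z + δ →
        H.Isomorphic ((W.subdivideTwice e₀ a₁ a₂).addOut (some none : Option (Option W.V)) a)) ∨
      (∀ a₁ a a₂ : ℝ, prHeight D i z - δ < a₂ → a₂ < prHeight D i z → prHeight D i z < a →
        a < a₁ → a₁ < prHeight D i z + δ →
        H.Isomorphic ((W.subdivideTwice e₀ a₂ a₁).addIn (none : Option (Option W.V)) a)))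

/-- The centre is not a pole, and is mapped to a vertex. -/
def ChangeGenericVertex (W : PoincareReebGraph S D i) (z : PRSpace D i) (δ : ℝ)
    (H : LabelledDigraph) : Prop :=
  ∃ (v₀ : W.V) (e₁ e₂ : W.E), W.pt v₀ = z ∧ W.tgt e₁ = v₀ ∧ W.src e₂ = v₀ ∧
    ((∀ a₁ a a₂ : ℝ, prHeight D i z - δ < a₁ → a₁ < a → a < prHeight D i z →
        prHeight D i z < a₂ → a₂ < prHeight D i z + δ →
        H.Isomorphic
          ((W.subdividePair e₁ e₂ a₁ a₂).addOut (some none : Option (Option W.V)) a)) ∨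
      (∀ a₁ a a₂ : ℝ, prHeight D i z - δ < a₁ → a₁ < prHeight D i z → prHeight D i z < a →
        a < a₂ → a₂ < prHeight D i z + δ →
        H.Isomorphic ((W.subdividePair e₁ e₂ a₁ a₂).addIn (none : Option (Option W.V)) a)))

/-- The centre is a pole for the `i`-th coordinate, and its image is a vertex of degree one, at
which two new edges are added. -/
def ChangePoleDegreeOne (W : PoincareReebGraph S D i) (z : PRSpace D i) (δ : ℝ)
    (H : LabelledDigraph) : Prop :=
  ∃ (v₀ : W.V) (e₀ : W.E), W.pt v₀ = z ∧ W.degree v₀ = 1 ∧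
    ((W.tgt e₀ = v₀ ∧ ∀ a₀ b : ℝ, prHeight D i z - δ < a₀ → a₀ < b → b < prHeight D i z →
        H.Isomorphic (((W.relabel v₀ a₀).addOut v₀ b).addOut (some v₀ : Option W.V) b)) ∨
      (W.src e₀ = v₀ ∧ ∀ a₀ b : ℝ, prHeight D i z < b → b < a₀ → a₀ < prHeight D i z + δ →
        H.Isomorphic (((W.relabel v₀ a₀).addIn v₀ b).addIn (some v₀ : Option W.V) b)))

/-- The centre is a pole for the `i`-th coordinate, and its image is a vertex of degree three, two
of whose edges are subdivided. -/
def ChangePoleDegreeThree (W : PoincareReebGraph S D i) (z : PRSpace D i) (δ : ℝ)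
    (H : LabelledDigraph) : Prop :=
  ∃ (v₀ : W.V) (e₀ e₁ e₂ : W.E), W.pt v₀ = z ∧ W.degree v₀ = 3 ∧ e₁ ≠ e₂ ∧
    ((W.tgt e₀ = v₀ ∧ W.src e₁ = v₀ ∧ W.src e₂ = v₀ ∧
        ∀ a₀ b : ℝ, prHeight D i z - δ < a₀ → a₀ < prHeight D i z → prHeight D i z < b →
          b < prHeight D i z + δ → H.Isomorphic ((W.relabel v₀ a₀).subdividePair e₁ e₂ b b)) ∨
      (W.src e₀ = v₀ ∧ W.tgt e₁ = v₀ ∧ W.tgt e₂ = v₀ ∧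
        ∀ a₀ b : ℝ, prHeight D i z - δ < b → b < prHeight D i z → prHeight D i z < a₀ →
          a₀ < prHeight D i z + δ → H.Isomorphic ((W.relabel v₀ a₀).subdividePair e₁ e₂ b b)))

/-- The centre is a pole for the other coordinate, is not mapped to a vertex, and two vertices are
added. -/
def ChangeOtherPoleEdge (W : PoincareReebGraph S D i) (z : PRSpace D i) (δ : ℝ)
    (H : LabelledDigraph) : Prop :=
  ∃ e₀ : W.E, W.InEdge e₀ z ∧
    ∀ a₁ a₂ : ℝ, prHeight D i z - δ < a₁ → a₁ < prHeight D i z → prHeight D i z < a₂ →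
      a₂ < prHeight D i z + δ → H.Isomorphic (W.subdivideTwice e₀ a₁ a₂)

/-- The centre is a pole for the other coordinate, is not mapped to a vertex, and two vertices and
two further edges are added. -/
def ChangeOtherPoleEdgeBranch (W : PoincareReebGraph S D i) (z : PRSpace D i) (δ : ℝ)
    (H : LabelledDigraph) : Prop :=
  ∃ e₀ : W.E, W.InEdge e₀ z ∧
    ∀ a₁ a₂ a₃ a₄ : ℝ, prHeight D i z - δ < a₁ → a₁ < a₃ → a₃ < prHeight D i z →
      prHeight D i z < a₄ → a₄ < a₂ → a₂ < prHeight D i z + δ →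
      H.Isomorphic
        (((W.subdivideTwice e₀ a₁ a₂).addOut (some none : Option (Option W.V)) a₃).addIn
          (some none : Option (Option (Option W.V))) a₄)

/-- The centre is a pole for the other coordinate, is mapped to a vertex, and two vertices are
added. -/
def ChangeOtherPoleVertex (W : PoincareReebGraph S D i) (z : PRSpace D i) (δ : ℝ)
    (H : LabelledDigraph) : Prop :=
  ∃ (v₀ : W.V) (e₁ e₂ : W.E), W.pt v₀ = z ∧ W.tgt e₁ = v₀ ∧ W.src e₂ = v₀ ∧
    ∀ a₁ a₂ : ℝ, prHeight D i z - δ < a₁ → a₁ < prHeight D i z → prHeight D i z < a₂ →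
      a₂ < prHeight D i z + δ → H.Isomorphic (W.subdividePair e₁ e₂ a₁ a₂)

/-- The centre is a pole for the other coordinate, is mapped to a vertex, and two vertices and two
further edges are added. -/
def ChangeOtherPoleVertexBranch (W : PoincareReebGraph S D i) (z : PRSpace D i) (δ : ℝ)
    (H : LabelledDigraph) : Prop :=
  ∃ (v₀ : W.V) (e₁ e₂ : W.E), W.pt v₀ = z ∧ W.tgt e₁ = v₀ ∧ W.src e₂ = v₀ ∧
    ∀ a₁ a₂ a₃ a₄ : ℝ, prHeight D i z - δ < a₁ → a₁ < a₃ → a₃ < prHeight D i z →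
      prHeight D i z < a₄ → a₄ < a₂ → a₂ < prHeight D i z + δ →
      H.Isomorphic
        (((W.subdividePair e₁ e₂ a₁ a₂).addOut (some none : Option (Option W.V)) a₃).addIn
          (some none : Option (Option (Option W.V))) a₄)

end PoincareReebGraph

/-!
The idea is to compare two drawings of digraphs in one quotient space. A drawing
(`LabelledDigraph.Realization`) of a digraph in a space with a height function consists of points
for the vertices and of sections of the height function for the edges. If two digraphs are drawn
with the same vertices, if the open edges cover the rest of the space, and if the height function is
locally injective there, then the digraphs are isomorphic (`Realization.isomorphic`): open edges
that share a point run together until both end in the same vertex. Hence it suffices to draw the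
modified V-digraph in the quotient space of the new closed set, with the right vertices, and to
compare the order of the labels with that of the heights
(`PoincareReebGraph.isomorphic_of_realization`).

*The quotient space is a graph.* Its points are the maximal segments of the closure of `D`
in the lines on which the coordinate `i` is constant (`prMk_eq_iff`). It is compact and Hausdorff, its
fibres over the line are finite, and outside the finitely many vertices the height function has
local sections (`IsMBC.hasLocalSection`), because near a point on only one circle `D` is one side of
this circle (`IsMBC.eventually_mem`). The open edges are the images of the maximal sections
(`exists_realization`).

*The new arrangement.* Near its centre `p`, the set `D` is one side of the circle `c`. Half an
annulus around `p` is connected, so that the removal of a small disc does not disconnect `D`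
(`IsMBC.isMBC_cut`).

*The centre is not a pole for the height.* Then `D` lies on one side of `p` in the direction of the
other coordinate. A fibre that is cut by the disc keeps its part that ends on the arc of the new
circle on this side, and so the old quotient space embeds in the new one (`Dent.exists_embedding`).
The rest of the new space comes from the opposite arc, which lies in the closure of `D` near those
poles of the new circle that do: each of them gives one additional edge. Where this happens is
decided by the sign of a component of the normal of `c`, and if it vanishes, by the side of `c`
on which `D` lies (`exists_arc_end`).

*The centre is a pole for the height.* Since `p` is alone in its fibre, the old quotient space
near the image of `p` consists of one edge in the direction of `D` and, if `D` is outside `c`, of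
two edges in the opposite direction (`PoleCut.exists_star`). In the new space the vertex has moved
along the first edge to a pole of the new circle (`Realization.exists_relocate`,
`PoleCut.exists_relocated`). If `D` is inside `c`, the two arcs of the new circle form two new edges;
if `D` is outside `c`, they prolong the two other edges, on which the ends of the arcs are new
vertices. The two directions are treated together, by means of the height in the direction of `D`.
-/

open Set Topology Filter

/-! ### Drawings of digraphs -/

/-- Two sections of `h` over an interval with values in a set on which `h` is locally injective
agree everywhere if they agree at one point. -/
theorem sections_agree {X : Type} [TopologicalSpace X] [T2Space X] {h : X → ℝ} {O : Set X}
    (hinj : ∀ z ∈ O, ∃ N ∈ 𝓝 z, InjOn h N) {J : Set ℝ} (hJ : IsPreconnected J)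
    {σ τ : ℝ → X} (hσ : ContinuousOn σ J) (hτ : ContinuousOn τ J)
    (hhσ : ∀ s ∈ J, h (σ s) = s) (hhτ : ∀ s ∈ J, h (τ s) = s) (hO : ∀ s ∈ J, σ s ∈ O)
    {s₀ : ℝ} (hs₀ : s₀ ∈ J) (h0 : σ s₀ = τ s₀) : EqOn σ τ J := by
  have : PreconnectedSpace J := isPreconnected_iff_preconnectedSpace.1 hJ
  have cσ : Continuous (fun s : J => σ s) := continuousOn_iff_continuous_domRestrict.1 hσ
  have cτ : Continuous (fun s : J => τ s) := continuousOn_iff_continuous_domRestrict.1 hτ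
  have hcl : IsClosed {s : J | σ s = τ s} := isClosed_eq cσ cτ
  have hop : IsOpen {s : J | σ s = τ s} := by
    rw [isOpen_iff_mem_nhds]
    intro s hs
    obtain ⟨N, hN, hNi⟩ := hinj _ (hO s s.2)
    have h1 := cσ.continuousAt.preimage_mem_nhds hN
    have h2 := cτ.continuousAt.preimage_mem_nhds (show N ∈ 𝓝 (τ s) from hs ▸ hN)
    filter_upwards [h1, h2] with u hu1 hu2
    exact hNi hu1 hu2 ((hhσ u u.2).trans (hhτ u u.2).symm)
  have huniv := IsClopen.eq_univ ⟨hcl, hop⟩ ⟨⟨s₀, hs₀⟩, h0⟩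
  intro s hs
  have : (⟨s, hs⟩ : J) ∈ {s : J | σ s = τ s} := huniv ▸ mem_univ _
  exact this

namespace LabelledDigraph

/-- A drawing of the digraph `Γ` in a space `X` with a height function `h`. The vertices are the
points of `Vs`, and each edge is a section of `h` over the interval between the heights of its two
ends; the open edges partition the set `O`. The sections are functions on all of `ℝ`, whose values
outside that interval are irrelevant. The labels of `Γ` play no role. -/
structure Realization (Γ : LabelledDigraph) {X : Type} [TopologicalSpace X] (h : X → ℝ)
    (Vs O : Set X) where
  pt : Γ.V → X
  pt_injective : Function.Injective pt
  range_pt : Set.range pt = Vs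
  sec : Γ.E → ℝ → X
  lt : ∀ e, h (pt (Γ.src e)) < h (pt (Γ.tgt e))
  continuousOn : ∀ e, ContinuousOn (sec e) (Icc (h (pt (Γ.src e))) (h (pt (Γ.tgt e))))
  height : ∀ e, ∀ s ∈ Icc (h (pt (Γ.src e))) (h (pt (Γ.tgt e))), h (sec e s) = s
  sec_src : ∀ e, sec e (h (pt (Γ.src e))) = pt (Γ.src e)
  sec_tgt : ∀ e, sec e (h (pt (Γ.tgt e))) = pt (Γ.tgt e)
  sec_mem : ∀ e, ∀ s ∈ Ioo (h (pt (Γ.src e))) (h (pt (Γ.tgt e))), sec e s ∈ O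
  cover : ∀ z ∈ O, ∃! e, h z ∈ Ioo (h (pt (Γ.src e))) (h (pt (Γ.tgt e))) ∧ sec e (h z) = z

namespace Realization

variable {Γ Γ' : LabelledDigraph} {X : Type} [TopologicalSpace X] {h : X → ℝ} {Vs O : Set X}

theorem pt_mem (R : Realization Γ h Vs O) (v : Γ.V) : R.pt v ∈ Vs :=
  (Set.ext_iff.1 R.range_pt _).1 (mem_range_self v)

theorem exists_pt (R : Realization Γ h Vs O) {z : X} (hz : z ∈ Vs) : ∃ v, R.pt v = z :=
  (Set.ext_iff.1 R.range_pt z).2 hz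

/-- The height of the source of an edge. -/
def lo (R : Realization Γ h Vs O) (e : Γ.E) : ℝ := h (R.pt (Γ.src e))

/-- The height of the target of an edge. -/
def hi (R : Realization Γ h Vs O) (e : Γ.E) : ℝ := h (R.pt (Γ.tgt e))

theorem edge_unique (R : Realization Γ h Vs O) {e e' : Γ.E} {s : ℝ} (hs : s ∈ Ioo (R.lo e) (R.hi e))
    (hs' : s ∈ Ioo (R.lo e') (R.hi e')) (he : R.sec e s = R.sec e' s) : e = e' := by
  have h1 := R.height e s (Ioo_subset_Icc_self hs)
  obtain ⟨f, -, hf⟩ := R.cover _ (R.sec_mem e s hs)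
  rw [hf e ⟨by rw [h1]; exact hs, by rw [h1]⟩, hf e' ⟨by rw [h1]; exact hs', by rw [h1, he]⟩]

/-- Near an interior height, two open edges which share a point agree; hence one of them cannot
run into a vertex before the other does. -/
theorem hi_le_of_meet [T2Space X] (hd : Disjoint Vs O) (hinj : ∀ z ∈ O, ∃ N ∈ 𝓝 z, InjOn h N)
    (R : Realization Γ h Vs O) (R' : Realization Γ' h Vs O) {e : Γ.E} {e' : Γ'.E} {s : ℝ}
    (hs : s ∈ Ioo (R.lo e) (R.hi e)) (hs' : s ∈ Ioo (R'.lo e') (R'.hi e'))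
    (he : R.sec e s = R'.sec e' s) : R'.hi e' ≤ R.hi e := by
  by_contra! hlt
  have hJ : EqOn (R.sec e) (R'.sec e') (Ico s (R.hi e)) := by
    refine sections_agree hinj isPreconnected_Ico
      ((R.continuousOn e).mono ?_) ((R'.continuousOn e').mono ?_) ?_ ?_ ?_
      (left_mem_Ico.2 hs.2) he
    · exact fun u hu => ⟨(hs.1.trans_le hu.1).le, hu.2.le⟩
    · exact fun u hu => ⟨(hs'.1.trans_le hu.1).le, (hu.2.trans hlt).le⟩
    · exact fun u hu => R.height e u ⟨(hs.1.trans_le hu.1).le, hu.2.le⟩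
    · exact fun u hu => R'.height e' u ⟨(hs'.1.trans_le hu.1).le, (hu.2.trans hlt).le⟩
    · exact fun u hu => R.sec_mem e u ⟨(hs.1.trans_le hu.1), hu.2⟩
  have hJ' : EqOn (R.sec e) (R'.sec e') (Icc s (R.hi e)) := by
    have := hJ.of_subset_closure (t := Icc s (R.hi e))
      ((R.continuousOn e).mono fun u hu => ⟨(hs.1.trans_le hu.1).le, hu.2⟩)
      ((R'.continuousOn e').mono fun u hu => ⟨(hs'.1.trans_le hu.1).le, (hu.2.trans_lt hlt).le⟩)
      Ico_subset_Icc_self (by rw [closure_Ico hs.2.ne])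
    exact this
  have h1 := hJ' (right_mem_Icc.2 hs.2.le)
  have h2 : R'.sec e' (R.hi e) ∈ O := R'.sec_mem e' _ ⟨hs'.1.trans hs.2, hlt⟩
  rw [← h1] at h2
  have h3 : R.sec e (R.hi e) = R.pt (Γ.tgt e) := R.sec_tgt e
  rw [h3] at h2
  exact hd.le_bot ⟨R.pt_mem _, h2⟩

theorem lo_le_of_meet [T2Space X] (hd : Disjoint Vs O) (hinj : ∀ z ∈ O, ∃ N ∈ 𝓝 z, InjOn h N)
    (R : Realization Γ h Vs O) (R' : Realization Γ' h Vs O) {e : Γ.E} {e' : Γ'.E} {s : ℝ}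
    (hs : s ∈ Ioo (R.lo e) (R.hi e)) (hs' : s ∈ Ioo (R'.lo e') (R'.hi e'))
    (he : R.sec e s = R'.sec e' s) : R.lo e ≤ R'.lo e' := by
  by_contra! hlt
  have hJ : EqOn (R.sec e) (R'.sec e') (Ioc (R.lo e) s) := by
    refine sections_agree hinj isPreconnected_Ioc
      ((R.continuousOn e).mono ?_) ((R'.continuousOn e').mono ?_) ?_ ?_ ?_
      (right_mem_Ioc.2 hs.1) he
    · exact fun u hu => ⟨hu.1.le, (hu.2.trans_lt hs.2).le⟩
    · exact fun u hu => ⟨(hlt.trans hu.1).le, (hu.2.trans_lt hs'.2).le⟩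
    · exact fun u hu => R.height e u ⟨hu.1.le, (hu.2.trans_lt hs.2).le⟩
    · exact fun u hu => R'.height e' u ⟨(hlt.trans hu.1).le, (hu.2.trans_lt hs'.2).le⟩
    · exact fun u hu => R.sec_mem e u ⟨hu.1, (hu.2.trans_lt hs.2)⟩
  have hJ' : EqOn (R.sec e) (R'.sec e') (Icc (R.lo e) s) := by
    have := hJ.of_subset_closure (t := Icc (R.lo e) s)
      ((R.continuousOn e).mono fun u hu => ⟨hu.1, (hu.2.trans_lt hs.2).le⟩)
      ((R'.continuousOn e').mono fun u hu => ⟨(hlt.trans_le hu.1).le, (hu.2.trans_lt hs'.2).le⟩)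
      Ioc_subset_Icc_self (by rw [closure_Ioc hs.1.ne])
    exact this
  have h1 := hJ' (left_mem_Icc.2 hs.1.le)
  have h2 : R'.sec e' (R.lo e) ∈ O := R'.sec_mem e' _ ⟨hlt, hs.1.trans hs'.2⟩
  rw [← h1] at h2
  have h3 : R.sec e (R.lo e) = R.pt (Γ.src e) := R.sec_src e
  rw [h3] at h2
  exact hd.le_bot ⟨R.pt_mem _, h2⟩

/-- Two edges of two drawings with the same vertices and the same open part which share an interior
point have the same ends. -/
theorem ends_eq_of_meet [T2Space X] (hd : Disjoint Vs O) (hinj : ∀ z ∈ O, ∃ N ∈ 𝓝 z, InjOn h N)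
    (R : Realization Γ h Vs O) (R' : Realization Γ' h Vs O) {e : Γ.E} {e' : Γ'.E} {s : ℝ}
    (hs : s ∈ Ioo (R.lo e) (R.hi e)) (hs' : s ∈ Ioo (R'.lo e') (R'.hi e'))
    (he : R.sec e s = R'.sec e' s) :
    R.pt (Γ.src e) = R'.pt (Γ'.src e') ∧ R.pt (Γ.tgt e) = R'.pt (Γ'.tgt e') ∧
      R.lo e = R'.lo e' ∧ R.hi e = R'.hi e' ∧ EqOn (R.sec e) (R'.sec e') (Icc (R.lo e) (R.hi e)) := by
  have hh : R.hi e = R'.hi e' := le_antisymm (hi_le_of_meet hd hinj R' R hs' hs he.symm)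
    (hi_le_of_meet hd hinj R R' hs hs' he)
  have hl : R.lo e = R'.lo e' := le_antisymm (lo_le_of_meet hd hinj R R' hs hs' he)
    (lo_le_of_meet hd hinj R' R hs' hs he.symm)
  have hc : ContinuousOn (R.sec e) (Icc (R.lo e) (R.hi e)) := R.continuousOn e
  have hc' : ContinuousOn (R'.sec e') (Icc (R.lo e) (R.hi e)) := by
    rw [hl, hh]; exact R'.continuousOn e'
  have hht : ∀ u ∈ Icc (R.lo e) (R.hi e), h (R.sec e u) = u := R.height e
  have hht' : ∀ u ∈ Icc (R.lo e) (R.hi e), h (R'.sec e' u) = u := by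
    rw [hl, hh]; exact R'.height e'
  have hJ : EqOn (R.sec e) (R'.sec e') (Ioo (R.lo e) (R.hi e)) :=
    sections_agree hinj isPreconnected_Ioo (hc.mono Ioo_subset_Icc_self)
      (hc'.mono Ioo_subset_Icc_self) (fun u hu => hht u (Ioo_subset_Icc_self hu))
      (fun u hu => hht' u (Ioo_subset_Icc_self hu)) (R.sec_mem e) hs he
  have hJ' : EqOn (R.sec e) (R'.sec e') (Icc (R.lo e) (R.hi e)) :=
    hJ.of_subset_closure hc hc' Ioo_subset_Icc_self
      (by rw [closure_Ioo (hs.1.trans hs.2).ne])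
  refine ⟨?_, ?_, hl, hh, hJ'⟩
  · have h1 := hJ' (left_mem_Icc.2 (hs.1.trans hs.2).le)
    have h2 : R.sec e (R.lo e) = _ := R.sec_src e
    have h3 : R'.sec e' (R'.lo e') = _ := R'.sec_src e'
    rw [← h2, ← h3, ← hl, h1]
  · have h1 := hJ' (right_mem_Icc.2 (hs.1.trans hs.2).le)
    have h2 : R.sec e (R.hi e) = _ := R.sec_tgt e
    have h3 : R'.sec e' (R'.hi e') = _ := R'.sec_tgt e'
    rw [← h2, ← h3, ← hh, h1]

theorem exists_meet (R : Realization Γ h Vs O) (R' : Realization Γ' h Vs O) (e : Γ.E) :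
    ∃ e' : Γ'.E, ∃ s, s ∈ Ioo (R.lo e) (R.hi e) ∧ s ∈ Ioo (R'.lo e') (R'.hi e') ∧
      R.sec e s = R'.sec e' s := by
  obtain ⟨s, hs⟩ := exists_between (R.lt e)
  have h1 := R.height e s (Ioo_subset_Icc_self hs)
  obtain ⟨e', ⟨h2, h3⟩, -⟩ := R'.cover _ (R.sec_mem e s hs)
  rw [h1] at h2 h3
  exact ⟨e', s, hs, h2, h3.symm⟩

theorem meet_unique [T2Space X] (hd : Disjoint Vs O) (hinj : ∀ z ∈ O, ∃ N ∈ 𝓝 z, InjOn h N)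
    (R : Realization Γ h Vs O) (R' : Realization Γ' h Vs O) {e f : Γ.E} {e' : Γ'.E} {s u : ℝ}
    (hs : s ∈ Ioo (R.lo e) (R.hi e)) (hs' : s ∈ Ioo (R'.lo e') (R'.hi e'))
    (he : R.sec e s = R'.sec e' s)
    (hu : u ∈ Ioo (R.lo f) (R.hi f)) (hu' : u ∈ Ioo (R'.lo e') (R'.hi e'))
    (hf : R.sec f u = R'.sec e' u) : e = f := by
  obtain ⟨-, -, h1, h2, h3⟩ := ends_eq_of_meet hd hinj R R' hs hs' he
  have hu'' : u ∈ Ioo (R.lo e) (R.hi e) := by rw [h1, h2]; exact hu'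
  exact R.edge_unique hu'' hu ((h3 (Ioo_subset_Icc_self hu'')).trans hf.symm)

/-- Digraphs drawn with the same vertices and the same open part are isomorphic as V-digraphs, if
their labels are ordered like the heights of the vertices. -/
theorem isomorphic [T2Space X] (hd : Disjoint Vs O) (hinj : ∀ z ∈ O, ∃ N ∈ 𝓝 z, InjOn h N)
    (R : Realization Γ h Vs O) (R' : Realization Γ' h Vs O)
    (hl : ∀ v w, Γ.label v < Γ.label w ↔ h (R.pt v) < h (R.pt w))
    (hl' : ∀ v w, Γ'.label v < Γ'.label w ↔ h (R'.pt v) < h (R'.pt w)) : Isomorphic Γ Γ' := by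
  have hV : ∀ v : Γ.V, ∃ v' : Γ'.V, R'.pt v' = R.pt v := fun v => R'.exists_pt (R.pt_mem v)
  have hV' : ∀ v : Γ'.V, ∃ v' : Γ.V, R.pt v' = R'.pt v := fun v => R.exists_pt (R'.pt_mem v)
  choose f hf using hV
  choose g hg using hV'
  choose a s ha hb hc using exists_meet R R'
  choose b u ha' hb' hc' using exists_meet R' R
  refine ⟨⟨⟨f, g, fun v => R.pt_injective (by rw [hg, hf]), fun v => R'.pt_injective
    (by rw [hf, hg])⟩, ⟨a, b, fun e => ?_, fun e => ?_⟩, fun e => ?_, fun e => ?_, fun v w => ?_⟩⟩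
  · exact meet_unique hd hinj R R' (hb' (a e)) (ha' (a e)) (hc' (a e)).symm (ha e) (hb e) (hc e)
  · exact meet_unique hd hinj R' R (hb (b e)) (ha (b e)) (hc (b e)).symm (ha' e) (hb' e) (hc' e)
  · exact R'.pt_injective ((ends_eq_of_meet hd hinj R R' (ha e) (hb e) (hc e)).1.symm.trans
      (hf _).symm)
  · exact R'.pt_injective ((ends_eq_of_meet hd hinj R R' (ha e) (hb e) (hc e)).2.1.symm.trans
      (hf _).symm)
  · show Γ'.label (f v) < Γ'.label (f w) ↔ _
    rw [hl', hl, hf, hf]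

/-- A point in the interior of an edge becomes a vertex. -/
noncomputable def mark (R : Realization Γ h Vs O) (hd : Disjoint Vs O) (e : Γ.E) (s : ℝ)
    (hs : s ∈ Ioo (R.lo e) (R.hi e)) (a : ℝ) :
    Realization (Γ.subdivide e a) h (insert (R.sec e s) Vs) (O \ {R.sec e s}) := by
  classical
  have hht : h (R.sec e s) = s := R.height e s (Ioo_subset_Icc_self hs)
  have hO : R.sec e s ∈ O := R.sec_mem e s hs
  have hnv : ∀ v, R.pt v ≠ R.sec e s := fun v hv =>
    hd.le_bot ⟨R.pt_mem v, hv ▸ hO⟩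
  let pt' : Option Γ.V → X := fun w => w.elim (R.sec e s) R.pt
  let sec' : Option Γ.E → ℝ → X := fun f => f.elim (R.sec e) R.sec
  have hsrc : ∀ g : Γ.E, pt' ((Γ.subdivide e a).src (some g)) = R.pt (Γ.src g) := fun g => rfl
  have hsrc0 : pt' ((Γ.subdivide e a).src none) = R.sec e s := rfl
  have htgt0 : pt' ((Γ.subdivide e a).tgt none) = R.pt (Γ.tgt e) := rfl
  have htgte : pt' ((Γ.subdivide e a).tgt (some e)) = R.sec e s := by
    simp [subdivide, pt']
  have htgt : ∀ g : Γ.E, g ≠ e → pt' ((Γ.subdivide e a).tgt (some g)) = R.pt (Γ.tgt g) := by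
    intro g hg
    simp [subdivide, pt', hg]
  have hIcc : Icc s (R.hi e) ⊆ Icc (R.lo e) (R.hi e) := Icc_subset_Icc_left hs.1.le
  have hIcc' : Icc (R.lo e) s ⊆ Icc (R.lo e) (R.hi e) := Icc_subset_Icc_right hs.2.le
  have hmem : ∀ (g : Γ.E) (u : ℝ), u ∈ Ioo (R.lo g) (R.hi g) → R.sec g u = R.sec e s →
      u = s ∧ g = e := by
    intro g u hu hgu
    have h1 : u = s := by rw [← R.height g u (Ioo_subset_Icc_self hu), hgu, hht]
    subst h1
    exact ⟨rfl, R.edge_unique hu hs hgu⟩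
  refine
    { pt := pt'
      pt_injective := ?_
      range_pt := ?_
      sec := sec'
      lt := ?_
      continuousOn := ?_
      height := ?_
      sec_src := ?_
      sec_tgt := ?_
      sec_mem := ?_
      cover := ?_ }
  · rintro (_ | v) (_ | w) hvw
    · rfl
    · exact absurd hvw.symm (hnv w)
    · exact absurd hvw (hnv v)
    · exact congrArg some (R.pt_injective hvw)
  · ext z
    constructor
    · rintro ⟨_ | v, rfl⟩
      · exact mem_insert _ _
      · exact mem_insert_of_mem _ (R.pt_mem v)
    · rintro (rfl | hz)
      · exact ⟨none, rfl⟩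
      · obtain ⟨v, rfl⟩ := R.exists_pt hz
        exact ⟨some v, rfl⟩
  · rintro (_ | g)
    · rw [hsrc0, htgt0, hht]; exact hs.2
    · by_cases hg : g = e
      · subst hg; rw [hsrc, htgte, hht]; exact hs.1
      · rw [hsrc, htgt g hg]; exact R.lt g
  · rintro (_ | g)
    · rw [hsrc0, htgt0, hht]; exact (R.continuousOn e).mono hIcc
    · by_cases hg : g = e
      · subst hg; rw [hsrc, htgte, hht]; exact (R.continuousOn g).mono hIcc'
      · rw [hsrc, htgt g hg]; exact R.continuousOn g
  · rintro (_ | g)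
    · rw [hsrc0, htgt0, hht]; exact fun u hu => R.height e u (hIcc hu)
    · by_cases hg : g = e
      · subst hg; rw [hsrc, htgte, hht]; exact fun u hu => R.height g u (hIcc' hu)
      · rw [hsrc, htgt g hg]; exact R.height g
  · rintro (_ | g)
    · rw [hsrc0, hht]; rfl
    · exact R.sec_src g
  · rintro (_ | g)
    · exact R.sec_tgt e
    · by_cases hg : g = e
      · subst hg; rw [htgte, hht]; rfl
      · rw [htgt g hg]; exact R.sec_tgt g
  · rintro (_ | g)
    · rw [hsrc0, htgt0, hht]
      intro u hu
      have hu' : u ∈ Ioo (R.lo e) (R.hi e) := ⟨hs.1.trans hu.1, hu.2⟩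
      exact ⟨R.sec_mem e u hu', fun hc => hu.1.ne' (hmem e u hu' hc).1⟩
    · by_cases hg : g = e
      · subst hg; rw [hsrc, htgte, hht]
        intro u hu
        have hu' : u ∈ Ioo (R.lo g) (R.hi g) := ⟨hu.1, hu.2.trans hs.2⟩
        exact ⟨R.sec_mem g u hu', fun hc => hu.2.ne (hmem g u hu' hc).1⟩
      · rw [hsrc, htgt g hg]
        exact fun u hu => ⟨R.sec_mem g u hu, fun hc => hg (hmem g u hu hc).2⟩
  · rintro z ⟨hzO, hzs⟩
    obtain ⟨g, ⟨hg1, hg2⟩, hg3⟩ := R.cover z hzO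
    have hzs' : g = e → h z ≠ s := by
      rintro rfl hc
      rw [hc] at hg2
      exact hzs hg2.symm
    -- on the subdivided edge, the height decides which half the point lies on
    by_cases hge : g = e
    · subst hge
      rcases lt_or_gt_of_ne (hzs' rfl) with hlt | hlt
      · refine ⟨some g, ⟨?_, hg2⟩, ?_⟩
        · rw [hsrc, htgte, hht]; exact ⟨hg1.1, hlt⟩
        · rintro (_ | f) ⟨hf1, hf2⟩
          · rw [hsrc0, htgt0, hht] at hf1
            exact absurd hf1.1 hlt.not_gt
          · by_cases hf : f = g
            · rw [hf]
            · rw [hsrc, htgt f hf] at hf1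
              exact congrArg some (hg3 f ⟨hf1, hf2⟩)
      · refine ⟨none, ⟨?_, hg2⟩, ?_⟩
        · rw [hsrc0, htgt0, hht]; exact ⟨hlt, hg1.2⟩
        · rintro (_ | f) ⟨hf1, hf2⟩
          · rfl
          · by_cases hf : f = g
            · subst hf
              rw [hsrc, htgte, hht] at hf1
              exact absurd hf1.2 hlt.not_gt
            · rw [hsrc, htgt f hf] at hf1
              exact absurd (hg3 f ⟨hf1, hf2⟩) hf
    · refine ⟨some g, ⟨?_, hg2⟩, ?_⟩
      · rw [hsrc, htgt g hge]; exact hg1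
      · rintro (_ | f) ⟨hf1, hf2⟩
        · rw [hsrc0, htgt0, hht] at hf1
          exact absurd (hg3 e ⟨⟨hs.1.trans hf1.1, hf1.2⟩, hf2⟩).symm hge
        · by_cases hf : f = e
          · subst hf
            rw [hsrc, htgte, hht] at hf1
            exact absurd (hg3 f ⟨⟨hf1.1, hf1.2.trans hs.2⟩, hf2⟩).symm hge
          · rw [hsrc, htgt f hf] at hf1
            exact congrArg some (hg3 f ⟨hf1, hf2⟩)

/-- A section of the height function that starts at a vertex and is otherwise disjoint from the
drawing becomes a new edge. -/
noncomputable def attachOut (R : Realization Γ h Vs O) (v : Γ.V) (γ : ℝ → X) (b : ℝ)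
    (hb : h (R.pt v) < b) (hγ : ContinuousOn γ (Icc (h (R.pt v)) b))
    (hh : ∀ s ∈ Icc (h (R.pt v)) b, h (γ s) = s) (h0 : γ (h (R.pt v)) = R.pt v)
    (hnew : ∀ s ∈ Ioc (h (R.pt v)) b, γ s ∉ Vs ∪ O) (a : ℝ) :
    Realization (Γ.addOut v a) h (insert (γ b) Vs) (O ∪ γ '' Ioo (h (R.pt v)) b) := by
  have hhb : h (γ b) = b := hh b (right_mem_Icc.2 hb.le)
  have hnv : ∀ w, R.pt w ≠ γ b := fun w hw =>
    hnew b (right_mem_Ioc.2 hb) (Or.inl (hw ▸ R.pt_mem w))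
  let pt' : Option Γ.V → X := fun w => w.elim (γ b) R.pt
  refine
    { pt := pt'
      pt_injective := ?_
      range_pt := ?_
      sec := fun f : Option Γ.E => f.elim γ R.sec
      lt := ?_
      continuousOn := ?_
      height := ?_
      sec_src := ?_
      sec_tgt := ?_
      sec_mem := ?_
      cover := ?_ }
  · rintro (_ | v) (_ | w) hvw
    · rfl
    · exact absurd hvw.symm (hnv w)
    · exact absurd hvw (hnv v)
    · exact congrArg some (R.pt_injective hvw)
  · ext z
    constructor
    · rintro ⟨_ | v, rfl⟩
      · exact mem_insert _ _
      · exact mem_insert_of_mem _ (R.pt_mem v)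
    · rintro (rfl | hz)
      · exact ⟨none, rfl⟩
      · obtain ⟨v, rfl⟩ := R.exists_pt hz
        exact ⟨some v, rfl⟩
  · rintro (_ | g)
    · show h (R.pt v) < h (γ b)
      rwa [hhb]
    · exact R.lt g
  · rintro (_ | g)
    · show ContinuousOn γ (Icc (h (R.pt v)) (h (γ b)))
      rwa [hhb]
    · exact R.continuousOn g
  · rintro (_ | g)
    · show ∀ s ∈ Icc (h (R.pt v)) (h (γ b)), h (γ s) = s
      rwa [hhb]
    · exact R.height g
  · rintro (_ | g)
    · exact h0
    · exact R.sec_src g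
  · rintro (_ | g)
    · exact congrArg γ hhb
    · exact R.sec_tgt g
  · rintro (_ | g)
    · show ∀ s ∈ Ioo (h (R.pt v)) (h (γ b)), γ s ∈ _
      rw [hhb]
      exact fun s hs => Or.inr (mem_image_of_mem γ hs)
    · exact fun s hs => Or.inl (R.sec_mem g s hs)
  · rintro z (hz | ⟨s, hs, rfl⟩)
    · obtain ⟨g, hg1, hg2⟩ := R.cover z hz
      refine ⟨some g, hg1, ?_⟩
      rintro (_ | f) ⟨hf1, hf2⟩
      · have hf1 : h z ∈ Ioo (h (R.pt v)) (h (γ b)) := hf1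
        have hf2 : γ (h z) = z := hf2
        rw [hhb] at hf1
        exact absurd (Or.inr (hf2.symm ▸ hz)) (hnew _ (Ioo_subset_Ioc_self hf1))
      · exact congrArg some (hg2 f ⟨hf1, hf2⟩)
    · have hhs : h (γ s) = s := hh s (Ioo_subset_Icc_self hs)
      refine ⟨none, ⟨?_, ?_⟩, ?_⟩
      · show h (γ s) ∈ Ioo (h (R.pt v)) (h (γ b))
        rwa [hhb, hhs]
      · exact congrArg γ hhs
      · rintro (_ | f) ⟨hf1, hf2⟩
        · rfl
        · have hf2 : R.sec f (h (γ s)) = γ s := hf2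
          exact absurd (Or.inr (hf2 ▸ R.sec_mem f _ hf1)) (hnew s (Ioo_subset_Ioc_self hs))

/-- A section of the height function that ends at a vertex and is otherwise disjoint from the
drawing becomes a new edge. -/
noncomputable def attachIn (R : Realization Γ h Vs O) (v : Γ.V) (γ : ℝ → X) (b : ℝ)
    (hb : b < h (R.pt v)) (hγ : ContinuousOn γ (Icc b (h (R.pt v))))
    (hh : ∀ s ∈ Icc b (h (R.pt v)), h (γ s) = s) (h0 : γ (h (R.pt v)) = R.pt v)
    (hnew : ∀ s ∈ Ico b (h (R.pt v)), γ s ∉ Vs ∪ O) (a : ℝ) :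
    Realization (Γ.addIn v a) h (insert (γ b) Vs) (O ∪ γ '' Ioo b (h (R.pt v))) := by
  have hhb : h (γ b) = b := hh b (left_mem_Icc.2 hb.le)
  have hnv : ∀ w, R.pt w ≠ γ b := fun w hw =>
    hnew b (left_mem_Ico.2 hb) (Or.inl (hw ▸ R.pt_mem w))
  let pt' : Option Γ.V → X := fun w => w.elim (γ b) R.pt
  refine
    { pt := pt'
      pt_injective := ?_
      range_pt := ?_
      sec := fun f : Option Γ.E => f.elim γ R.sec
      lt := ?_
      continuousOn := ?_
      height := ?_
      sec_src := ?_
      sec_tgt := ?_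
      sec_mem := ?_
      cover := ?_ }
  · rintro (_ | v) (_ | w) hvw
    · rfl
    · exact absurd hvw.symm (hnv w)
    · exact absurd hvw (hnv v)
    · exact congrArg some (R.pt_injective hvw)
  · ext z
    constructor
    · rintro ⟨_ | v, rfl⟩
      · exact mem_insert _ _
      · exact mem_insert_of_mem _ (R.pt_mem v)
    · rintro (rfl | hz)
      · exact ⟨none, rfl⟩
      · obtain ⟨v, rfl⟩ := R.exists_pt hz
        exact ⟨some v, rfl⟩
  · rintro (_ | g)
    · show h (γ b) < h (R.pt v)
      rwa [hhb]
    · exact R.lt g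
  · rintro (_ | g)
    · show ContinuousOn γ (Icc (h (γ b)) (h (R.pt v)))
      rwa [hhb]
    · exact R.continuousOn g
  · rintro (_ | g)
    · show ∀ s ∈ Icc (h (γ b)) (h (R.pt v)), h (γ s) = s
      rwa [hhb]
    · exact R.height g
  · rintro (_ | g)
    · exact congrArg γ hhb
    · exact R.sec_src g
  · rintro (_ | g)
    · exact h0
    · exact R.sec_tgt g
  · rintro (_ | g)
    · show ∀ s ∈ Ioo (h (γ b)) (h (R.pt v)), γ s ∈ _
      rw [hhb]
      exact fun s hs => Or.inr (mem_image_of_mem γ hs)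
    · exact fun s hs => Or.inl (R.sec_mem g s hs)
  · rintro z (hz | ⟨s, hs, rfl⟩)
    · obtain ⟨g, hg1, hg2⟩ := R.cover z hz
      refine ⟨some g, hg1, ?_⟩
      rintro (_ | f) ⟨hf1, hf2⟩
      · have hf1 : h z ∈ Ioo (h (γ b)) (h (R.pt v)) := hf1
        have hf2 : γ (h z) = z := hf2
        rw [hhb] at hf1
        exact absurd (Or.inr (hf2.symm ▸ hz)) (hnew _ (Ioo_subset_Ico_self hf1))
      · exact congrArg some (hg2 f ⟨hf1, hf2⟩)
    · have hhs : h (γ s) = s := hh s (Ioo_subset_Icc_self hs)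
      refine ⟨none, ⟨?_, ?_⟩, ?_⟩
      · show h (γ s) ∈ Ioo (h (γ b)) (h (R.pt v))
        rwa [hhb, hhs]
      · exact congrArg γ hhs
      · rintro (_ | f) ⟨hf1, hf2⟩
        · rfl
        · have hf2 : R.sec f (h (γ s)) = γ s := hf2
          exact absurd (Or.inr (hf2 ▸ R.sec_mem f _ hf1)) (hnew s (Ioo_subset_Ico_self hs))

/-- The image of a drawing under a continuous injection that preserves heights. -/
def map {X' : Type} [TopologicalSpace X'] {h' : X' → ℝ} (R : Realization Γ h Vs O) (ψ : X → X')
    (hψ : Continuous ψ) (hi : Function.Injective ψ) (hh : ∀ x, h' (ψ x) = h x) :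
    Realization Γ h' (ψ '' Vs) (ψ '' O) where
  pt v := ψ (R.pt v)
  pt_injective := hi.comp R.pt_injective
  range_pt := (range_comp ψ R.pt).trans (congrArg _ R.range_pt)
  sec e s := ψ (R.sec e s)
  lt e := by rw [hh, hh]; exact R.lt e
  continuousOn e := by rw [hh, hh]; exact hψ.comp_continuousOn (R.continuousOn e)
  height e s hs := by rw [hh, hh] at hs; rw [hh]; exact R.height e s hs
  sec_src e := by rw [hh, R.sec_src]
  sec_tgt e := by rw [hh, R.sec_tgt]
  sec_mem e s hs := by rw [hh, hh] at hs; exact mem_image_of_mem ψ (R.sec_mem e s hs)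
  cover := by
    rintro _ ⟨z, hz, rfl⟩
    obtain ⟨e, ⟨h1, h2⟩, h3⟩ := R.cover z hz
    refine ⟨e, ⟨by simpa only [hh] using h1, by rw [hh, h2]⟩, fun f hf => h3 f ⟨?_, ?_⟩⟩
    · simpa only [hh] using hf.1
    · have := hf.2
      rw [hh] at this
      exact hi this

/-- A drawing of `Γ` is a drawing of the digraph with one label replaced. -/
noncomputable def relabel (R : Realization Γ h Vs O) (v : Γ.V) (a : ℝ) :
    Realization (Γ.relabel v a) h Vs O where
  pt := R.pt
  pt_injective := R.pt_injective
  range_pt := R.range_pt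
  sec := R.sec
  lt := R.lt
  continuousOn := R.continuousOn
  height := R.height
  sec_src := R.sec_src
  sec_tgt := R.sec_tgt
  sec_mem := R.sec_mem
  cover := R.cover

end Realization

end LabelledDigraph

/-! ### Maximal sections of a height function -/

/-- `h` has a section through `z` near the height of `z`, and all points near `z` lie on it. -/
def HasLocalSection {X : Type} [TopologicalSpace X] (h : X → ℝ) (z : X) : Prop :=
  ∃ δ > 0, ∃ σ : ℝ → X, ContinuousOn σ (Ioo (h z - δ) (h z + δ)) ∧
    (∀ s ∈ Ioo (h z - δ) (h z + δ), h (σ s) = s) ∧ ∀ᶠ w in 𝓝 z, w = σ (h w)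

theorem HasLocalSection.exists_injOn {X : Type} [TopologicalSpace X] {h : X → ℝ} {z : X}
    (hz : HasLocalSection h z) : ∃ N ∈ 𝓝 z, InjOn h N := by
  obtain ⟨δ, -, σ, -, -, hw⟩ := hz
  exact ⟨_, hw, fun a ha b hb hab => by rw [show a = σ (h a) from ha, hab]; exact hb.symm⟩

/-- A section of `h` over the open interval `(a, b)` through the point `z`, with values in `O`. -/
structure IsSectionThrough {X : Type} [TopologicalSpace X] (h : X → ℝ) (O : Set X) (z : X)
    (a b : ℝ) (σ : ℝ → X) : Prop where
  mem : h z ∈ Ioo a b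
  cont : ContinuousOn σ (Ioo a b)
  height : ∀ s ∈ Ioo a b, h (σ s) = s
  maps : ∀ s ∈ Ioo a b, σ s ∈ O
  val : σ (h z) = z

section Existence

variable {X : Type} [TopologicalSpace X] (h : X → ℝ) (O : Set X)

/-- The domain of the maximal section through `z`. -/
def maxDomain (z : X) : Set ℝ := {s | ∃ a b σ, IsSectionThrough h O z a b σ ∧ s ∈ Ioo a b}

open Classical in
/-- The maximal section through `z`; its values outside the maximal domain are irrelevant. -/
noncomputable def maxSection (z : X) (s : ℝ) : X :=
  if H : ∃ σ : ℝ → X, ∃ a b, IsSectionThrough h O z a b σ ∧ s ∈ Ioo a b then H.choose s else z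

variable {h O}

theorem IsSectionThrough.subset_maxDomain {z : X} {a b : ℝ} {σ : ℝ → X}
    (H : IsSectionThrough h O z a b σ) : Ioo a b ⊆ maxDomain h O z :=
  fun _ hs => ⟨a, b, σ, H, hs⟩

theorem isOpen_maxDomain (z : X) : IsOpen (maxDomain h O z) := by
  rw [isOpen_iff_mem_nhds]
  rintro s ⟨a, b, σ, H, hs⟩
  exact mem_of_superset (isOpen_Ioo.mem_nhds hs) H.subset_maxDomain

theorem ordConnected_maxDomain (z : X) : OrdConnected (maxDomain h O z) := by
  refine ⟨?_⟩
  rintro s ⟨a, b, σ, H, hs⟩ u ⟨a', b', σ', H', hu⟩ x hx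
  rcases le_total x (h z) with hz | hz
  · exact ⟨a, b, σ, H, hs.1.trans_le hx.1, hz.trans_lt H.mem.2⟩
  · exact ⟨a', b', σ', H', H'.mem.1.trans_le hz, hx.2.trans_lt hu.2⟩

theorem IsSectionThrough.eqOn [T2Space X] (hB : ∀ z ∈ O, HasLocalSection h z) {z : X}
    {a b a' b' : ℝ} {σ σ' : ℝ → X} (H : IsSectionThrough h O z a b σ)
    (H' : IsSectionThrough h O z a' b' σ') : EqOn σ σ' (Ioo a b ∩ Ioo a' b') := by
  refine sections_agree (fun z hz => (hB z hz).exists_injOn)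
    (ordConnected_Ioo.inter ordConnected_Ioo).isPreconnected
    (H.cont.mono inter_subset_left) (H'.cont.mono inter_subset_right)
    (fun s hs => H.height s hs.1) (fun s hs => H'.height s hs.2) (fun s hs => H.maps s hs.1)
    ⟨H.mem, H'.mem⟩ (H.val.trans H'.val.symm)

theorem IsSectionThrough.maxSection_eq [T2Space X] (hB : ∀ z ∈ O, HasLocalSection h z) {z : X}
    {a b : ℝ} {σ : ℝ → X} (H : IsSectionThrough h O z a b σ) :
    EqOn (maxSection h O z) σ (Ioo a b) := by
  intro s hs
  have hex : ∃ σ : ℝ → X, ∃ a b, IsSectionThrough h O z a b σ ∧ s ∈ Ioo a b := ⟨σ, a, b, H, hs⟩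
  obtain ⟨a', b', H', hs'⟩ := hex.choose_spec
  rw [maxSection, dif_pos hex]
  exact H'.eqOn hB H ⟨hs', hs⟩

theorem continuousOn_maxSection [T2Space X] (hB : ∀ z ∈ O, HasLocalSection h z) (z : X) :
    ContinuousOn (maxSection h O z) (maxDomain h O z) := by
  rintro s ⟨a, b, σ, H, hs⟩
  have h1 : ContinuousAt σ s := H.cont.continuousAt (isOpen_Ioo.mem_nhds hs)
  refine ContinuousAt.continuousWithinAt (h1.congr ?_)
  filter_upwards [isOpen_Ioo.mem_nhds hs] with u hu
  exact (H.maxSection_eq hB hu).symm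

theorem height_maxSection [T2Space X] (hB : ∀ z ∈ O, HasLocalSection h z) (z : X) :
    ∀ s ∈ maxDomain h O z, h (maxSection h O z s) = s := by
  rintro s ⟨a, b, σ, H, hs⟩
  rw [H.maxSection_eq hB hs, H.height s hs]

theorem maxSection_mem [T2Space X] (hB : ∀ z ∈ O, HasLocalSection h z) (z : X) :
    ∀ s ∈ maxDomain h O z, maxSection h O z s ∈ O := by
  rintro s ⟨a, b, σ, H, hs⟩
  rw [H.maxSection_eq hB hs]
  exact H.maps s hs

theorem exists_isSectionThrough (hO : IsOpen O) (hB : ∀ z ∈ O, HasLocalSection h z) {z : X}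
    (hz : z ∈ O) : ∃ δ > 0, ∃ σ, IsSectionThrough h O z (h z - δ) (h z + δ) σ := by
  obtain ⟨δ, hδ, σ, h1, h2, h3⟩ := hB z hz
  have hmem : h z ∈ Ioo (h z - δ) (h z + δ) := ⟨by linarith, by linarith⟩
  have hval : σ (h z) = z := h3.self_of_nhds.symm
  have hc : ContinuousAt σ (h z) := h1.continuousAt (isOpen_Ioo.mem_nhds hmem)
  have h4 := hc.preimage_mem_nhds (hO.mem_nhds (show σ (h z) ∈ O by rwa [hval]))
  obtain ⟨η, hη, h5⟩ := Metric.mem_nhds_iff.1 h4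
  refine ⟨min δ η, lt_min hδ hη, σ, ⟨?_, h1.mono ?_, fun s hs => h2 s ?_, fun s hs => h5 ?_, hval⟩⟩
  · have := lt_min hδ hη
    exact ⟨by linarith, by linarith⟩
  · exact Ioo_subset_Ioo (by linarith [min_le_left δ η]) (by linarith [min_le_left δ η])
  · exact Ioo_subset_Ioo (by linarith [min_le_left δ η]) (by linarith [min_le_left δ η]) hs
  · rw [Real.ball_eq_Ioo]
    exact Ioo_subset_Ioo (by linarith [min_le_right δ η]) (by linarith [min_le_right δ η]) hs

theorem height_mem_maxDomain (hO : IsOpen O) (hB : ∀ z ∈ O, HasLocalSection h z) {z : X}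
    (hz : z ∈ O) : h z ∈ maxDomain h O z := by
  obtain ⟨δ, -, σ, H⟩ := exists_isSectionThrough hO hB hz
  exact H.subset_maxDomain H.mem

theorem maxSection_self [T2Space X] (hO : IsOpen O) (hB : ∀ z ∈ O, HasLocalSection h z) {z : X}
    (hz : z ∈ O) : maxSection h O z (h z) = z := by
  obtain ⟨δ, -, σ, H⟩ := exists_isSectionThrough hO hB hz
  rw [H.maxSection_eq hB H.mem, H.val]

/-- The maximal domain of `z` is an open interval, and the maximal section is the only one. -/
theorem maxDomain_eq_Ioo [T2Space X] [CompactSpace X] (hh : Continuous h) (hO : IsOpen O)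
    (hB : ∀ z ∈ O, HasLocalSection h z) {z : X} (hz : z ∈ O) :
    ∃ a b, maxDomain h O z = Ioo a b ∧ IsSectionThrough h O z a b (maxSection h O z) := by
  have hbdd : maxDomain h O z ⊆ range h := fun s hs => ⟨_, height_maxSection hB z s hs⟩
  have hcomp : IsCompact (range h) := isCompact_range hh
  have h1 : BddBelow (maxDomain h O z) := hcomp.bddBelow.mono hbdd
  have h2 : BddAbove (maxDomain h O z) := hcomp.bddAbove.mono hbdd
  have hne := height_mem_maxDomain hO hB hz
  have hop := isOpen_maxDomain (h := h) (O := O) z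
  have hoc := ordConnected_maxDomain (h := h) (O := O) z
  have heq : maxDomain h O z = Ioo (sInf (maxDomain h O z)) (sSup (maxDomain h O z)) := by
    apply Subset.antisymm
    · intro s hs
      obtain ⟨ε, hε, hb⟩ := Metric.isOpen_iff.1 hop s hs
      rw [Real.ball_eq_Ioo] at hb
      have h3 := csInf_le h1 (hb (show s - ε / 2 ∈ _ from ⟨by linarith, by linarith⟩))
      have h4 := le_csSup h2 (hb (show s + ε / 2 ∈ _ from ⟨by linarith, by linarith⟩))
      exact ⟨by linarith, by linarith⟩
    · intro s hs
      obtain ⟨u, hu, hus⟩ := exists_lt_of_csInf_lt ⟨_, hne⟩ hs.1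
      obtain ⟨v, hv, hvs⟩ := exists_lt_of_lt_csSup ⟨_, hne⟩ hs.2
      exact hoc.out hu hv ⟨hus.le, hvs.le⟩
  refine ⟨_, _, heq, ?_⟩
  constructor
  · exact heq ▸ hne
  · rw [← heq]; exact continuousOn_maxSection hB z
  · rw [← heq]; exact height_maxSection hB z
  · rw [← heq]; exact maxSection_mem hB z
  · exact maxSection_self hO hB hz

/-- Points of a maximal section have the same maximal section. -/
theorem maxDomain_congr [T2Space X] [CompactSpace X] (hh : Continuous h) (hO : IsOpen O)
    (hB : ∀ z ∈ O, HasLocalSection h z) {z : X} (hz : z ∈ O) {s : ℝ} (hs : s ∈ maxDomain h O z) :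
    maxDomain h O (maxSection h O z s) = maxDomain h O z ∧
      EqOn (maxSection h O (maxSection h O z s)) (maxSection h O z) (maxDomain h O z) := by
  have key : ∀ z ∈ O, ∀ s ∈ maxDomain h O z,
      maxDomain h O z ⊆ maxDomain h O (maxSection h O z s) ∧
      EqOn (maxSection h O (maxSection h O z s)) (maxSection h O z) (maxDomain h O z) := by
    intro z hz s hs
    obtain ⟨a, b, hab, H⟩ := maxDomain_eq_Ioo hh hO hB hz
    have hht := height_maxSection hB z s hs
    have H' : IsSectionThrough h O (maxSection h O z s) a b (maxSection h O z) :=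
      ⟨by rw [hht, ← hab]; exact hs, H.cont, H.height, H.maps, by rw [hht]⟩
    rw [hab]
    exact ⟨H'.subset_maxDomain, H'.maxSection_eq hB⟩
  obtain ⟨h1, h2⟩ := key z hz s hs
  refine ⟨Subset.antisymm ?_ h1, h2⟩
  set w := maxSection h O z s with hw
  have hwO : w ∈ O := maxSection_mem hB z s hs
  have hzd := h1 (height_mem_maxDomain hO hB hz)
  have hzw : maxSection h O w (h z) = z :=
    (h2 (height_mem_maxDomain hO hB hz)).trans (maxSection_self hO hB hz)
  have := (key w hwO (h z) hzd).1
  rwa [hzw] at this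

/-- In a compact space with finite fibres, a section of the height function converges. -/
theorem exists_tendsto_section [T2Space X] [CompactSpace X] (hh : Continuous h) {b : ℝ}
    (hfin : (h ⁻¹' {b}).Finite) {l : Filter ℝ} [NeBot l] {σ : ℝ → X} (hl : l ≤ 𝓝 b)
    (hconn : ∀ U ∈ l, ∃ J ∈ l, J ⊆ U ∧ IsPreconnected (σ '' J)) (hs : ∀ᶠ s in l, h (σ s) = s) :
    ∃ w, h w = b ∧ Tendsto σ l (𝓝 w) := by
  obtain ⟨w, -, hw⟩ := isCompact_univ (X := X) (f := map σ l) (by simp)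
  have hlim : Tendsto (h ∘ σ) l (𝓝 b) := by
    have : Tendsto id l (𝓝 b) := hl
    refine this.congr' ?_
    filter_upwards [hs] with s hs using hs.symm
  have hcl : ∀ w, ClusterPt w (map σ l) → h w = b := by
    intro w hw
    have h1 : MapClusterPt (h w) l (h ∘ σ) := MapClusterPt.continuousAt_comp hh.continuousAt hw
    by_contra hne
    obtain ⟨U, V, hU, hV, hwU, hbV, hUV⟩ := t2_separation hne
    have h3 : ∃ᶠ s in l, (h ∘ σ) s ∈ U := h1.frequently (hU.mem_nhds hwU)
    have h4 := hlim (hV.mem_nhds hbV)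
    obtain ⟨s, hsU, hsV⟩ := (h3.and_eventually h4).exists
    exact hUV.le_bot ⟨hsU, hsV⟩
  refine ⟨w, hcl w hw, ?_⟩
  -- separate `w` from the rest of its fibre
  have hfin' : (h ⁻¹' {b} \ {w}).Finite := hfin.subset sdiff_subset
  obtain ⟨U₀, V₀, hU₀, hV₀, hwU₀, hV₀s, hdisj⟩ :=
    SeparatedNhds.of_isCompact_isCompact (isCompact_singleton (x := w)) hfin'.isCompact
      (disjoint_singleton_left.2 fun hc => hc.2 rfl)
  have hwU₀ : w ∈ U₀ := hwU₀ rfl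
  intro U hU
  obtain ⟨U', hU'U, hU'o, hwU'⟩ := mem_nhds_iff.1 hU
  have hev : ∀ᶠ s in l, σ s ∈ (U' ∩ U₀) ∪ V₀ := by
    by_contra hne
    rw [not_eventually] at hne
    have : ∃ w', ClusterPt w' (map σ (l ⊓ 𝓟 {s | σ s ∉ (U' ∩ U₀) ∪ V₀})) := by
      have : NeBot (l ⊓ 𝓟 {s | σ s ∉ (U' ∩ U₀) ∪ V₀}) := frequently_mem_iff_neBot.1 hne
      obtain ⟨w', -, hw'⟩ := isCompact_univ (X := X)
        (f := map σ (l ⊓ 𝓟 {s | σ s ∉ (U' ∩ U₀) ∪ V₀})) (by simp)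
      exact ⟨w', hw'⟩
    obtain ⟨w', hw'⟩ := this
    have hb' : h w' = b := hcl w' (hw'.mono (map_mono inf_le_left))
    have hw'n : w' ∈ (U' ∩ U₀) ∪ V₀ := by
      by_cases hww : w' = w
      · exact Or.inl ⟨hww ▸ hwU', hww ▸ hwU₀⟩
      · exact Or.inr (hV₀s ⟨hb', hww⟩)
    have hop : IsOpen ((U' ∩ U₀) ∪ V₀) := (hU'o.inter hU₀).union hV₀
    have hf : ∃ᶠ x in map σ (l ⊓ 𝓟 {s | σ s ∉ (U' ∩ U₀) ∪ V₀}), x ∈ (U' ∩ U₀) ∪ V₀ :=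
      hw'.frequently (hop.mem_nhds hw'n)
    rw [frequently_map] at hf
    have he : ∀ᶠ s in l ⊓ 𝓟 {s | σ s ∉ (U' ∩ U₀) ∪ V₀}, σ s ∉ (U' ∩ U₀) ∪ V₀ :=
      mem_inf_of_right (mem_principal_self _)
    obtain ⟨s, hs1, hs2⟩ := (hf.and_eventually he).exists
    exact hs2 hs1
  obtain ⟨J, hJl, hJ, hJc⟩ := hconn _ hev
  -- the connected set `σ '' J` meets `U' ∩ U₀`, so it avoids `V₀`
  have hfr : ∃ᶠ x in map σ l, x ∈ U' ∩ U₀ :=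
    hw.frequently ((hU'o.inter hU₀).mem_nhds ⟨hwU', hwU₀⟩)
  rw [frequently_map] at hfr
  obtain ⟨s, hs1, hs2⟩ := (hfr.and_eventually hJl).exists
  have hsub : σ '' J ⊆ U' ∩ U₀ := by
    refine hJc.subset_left_of_subset_union (hU'o.inter hU₀) hV₀
      (hdisj.mono_left inter_subset_right) ?_ ⟨σ s, mem_image_of_mem σ hs2, hs1⟩
    rintro _ ⟨u, hu, rfl⟩
    exact hJ hu
  exact mem_map.2 (mem_of_superset hJl fun u hu => hU'U (hsub (mem_image_of_mem σ hu)).1)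

end Existence

/-! ### Compact spaces with a height function as graphs -/

section Existence

variable {X : Type} [TopologicalSpace X] {h : X → ℝ} {O : Set X}

/-- A section that converges at its right end to a point of `O` can be continued. -/
theorem IsSectionThrough.extend_right (hO : IsOpen O) (hB : ∀ z ∈ O, HasLocalSection h z) {z w : X}
    {a b : ℝ} {σ : ℝ → X} (H : IsSectionThrough h O z a b σ) (hw : w ∈ O) (hwb : h w = b)
    (hlim : Tendsto σ (𝓝[<] b) (𝓝 w)) : ∃ b' > b, ∃ σ', IsSectionThrough h O z a b' σ' := by
  obtain ⟨δ, hδ, τ, T⟩ := exists_isSectionThrough hO hB hw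
  rw [hwb] at T
  have hab : a < b := H.mem.1.trans H.mem.2
  have hbm : b ∈ Ioo (b - δ) (b + δ) := ⟨by linarith, by linarith⟩
  have hτb : τ b = w := by rw [← hwb]; exact T.val
  have hτc : ContinuousAt τ b := T.cont.continuousAt (isOpen_Ioo.mem_nhds hbm)
  obtain ⟨N, hN, hNi⟩ := (hB w hw).exists_injOn
  have h1 : ∀ᶠ u in 𝓝[<] b, σ u = τ u := by
    have e1 : ∀ᶠ u in 𝓝[<] b, σ u ∈ N := hlim hN
    have e2 : ∀ᶠ u in 𝓝[<] b, τ u ∈ N :=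
      (hτc.tendsto.mono_left nhdsWithin_le_nhds) (by rw [hτb]; exact hN)
    have e3 : ∀ᶠ u in 𝓝[<] b, u ∈ Ioo a b := Ioo_mem_nhdsLT hab
    have e4 : ∀ᶠ u in 𝓝[<] b, u ∈ Ioo (b - δ) (b + δ) :=
      nhdsWithin_le_nhds (isOpen_Ioo.mem_nhds hbm)
    filter_upwards [e1, e2, e3, e4] with u u1 u2 u3 u4
    exact hNi u1 u2 ((H.height u u3).trans (T.height u u4).symm)
  refine ⟨b + δ, by linarith, fun s => if s < b then σ s else τ s, ?_, ?_, ?_, ?_, ?_⟩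
  · exact ⟨H.mem.1, H.mem.2.trans (by linarith)⟩
  · intro s hs
    apply ContinuousAt.continuousWithinAt
    rcases lt_trichotomy s b with hsb | rfl | hsb
    · have : ContinuousAt σ s := H.cont.continuousAt (isOpen_Ioo.mem_nhds ⟨hs.1, hsb⟩)
      refine this.congr ?_
      filter_upwards [Iio_mem_nhds hsb] with u hu
      exact (if_pos (mem_Iio.1 hu)).symm
    · refine hτc.congr ?_
      rw [eventually_nhdsWithin_iff] at h1
      filter_upwards [h1] with u hu
      by_cases hus : u < s
      · simp [hus, hu hus]
      · simp [hus]
    · have : ContinuousAt τ s := T.cont.continuousAt (isOpen_Ioo.mem_nhds ⟨by linarith, hs.2⟩)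
      refine this.congr ?_
      filter_upwards [Ioi_mem_nhds hsb] with u hu
      rw [if_neg (not_lt.2 (le_of_lt hu))]
  · intro s hs
    by_cases hsb : s < b
    · simp only [hsb, if_true]; exact H.height s ⟨hs.1, hsb⟩
    · simp only [hsb, if_false]; exact T.height s ⟨by linarith, hs.2⟩
  · intro s hs
    by_cases hsb : s < b
    · simp only [hsb, if_true]; exact H.maps s ⟨hs.1, hsb⟩
    · simp only [hsb, if_false]; exact T.maps s ⟨by linarith, hs.2⟩
  · simp only [H.mem.2, if_true]; exact H.val

/-- A section that converges at its left end to a point of `O` can be continued. -/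
theorem IsSectionThrough.extend_left (hO : IsOpen O) (hB : ∀ z ∈ O, HasLocalSection h z) {z w : X}
    {a b : ℝ} {σ : ℝ → X} (H : IsSectionThrough h O z a b σ) (hw : w ∈ O) (hwb : h w = a)
    (hlim : Tendsto σ (𝓝[>] a) (𝓝 w)) : ∃ a' < a, ∃ σ', IsSectionThrough h O z a' b σ' := by
  obtain ⟨δ, hδ, τ, T⟩ := exists_isSectionThrough hO hB hw
  rw [hwb] at T
  have hab : a < b := H.mem.1.trans H.mem.2
  have hbm : a ∈ Ioo (a - δ) (a + δ) := ⟨by linarith, by linarith⟩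
  have hτb : τ a = w := by rw [← hwb]; exact T.val
  have hτc : ContinuousAt τ a := T.cont.continuousAt (isOpen_Ioo.mem_nhds hbm)
  obtain ⟨N, hN, hNi⟩ := (hB w hw).exists_injOn
  have h1 : ∀ᶠ u in 𝓝[>] a, σ u = τ u := by
    have e1 : ∀ᶠ u in 𝓝[>] a, σ u ∈ N := hlim hN
    have e2 : ∀ᶠ u in 𝓝[>] a, τ u ∈ N :=
      (hτc.tendsto.mono_left nhdsWithin_le_nhds) (by rw [hτb]; exact hN)
    have e3 : ∀ᶠ u in 𝓝[>] a, u ∈ Ioo a b := Ioo_mem_nhdsGT hab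
    have e4 : ∀ᶠ u in 𝓝[>] a, u ∈ Ioo (a - δ) (a + δ) :=
      nhdsWithin_le_nhds (isOpen_Ioo.mem_nhds hbm)
    filter_upwards [e1, e2, e3, e4] with u u1 u2 u3 u4
    exact hNi u1 u2 ((H.height u u3).trans (T.height u u4).symm)
  refine ⟨a - δ, by linarith, fun s => if a < s then σ s else τ s, ?_, ?_, ?_, ?_, ?_⟩
  · exact ⟨(show a - δ < a by linarith).trans H.mem.1, H.mem.2⟩
  · intro s hs
    apply ContinuousAt.continuousWithinAt
    rcases lt_trichotomy a s with hsb | rfl | hsb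
    · have : ContinuousAt σ s := H.cont.continuousAt (isOpen_Ioo.mem_nhds ⟨hsb, hs.2⟩)
      refine this.congr ?_
      filter_upwards [Ioi_mem_nhds hsb] with u hu
      exact (if_pos (mem_Ioi.1 hu)).symm
    · refine hτc.congr ?_
      rw [eventually_nhdsWithin_iff] at h1
      filter_upwards [h1] with u hu
      by_cases hus : a < u
      · simp [hus, hu hus]
      · simp [hus]
    · have : ContinuousAt τ s := T.cont.continuousAt (isOpen_Ioo.mem_nhds ⟨hs.1, by linarith⟩)
      refine this.congr ?_
      filter_upwards [Iio_mem_nhds hsb] with u hu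
      rw [if_neg (not_lt.2 (le_of_lt hu))]
  · intro s hs
    by_cases hsb : a < s
    · simp only [hsb, if_true]; exact H.height s ⟨hsb, hs.2⟩
    · simp only [hsb, if_false]; exact T.height s ⟨hs.1, by linarith⟩
  · intro s hs
    by_cases hsb : a < s
    · simp only [hsb, if_true]; exact H.maps s ⟨hsb, hs.2⟩
    · simp only [hsb, if_false]; exact T.maps s ⟨hs.1, by linarith⟩
  · simp only [H.mem.1, if_true]; exact H.val

/-- The maximal section through a point, together with its two limits, which lie outside `O`. -/
theorem exists_closed_section [T2Space X] [CompactSpace X] (hh : Continuous h)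
    (hfib : ∀ s, (h ⁻¹' {s}).Finite) (hO : IsOpen O) (hB : ∀ z ∈ O, HasLocalSection h z) {z : X}
    (hz : z ∈ O) : ∃ (v w : X) (σ : ℝ → X), v ∉ O ∧ w ∉ O ∧ maxDomain h O z = Ioo (h v) (h w) ∧
      h v < h w ∧ ContinuousOn σ (Icc (h v) (h w)) ∧ (∀ s ∈ Icc (h v) (h w), h (σ s) = s) ∧
      σ (h v) = v ∧ σ (h w) = w ∧ EqOn σ (maxSection h O z) (Ioo (h v) (h w)) := by
  obtain ⟨a, b, hab, H⟩ := maxDomain_eq_Ioo hh hO hB hz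
  have hlt : a < b := H.mem.1.trans H.mem.2
  set σ := maxSection h O z with hσ
  have hconn : ∀ a' b', a ≤ a' → b' ≤ b → IsPreconnected (σ '' Ioo a' b') := fun a' b' h1 h2 =>
    isPreconnected_Ioo.image _ (H.cont.mono (Ioo_subset_Ioo h1 h2))
  obtain ⟨w, hw1, hw2⟩ : ∃ w, h w = b ∧ Tendsto σ (𝓝[<] b) (𝓝 w) := by
    refine exists_tendsto_section hh (hfib b) nhdsWithin_le_nhds (fun U hU => ?_) ?_
    · obtain ⟨c, hc, hcU⟩ := (mem_nhdsLT_iff_exists_Ioo_subset' hlt).1 hU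
      exact ⟨Ioo (max a c) b, Ioo_mem_nhdsLT (max_lt hlt hc),
        (Ioo_subset_Ioo_left (le_max_right _ _)).trans hcU, hconn _ _ (le_max_left _ _) le_rfl⟩
    · filter_upwards [Ioo_mem_nhdsLT hlt] with s hs using H.height s hs
  obtain ⟨v, hv1, hv2⟩ : ∃ v, h v = a ∧ Tendsto σ (𝓝[>] a) (𝓝 v) := by
    refine exists_tendsto_section hh (hfib a) nhdsWithin_le_nhds (fun U hU => ?_) ?_
    · obtain ⟨c, hc, hcU⟩ := (mem_nhdsGT_iff_exists_Ioo_subset' hlt).1 hU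
      exact ⟨Ioo a (min b c), Ioo_mem_nhdsGT (lt_min hlt hc),
        (Ioo_subset_Ioo_right (min_le_right _ _)).trans hcU, hconn _ _ le_rfl (min_le_left _ _)⟩
    · filter_upwards [Ioo_mem_nhdsGT hlt] with s hs using H.height s hs
  have hext : ∀ s ∈ Ioo a b, extendFrom (Ioo a b) σ s = σ s := fun s hs =>
    extendFrom_eq (subset_closure hs) (H.cont s hs)
  have hcont : ContinuousOn (extendFrom (Ioo a b) σ) (Icc a b) :=
    continuousOn_Icc_extendFrom_Ioo H.cont hv2 hw2
  have hva : extendFrom (Ioo a b) σ a = v := eq_lim_at_left_extendFrom_Ioo hlt hv2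
  have hwb : extendFrom (Ioo a b) σ b = w := eq_lim_at_right_extendFrom_Ioo hlt hw2
  refine ⟨v, w, extendFrom (Ioo a b) σ, fun hc => ?_, fun hc => ?_, ?_⟩
  · obtain ⟨a', ha', σ', H'⟩ := H.extend_left hO hB hc hv1 hv2
    have : a ∈ maxDomain h O z := H'.subset_maxDomain ⟨ha', hlt⟩
    rw [hab] at this
    exact lt_irrefl _ this.1
  · obtain ⟨b', hb', σ', H'⟩ := H.extend_right hO hB hc hw1 hw2
    have : b ∈ maxDomain h O z := H'.subset_maxDomain ⟨hlt, hb'⟩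
    rw [hab] at this
    exact lt_irrefl _ this.2
  · rw [hv1, hw1]
    refine ⟨hab, hlt, hcont, fun s hs => ?_, hva, hwb, hext⟩
    rcases eq_or_lt_of_le hs.1 with rfl | h1
    · rw [hva, hv1]
    rcases eq_or_lt_of_le hs.2 with rfl | h2
    · rw [hwb, hw1]
    · rw [hext s ⟨h1, h2⟩, H.height s ⟨h1, h2⟩]

/-- A compact Hausdorff space with a height function with finite fibres, which has local sections
outside a finite set `Vs`, is a finite graph with vertex set `Vs`. -/
theorem exists_realization [T2Space X] [CompactSpace X] (hh : Continuous h)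
    (hfib : ∀ s, (h ⁻¹' {s}).Finite) {Vs : Set X} (hV : Vs.Finite)
    (hB : ∀ z ∈ Vsᶜ, HasLocalSection h z) :
    ∃ Γ : LabelledDigraph, Finite Γ.V ∧ Finite Γ.E ∧ ∃ R : Γ.Realization h Vs Vsᶜ,
      ∀ v, Γ.label v = h (R.pt v) := by
  classical
  have hO : IsOpen Vsᶜ := hV.isClosed.isOpen_compl
  have hex := fun z : (Vsᶜ : Set X) => exists_closed_section hh hfib hO hB z.2
  choose v w σ hv hw hdom hlt hcont hht hσv hσw hσ using hex
  -- an edge is the image of a maximal open section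
  let C : (Vsᶜ : Set X) → Set X := fun z => σ z '' Ioo (h (v z)) (h (w z))
  have hself : ∀ z : (Vsᶜ : Set X), h z ∈ Ioo (h (v z)) (h (w z)) ∧ σ z (h z) = z := by
    intro z
    have h1 := height_mem_maxDomain hO hB z.2
    rw [hdom] at h1
    exact ⟨h1, by rw [hσ z h1]; exact maxSection_self hO hB z.2⟩
  have hOm : ∀ z : (Vsᶜ : Set X), ∀ s ∈ Ioo (h (v z)) (h (w z)), σ z s ∈ Vsᶜ := by
    intro z s hs
    rw [hσ z hs]
    exact maxSection_mem hB z s (by rw [hdom]; exact hs)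
  have hcongr : ∀ z y : (Vsᶜ : Set X), (y : X) ∈ C z →
      Ioo (h (v y)) (h (w y)) = Ioo (h (v z)) (h (w z)) ∧
      EqOn (σ y) (σ z) (Ioo (h (v z)) (h (w z))) := by
    rintro z ⟨y, hy⟩ ⟨s, hs, rfl⟩
    have hs' : s ∈ maxDomain h Vsᶜ z := by rw [hdom]; exact hs
    obtain ⟨h1, h2⟩ := maxDomain_congr hh hO hB z.2 hs'
    have h3 : maxSection h Vsᶜ (σ z s) = maxSection h Vsᶜ (maxSection h Vsᶜ z s) := by rw [hσ z hs]
    have h4 : maxDomain h Vsᶜ (σ z s) = maxDomain h Vsᶜ z := by rw [hσ z hs]; exact h1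
    have h5 : Ioo (h (v ⟨σ z s, hy⟩)) (h (w ⟨σ z s, hy⟩)) = Ioo (h (v z)) (h (w z)) := by
      rw [← hdom z, ← hdom ⟨σ z s, hy⟩]; exact h4
    refine ⟨h5, fun u hu => ?_⟩
    rw [hσ ⟨σ z s, hy⟩ (h5 ▸ hu), hσ z hu]
    show maxSection h Vsᶜ (σ z s) u = _
    rw [h3]
    exact h2 (by rw [hdom]; exact hu)
  have hCeq : ∀ z y : (Vsᶜ : Set X), (y : X) ∈ C z → C y = C z := by
    intro z y hy
    obtain ⟨h1, h2⟩ := hcongr z y hy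
    show σ y '' _ = σ z '' _
    rw [h1]
    exact image_congr h2
  have hselfC : ∀ z : (Vsᶜ : Set X), (z : X) ∈ C z := fun z => ⟨_, (hself z).1, (hself z).2⟩
  have hrep : ∀ e : range C, ∃ z, C z = e := fun e => e.2
  choose rep hrepC using hrep
  let Γ : LabelledDigraph :=
    { V := Vs
      E := range C
      src := fun e => ⟨v (rep e), not_notMem.1 (hv _)⟩
      tgt := fun e => ⟨w (rep e), not_notMem.1 (hw _)⟩
      label := fun x => h x }
  have hcover : ∀ z (hz : z ∈ Vsᶜ), ∃! e : range C,
      h z ∈ Ioo (h (v (rep e))) (h (w (rep e))) ∧ σ (rep e) (h z) = z := by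
    intro z hz
    refine ⟨⟨C ⟨z, hz⟩, mem_range_self _⟩, ?_, ?_⟩
    · have h1 : (⟨z, hz⟩ : (Vsᶜ : Set X)).1 ∈ C (rep ⟨C ⟨z, hz⟩, mem_range_self _⟩) := by
        rw [hrepC]; exact hselfC ⟨z, hz⟩
      obtain ⟨h2, h3⟩ := hcongr _ _ h1
      have h4 := hself ⟨z, hz⟩
      refine ⟨h2 ▸ h4.1, ?_⟩
      rw [← h3 (h2 ▸ h4.1)]
      exact h4.2
    · rintro ⟨e, he⟩ ⟨h1, h2⟩
      apply Subtype.ext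
      show e = C ⟨z, hz⟩
      have h3 : (⟨z, hz⟩ : (Vsᶜ : Set X)).1 ∈ C (rep ⟨e, he⟩) := ⟨_, h1, h2⟩
      rw [hCeq _ _ h3]
      exact (hrepC ⟨e, he⟩).symm
  have hmid : ∀ e : range C, (h (v (rep e)) + h (w (rep e))) / 2 ∈
      Ioo (h (v (rep e))) (h (w (rep e))) := fun e => by
    have := hlt (rep e)
    exact ⟨by linarith, by linarith⟩
  have hfinE : Finite (range C) := by
    -- an edge is determined by the point at the mean height of its ends
    have : (⋃ x ∈ Vs, ⋃ y ∈ Vs, h ⁻¹' {(h x + h y) / 2}).Finite :=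
      hV.biUnion fun x _ => hV.biUnion fun y _ => hfib _
    have := this.to_subtype
    refine Finite.of_injective
      (β := (⋃ x ∈ Vs, ⋃ y ∈ Vs, h ⁻¹' {(h x + h y) / 2} : Set X)) (fun e : range C =>
      ⟨σ (rep e) ((h (v (rep e)) + h (w (rep e))) / 2), ?_⟩) ?_
    · simp only [mem_iUnion]
      exact ⟨_, not_notMem.1 (hv (rep e)), _, not_notMem.1 (hw (rep e)),
        hht _ _ (Ioo_subset_Icc_self (hmid e))⟩
    · intro e f hef
      have hef := congrArg Subtype.val hef
      simp only at hef
      have h1 := hOm _ _ (hmid e)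
      have h2 := hht _ _ (Ioo_subset_Icc_self (hmid e))
      have h3 := hht _ _ (Ioo_subset_Icc_self (hmid f))
      have h4 : (h (v (rep e)) + h (w (rep e))) / 2 = (h (v (rep f)) + h (w (rep f))) / 2 := by
        rw [← h2, ← h3, hef]
      obtain ⟨g, -, hg⟩ := hcover _ h1
      rw [hg e ⟨by rw [h2]; exact hmid e, by rw [h2]⟩,
        hg f ⟨by rw [h2, h4]; exact hmid f, by rw [h2, hef, h4]⟩]
  have := hV.to_subtype
  refine ⟨Γ, ‹Finite Vs›, hfinE,
    { pt := Subtype.val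
      pt_injective := Subtype.val_injective
      range_pt := Subtype.range_val
      sec := fun e => σ (rep e)
      lt := fun e => hlt _
      continuousOn := fun e => hcont _
      height := fun e => hht _
      sec_src := fun e => hσv _
      sec_tgt := fun e => hσw _
      sec_mem := fun e => hOm _
      cover := hcover }, fun _ => rfl⟩

end Existence

/-! ### From drawings to graph structures and back -/

namespace PoincareReebGraph

variable {S : Set PlaneCircle} {D : Set Plane} {i : Fin 2}

theorem exists_section {X : Type} [TopologicalSpace X] {h : X → ℝ} (hh : Continuous h)
    {f : unitInterval → X} (hf : Continuous f) (hm : StrictMono fun s => h (f s)) :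
    ∃ σ : ℝ → X, Continuous σ ∧ (∀ s ∈ Icc (h (f 0)) (h (f 1)), h (σ s) = s) ∧
      ∀ u, σ (h (f u)) = f u := by
  have h01 : h (f 0) < h (f 1) := hm (by exact zero_lt_one)
  have hmem : ∀ u, h (f u) ∈ Icc (h (f 0)) (h (f 1)) := fun u =>
    ⟨hm.monotone u.2.1, hm.monotone u.2.2⟩
  let g : unitInterval → Icc (h (f 0)) (h (f 1)) := fun u => ⟨h (f u), hmem u⟩
  have hg : StrictMono g := fun a b hab => hm hab
  have hsurj : Function.Surjective g := by
    rintro ⟨s, hs⟩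
    have hc : Continuous fun u : unitInterval => h (f u) := hh.comp hf
    obtain ⟨u, hu⟩ := mem_range_of_exists_le_of_exists_ge hc ⟨0, hs.1⟩ ⟨1, hs.2⟩
    exact ⟨u, Subtype.ext hu⟩
  let o := StrictMono.orderIsoOfSurjective g hg hsurj
  have ho : ∀ u, o u = g u := fun u => rfl
  refine ⟨fun s => f (o.symm (projIcc _ _ h01.le s)), ?_, ?_, ?_⟩
  · exact hf.comp (o.symm.continuous.comp continuous_projIcc)
  · intro s hs
    have h1 : g (o.symm (projIcc _ _ h01.le s)) = ⟨s, hs⟩ := by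
      rw [← ho, o.apply_symm_apply, projIcc_of_mem _ hs]
    exact congrArg Subtype.val h1
  · intro u
    simp only
    rw [projIcc_of_mem _ (hmem u)]
    congr 1
    rw [OrderIso.symm_apply_eq]
    rfl

/-- The drawing given by a graph structure on the quotient space. -/
theorem exists_realization (W : PoincareReebGraph S D i) (hh : Continuous (prHeight D i)) :
    ∃ R : W.toLabelledDigraph.Realization (prHeight D i) (prVertices S D i) (prVertices S D i)ᶜ,
      R.pt = W.pt ∧ ∀ e u, R.sec e (prHeight D i (W.path e u)) = W.path e u := by
  have hex := fun e => exists_section hh (W.path_continuous e) (W.path_strictMono e)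
  choose σ hc hht hσ using hex
  have h0 : ∀ e, prHeight D i (W.pt (W.src e)) = prHeight D i (W.path e 0) := fun e => by
    rw [W.path_zero]
  have h1 : ∀ e, prHeight D i (W.pt (W.tgt e)) = prHeight D i (W.path e 1) := fun e => by
    rw [W.path_one]
  have hivt : ∀ e, ∀ s ∈ Ioo (prHeight D i (W.path e 0)) (prHeight D i (W.path e 1)),
      ∃ u, 0 < u ∧ u < 1 ∧ prHeight D i (W.path e u) = s := by
    intro e s hs
    have hc : Continuous fun u : unitInterval => prHeight D i (W.path e u) :=
      hh.comp (W.path_continuous e)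
    obtain ⟨u, hu⟩ := mem_range_of_exists_le_of_exists_ge hc ⟨0, hs.1.le⟩ ⟨1, hs.2.le⟩
    refine ⟨u, (W.path_strictMono e).lt_iff_lt.1 ?_, (W.path_strictMono e).lt_iff_lt.1 ?_, hu⟩
    · simp only [hu]; exact hs.1
    · simp only [hu]; exact hs.2
  refine ⟨
    { pt := W.pt
      pt_injective := W.pt_injective
      range_pt := W.range_pt
      sec := σ
      lt := fun e => ?_
      continuousOn := fun e => (hc e).continuousOn
      height := fun e => ?_
      sec_src := fun e => ?_
      sec_tgt := fun e => ?_
      sec_mem := fun e => ?_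
      cover := ?_ }, rfl, hσ⟩
  · rw [h0, h1]; exact W.path_strictMono e zero_lt_one
  · rw [h0, h1]; exact hht e
  · rw [h0, hσ, W.path_zero]
  · rw [h1, hσ, W.path_one]
  · rw [h0, h1]
    intro s hs
    obtain ⟨u, hu0, hu1, rfl⟩ := hivt e s hs
    rw [hσ]
    exact W.path_not_vertex e u hu0 hu1
  · intro z hz
    obtain ⟨⟨e, u⟩, ⟨hu0, hu1, hu⟩, huniq⟩ := W.path_cover z hz
    simp only at hu0 hu1 hu
    refine ⟨e, ⟨?_, ?_⟩, ?_⟩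
    · simp only [h0, h1]
      rw [← hu]
      exact ⟨W.path_strictMono e hu0, W.path_strictMono e hu1⟩
    · rw [← hu, hσ]
    · rintro f ⟨hf1, hf2⟩
      simp only [h0, h1] at hf1
      obtain ⟨x, hx0, hx1, hx⟩ := hivt f _ hf1
      rw [← hx, hσ] at hf2
      exact congrArg Prod.fst (huniq (f, x) ⟨hx0, hx1, hf2⟩)

/-- A finite drawing is a graph structure on the quotient space. -/
theorem nonempty_of_realization [T2Space (PRSpace D i)] {Γ : LabelledDigraph} [Finite Γ.V]
    [Finite Γ.E]
    (R : Γ.Realization (prHeight D i) (prVertices S D i) (prVertices S D i)ᶜ)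
    (hl : ∀ v, Γ.label v = prHeight D i (R.pt v)) : Nonempty (PoincareReebGraph S D i) := by
  let g : Γ.E → unitInterval → ℝ := fun e u => R.lo e + u * (R.hi e - R.lo e)
  have hlt : ∀ e, R.lo e < R.hi e := R.lt
  have hg : ∀ e u, g e u ∈ Icc (R.lo e) (R.hi e) := by
    intro e u
    have := hlt e
    have h0 := u.2.1
    have h1 := u.2.2
    constructor <;> simp only [g] <;> nlinarith
  have hgm : ∀ e, StrictMono (g e) := by
    intro e a b hab
    have h1 := hlt e
    have h2 : (a : ℝ) < b := hab
    simp only [g]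
    nlinarith
  have hg0 : ∀ e, g e 0 = R.lo e := fun e => by simp [g]
  have hg1 : ∀ e, g e 1 = R.hi e := fun e => by simp [g]
  have hht : ∀ e u, prHeight D i (R.sec e (g e u)) = g e u := fun e u => R.height e _ (hg e u)
  have hgo : ∀ e u, 0 < u → u < 1 → g e u ∈ Ioo (R.lo e) (R.hi e) := fun e u h0 h1 => by
    rw [← hg0, ← hg1]
    exact ⟨hgm e h0, hgm e h1⟩
  exact ⟨
    { Γ with
      t2 := inferInstance
      finite_V := inferInstance
      finite_E := inferInstance
      pt := R.pt
      pt_injective := R.pt_injective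
      range_pt := R.range_pt
      label_eq := hl
      path := fun e u => R.sec e (g e u)
      path_continuous := fun e => by
        have h1 : Continuous fun u : unitInterval => (⟨g e u, hg e u⟩ : Icc (R.lo e) (R.hi e)) := by
          apply Continuous.subtype_mk
          simp only [g]
          fun_prop
        exact (continuousOn_iff_continuous_domRestrict.1 (R.continuousOn e)).comp h1
      path_zero := fun e => by
        rw [hg0]; exact R.sec_src e
      path_one := fun e => by
        rw [hg1]; exact R.sec_tgt e
      path_strictMono := fun e a b hab => by
        simp only [hht]
        exact hgm e hab
      path_not_vertex := fun e s h0 h1 => R.sec_mem e _ (hgo e s h0 h1)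
      path_cover := fun z hz => by
        obtain ⟨e, ⟨h1, h2⟩, h3⟩ := R.cover z hz
        have h1' : prHeight D i z ∈ Ioo (R.lo e) (R.hi e) := h1
        have hd : 0 < R.hi e - R.lo e := sub_pos.2 (hlt e)
        have hu0 : 0 < (prHeight D i z - R.lo e) / (R.hi e - R.lo e) :=
          div_pos (sub_pos.2 h1'.1) hd
        have hu1 : (prHeight D i z - R.lo e) / (R.hi e - R.lo e) < 1 :=
          (div_lt_one hd).2 (by linarith [h1'.2])
        have hgu : g e ⟨_, hu0.le, hu1.le⟩ = prHeight D i z := by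
          simp only [g]
          field_simp
          ring
        refine ⟨(e, ⟨_, hu0.le, hu1.le⟩), ⟨hu0, hu1, ?_⟩, ?_⟩
        · show R.sec e (g e _) = z
          rw [hgu, h2]
        · rintro ⟨f, u⟩ ⟨hf0, hf1, hf2⟩
          simp only at hf0 hf1 hf2
          have h4 : g f u = prHeight D i z := by rw [← hf2, hht]
          have h5 : f = e := h3 f ⟨h4 ▸ hgo f u hf0 hf1, h4 ▸ hf2⟩
          subst h5
          have h6 := (hgm f).injective (h4.trans hgu.symm)
          rw [h6] }⟩

end PoincareReebGraph

/-! ### Coordinates in the plane -/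

/-- The point of the plane whose `i`-th coordinate is `s` and whose other coordinate is `y`. -/
noncomputable def pnt (i : Fin 2) (s y : ℝ) : Plane := WithLp.toLp 2 fun k => if k = i then s else y

@[simp] theorem pnt_same (i : Fin 2) (s y : ℝ) : pnt i s y i = s := by simp [pnt]

theorem pnt_other {i j : Fin 2} (hij : i ≠ j) (s y : ℝ) : pnt i s y j = y := by
  simp [pnt, hij.symm]

theorem continuous_pnt (i : Fin 2) : Continuous fun x : ℝ × ℝ => pnt i x.1 x.2 := by
  refine (PiLp.continuous_toLp 2 _).comp (continuous_pi fun k => ?_)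
  by_cases hk : k = i
  · simp only [hk, if_true]; exact continuous_fst
  · simp only [hk, if_false]; exact continuous_snd

@[fun_prop]
theorem Continuous.pnt {α : Type*} [TopologicalSpace α] {i : Fin 2} {f g : α → ℝ}
    (hf : Continuous f) (hg : Continuous g) : Continuous fun a => pnt i (f a) (g a) :=
  (continuous_pnt i).comp (hf.prodMk hg)

@[fun_prop]
theorem ContinuousOn.pnt {α : Type*} [TopologicalSpace α] {i : Fin 2} {f g : α → ℝ} {s : Set α}
    (hf : ContinuousOn f s) (hg : ContinuousOn g s) : ContinuousOn (fun a => _root_.pnt i (f a) (g a)) s :=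
  (continuous_pnt i).comp_continuousOn (hf.prodMk hg)

theorem continuous_coord (k : Fin 2) : Continuous fun x : Plane => x k := by fun_prop

theorem plane_ext {i j : Fin 2} (hij : i ≠ j) {x y : Plane} (h1 : x i = y i) (h2 : x j = y j) :
    x = y := by
  ext k
  have : k = i ∨ k = j := by omega
  rcases this with rfl | rfl
  · exact h1
  · exact h2

theorem pnt_eta {i j : Fin 2} (hij : i ≠ j) (x : Plane) : pnt i (x i) (x j) = x :=
  plane_ext hij (pnt_same _ _ _) (pnt_other hij _ _)

theorem sum_fin_two {i j : Fin 2} (hij : i ≠ j) (f : Fin 2 → ℝ) : ∑ k, f k = f i + f j := by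
  rw [Fin.sum_univ_two]
  have : i = 0 ∧ j = 1 ∨ i = 1 ∧ j = 0 := by omega
  rcases this with ⟨rfl, rfl⟩ | ⟨rfl, rfl⟩
  · rfl
  · ring

theorem dist_sq {i j : Fin 2} (hij : i ≠ j) (x y : Plane) :
    dist x y ^ 2 = (x i - y i) ^ 2 + (x j - y j) ^ 2 := by
  rw [EuclideanSpace.dist_eq, Real.sq_sqrt (Finset.sum_nonneg fun _ _ => sq_nonneg _),
    sum_fin_two hij]
  simp only [Real.dist_eq, sq_abs]

theorem abs_coord_sub_le (k : Fin 2) (x y : Plane) : |x k - y k| ≤ dist x y := by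
  obtain ⟨l, hl⟩ : ∃ l : Fin 2, k ≠ l := ⟨1 - k, by omega⟩
  have e := dist_sq hl x y
  refine abs_le_of_sq_le_sq ?_ dist_nonneg
  nlinarith [sq_nonneg (x l - y l)]

/-! ### The quotient space -/

section Quotient

variable {D : Set Plane} {i j : Fin 2}

/-- The points of the segment between `(s, y)` and `(s, y')` lie in `K`. -/
def VertConn (K : Set Plane) (i : Fin 2) (s y y' : ℝ) : Prop := ∀ η ∈ uIcc y y', pnt i s η ∈ K

theorem VertConn.symm {K : Set Plane} {s y y' : ℝ} (h : VertConn K i s y y') :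
    VertConn K i s y' y := fun η hη => h η (by rwa [uIcc_comm])

theorem VertConn.trans {K : Set Plane} {s y y' y'' : ℝ} (h : VertConn K i s y y')
    (h' : VertConn K i s y' y'') : VertConn K i s y y'' := fun η hη => by
  rcases uIcc_subset_uIcc_union_uIcc (b := y') hη with h1 | h1
  · exact h η h1
  · exact h' η h1

theorem VertConn.sub {K : Set Plane} {s y y' z z' : ℝ} (h : VertConn K i s y y')
    (hz : z ∈ uIcc y y') (hz' : z' ∈ uIcc y y') : VertConn K i s z z' := fun η hη =>
  h η (uIcc_subset_uIcc hz hz' hη)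

/-- Two points have the same image in the quotient space if and only if they lie on a common
segment in the closure of `D` parallel to the second axis. -/
theorem prMk_eq_iff (hij : i ≠ j) (x y : closure D) :
    prMk D i x = prMk D i y ↔
      (x : Plane) i = (y : Plane) i ∧ VertConn (closure D) i ((x : Plane) i) ((x : Plane) j)
        ((y : Plane) j) := by
  constructor
  · intro h
    have h1 : levelComponent D i (x : Plane) = levelComponent D i (y : Plane) := Quotient.exact h
    have h2 : (x : Plane) i = (y : Plane) i := prSetoid_coord x y h1
    refine ⟨h2, fun η hη => ?_⟩
    have hx : (x : Plane) ∈ levelComponent D i (x : Plane) := mem_connectedComponentIn ⟨x.2, rfl⟩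
    have hy : (y : Plane) ∈ levelComponent D i (x : Plane) := by
      rw [h1]; exact mem_connectedComponentIn ⟨y.2, rfl⟩
    have hpre : IsPreconnected ((fun z : Plane => z j) '' levelComponent D i (x : Plane)) :=
      isPreconnected_connectedComponentIn.image _ (continuous_coord j).continuousOn
    obtain ⟨z, hz, hzη⟩ := hpre.ordConnected.uIcc_subset (mem_image_of_mem _ hx)
      (mem_image_of_mem _ hy) hη
    have hz' := connectedComponentIn_subset _ _ hz
    have : pnt i ((x : Plane) i) η = z :=
      plane_ext hij ((pnt_same _ _ _).trans hz'.2.symm) ((pnt_other hij _ _).trans hzη.symm)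
    rw [this]
    exact hz'.1
  · rintro ⟨h1, h2⟩
    refine Quotient.sound ?_
    show levelComponent D i (x : Plane) = levelComponent D i (y : Plane)
    unfold levelComponent
    rw [← h1]
    refine connectedComponentIn_eq ?_
    have hpre : IsPreconnected ((fun η => pnt i ((x : Plane) i) η) ''
        uIcc ((x : Plane) j) ((y : Plane) j)) :=
      isPreconnected_uIcc.image _ (by fun_prop)
    refine hpre.subset_connectedComponentIn (x := (x : Plane)) ?_ ?_ ?_
    · exact ⟨_, left_mem_uIcc, pnt_eta hij _⟩
    · rintro _ ⟨η, hη, rfl⟩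
      exact ⟨h2 η hη, pnt_same _ _ _⟩
    · refine ⟨_, right_mem_uIcc, ?_⟩
      simp only [h1]
      exact pnt_eta hij _

theorem continuous_prMk : Continuous (prMk D i) := continuous_quotient_mk'

theorem surjective_prMk : Function.Surjective (prMk D i) := Quotient.mk_surjective

@[simp] theorem prHeight_prMk (x : closure D) : prHeight D i (prMk D i x) = (x : Plane) i := rfl

theorem continuous_prHeight : Continuous (prHeight D i) :=
  Continuous.quotient_lift ((continuous_coord i).comp continuous_subtype_val) _

theorem compactSpace_closure (hb : Bornology.IsBounded D) : CompactSpace (closure D) :=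
  isCompact_iff_compactSpace.1 hb.isCompact_closure

theorem isClosed_rel (hij : i ≠ j) :
    IsClosed {x : closure D × closure D | prMk D i x.1 = prMk D i x.2} := by
  have : {x : closure D × closure D | prMk D i x.1 = prMk D i x.2} =
      {x : closure D × closure D | (x.1 : Plane) i = (x.2 : Plane) i} ∩
      ⋂ l ∈ Icc (0 : ℝ) 1, {x : closure D × closure D |
        pnt i ((x.1 : Plane) i) ((1 - l) * (x.1 : Plane) j + l * (x.2 : Plane) j) ∈ closure D} := by
    ext x
    simp only [mem_inter_iff, mem_iInter, Set.mem_ofPred_eq, prMk_eq_iff hij]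
    refine and_congr_right fun _ => ⟨fun h l hl => h _ ?_, fun h η hη => ?_⟩
    · rw [← segment_eq_uIcc]
      exact ⟨1 - l, l, by linarith [hl.2], hl.1, by ring, by simp⟩
    · rw [← segment_eq_uIcc] at hη
      obtain ⟨a, b, ha, hb, hab, rfl⟩ := hη
      have := h b ⟨hb, by linarith⟩
      rwa [show 1 - b = a by linarith] at this
  rw [this]
  refine IsClosed.inter (isClosed_eq (by fun_prop) (by fun_prop)) ?_
  refine isClosed_biInter fun l _ => isClosed_closure.preimage ?_
  fun_prop

theorem isClosedMap_prMk (hij : i ≠ j) (hb : Bornology.IsBounded D) : IsClosedMap (prMk D i) := by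
  have := compactSpace_closure hb
  intro C hC
  have hq : IsQuotientMap (prMk D i) := isQuotientMap_quotient_mk'
  rw [← hq.isClosed_preimage]
  have : prMk D i ⁻¹' (prMk D i '' C) =
      Prod.snd '' ({x : closure D × closure D | prMk D i x.1 = prMk D i x.2} ∩ Prod.fst ⁻¹' C) := by
    ext y
    constructor
    · rintro ⟨x, hx, hxy⟩
      exact ⟨(x, y), ⟨hxy, hx⟩, rfl⟩
    · rintro ⟨⟨x, y'⟩, ⟨hxy, hx⟩, rfl⟩
      exact ⟨x, hx, hxy⟩
  rw [this]
  exact (((isClosed_rel hij).inter (hC.preimage continuous_fst)).isCompact.image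
    continuous_snd).isClosed

/-- A property that holds near all points of a fibre of the quotient map holds on the nearby
fibres. -/
theorem eventually_fibre (hij : i ≠ j) (hb : Bornology.IsBounded D) {P : Plane → Prop}
    {z : PRSpace D i} (h : ∀ x : closure D, prMk D i x = z → ∀ᶠ y in 𝓝[closure D] (x : Plane), P y) :
    ∀ᶠ w in 𝓝 z, ∀ y : closure D, prMk D i y = w → P y := by
  refine (isClosedMap_prMk hij hb).eventually_nhds_fiber (p := fun y => P y) z fun x hx => ?_
  have := h x hx
  rwa [nhdsWithin_eq_map_subtype_coe x.2, eventually_map] at this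

theorem t2Space_prSpace (hij : i ≠ j) (hb : Bornology.IsBounded D) : T2Space (PRSpace D i) := by
  have := compactSpace_closure hb
  rw [t2Space_iff_disjoint_nhds]
  intro z w hzw
  have hcl : ∀ z : PRSpace D i, IsClosed (prMk D i ⁻¹' {z}) := by
    intro z
    obtain ⟨x, rfl⟩ := surjective_prMk z
    have := (isClosed_rel (D := D) hij).preimage (f := fun y : closure D => (y, x)) (by fun_prop)
    exact this
  have hdis : Disjoint (prMk D i ⁻¹' {z}) (prMk D i ⁻¹' {w}) :=
    Disjoint.preimage _ (disjoint_singleton.2 hzw)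
  obtain ⟨U, V, hU, hV, hzU, hwV, hUV⟩ := SeparatedNhds.of_isCompact_isCompact
    (hcl z).isCompact (hcl w).isCompact hdis
  have h1 := (isClosedMap_prMk hij hb).eventually_nhds_fiber (p := fun y => y ∈ U) z
    fun x hx => hU.mem_nhds (hzU hx)
  have h2 := (isClosedMap_prMk hij hb).eventually_nhds_fiber (p := fun y => y ∈ V) w
    fun x hx => hV.mem_nhds (hwV hx)
  refine (Filter.disjoint_iff).2 ⟨_, h1, _, h2, ?_⟩
  rw [Set.disjoint_left]
  intro u hu1 hu2
  obtain ⟨x, rfl⟩ := surjective_prMk u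
  exact hUV.le_bot ⟨hu1 x rfl, hu2 x rfl⟩

/-- The image of a point of the closure of `D` in the quotient space; for other points, the value
is irrelevant. -/
noncomputable def prAt (D : Set Plane) (i : Fin 2) [Nonempty (closure D)] (x : Plane) :
    PRSpace D i :=
  open Classical in if h : x ∈ closure D then prMk D i ⟨x, h⟩ else prMk D i (Classical.arbitrary _)

variable [Nonempty (closure D)]

theorem prAt_of_mem {x : Plane} (hx : x ∈ closure D) : prAt D i x = prMk D i ⟨x, hx⟩ := by
  rw [prAt, dif_pos hx]

theorem prAt_coe (x : closure D) : prAt D i (x : Plane) = prMk D i x := prAt_of_mem x.2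

theorem exists_prAt (z : PRSpace D i) : ∃ x ∈ closure D, prAt D i x = z := by
  obtain ⟨x, rfl⟩ := surjective_prMk z
  exact ⟨x, x.2, prAt_coe x⟩

theorem prHeight_prAt {x : Plane} (hx : x ∈ closure D) : prHeight D i (prAt D i x) = x i := by
  rw [prAt_of_mem hx, prHeight_prMk]

theorem continuousOn_prAt : ContinuousOn (prAt D i) (closure D) := by
  rw [continuousOn_iff_continuous_domRestrict]
  have : (closure D).domRestrict (prAt D i) = prMk D i := by
    ext x
    exact prAt_coe x
  rw [this]
  exact continuous_prMk

theorem prAt_eq_iff (hij : i ≠ j) {x y : Plane} (hx : x ∈ closure D) (hy : y ∈ closure D) :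
    prAt D i x = prAt D i y ↔ x i = y i ∧ VertConn (closure D) i (x i) (x j) (y j) := by
  rw [prAt_of_mem hx, prAt_of_mem hy, prMk_eq_iff hij]

theorem prAt_pnt_eq_iff (hij : i ≠ j) {s y y' : ℝ} (hx : pnt i s y ∈ closure D)
    (hy : pnt i s y' ∈ closure D) :
    prAt D i (pnt i s y) = prAt D i (pnt i s y') ↔ VertConn (closure D) i s y y' := by
  rw [prAt_eq_iff hij hx hy]
  simp [pnt_other hij]

theorem VertConn.prAt_eq (hij : i ≠ j) {s y y' : ℝ} (h : VertConn (closure D) i s y y') :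
    prAt D i (pnt i s y) = prAt D i (pnt i s y') :=
  (prAt_pnt_eq_iff hij (h _ left_mem_uIcc) (h _ right_mem_uIcc)).2 h

/-- A continuous section of the height function given by a curve in the closure of `D`. -/
theorem continuousOn_prAt_pnt {f : ℝ → ℝ} {J : Set ℝ} (hf : ContinuousOn f J)
    (hJ : ∀ s ∈ J, pnt i s (f s) ∈ closure D) : ContinuousOn (fun s => prAt D i (pnt i s (f s))) J :=
  continuousOn_prAt.comp (f := fun s => pnt i s (f s)) (continuousOn_id.pnt hf) hJ

theorem mem_prVertices_iff {S : Set PlaneCircle} {z : PRSpace D i} :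
    z ∈ prVertices S D i ↔ ∃ x ∈ closure D, prAt D i x = z ∧
      ((∃ c ∈ S, c.IsPole i x) ∨ IsCrossing S x) := by
  constructor
  · rintro ⟨x, rfl, hx⟩
    exact ⟨x, x.2, prAt_coe x, hx⟩
  · rintro ⟨x, hx, rfl, h⟩
    exact ⟨⟨x, hx⟩, (prAt_of_mem hx).symm, h⟩

end Quotient

/-! ### The local structure of the closure of the component -/

namespace PlaneCircle

/-- The power of a point with respect to a circle: negative inside, positive outside. -/
noncomputable def pow (c : PlaneCircle) (x : Plane) : ℝ := dist x c.center ^ 2 - c.radius ^ 2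

theorem pow_eq_zero_iff (c : PlaneCircle) (x : Plane) : c.pow x = 0 ↔ x ∈ c.carrier := by
  rw [pow, sub_eq_zero, carrier, Metric.mem_sphere]
  exact pow_left_inj₀ dist_nonneg c.radius_pos.le two_ne_zero

theorem continuous_pow (c : PlaneCircle) : Continuous c.pow := by
  unfold pow
  fun_prop

theorem pow_coord {i j : Fin 2} (hij : i ≠ j) (c : PlaneCircle) (x : Plane) :
    c.pow x = (x i - c.center i) ^ 2 + (x j - c.center j) ^ 2 - c.radius ^ 2 := by
  rw [pow, dist_sq hij]

theorem pow_pnt {i j : Fin 2} (hij : i ≠ j) (c : PlaneCircle) (s y : ℝ) :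
    c.pow (pnt i s y) = (s - c.center i) ^ 2 + (y - c.center j) ^ 2 - c.radius ^ 2 := by
  rw [pow_coord hij, pnt_same, pnt_other hij]

theorem pow_add (c : PlaneCircle) (x v : Plane) (τ : ℝ) :
    c.pow (x + τ • v) - c.pow x = τ * (2 * inner ℝ (x - c.center) v + τ * ‖v‖ ^ 2) := by
  unfold pow
  rw [dist_eq_norm, dist_eq_norm, show x + τ • v - c.center = (x - c.center) + τ • v by abel,
    norm_add_sq_real, inner_smul_right, norm_smul, mul_pow, Real.norm_eq_abs, sq_abs]
  ring

theorem isPole_iff {i j : Fin 2} (hij : i ≠ j) (c : PlaneCircle) (x : Plane) :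
    c.IsPole i x ↔ x ∈ c.carrier ∧ x j = c.center j := by
  rw [← pow_eq_zero_iff, pow_coord hij]
  have e1 : ∀ σ : ℝ, (c.center + σ • EuclideanSpace.single i (1 : ℝ)) i = c.center i + σ := by
    intro σ; simp
  have e2 : ∀ σ : ℝ, (c.center + σ • EuclideanSpace.single i (1 : ℝ)) j = c.center j := by
    intro σ; simp [hij.symm]
  have hneg : c.center - c.radius • EuclideanSpace.single i (1 : ℝ) =
      c.center + (-c.radius) • EuclideanSpace.single i (1 : ℝ) := by
    rw [neg_smul, sub_eq_add_neg]
  unfold IsPole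
  rw [hneg]
  constructor
  · rintro (rfl | rfl)
    · rw [e1, e2]; exact ⟨by ring, rfl⟩
    · rw [e1, e2]; exact ⟨by ring, rfl⟩
  · rintro ⟨h1, h2⟩
    have h3 : (x i - c.center i - c.radius) * (x i - c.center i + c.radius) = 0 := by
      rw [h2] at h1; linarith
    rcases mul_eq_zero.1 h3 with h | h
    · left
      exact plane_ext hij (by rw [e1]; linarith) (by rw [e2, h2])
    · right
      exact plane_ext hij (by rw [e1]; linarith) (by rw [e2, h2])

end PlaneCircle

/-- The sign which makes the power with respect to `c` positive on `D`, for `D` on one side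
of `c`. -/
noncomputable def sideSign (D : Set Plane) (c : PlaneCircle) : ℝ :=
  open Classical in if D ⊆ Metric.ball c.center c.radius then -1 else 1

/-- The power with respect to `c`, with the sign that makes it positive on `D`. -/
noncomputable def sidePow (D : Set Plane) (c : PlaneCircle) (x : Plane) : ℝ :=
  sideSign D c * c.pow x

theorem sideSign_eq (D : Set Plane) (c : PlaneCircle) : sideSign D c = 1 ∨ sideSign D c = -1 := by
  unfold sideSign
  split_ifs <;> simp

theorem sideSign_ne_zero (D : Set Plane) (c : PlaneCircle) : sideSign D c ≠ 0 := by
  rcases sideSign_eq D c with h | h <;> rw [h] <;> norm_num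

theorem continuous_sidePow (D : Set Plane) (c : PlaneCircle) : Continuous (sidePow D c) :=
  continuous_const.mul c.continuous_pow

theorem sidePow_eq_zero_iff (D : Set Plane) (c : PlaneCircle) (x : Plane) :
    sidePow D c x = 0 ↔ x ∈ c.carrier := by
  rw [← c.pow_eq_zero_iff, sidePow, mul_eq_zero]
  exact or_iff_right (sideSign_ne_zero D c)

namespace IsMBC

variable {S : Set PlaneCircle} {D : Set Plane} {i j : Fin 2}

theorem isClosed_circles (hS : S.Finite) : IsClosed (⋃ c ∈ S, c.carrier) :=
  hS.isClosed_biUnion fun _ _ => Metric.isClosed_sphere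

theorem isOpen (h : IsMBC S D) : IsOpen D := by
  obtain ⟨x, -, rfl⟩ := h.component
  exact (isClosed_circles h.finite).isOpen_compl.connectedComponentIn

theorem nonempty (h : IsMBC S D) : D.Nonempty := by
  obtain ⟨x, hx, rfl⟩ := h.component
  exact ⟨x, mem_connectedComponentIn hx⟩

theorem nonempty_closure (h : IsMBC S D) : Nonempty (closure D) :=
  h.nonempty.closure.to_subtype

theorem isPreconnected (h : IsMBC S D) : IsPreconnected D := by
  obtain ⟨x, -, rfl⟩ := h.component
  exact isPreconnected_connectedComponentIn

theorem notMem_carrier (h : IsMBC S D) {c : PlaneCircle} (hc : c ∈ S) {x : Plane} (hx : x ∈ D) :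
    x ∉ c.carrier := by
  obtain ⟨y, -, rfl⟩ := h.component
  exact fun hxc => connectedComponentIn_subset _ _ hx (mem_biUnion hc hxc)

theorem sidePow_pos (h : IsMBC S D) {c : PlaneCircle} (hc : c ∈ S) {x : Plane} (hx : x ∈ D) :
    0 < sidePow D c x := by
  have hsub : D ⊆ Metric.ball c.center c.radius ∪ (Metric.closedBall c.center c.radius)ᶜ := by
    intro y hy
    rcases lt_trichotomy (dist y c.center) c.radius with h1 | h1 | h1
    · exact Or.inl h1
    · exact absurd h1 (h.notMem_carrier hc hy)
    · exact Or.inr fun h2 => absurd (Metric.mem_closedBall.1 h2) (not_le.2 h1)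
  have hd : Disjoint (Metric.ball c.center c.radius) (Metric.closedBall c.center c.radius)ᶜ :=
    disjoint_compl_right.mono_left Metric.ball_subset_closedBall
  unfold sidePow sideSign PlaneCircle.pow
  have hr := c.radius_pos
  have hd0 := dist_nonneg (x := x) (y := c.center)
  split_ifs with hD
  · have := Metric.mem_ball.1 (hD hx)
    nlinarith
  · rcases h.isPreconnected.subset_or_subset Metric.isOpen_ball
      Metric.isClosed_closedBall.isOpen_compl hd hsub with h1 | h1
    · exact absurd h1 hD
    · have := h1 hx
      rw [mem_compl_iff, Metric.mem_closedBall, not_le] at this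
      nlinarith

theorem sidePow_nonneg (h : IsMBC S D) {c : PlaneCircle} (hc : c ∈ S) {x : Plane}
    (hx : x ∈ closure D) : 0 ≤ sidePow D c x :=
  closure_minimal (fun _ hy => (h.sidePow_pos hc hy).le)
    (isClosed_le continuous_const (continuous_sidePow D c)) hx

/-- A connected set that avoids the circles and meets `D` lies in `D`. -/
theorem subset_of_isPreconnected (h : IsMBC S D) {M : Set Plane} (hM : IsPreconnected M)
    (hMS : ∀ x ∈ M, ∀ c ∈ S, x ∉ c.carrier) (hne : (M ∩ D).Nonempty) : M ⊆ D := by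
  obtain ⟨y, hyM, hyD⟩ := hne
  obtain ⟨x, -, rfl⟩ := h.component
  rw [connectedComponentIn_eq hyD]
  refine hM.subset_connectedComponentIn hyM fun z hz => ?_
  simp only [mem_compl_iff, mem_iUnion, not_exists]
  exact fun c hc => hMS z hz c hc

theorem carrier_of_closure (h : IsMBC S D) {x : Plane} (hx : x ∈ closure D) (hxD : x ∉ D) :
    ∃ c ∈ S, x ∈ c.carrier := by
  by_contra! hne
  have hopen := (isClosed_circles h.finite).isOpen_compl
  have hxU : x ∈ (⋃ c ∈ S, c.carrier)ᶜ := by simpa using hne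
  obtain ⟨ε, hε, hball⟩ := Metric.isOpen_iff.1 hopen x hxU
  have hsub : Metric.ball x ε ⊆ D := by
    refine h.subset_of_isPreconnected (convex_ball x ε).isPreconnected (fun y hy c hc hyc => ?_) ?_
    · exact hball hy (mem_biUnion hc hyc)
    · exact mem_closure_iff.1 hx _ Metric.isOpen_ball (Metric.mem_ball_self hε)
  exact hxD (hsub (Metric.mem_ball_self hε))

/-- At each point of the closure of `D` some direction points to the side of `D` of all circles
through that point. -/
theorem exists_direction (h : IsMBC S D) {x : Plane} (hx : x ∈ closure D) :
    ∃ v : Plane, ∀ c ∈ S, x ∈ c.carrier → 0 < sideSign D c * inner ℝ (x - c.center) v := by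
  have hn : ∀ c : PlaneCircle, x ∈ c.carrier → ‖x - c.center‖ = c.radius := fun c hc => by
    rw [← dist_eq_norm]; exact hc
  by_cases h1 : ∃ c ∈ S, x ∈ c.carrier
  swap
  · exact ⟨0, fun c hc hxc => absurd ⟨c, hc, hxc⟩ h1⟩
  obtain ⟨c, hc, hxc⟩ := h1
  have hεc : sideSign D c * sideSign D c = 1 := by
    rcases sideSign_eq D c with e | e <;> rw [e] <;> norm_num
  by_cases h2 : ∃ d ∈ S, d ≠ c ∧ x ∈ d.carrier
  swap
  · refine ⟨sideSign D c • (x - c.center), fun d hd hxd => ?_⟩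
    have hdc : d = c := by
      by_contra hne
      exact h2 ⟨d, hd, hne, hxd⟩
    rw [hdc, inner_smul_right, ← mul_assoc, hεc, one_mul, real_inner_self_eq_norm_sq, hn c hxc]
    have := c.radius_pos
    positivity
  obtain ⟨d, hd, hdc, hxd⟩ := h2
  have hεd : sideSign D d * sideSign D d = 1 := by
    rcases sideSign_eq D d with e | e <;> rw [e] <;> norm_num
  set u := (sideSign D c / c.radius) • (x - c.center) with hu
  set w := (sideSign D d / d.radius) • (x - d.center) with hw
  have hcr := c.radius_pos
  have hdr := d.radius_pos
  have hnu : ‖u‖ = 1 := by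
    rw [hu, norm_smul, hn c hxc, Real.norm_eq_abs, abs_div, abs_of_pos hcr]
    rcases sideSign_eq D c with e | e <;> rw [e] <;> simp [hcr.ne']
  have hnw : ‖w‖ = 1 := by
    rw [hw, norm_smul, hn d hxd, Real.norm_eq_abs, abs_div, abs_of_pos hdr]
    rcases sideSign_eq D d with e | e <;> rw [e] <;> simp [hdr.ne']
  have hne : inner ℝ u w ≠ -1 := by
    rw [Ne, inner_eq_neg_one_iff_of_norm_eq_one hnu hnw]
    intro huw
    -- parallel radii contradict transversality
    have htr := h.transversal c hc d hd (Ne.symm hdc) x hx hxc hxd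
    have hle : c.tangentSpace x ⊔ d.tangentSpace x ≤ (Submodule.span ℝ {u})ᗮ := by
      refine sup_le (Submodule.orthogonal_le ?_) (Submodule.orthogonal_le ?_)
      · rw [Submodule.span_singleton_le_iff_mem]
        exact Submodule.smul_mem _ _ (Submodule.mem_span_singleton_self _)
      · rw [Submodule.span_singleton_le_iff_mem, huw]
        exact Submodule.neg_mem _ (Submodule.smul_mem _ _ (Submodule.mem_span_singleton_self _))
    rw [htr, top_le_iff, Submodule.orthogonal_eq_top_iff, Submodule.span_singleton_eq_bot] at hle
    rw [hle] at hnu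
    simp at hnu
  have hgt : -1 < inner ℝ u w := by
    refine lt_of_le_of_ne ?_ (Ne.symm hne)
    have := neg_le_of_abs_le (abs_real_inner_le_norm u w)
    rw [hnu, hnw] at this
    linarith
  have hcu : ∀ y : Plane, sideSign D c * inner ℝ (x - c.center) y = c.radius * inner ℝ u y := by
    intro y
    rw [hu, inner_smul_left]
    simp only [conj_trivial]
    field_simp
  have hdw : ∀ y : Plane, sideSign D d * inner ℝ (x - d.center) y = d.radius * inner ℝ w y := by
    intro y
    rw [hw, inner_smul_left]
    simp only [conj_trivial]
    field_simp
  refine ⟨u + w, fun e he hxe => ?_⟩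
  have hecd : e = c ∨ e = d := by
    by_contra! hne
    exact h.no_triple c hc d hd e he (Ne.symm hdc) (Ne.symm hne.1) (Ne.symm hne.2) x hx
      ⟨hxc, hxd, hxe⟩
  rcases hecd with rfl | rfl
  · rw [hcu, inner_add_right, real_inner_self_eq_norm_sq, hnu]
    exact mul_pos hcr (by linarith)
  · rw [hdw, inner_add_right, real_inner_self_eq_norm_sq, hnw, real_inner_comm]
    exact mul_pos hdr (by linarith)

/-- Near each point of its closure, `D` is given by the inequalities which say that a point lies on
the side of `D` of all circles, and its closure by the weak inequalities. -/
theorem eventually_mem (h : IsMBC S D) {x : Plane} (hx : x ∈ closure D) :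
    ∀ᶠ y in 𝓝 x, ((∀ c ∈ S, 0 < sidePow D c y) → y ∈ D) ∧
      ((∀ c ∈ S, 0 ≤ sidePow D c y) → y ∈ closure D) := by
  obtain ⟨v, hv⟩ := h.exists_direction hx
  -- moving in the direction `v`, the signed powers of the circles through `x` increase
  have key : ∀ᶠ p : Plane × ℝ in 𝓝 x ×ˢ 𝓝[>] (0 : ℝ), ∀ c ∈ S,
      (x ∈ c.carrier → sidePow D c p.1 < sidePow D c (p.1 + p.2 • v)) ∧
      (x ∉ c.carrier → 0 < sidePow D c p.1) := by
    refine (eventually_all_finite h.finite).2 fun c hc => ?_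
    by_cases hxc : x ∈ c.carrier
    · have hcont : Continuous fun p : Plane × ℝ =>
          sideSign D c * (2 * inner ℝ (p.1 - c.center) v + p.2 * ‖v‖ ^ 2) := by fun_prop
      have h0 : 0 < sideSign D c * (2 * inner ℝ (x - c.center) v + (0 : ℝ) * ‖v‖ ^ 2) := by
        have := hv c hc hxc
        linarith
      have h1 := hcont.continuousAt (x := (x, (0 : ℝ))).eventually_mem
        (isOpen_Ioi.mem_nhds (mem_Ioi.2 h0))
      rw [nhds_prod_eq] at h1
      have h2 : ∀ᶠ p : Plane × ℝ in 𝓝 x ×ˢ 𝓝[>] (0 : ℝ), 0 < p.2 :=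
        (eventually_mem_nhdsWithin).prod_inr _
      filter_upwards [h1.filter_mono (prod_mono le_rfl nhdsWithin_le_nhds), h2] with p hp hp2
      refine ⟨fun _ => ?_, fun hc => absurd hxc hc⟩
      rw [← sub_pos, sidePow, sidePow, ← mul_sub, c.pow_add]
      have := mul_pos hp2 (mem_Ioi.1 hp)
      linarith
    · have h0 : 0 < sidePow D c x := lt_of_le_of_ne (h.sidePow_nonneg hc hx)
        (fun h0 => hxc ((sidePow_eq_zero_iff D c x).1 h0.symm))
      have h1 := (continuous_sidePow D c).continuousAt.eventually_mem
        (isOpen_Ioi.mem_nhds (mem_Ioi.2 h0))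
      filter_upwards [h1.prod_inl (𝓝[>] (0 : ℝ))] with p hp
      exact ⟨fun hc => absurd hc hxc, fun _ => hp⟩
  obtain ⟨pa, hpa, pb, hpb, hpab⟩ := eventually_prod_iff.1 key
  obtain ⟨ρ₁, hρ₁, hball⟩ := Metric.eventually_nhds_iff_ball.1 hpa
  obtain ⟨τ₁, hτ₁, hIoo⟩ := (mem_nhdsGT_iff_exists_Ioo_subset).1 hpb
  have hτ₁ : 0 < τ₁ := hτ₁
  obtain ⟨τ₀, hτ₀, hτ₀1, hτ₀v⟩ : ∃ τ₀ > 0, τ₀ < τ₁ ∧ τ₀ * ‖v‖ < ρ₁ / 2 := by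
    refine ⟨min (τ₁ / 2) (ρ₁ / 4 / (‖v‖ + 1)), by positivity, ?_, ?_⟩
    · exact (min_le_left _ _).trans_lt (by linarith)
    · have h1 : min (τ₁ / 2) (ρ₁ / 4 / (‖v‖ + 1)) * ‖v‖ ≤ ρ₁ / 4 / (‖v‖ + 1) * (‖v‖ + 1) :=
        mul_le_mul (min_le_right _ _) (by linarith) (norm_nonneg _) (by positivity)
      rw [div_mul_cancel₀ _ (by positivity)] at h1
      linarith
  have hinc : ∀ y ∈ Metric.ball x ρ₁, ∀ τ ∈ Ioo 0 τ₁, ∀ c ∈ S,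
      (x ∈ c.carrier → sidePow D c y < sidePow D c (y + τ • v)) ∧
      (x ∉ c.carrier → 0 < sidePow D c y) := fun y hy τ hτ => hpab (hball y hy) (hIoo hτ)
  have hxτ : x + τ₀ • v ∈ Metric.ball x ρ₁ := by
    rw [Metric.mem_ball, dist_eq_norm, add_sub_cancel_left, norm_smul, Real.norm_eq_abs,
      abs_of_pos hτ₀]
    linarith
  have htop : ∀ c ∈ S, 0 < sidePow D c (x + τ₀ • v) := by
    intro c hc
    by_cases hxc : x ∈ c.carrier
    · have h1 := (hinc x (Metric.mem_ball_self hρ₁) τ₀ ⟨hτ₀, hτ₀1⟩ c hc).1 hxc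
      rwa [(sidePow_eq_zero_iff D c x).2 hxc] at h1
    · exact (hinc _ hxτ τ₀ ⟨hτ₀, hτ₀1⟩ c hc).2 hxc
  have hopen : IsOpen {y | ∀ c ∈ S, 0 < sidePow D c y} := by
    have : {y | ∀ c ∈ S, 0 < sidePow D c y} = ⋂ c ∈ S, {y | 0 < sidePow D c y} := by
      ext y; simp
    rw [this]
    exact h.finite.isOpen_biInter fun c _ => isOpen_lt continuous_const (continuous_sidePow D c)
  obtain ⟨ρ₂, hρ₂, hball₂⟩ := Metric.isOpen_iff.1 hopen _ htop
  set ρ := min ρ₂ (ρ₁ / 2) with hρdef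
  have hρ : 0 < ρ := lt_min hρ₂ (by linarith)
  have hρ₁2 : ρ ≤ ρ₁ / 2 := min_le_right _ _
  -- a connected neighbourhood of `x`, swept out by a disc moving in the direction `v`
  set N : Set Plane := ⋃ τ ∈ Icc 0 τ₀, Metric.ball (x + τ • v) ρ with hN
  have hNo : IsOpen N := isOpen_biUnion fun τ _ => Metric.isOpen_ball
  have hNx : N ∈ 𝓝 x := by
    refine hNo.mem_nhds (mem_biUnion (left_mem_Icc.2 hτ₀.le) ?_)
    rw [zero_smul, add_zero]
    exact Metric.mem_ball_self hρ
  have hNball : N ⊆ Metric.ball x ρ₁ := by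
    intro y hy
    obtain ⟨τ, hτ, hy⟩ := mem_iUnion₂.1 hy
    have h1 : dist (x + τ • v) x ≤ τ₀ * ‖v‖ := by
      rw [dist_eq_norm, add_sub_cancel_left, norm_smul, Real.norm_eq_abs, abs_of_nonneg hτ.1]
      exact mul_le_mul_of_nonneg_right hτ.2 (norm_nonneg _)
    have h2 := dist_triangle y (x + τ • v) x
    have h3 := Metric.mem_ball.1 hy
    rw [Metric.mem_ball]
    linarith
  have hmono : ∀ y ∈ N, ∀ τ, 0 ≤ τ → τ < τ₁ → y + τ • v ∈ N → (∀ c ∈ S, 0 < sidePow D c y) →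
      ∀ c ∈ S, 0 < sidePow D c (y + τ • v) := by
    intro y hy τ hτ0 hτ1 hyτ hpos c hc
    rcases hτ0.eq_or_lt with rfl | hτ0
    · rw [zero_smul, add_zero]; exact hpos c hc
    by_cases hxc : x ∈ c.carrier
    · exact (hpos c hc).trans ((hinc y (hNball hy) τ ⟨hτ0, hτ1⟩ c hc).1 hxc)
    · exact (hinc _ (hNball hyτ) τ ⟨hτ0, hτ1⟩ c hc).2 hxc
  set M : Set Plane := N ∩ {y | ∀ c ∈ S, 0 < sidePow D c y} with hM
  have hT : Metric.ball (x + τ₀ • v) ρ ⊆ M := fun y hy =>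
    ⟨mem_biUnion (right_mem_Icc.2 hτ₀.le) hy,
      hball₂ (Metric.ball_subset_ball (min_le_left _ _) hy)⟩
  have hMpre : IsPreconnected M := by
    refine isPreconnected_of_forall (x + τ₀ • v) fun y hy => ?_
    obtain ⟨hyN, hyp⟩ := hy
    obtain ⟨τ, hτ, hyb⟩ := mem_iUnion₂.1 hyN
    have hline : ∀ σ ∈ Icc 0 (τ₀ - τ), y + σ • v ∈ N := fun σ hσ => by
      refine mem_biUnion (x := τ + σ) ⟨add_nonneg hτ.1 hσ.1, by linarith [hσ.2]⟩ ?_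
      rw [Metric.mem_ball, dist_eq_norm, add_smul,
        show y + σ • v - (x + (τ • v + σ • v)) = y - (x + τ • v) by abel, ← dist_eq_norm]
      exact hyb
    refine ⟨(fun σ : ℝ => y + σ • v) '' Icc 0 (τ₀ - τ) ∪ Metric.ball (x + τ₀ • v) ρ, ?_, ?_, ?_, ?_⟩
    · refine union_subset ?_ hT
      rintro _ ⟨σ, hσ, rfl⟩
      exact ⟨hline σ hσ, hmono y hyN σ hσ.1 (by linarith [hσ.2, hτ.1]) (hline σ hσ) hyp⟩
    · exact Or.inr (Metric.mem_ball_self hρ)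
    · exact Or.inl ⟨0, left_mem_Icc.2 (by linarith [hτ.2]), by simp⟩
    · refine IsPreconnected.union (y + (τ₀ - τ) • v) ?_ ?_ ?_ ?_
      · exact ⟨_, right_mem_Icc.2 (by linarith [hτ.2]), rfl⟩
      · rw [Metric.mem_ball, dist_eq_norm, sub_smul,
          show y + (τ₀ • v - τ • v) - (x + τ₀ • v) = y - (x + τ • v) by abel, ← dist_eq_norm]
        exact hyb
      · exact isPreconnected_Icc.image _ (by fun_prop)
      · exact (convex_ball _ _).isPreconnected
  have hMD : M ⊆ D := by
    refine h.subset_of_isPreconnected hMpre (fun y hy c hc hyc => ?_) ?_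
    · exact (hy.2 c hc).ne' ((sidePow_eq_zero_iff D c y).2 hyc)
    · obtain ⟨y, hyN, hyD⟩ := mem_closure_iff_nhds.1 hx N hNx
      exact ⟨y, ⟨hyN, fun c hc => h.sidePow_pos hc hyD⟩, hyD⟩
  filter_upwards [hNx] with y hy
  refine ⟨fun hpos => hMD ⟨hy, hpos⟩, fun hnn => ?_⟩
  have hlim : Tendsto (fun τ : ℝ => y + τ • v) (𝓝[>] 0) (𝓝 y) := by
    have : Continuous fun τ : ℝ => y + τ • v := by fun_prop
    have h1 := this.tendsto 0
    rw [zero_smul, add_zero] at h1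
    exact h1.mono_left nhdsWithin_le_nhds
  refine mem_closure_of_tendsto hlim ?_
  filter_upwards [hlim (hNo.mem_nhds hy), Ioo_mem_nhdsGT hτ₁] with τ hτN hτ
  refine hMD ⟨hτN, fun c hc => ?_⟩
  by_cases hxc : x ∈ c.carrier
  · exact (hnn c hc).trans_lt ((hinc y (hNball hy) τ hτ c hc).1 hxc)
  · exact (hinc _ (hNball hτN) τ hτ c hc).2 hxc

/-- Near a point of the closure of `D` on only one circle `c`, the set `D` is one side of `c`. -/
theorem eventually_mem_of_single (h : IsMBC S D) {c : PlaneCircle} {x : Plane}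
    (hx : x ∈ closure D) (huniq : ∀ d ∈ S, x ∈ d.carrier → d = c) :
    ∀ᶠ y in 𝓝 x, (0 < sidePow D c y → y ∈ D) ∧ (0 ≤ sidePow D c y → y ∈ closure D) ∧
      ∀ d ∈ S, y ∈ d.carrier → d = c := by
  have h1 : ∀ᶠ y in 𝓝 x, ∀ d ∈ S, d ≠ c → 0 < sidePow D d y := by
    refine (eventually_all_finite h.finite).2 fun d hd => ?_
    by_cases hdc : d = c
    · exact Eventually.of_forall fun y hy => absurd hdc hy
    · have h0 : 0 < sidePow D d x := lt_of_le_of_ne (h.sidePow_nonneg hd hx)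
        (fun h0 => hdc (huniq d hd ((sidePow_eq_zero_iff D d x).1 h0.symm)))
      filter_upwards [(continuous_sidePow D d).continuousAt.eventually_mem
        (isOpen_Ioi.mem_nhds (mem_Ioi.2 h0))] with y hy _
      exact hy
  filter_upwards [h1, h.eventually_mem hx] with y hy1 hy2
  refine ⟨fun hp => hy2.1 fun d hd => ?_, fun hp => hy2.2 fun d hd => ?_, fun d hd hyd => ?_⟩
  · by_cases hdc : d = c
    · rw [hdc]; exact hp
    · exact hy1 d hd hdc
  · by_cases hdc : d = c
    · rw [hdc]; exact hp
    · exact (hy1 d hd hdc).le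
  · by_contra hdc
    exact (hy1 d hd hdc).ne' ((sidePow_eq_zero_iff D d y).2 hyd)

end IsMBC

/-! ### Slices of the closure of the component -/

theorem exists_box {i : Fin 2} {t y₀ : ℝ} {P : Plane → Prop} (h : ∀ᶠ x in 𝓝 (pnt i t y₀), P x) :
    ∃ ρ > 0, ∀ s y, |s - t| < ρ → |y - y₀| < ρ → P (pnt i s y) := by
  have h1 := (continuous_pnt i).continuousAt (x := (t, y₀)) h
  obtain ⟨ρ, hρ, hb⟩ := Metric.mem_nhds_iff.1 h1
  refine ⟨ρ, hρ, fun s y hs hy => hb (show (s, y) ∈ Metric.ball (t, y₀) ρ from ?_)⟩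
  rw [Metric.mem_ball, Prod.dist_eq, Real.dist_eq, Real.dist_eq]
  exact max_lt hs hy

theorem VertConn.mono {K K' : Set Plane} {i : Fin 2} {s y y' : ℝ} (h : VertConn K i s y y')
    (hK : K ⊆ K') : VertConn K' i s y y' := fun η hη => hK (h η hη)

theorem VertConn.eventually {U : Set Plane} (hU : IsOpen U) {i : Fin 2} {t y y' : ℝ}
    (h : VertConn U i t y y') : ∀ᶠ s in 𝓝 t, VertConn U i s y y' := by
  have h1 : ∀ᶠ s in 𝓝 t, ∀ η ∈ uIcc y y', pnt i s η ∈ U := by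
    refine isCompact_uIcc.eventually_forall_of_forall_eventually (x₀ := t)
      (P := fun s η => pnt i s η ∈ U) fun η hη => ?_
    have h2 := (continuous_pnt i).continuousAt (x := (t, η)) (hU.mem_nhds (h η hη))
    exact h2
  exact h1

/-- Near `(t, y₀)`, the intersections of the closure of `D` with the lines parallel to the second
axis are closed under moving in the direction `η`, and the points reached lie in `D`. -/
def UpSlices (D : Set Plane) (i : Fin 2) (t y₀ ρ η : ℝ) : Prop :=
  ∀ s y y', |s - t| < ρ → |y - y₀| < ρ → |y' - y₀| < ρ → η * y < η * y' →
    pnt i s y ∈ closure D → pnt i s y' ∈ D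

/-- The property of the points of the closure of `D` that do not give rise to vertices. -/
def IsOrdinary (S : Set PlaneCircle) (i : Fin 2) (x : Plane) : Prop :=
  ¬ ((∃ c ∈ S, c.IsPole i x) ∨ IsCrossing S x)

theorem finite_not_isOrdinary {S : Set PlaneCircle} (hS : S.Finite) (i : Fin 2) :
    {x | ¬ IsOrdinary S i x}.Finite := by
  have h1 : (⋃ c ∈ S, {x | c.IsPole i x}).Finite := hS.biUnion fun c _ =>
    ((Set.finite_singleton _).insert _).subset fun x hx => hx
  have h2 : (⋃ c ∈ S, ⋃ d ∈ S, {x | c ≠ d ∧ x ∈ c.carrier ∧ x ∈ d.carrier}).Finite := by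
    refine hS.biUnion fun c _ => hS.biUnion fun d _ => ?_
    by_cases hne : c.center = d.center
    · refine Set.finite_empty.subset fun x hx => ?_
      obtain ⟨hcd, hc, hd⟩ := hx
      refine hcd (PlaneCircle.ext hne ?_)
      rw [← Metric.mem_sphere.1 hc, ← Metric.mem_sphere.1 hd, hne]
    · have hfr : Module.finrank ℝ Plane = 2 := by simp
      by_contra hinf
      obtain ⟨a, ha⟩ := Set.Infinite.nonempty hinf
      obtain ⟨b, hb, hba⟩ := (Set.Infinite.exists_notMem_finite hinf (Set.finite_singleton a))
      refine hinf (((Set.finite_singleton b).insert a).subset fun x hx => ?_)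
      exact EuclideanGeometry.eq_of_dist_eq_of_dist_eq_of_finrank_eq_two hfr hne
        (fun hab => hba hab.symm) ha.2.1 hb.2.1 hx.2.1 ha.2.2 hb.2.2 hx.2.2
  refine (h1.union h2).subset fun x hx => ?_
  rcases not_not.1 hx with ⟨c, hc, hp⟩ | ⟨c, hc, d, hd, hx⟩
  · exact Or.inl (mem_biUnion hc hp)
  · exact Or.inr (mem_biUnion hc (mem_biUnion hd hx))

theorem finite_prVertices {S : Set PlaneCircle} (hS : S.Finite) (D : Set Plane) (i : Fin 2) :
    (prVertices S D i).Finite := by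
  have h1 := (finite_not_isOrdinary hS i).preimage
    (f := (Subtype.val : closure D → Plane)) Subtype.val_injective.injOn
  refine (h1.image (prMk D i)).subset ?_
  rintro z ⟨x, rfl, hx⟩
  exact ⟨x, not_not.2 hx, rfl⟩

section Sup

/-- A point of a compact subset of the line lies in a maximal interval going up. -/
theorem exists_max_interval {A : Set ℝ} (hA : IsCompact A) {y : ℝ} (hy : y ∈ A) :
    ∃ b, y ≤ b ∧ Icc y b ⊆ A ∧ ∀ b' > b, ¬ Icc y b' ⊆ A := by
  set C := {b | y ≤ b ∧ Icc y b ⊆ A} with hC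
  have hne : C.Nonempty := ⟨y, le_rfl, by rw [Icc_self]; exact singleton_subset_iff.2 hy⟩
  have hbdd : BddAbove C := hA.bddAbove.mono fun b hb => hb.2 (right_mem_Icc.2 hb.1)
  have hyb : y ≤ sSup C := le_csSup hbdd ⟨le_rfl, by rw [Icc_self]; exact singleton_subset_iff.2 hy⟩
  have hmem : sSup C ∈ A := by
    have : sSup C ∈ closure C := csSup_mem_closure hne hbdd
    exact closure_minimal (fun b hb => hb.2 (right_mem_Icc.2 hb.1)) hA.isClosed this
  refine ⟨sSup C, hyb, fun η hη => ?_, fun b' hb' hsub => ?_⟩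
  · rcases eq_or_lt_of_le hη.2 with rfl | hlt
    · exact hmem
    · obtain ⟨b, hb, hηb⟩ := exists_lt_of_lt_csSup hne hlt
      exact hb.2 ⟨hη.1, hηb.le⟩
  · exact absurd (le_csSup hbdd ⟨(hyb.trans hb'.le), hsub⟩) (not_le.2 hb')

theorem exists_min_interval {A : Set ℝ} (hA : IsCompact A) {y : ℝ} (hy : y ∈ A) :
    ∃ a, a ≤ y ∧ Icc a y ⊆ A ∧ ∀ a' < a, ¬ Icc a' y ⊆ A := by
  obtain ⟨b, h1, h2, h3⟩ := exists_max_interval (hA.image continuous_neg) (mem_image_of_mem _ hy)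
  have hmem : ∀ η, -η ∈ (fun x : ℝ => -x) '' A → η ∈ A := by
    rintro η ⟨x, hx, hxη⟩
    simp only [neg_inj] at hxη
    exact hxη ▸ hx
  refine ⟨-b, by linarith, fun η hη => hmem η (h2 ⟨by linarith [hη.2], by linarith [hη.1]⟩),
    fun a' ha' hsub => h3 (-a') (by linarith) fun η hη => ⟨-η, hsub ⟨?_, ?_⟩, by simp⟩⟩
  · linarith [hη.2]
  · linarith [hη.1]

end Sup

namespace IsMBC

variable {S : Set PlaneCircle} {D : Set Plane} {i j : Fin 2}

theorem isCompact_slice (h : IsMBC S D) (hij : i ≠ j) (t : ℝ) :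
    IsCompact {y | pnt i t y ∈ closure D} := by
  have hK : IsCompact (closure D) := h.bounded.isCompact_closure
  have hc : Continuous fun y => pnt i t y := by fun_prop
  refine Metric.isCompact_of_isClosed_isBounded (isClosed_closure.preimage hc) ?_
  refine (hK.image (continuous_coord j)).isBounded.subset fun y hy => ?_
  exact ⟨_, hy, pnt_other hij _ _⟩

/-- The fibres of the quotient map are closed intervals, whose ends lie on circles. -/
theorem exists_interval (h : IsMBC S D) (hij : i ≠ j) {t y : ℝ} (hy : pnt i t y ∈ closure D) :
    ∃ a b, a ≤ y ∧ y ≤ b ∧ (∀ η, VertConn (closure D) i t y η ↔ η ∈ Icc a b) ∧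
      pnt i t a ∉ D ∧ pnt i t b ∉ D := by
  obtain ⟨b, hb1, hb2, hb3⟩ := exists_max_interval (h.isCompact_slice hij t) hy
  obtain ⟨a, ha1, ha2, ha3⟩ := exists_min_interval (h.isCompact_slice hij t) hy
  have hop : ∀ η, pnt i t η ∈ D → ∃ ρ > 0, ∀ η', |η' - η| < ρ → pnt i t η' ∈ D := by
    intro η hη
    obtain ⟨ρ, hρ, hb⟩ := exists_box (h.isOpen.mem_nhds hη)
    exact ⟨ρ, hρ, fun η' hη' => hb t η' (by simpa using hρ) hη'⟩
  refine ⟨a, b, ha1, hb1, fun η => ⟨fun hη => ⟨?_, ?_⟩, fun hη η' hη' => ?_⟩, fun hD => ?_,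
    fun hD => ?_⟩
  · by_contra! hlt
    exact ha3 η hlt fun η' hη' => hη η' (by rw [uIcc_of_ge (hlt.le.trans ha1)]; exact hη')
  · by_contra! hlt
    exact hb3 η hlt fun η' hη' => hη η' (by rw [uIcc_of_le (hb1.trans hlt.le)]; exact hη')
  · rcases le_total η' y with h1 | h1
    · refine ha2 ⟨?_, h1⟩
      exact (le_inf ha1 hη.1).trans hη'.1
    · refine hb2 ⟨h1, ?_⟩
      exact hη'.2.trans (sup_le hb1 hη.2)
  · obtain ⟨ρ, hρ, hb⟩ := hop a hD
    refine ha3 (a - ρ / 2) (by linarith) fun η hη => ?_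
    rcases le_or_gt a η with h1 | h1
    · exact ha2 ⟨h1, hη.2⟩
    · exact subset_closure (hb η (by rw [abs_lt]; constructor <;> linarith [hη.1]))
  · obtain ⟨ρ, hρ, hb⟩ := hop b hD
    refine hb3 (b + ρ / 2) (by linarith) fun η hη => ?_
    rcases le_or_gt η b with h1 | h1
    · exact hb2 ⟨hη.1, h1⟩
    · exact subset_closure (hb η (by rw [abs_lt]; constructor <;> linarith [hη.2]))

theorem finite_fibre (h : IsMBC S D) (hij : i ≠ j) (t : ℝ) :
    (prHeight D i ⁻¹' {t}).Finite := by
  have := h.nonempty_closure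
  -- each fibre contains a point at height `t` on one of the circles
  have hfin : (⋃ c ∈ S, {x : Plane | x ∈ c.carrier ∧ x i = t}).Finite := by
    refine h.finite.biUnion fun c _ => ?_
    set w := Real.sqrt (c.radius ^ 2 - (t - c.center i) ^ 2)
    refine (((Set.finite_singleton (pnt i t (c.center j - w))).insert
      (pnt i t (c.center j + w)))).subset ?_
    rintro x ⟨hx, hxt⟩
    rw [← c.pow_eq_zero_iff, c.pow_coord hij, hxt] at hx
    have hw : w ^ 2 = c.radius ^ 2 - (t - c.center i) ^ 2 :=
      Real.sq_sqrt (by nlinarith [sq_nonneg (x j - c.center j)])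
    have h3 : (x j - c.center j - w) * (x j - c.center j + w) = 0 := by nlinarith
    rcases mul_eq_zero.1 h3 with h4 | h4
    · left
      exact plane_ext hij (by rw [hxt, pnt_same]) (by rw [pnt_other hij]; linarith)
    · right
      exact plane_ext hij (by rw [hxt, pnt_same]) (by rw [pnt_other hij]; linarith)
  refine (hfin.image (prAt D i)).subset fun z hz => ?_
  obtain ⟨x, hx, rfl⟩ := exists_prAt z
  have hz : prHeight D i (prAt D i x) = t := hz
  rw [prHeight_prAt hx] at hz
  have hx' : pnt i t (x j) ∈ closure D := by rw [← hz, pnt_eta hij]; exact hx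
  obtain ⟨a, b, ha, hb, hab, haD, -⟩ := h.exists_interval hij hx'
  have hconn := (hab a).2 ⟨le_rfl, ha.trans hb⟩
  have haK := hconn a right_mem_uIcc
  obtain ⟨c, hc, hac⟩ := h.carrier_of_closure haK haD
  refine ⟨pnt i t a, mem_biUnion hc ⟨hac, pnt_same _ _ _⟩, ?_⟩
  rw [← hconn.prAt_eq hij, ← hz, pnt_eta hij]

theorem exists_upSlices (h : IsMBC S D) (hij : i ≠ j) {c : PlaneCircle} (hc : c ∈ S) {t y₀ η : ℝ}
    (hx : pnt i t y₀ ∈ closure D) (huniq : ∀ d ∈ S, pnt i t y₀ ∈ d.carrier → d = c)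
    (hη : η = 1 ∨ η = -1) (hpos : 0 < η * (sideSign D c * (y₀ - c.center j))) :
    ∃ ρ > 0, UpSlices D i t y₀ ρ η := by
  obtain ⟨ρ₁, hρ₁, h1⟩ := exists_box (h.eventually_mem_of_single hx huniq)
  have hcont : Continuous fun y : ℝ => η * (sideSign D c * (y - c.center j)) := by fun_prop
  obtain ⟨ρ₂, hρ₂, h2⟩ := Metric.eventually_nhds_iff.1
    (hcont.continuousAt.eventually_mem (isOpen_Ioi.mem_nhds (mem_Ioi.2 hpos)))
  refine ⟨min ρ₁ ρ₂, lt_min hρ₁ hρ₂, fun s y y' hs hy hy' hyy hK => ?_⟩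
  refine (h1 s y' (hs.trans_le (min_le_left _ _)) (hy'.trans_le (min_le_left _ _))).1 ?_
  have e1 : 0 < η * (sideSign D c * (y - c.center j)) :=
    h2 (by rw [Real.dist_eq]; exact hy.trans_le (min_le_right _ _))
  have e2 : 0 < η * (sideSign D c * (y' - c.center j)) :=
    h2 (by rw [Real.dist_eq]; exact hy'.trans_le (min_le_right _ _))
  have e3 : sidePow D c (pnt i s y') = sidePow D c (pnt i s y) + (η * y' - η * y) *
      (η * (sideSign D c * (y - c.center j)) + η * (sideSign D c * (y' - c.center j))) := by
    rw [sidePow, sidePow, c.pow_pnt hij, c.pow_pnt hij]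
    rcases hη with rfl | rfl <;> ring
  have e4 := h.sidePow_nonneg hc hK
  have e5 := mul_pos (sub_pos.2 hyy) (add_pos e1 e2)
  linarith

/-- An ordinary point of the closure of `D` lies in `D`, or in a neighbourhood the slices are closed
under moving up, or under moving down. -/
theorem mem_or_upSlices (h : IsMBC S D) (hij : i ≠ j) {t y₀ : ℝ} (hx : pnt i t y₀ ∈ closure D)
    (hord : IsOrdinary S i (pnt i t y₀)) :
    pnt i t y₀ ∈ D ∨ ∃ ρ > 0, ∃ η : ℝ, (η = 1 ∨ η = -1) ∧ UpSlices D i t y₀ ρ η := by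
  by_cases hD : pnt i t y₀ ∈ D
  · exact Or.inl hD
  right
  obtain ⟨c, hc, hxc⟩ := h.carrier_of_closure hx hD
  have huniq : ∀ d ∈ S, pnt i t y₀ ∈ d.carrier → d = c := fun d hd hxd => by
    by_contra hne
    exact hord (Or.inr ⟨d, hd, c, hc, hne, hxd, hxc⟩)
  have hne : y₀ - c.center j ≠ 0 := fun h0 =>
    hord (Or.inl ⟨c, hc, (c.isPole_iff hij _).2 ⟨hxc, by rw [pnt_other hij]; linarith⟩⟩)
  rcases lt_or_gt_of_ne (mul_ne_zero (sideSign_ne_zero D c) hne) with h1 | h1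
  · obtain ⟨ρ, hρ, hup⟩ := h.exists_upSlices hij hc hx huniq (Or.inr rfl) (by linarith)
    exact ⟨ρ, hρ, -1, Or.inr rfl, hup⟩
  · obtain ⟨ρ, hρ, hup⟩ := h.exists_upSlices hij hc hx huniq (Or.inl rfl) (by linarith)
    exact ⟨ρ, hρ, 1, Or.inl rfl, hup⟩

/-- An ordinary point in the interior of a fibre lies in `D`. -/
theorem mem_of_interior (h : IsMBC S D) (hij : i ≠ j) {t a b y₀ : ℝ}
    (hab : ∀ η ∈ Icc a b, pnt i t η ∈ closure D) (hy : y₀ ∈ Ioo a b)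
    (hord : IsOrdinary S i (pnt i t y₀)) : pnt i t y₀ ∈ D := by
  rcases h.mem_or_upSlices hij (hab _ (Ioo_subset_Icc_self hy)) hord with h1 | ⟨ρ, hρ, η, hη, hup⟩
  · exact h1
  obtain ⟨ε, hε, hερ, h1, h2⟩ : ∃ ε > 0, ε < ρ ∧ a ≤ y₀ - ε ∧ y₀ + ε ≤ b := by
    refine ⟨min (ρ / 2) (min (y₀ - a) (b - y₀)), ?_, ?_, ?_, ?_⟩
    · exact lt_min (by linarith) (lt_min (sub_pos.2 hy.1) (sub_pos.2 hy.2))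
    · exact (min_le_left _ _).trans_lt (by linarith)
    · linarith [(min_le_right (ρ / 2) (min (y₀ - a) (b - y₀))).trans (min_le_left _ _)]
    · linarith [(min_le_right (ρ / 2) (min (y₀ - a) (b - y₀))).trans (min_le_right _ _)]
  rcases hη with rfl | rfl
  · exact hup t (y₀ - ε) y₀ (by simpa) (by simpa [abs_of_pos hε]) (by simpa) (by linarith)
      (hab _ ⟨h1, by linarith⟩)
  · exact hup t (y₀ + ε) y₀ (by simpa) (by simpa [abs_of_pos hε]) (by simpa) (by linarith)
      (hab _ ⟨by linarith, h2⟩)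

/-- At an ordinary end of a fibre, the slices are closed under moving into the fibre. Here `η`
is the direction in which the fibre leaves its end `y₀`. -/
theorem upSlices_of_end (h : IsMBC S D) (hij : i ≠ j) {t y₀ η : ℝ} (hη : η = 1 ∨ η = -1)
    (hx : pnt i t y₀ ∈ closure D) (hD : pnt i t y₀ ∉ D)
    (hend : ∀ ε > 0, ¬ VertConn (closure D) i t y₀ (y₀ - η * ε))
    (hord : IsOrdinary S i (pnt i t y₀)) : ∃ ρ > 0, UpSlices D i t y₀ ρ η := by
  rcases h.mem_or_upSlices hij hx hord with h1 | ⟨ρ, hρ, η', hη', hup⟩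
  · exact absurd h1 hD
  by_cases hηη : η' = η
  · exact ⟨ρ, hρ, hηη ▸ hup⟩
  have hη'' : η' = -η := by
    rcases hη with rfl | rfl <;> rcases hη' with rfl | rfl <;> first | rfl | simp at hηη | simp
  refine absurd (fun y hy => ?_) (hend (ρ / 2) (by linarith))
  have hyy : |y - y₀| < ρ ∧ (y = y₀ ∨ η' * y₀ < η' * y) := by
    rw [hη'']
    rcases hη with rfl | rfl
    · rw [uIcc_of_ge (by linarith)] at hy
      refine ⟨by rw [abs_lt]; constructor <;> linarith [hy.1, hy.2], ?_⟩
      rcases eq_or_lt_of_le hy.2 with h1 | h1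
      · exact Or.inl h1
      · right; linarith
    · rw [uIcc_of_le (by linarith)] at hy
      refine ⟨by rw [abs_lt]; constructor <;> linarith [hy.1, hy.2], ?_⟩
      rcases eq_or_lt_of_le hy.1 with h1 | h1
      · exact Or.inl h1.symm
      · right; linarith
  rcases hyy with ⟨h1, rfl | h2⟩
  · exact hx
  · exact subset_closure (hup t y₀ y (by simpa) (by simpa) h1 h2 hx)

/-- If the slices near `(t, y₀)` are closed under moving towards `ym`, and the points between
`(t, y₀)` and `(t, ym)` lie in `D`, then all points near `(t, y₀)` are joined to the line through
`(t, ym)` in the closure of `D`. -/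
theorem eventually_vertConn_of_upSlices (h : IsMBC S D) (hij : i ≠ j) {t y₀ ym ρ η : ℝ}
    (hη : η = 1 ∨ η = -1) (hρ : 0 < ρ) (hup : UpSlices D i t y₀ ρ η) (hym : η * y₀ < η * ym)
    (hmid : ∀ y ∈ uIcc y₀ ym, y ≠ y₀ → pnt i t y ∈ D) :
    ∀ᶠ x in 𝓝[closure D] (pnt i t y₀), VertConn (closure D) i (x i) (x j) ym := by
  obtain ⟨y₁, h1, h2, h3⟩ : ∃ y₁, η * y₀ < η * y₁ ∧ |y₁ - y₀| < ρ ∧ y₁ ∈ uIcc y₀ ym := by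
    have hε : 0 < min (ρ / 2) (η * ym - η * y₀) := lt_min (by linarith) (sub_pos.2 hym)
    have e1 := min_le_left (ρ / 2) (η * ym - η * y₀)
    have e2 := min_le_right (ρ / 2) (η * ym - η * y₀)
    refine ⟨y₀ + η * min (ρ / 2) (η * ym - η * y₀), ?_, ?_, ?_⟩
    · rcases hη with rfl | rfl <;> linarith
    · rcases hη with rfl | rfl
      · rw [abs_lt]; constructor <;> linarith
      · rw [abs_lt]; constructor <;> linarith
    · rcases hη with rfl | rfl
      · rw [uIcc_of_le (by linarith)]; constructor <;> linarith
      · rw [uIcc_of_ge (by linarith)]; constructor <;> linarith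
  have hD : VertConn D i t y₁ ym := fun y hy => hmid y (uIcc_subset_uIcc h3 right_mem_uIcc hy) (by
    rintro rfl
    rcases hη with rfl | rfl
    · rw [uIcc_of_le (by linarith)] at h3
      rw [uIcc_of_le h3.2] at hy
      linarith [hy.1]
    · rw [uIcc_of_ge (by linarith)] at h3
      rw [uIcc_of_ge h3.1] at hy
      linarith [hy.2])
  have c1 : ∀ᶠ x in 𝓝 (pnt i t y₀), VertConn D i (x i) y₁ ym := by
    have := (continuous_coord i).tendsto (pnt i t y₀)
    rw [pnt_same] at this
    exact this.eventually (hD.eventually h.isOpen)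
  have c2 : ∀ᶠ x in 𝓝 (pnt i t y₀), |x i - t| < ρ := by
    have hc : Continuous fun x : Plane => |x i - t| := by fun_prop
    refine hc.continuousAt.eventually_mem (isOpen_Iio.mem_nhds ?_)
    simpa using hρ
  have c3 : ∀ᶠ x in 𝓝 (pnt i t y₀), |x j - y₀| < ρ := by
    have hc : Continuous fun x : Plane => |x j - y₀| := by fun_prop
    refine hc.continuousAt.eventually_mem (isOpen_Iio.mem_nhds ?_)
    simpa [pnt_other hij] using hρ
  have c4 : ∀ᶠ x in 𝓝 (pnt i t y₀), η * x j < η * y₁ := by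
    have hc : Continuous fun x : Plane => η * x j := by fun_prop
    refine hc.continuousAt.eventually_mem (isOpen_Iio.mem_nhds ?_)
    simpa [pnt_other hij] using h1
  filter_upwards [nhdsWithin_le_nhds c1, nhdsWithin_le_nhds c2, nhdsWithin_le_nhds c3,
    nhdsWithin_le_nhds c4, self_mem_nhdsWithin] with x x1 x2 x3 x4 x5
  refine VertConn.trans (y' := y₁) (fun y hy => ?_) (x1.mono subset_closure)
  have hx : pnt i (x i) (x j) ∈ closure D := by rw [pnt_eta hij]; exact x5
  by_cases hyx : y = x j
  · rw [hyx]; exact hx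
  refine subset_closure (hup (x i) (x j) y x2 x3 ?_ ?_ hx)
  · have : |y - y₀| ≤ max |x j - y₀| |y₁ - y₀| := by
      rcases mem_uIcc.1 hy with hy | hy
      · exact abs_le_max_abs_abs (by linarith [hy.1]) (by linarith [hy.2])
      · rw [max_comm]
        exact abs_le_max_abs_abs (by linarith [hy.1]) (by linarith [hy.2])
    exact this.trans_lt (max_lt x3 h2)
  · rcases hη with rfl | rfl
    · rw [uIcc_of_le (by linarith)] at hy
      have := lt_of_le_of_ne hy.1 (Ne.symm hyx)
      linarith
    · rw [uIcc_of_ge (by linarith)] at hy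
      have := lt_of_le_of_ne hy.2 hyx
      linarith

/-- If the points between `(t, y₀)` and `(t, ym)` lie in `D`, then all points near `(t, y₀)` are
joined to the line through `(t, ym)`. -/
theorem eventually_vertConn_of_mem (h : IsMBC S D) (hij : i ≠ j) {t y₀ ym : ℝ}
    (hmid : VertConn D i t y₀ ym) :
    ∀ᶠ x in 𝓝 (pnt i t y₀), VertConn (closure D) i (x i) (x j) ym := by
  obtain ⟨ρ, hρ, hb⟩ := exists_box (h.isOpen.mem_nhds (hmid y₀ left_mem_uIcc))
  have c1 : ∀ᶠ x in 𝓝 (pnt i t y₀), VertConn D i (x i) y₀ ym := by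
    have := (continuous_coord i).tendsto (pnt i t y₀)
    rw [pnt_same] at this
    exact this.eventually (hmid.eventually h.isOpen)
  have c2 : ∀ᶠ x in 𝓝 (pnt i t y₀), |x i - t| < ρ := by
    have hc : Continuous fun x : Plane => |x i - t| := by fun_prop
    refine hc.continuousAt.eventually_mem (isOpen_Iio.mem_nhds ?_)
    simpa using hρ
  have c3 : ∀ᶠ x in 𝓝 (pnt i t y₀), |x j - y₀| < ρ := by
    have hc : Continuous fun x : Plane => |x j - y₀| := by fun_prop
    refine hc.continuousAt.eventually_mem (isOpen_Iio.mem_nhds ?_)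
    simpa [pnt_other hij] using hρ
  filter_upwards [c1, c2, c3] with x x1 x2 x3
  refine VertConn.trans (y' := y₀) (fun y hy => subset_closure (hb _ _ x2 ?_))
    (x1.mono subset_closure)
  rcases mem_uIcc.1 hy with hy | hy
  · rw [abs_lt] at x3 ⊢; constructor <;> linarith [hy.1, hy.2]
  · rw [abs_lt] at x3 ⊢; constructor <;> linarith [hy.1, hy.2]

/-- If near the fibre of `z` all points are joined to the line at level `ym`, then this line
provides a local section. -/
theorem hasLocalSection_of_eventually (h : IsMBC S D) (hij : i ≠ j) {z : PRSpace D i} {ym : ℝ}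
    (hD : pnt i (prHeight D i z) ym ∈ D)
    (hev : ∀ x : closure D, prMk D i x = z →
      ∀ᶠ y in 𝓝[closure D] (x : Plane), VertConn (closure D) i (y i) (y j) ym) :
    HasLocalSection (prHeight D i) z := by
  have := h.nonempty_closure
  obtain ⟨ρ, hρ, hb⟩ := exists_box (h.isOpen.mem_nhds hD)
  have hbD : ∀ s ∈ Ioo (prHeight D i z - ρ) (prHeight D i z + ρ), pnt i s ym ∈ closure D :=
    fun s hs => subset_closure (hb s ym (by rw [abs_lt]; constructor <;> linarith [hs.1, hs.2])
      (by simpa using hρ))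
  refine ⟨ρ, hρ, fun s => prAt D i (pnt i s ym), ?_, ?_, ?_⟩
  · exact continuousOn_prAt_pnt continuousOn_const hbD
  · intro s hs
    rw [prHeight_prAt (hbD s hs), pnt_same]
  · filter_upwards [eventually_fibre hij h.bounded hev] with w hw
    obtain ⟨x, rfl⟩ := surjective_prMk w
    have h1 := hw x rfl
    rw [prHeight_prMk, ← h1.prAt_eq hij, pnt_eta hij, prAt_coe]

/-- The quotient space has local sections outside the vertices. -/
theorem hasLocalSection (h : IsMBC S D) (hij : i ≠ j) {z : PRSpace D i}
    (hz : z ∈ (prVertices S D i)ᶜ) : HasLocalSection (prHeight D i) z := by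
  have := h.nonempty_closure
  have hord : ∀ x ∈ closure D, prAt D i x = z → IsOrdinary S i x := fun x hx hxz hn =>
    hz (mem_prVertices_iff.2 ⟨x, hx, hxz, hn⟩)
  obtain ⟨x₀, hx₀, hx₀z⟩ := exists_prAt z
  set t := x₀ i with ht
  have hzt : prHeight D i z = t := by rw [← hx₀z, prHeight_prAt hx₀]
  have hx₀' : pnt i t (x₀ j) ∈ closure D := by rw [ht, pnt_eta hij]; exact hx₀
  obtain ⟨a, b, ha, hb, hab, haD, hbD⟩ := h.exists_interval hij hx₀'
  have hK : ∀ y ∈ Icc a b, pnt i t y ∈ closure D := fun y hy => (hab y).2 hy y right_mem_uIcc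
  have hpz : ∀ y ∈ Icc a b, prAt D i (pnt i t y) = z := fun y hy => by
    rw [← ((hab y).2 hy).prAt_eq hij, ht, pnt_eta hij, hx₀z]
  have hord' : ∀ y ∈ Icc a b, IsOrdinary S i (pnt i t y) := fun y hy => hord _ (hK y hy) (hpz y hy)
  have hle : a ≤ b := ha.trans hb
  have hconn : ∀ y ∈ Icc a b, ∀ y', VertConn (closure D) i t y y' → y' ∈ Icc a b :=
    fun y hy y' hyy' => (hab y').1 (((hab y).2 hy).trans hyy')
  obtain ⟨ρ₁, hρ₁, hup₁⟩ := h.upSlices_of_end hij (Or.inl rfl) (hK a ⟨le_rfl, hle⟩) haD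
    (fun ε hε hc => by linarith [(hconn a ⟨le_rfl, hle⟩ _ hc).1]) (hord' a ⟨le_rfl, hle⟩)
  obtain ⟨ρ₂, hρ₂, hup₂⟩ := h.upSlices_of_end hij (Or.inr rfl) (hK b ⟨hle, le_rfl⟩) hbD
    (fun ε hε hc => by linarith [(hconn b ⟨hle, le_rfl⟩ _ hc).2]) (hord' b ⟨hle, le_rfl⟩)
  have hlt : a < b := by
    refine lt_of_le_of_ne hle fun hab' => ?_
    -- a one-point fibre cannot be closed under moving in
    have h1 : pnt i t (a + ρ₁ / 2) ∈ D := hup₁ t a (a + ρ₁ / 2) (by simpa) (by simpa)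
      (by rw [add_sub_cancel_left, abs_of_pos] <;> linarith) (by linarith) (hK a ⟨le_rfl, hle⟩)
    have h2 : VertConn (closure D) i t a (a + ρ₁ / 2) := fun y hy => by
      rw [uIcc_of_le (by linarith)] at hy
      rcases eq_or_lt_of_le hy.1 with rfl | hlt
      · exact hK _ ⟨le_rfl, hle⟩
      · exact subset_closure (hup₁ t a y (by simpa) (by simpa)
          (by rw [abs_of_pos] <;> linarith [hy.2]) (by linarith) (hK a ⟨le_rfl, hle⟩))
    linarith [(hconn a ⟨le_rfl, hle⟩ _ h2).2]
  have hint : ∀ y ∈ Ioo a b, pnt i t y ∈ D := fun y hy =>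
    h.mem_of_interior hij hK hy (hord' y (Ioo_subset_Icc_self hy))
  have hm : (a + b) / 2 ∈ Ioo a b := ⟨by linarith, by linarith⟩
  refine h.hasLocalSection_of_eventually hij (ym := (a + b) / 2) (by rw [hzt]; exact hint _ hm) ?_
  intro x hxz
  have hxt : (x : Plane) i = t := by
    rw [← hzt, ← hxz, prHeight_prMk]
  have hxab : (x : Plane) j ∈ Icc a b := by
    rw [← hab]
    rw [← prAt_coe, ← hx₀z, prAt_eq_iff hij x.2 hx₀, hxt] at hxz
    exact hxz.2.symm
  rw [← pnt_eta hij (x : Plane), hxt]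
  rcases eq_or_lt_of_le hxab.1 with h1 | h1
  · rw [← h1]
    refine h.eventually_vertConn_of_upSlices hij (Or.inl rfl) hρ₁ hup₁ (by linarith [hm.1])
      fun y hy hya => hint y ?_
    rw [uIcc_of_le hm.1.le] at hy
    exact ⟨lt_of_le_of_ne hy.1 (Ne.symm hya), hy.2.trans_lt hm.2⟩
  rcases eq_or_lt_of_le hxab.2 with h2 | h2
  · rw [h2]
    refine h.eventually_vertConn_of_upSlices hij (Or.inr rfl) hρ₂ hup₂ (by linarith [hm.2])
      fun y hy hyb => hint y ?_
    rw [uIcc_of_ge hm.2.le] at hy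
    exact ⟨hm.1.trans_le hy.1, lt_of_le_of_ne hy.2 hyb⟩
  · refine nhdsWithin_le_nhds (h.eventually_vertConn_of_mem hij fun y hy => hint y ?_)
    exact ordConnected_Ioo.uIcc_subset ⟨h1, h2⟩ hm hy

/-- The Poincaré–Reeb V-digraph of an arrangement is a finite graph. -/
theorem nonempty_poincareReebGraph (h : IsMBC S D) (hij : i ≠ j) :
    Nonempty (PoincareReebGraph S D i) := by
  have := t2Space_prSpace (D := D) hij h.bounded
  have := compactSpace_closure h.bounded
  have : CompactSpace (PRSpace D i) := Quotient.compactSpace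
  obtain ⟨Γ, hV, hE, R, hl⟩ := exists_realization (h := prHeight D i) continuous_prHeight
    (h.finite_fibre hij) (finite_prVertices h.finite D i) fun z hz => h.hasLocalSection hij hz
  exact PoincareReebGraph.nonempty_of_realization R hl

end IsMBC

/-! ### Removing a small disc centred on the boundary -/

/-- Half an annulus centred at a point of a circle, on one side of that circle, is connected. -/
theorem isPreconnected_half_annulus {i j : Fin 2} (hij : i ≠ j) (c : PlaneCircle) {p : Plane}
    (hp : p ∈ c.carrier) {ε : ℝ} (hε : ε = 1 ∨ ε = -1) {r ρ : ℝ} (hr : 0 < r) (hrρ : r < ρ)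
    (hρ : ρ < 2 * c.radius) :
    IsPreconnected {x | r < dist x p ∧ dist x p < ρ ∧ 0 < ε * c.pow x} := by
  have hR := c.radius_pos
  have hεε : ε * ε = 1 := by rcases hε with rfl | rfl <;> norm_num
  set u := ε * (p i - c.center i) / c.radius with hu
  set v := ε * (p j - c.center j) / c.radius with hv
  have hpR : (p i - c.center i) ^ 2 + (p j - c.center j) ^ 2 = c.radius ^ 2 := by
    have := (c.pow_eq_zero_iff p).2 hp
    rw [c.pow_coord hij] at this
    linarith
  have huv : u ^ 2 + v ^ 2 = 1 := by
    rw [hu, hv]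
    field_simp
    linear_combination (ε * ε) * hpR + c.radius ^ 2 * hεε
  have huR : p i - c.center i = ε * c.radius * u := by
    rw [hu]; field_simp; linear_combination (-(p i - c.center i)) * hεε
  have hvR : p j - c.center j = ε * c.radius * v := by
    rw [hv]; field_simp; linear_combination (-(p j - c.center j)) * hεε
  -- polar coordinates around `p`, starting from the normal of the circle
  set f : ℝ → ℝ → Plane := fun l θ => pnt i (p i + l * (Real.cos θ * u - Real.sin θ * v))
    (p j + l * (Real.cos θ * v + Real.sin θ * u)) with hf
  have hfd : ∀ l θ, 0 ≤ l → dist (f l θ) p = l := by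
    intro l θ hl
    have h1 : dist (f l θ) p ^ 2 = l ^ 2 := by
      rw [dist_sq hij, hf]
      simp only [pnt_same, pnt_other hij]
      linear_combination l ^ 2 * (u ^ 2 + v ^ 2) * Real.sin_sq_add_cos_sq θ + l ^ 2 * huv
    exact (pow_left_inj₀ dist_nonneg hl two_ne_zero).1 h1
  have hfp : ∀ l θ, ε * c.pow (f l θ) = 2 * c.radius * l * Real.cos θ + ε * l ^ 2 := by
    intro l θ
    rw [c.pow_coord hij, hf]
    simp only [pnt_same, pnt_other hij]
    linear_combination ε * hpR + (2 * ε * l * (Real.cos θ * u - Real.sin θ * v)) * huR +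
      (2 * ε * l * (Real.cos θ * v + Real.sin θ * u)) * hvR +
      (ε * l ^ 2 * (u ^ 2 + v ^ 2)) * Real.sin_sq_add_cos_sq θ +
      (2 * ε * ε * l * c.radius * Real.cos θ + ε * l ^ 2) * huv +
      2 * l * c.radius * Real.cos θ * hεε
  have hray : ∀ l ∈ Ioo r ρ, f l 0 ∈ {x | r < dist x p ∧ dist x p < ρ ∧ 0 < ε * c.pow x} := by
    intro l hl
    refine ⟨?_, ?_, ?_⟩
    · rw [hfd l 0 (hr.le.trans hl.1.le)]; exact hl.1
    · rw [hfd l 0 (hr.le.trans hl.1.le)]; exact hl.2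
    · rw [hfp, Real.cos_zero]
      have h1 := hl.1
      have h2 := hl.2
      rcases hε with h | h <;> rw [h] <;> nlinarith
  refine isPreconnected_of_forall (f ((r + ρ) / 2) 0) fun x hx => ?_
  obtain ⟨hx1, hx2, hx3⟩ := hx
  set z : ℂ := ⟨(x i - p i) * u + (x j - p j) * v, (x j - p j) * u - (x i - p i) * v⟩ with hz
  have hzn : ‖z‖ = dist x p := by
    have h1 : ‖z‖ ^ 2 = dist x p ^ 2 := by
      rw [← Complex.normSq_eq_norm_sq, Complex.normSq_apply, dist_sq hij, hz]
      simp only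
      linear_combination ((x i - p i) ^ 2 + (x j - p j) ^ 2) * huv
    exact (pow_left_inj₀ (norm_nonneg _) dist_nonneg two_ne_zero).1 h1
  have hxf : f (dist x p) z.arg = x := by
    have h1 := Complex.norm_mul_cos_arg z
    have h2 := Complex.norm_mul_sin_arg z
    rw [hzn] at h1 h2
    have h3 : z.re = (x i - p i) * u + (x j - p j) * v := rfl
    have h4 : z.im = (x j - p j) * u - (x i - p i) * v := rfl
    rw [h3] at h1
    rw [h4] at h2
    refine plane_ext hij ?_ ?_
    · simp only [hf, pnt_same]
      linear_combination u * h1 - v * h2 + (x i - p i) * huv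
    · simp only [hf, pnt_other hij]
      linear_combination v * h1 + u * h2 + (x j - p j) * huv
  have harc : ∀ θ ∈ uIcc 0 z.arg, f (dist x p) θ ∈
      {x | r < dist x p ∧ dist x p < ρ ∧ 0 < ε * c.pow x} := by
    intro θ hθ
    have hl := hfd (dist x p) θ dist_nonneg
    refine ⟨by rw [hl]; exact hx1, by rw [hl]; exact hx2, ?_⟩
    have h1 : Real.cos z.arg ≤ Real.cos θ := by
      rw [← Real.cos_abs z.arg, ← Real.cos_abs θ]
      refine Real.cos_le_cos_of_nonneg_of_le_pi (abs_nonneg _) (Complex.abs_arg_le_pi z) ?_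
      rcases mem_uIcc.1 hθ with h | h
      · rw [abs_of_nonneg h.1, abs_of_nonneg (h.1.trans h.2)]; exact h.2
      · rw [abs_of_nonpos h.2, abs_of_nonpos (h.1.trans h.2)]; linarith [h.1]
    have h2 : 0 < ε * c.pow (f (dist x p) z.arg) := by rw [hxf]; exact hx3
    rw [hfp] at h2 ⊢
    have h3 : 0 ≤ 2 * c.radius * dist x p * (Real.cos θ - Real.cos z.arg) :=
      mul_nonneg (by positivity) (by linarith)
    linarith
  have hcont : Continuous fun q : ℝ × ℝ => f q.1 q.2 := by
    simp only [hf]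
    fun_prop
  refine ⟨(fun l => f l 0) '' Ioo r ρ ∪ (fun θ => f (dist x p) θ) '' uIcc 0 z.arg, ?_, ?_, ?_, ?_⟩
  · rintro _ (⟨l, hl, rfl⟩ | ⟨θ, hθ, rfl⟩)
    · exact hray l hl
    · exact harc θ hθ
  · exact Or.inl ⟨_, ⟨by linarith, by linarith⟩, rfl⟩
  · exact Or.inr ⟨_, right_mem_uIcc, hxf⟩
  · refine IsPreconnected.union (f (dist x p) 0) ⟨_, ⟨hx1, hx2⟩, rfl⟩ ⟨_, left_mem_uIcc, rfl⟩ ?_ ?_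
    · exact isPreconnected_Ioo.image _ (hcont.comp (by fun_prop :
        Continuous fun l : ℝ => (l, (0 : ℝ)))).continuousOn
    · exact isPreconnected_uIcc.image _ (hcont.comp (by fun_prop :
        Continuous fun θ : ℝ => (dist x p, θ))).continuousOn

/-- The disc of radius `ρ` around `p` is small compared with the arrangement: in it, `D` is one
side of the circle `c` through `p`, there are no poles except perhaps `p`, and it is small compared
with the circles and with the nonzero coordinates of the radius of `c` at `p`. -/
structure IsSmall (S : Set PlaneCircle) (D : Set Plane) (c : PlaneCircle) (p : Plane) (ρ : ℝ) :
    Prop where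
  pos : 0 < ρ
  mem : ∀ x, dist x p < ρ → 0 < sidePow D c x → x ∈ D
  mem_closure : ∀ x, dist x p < ρ → 0 ≤ sidePow D c x → x ∈ closure D
  single : ∀ x, dist x p < ρ → ∀ d ∈ S, x ∈ d.carrier → d = c
  no_pole : ∀ x, dist x p < ρ → x ≠ p → ∀ d ∈ S, ∀ k, ¬ d.IsPole k x
  radius_le : ∀ d ∈ S, ρ < d.radius
  coord : ∀ k : Fin 2, p k - c.center k ≠ 0 → ρ < |p k - c.center k|

namespace IsMBC

variable {S : Set PlaneCircle} {D : Set Plane} {i j : Fin 2} {c : PlaneCircle} {p : Plane}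

theorem exists_isSmall (h : IsMBC S D) (hpD : p ∈ closure D)
    (huniq : ∀ d ∈ S, p ∈ d.carrier → d = c) : ∃ ρ, IsSmall S D c p ρ := by
  obtain ⟨ρ₁, hρ₁, h1⟩ := Metric.eventually_nhds_iff.1 (h.eventually_mem_of_single hpD huniq)
  have hfin : (⋃ k : Fin 2, {x | ¬ IsOrdinary S k x}).Finite :=
    Set.finite_iUnion fun k => finite_not_isOrdinary h.finite k
  have hnear : ∀ᶠ x in 𝓝 p, x ≠ p → x ∉ ⋃ k : Fin 2, {x | ¬ IsOrdinary S k x} := by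
    have := (hfin.sdiff (t := {p})).isClosed.isOpen_compl.mem_nhds (x := p) (by simp)
    filter_upwards [this] with x hx hxp hxn
    exact hx ⟨hxn, hxp⟩
  obtain ⟨ρ₂, hρ₂, h2⟩ := Metric.eventually_nhds_iff.1 hnear
  obtain ⟨ρ₃, hρ₃, h3⟩ : ∃ ρ > 0, ∀ d ∈ S, ρ < d.radius := by
    have : ∀ᶠ ρ : ℝ in 𝓝[>] 0, ∀ d ∈ S, ρ < d.radius :=
      (eventually_all_finite h.finite).2 fun d _ =>
        nhdsWithin_le_nhds (Iio_mem_nhds d.radius_pos)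
    obtain ⟨ρ, hρ, hρ0⟩ := (this.and self_mem_nhdsWithin).exists
    exact ⟨ρ, hρ0, hρ⟩
  obtain ⟨ρ₄, hρ₄, h4⟩ : ∃ ρ > 0, ∀ k : Fin 2, p k - c.center k ≠ 0 → ρ < |p k - c.center k| := by
    have : ∀ᶠ ρ : ℝ in 𝓝[>] 0, ∀ k : Fin 2, p k - c.center k ≠ 0 → ρ < |p k - c.center k| := by
      refine eventually_all.2 fun k => ?_
      by_cases hk : p k - c.center k = 0
      · exact Eventually.of_forall fun _ hne => absurd hk hne
      · filter_upwards [nhdsWithin_le_nhds (Iio_mem_nhds (abs_pos.2 hk))] with ρ hρ _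
        exact hρ
    obtain ⟨ρ, hρ, hρ0⟩ := (this.and self_mem_nhdsWithin).exists
    exact ⟨ρ, hρ0, hρ⟩
  refine ⟨min (min ρ₁ ρ₂) (min ρ₃ ρ₄), by positivity, fun x hx => ?_, fun x hx => ?_, fun x hx => ?_,
    fun x hx hxp d hd k hk => ?_, fun d hd => ?_, fun k hk => ?_⟩
  · exact (h1 (hx.trans_le ((min_le_left _ _).trans (min_le_left _ _)))).1
  · exact (h1 (hx.trans_le ((min_le_left _ _).trans (min_le_left _ _)))).2.1
  · exact (h1 (hx.trans_le ((min_le_left _ _).trans (min_le_left _ _)))).2.2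
  · refine h2 (hx.trans_le ((min_le_left _ _).trans (min_le_right _ _))) hxp ?_
    exact mem_iUnion.2 ⟨k, not_not.2 (Or.inl ⟨d, hd, hk⟩)⟩
  · exact ((min_le_right _ _).trans (min_le_left _ _)).trans_lt (h3 d hd)
  · exact ((min_le_right _ _).trans (min_le_right _ _)).trans_lt (h4 k hk)

end IsMBC

theorem IsSmall.mono {S : Set PlaneCircle} {D : Set Plane} {c : PlaneCircle} {p : Plane} {ρ ρ' : ℝ}
    (h : IsSmall S D c p ρ) (h0 : 0 < ρ') (hle : ρ' ≤ ρ) : IsSmall S D c p ρ' where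
  pos := h0
  mem x hx := h.mem x (hx.trans_le hle)
  mem_closure x hx := h.mem_closure x (hx.trans_le hle)
  single x hx := h.single x (hx.trans_le hle)
  no_pole x hx := h.no_pole x (hx.trans_le hle)
  radius_le d hd := hle.trans_lt (h.radius_le d hd)
  coord k hk := hle.trans_lt (h.coord k hk)

/-- The set `D` without the closed disc of radius `r` around `p`. -/
abbrev cut (D : Set Plane) (p : Plane) (r : ℝ) : Set Plane := D \ Metric.closedBall p r

namespace IsMBC

variable {S : Set PlaneCircle} {D : Set Plane} {i j : Fin 2} {c : PlaneCircle} {p : Plane} {ρ r : ℝ}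

theorem isPreconnected_cut (h : IsMBC S D) (hij : i ≠ j) (hc : c ∈ S) (hp : p ∈ c.carrier)
    (hpD : p ∈ closure D) (hs : IsSmall S D c p ρ) (hr : 0 < r) (hrρ : r < ρ) :
    IsPreconnected (cut D p r) := by
  have hρR : ρ < 2 * c.radius := by linarith [hs.radius_le c hc, c.radius_pos]
  have hring := isPreconnected_half_annulus hij c hp (sideSign_eq D c) hr hrρ hρR
  set A := {x | r < dist x p ∧ dist x p < ρ ∧ 0 < sideSign D c * c.pow x} with hA
  have hAD : ∀ x ∈ cut D p r, dist x p < ρ → x ∈ A := fun x hx hxρ =>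
    ⟨not_le.1 fun hle => hx.2 hle, hxρ, h.sidePow_pos hc hx.1⟩
  have hDA : A ⊆ cut D p r := fun x hx => ⟨hs.mem x hx.2.1 hx.2.2, not_le.2 hx.1⟩
  have hopen : IsOpen (cut D p r) := h.isOpen.sdiff Metric.isClosed_closedBall
  obtain ⟨x₀, hx₀, hx₀D⟩ := mem_closure_iff.1 hpD _ Metric.isOpen_ball (Metric.mem_ball_self hr)
  -- a part of the new set that contains the half annulus can be extended over the disc
  have key : ∀ u v : Set Plane, IsOpen u → IsOpen v → cut D p r ⊆ u ∪ v →
      cut D p r ∩ (u ∩ v) = ∅ → A ⊆ u → cut D p r ⊆ u := by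
    intro u v hu hv huv hdis hAu
    have h1 : D ⊆ ((cut D p r ∩ u) ∪ (D ∩ Metric.ball p ρ)) ∪ (cut D p r ∩ v) := by
      intro x hx
      by_cases hxr : x ∈ Metric.closedBall p r
      · exact Or.inl (Or.inr ⟨hx, (Metric.mem_closedBall.1 hxr).trans_lt hrρ⟩)
      · rcases huv ⟨hx, hxr⟩ with h1 | h1
        · exact Or.inl (Or.inl ⟨⟨hx, hxr⟩, h1⟩)
        · exact Or.inr ⟨⟨hx, hxr⟩, h1⟩
    have h2 : Disjoint ((cut D p r ∩ u) ∪ (D ∩ Metric.ball p ρ)) (cut D p r ∩ v) := by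
      rw [Set.disjoint_left]
      rintro x (hx | hx) hxv
      · have : x ∈ cut D p r ∩ (u ∩ v) := ⟨hx.1, hx.2, hxv.2⟩
        rw [hdis] at this
        exact this
      · have : x ∈ cut D p r ∩ (u ∩ v) := ⟨hxv.1, hAu (hAD x hxv.1 hx.2), hxv.2⟩
        rw [hdis] at this
        exact this
    rcases h.isPreconnected.subset_or_subset ((hopen.inter hu).union
      (h.isOpen.inter Metric.isOpen_ball)) (hopen.inter hv) h2 h1 with h3 | h3
    · intro x hx
      rcases h3 hx.1 with h4 | h4
      · exact h4.2
      · exact hAu (hAD x hx h4.2)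
    · exact absurd (Metric.ball_subset_closedBall hx₀) (h3 hx₀D).1.2
  rw [isPreconnected_iff_subset_of_disjoint]
  intro u v hu hv huv hdis
  have hA' : A ∩ (u ∩ v) = ∅ := by
    rw [← subset_empty_iff, ← hdis]
    exact inter_subset_inter_left _ hDA
  rcases isPreconnected_iff_subset_of_disjoint.1 hring u v hu hv (hDA.trans huv) hA' with h1 | h1
  · exact Or.inl (key u v hu hv huv hdis h1)
  · exact Or.inr (key v u hv hu (by rwa [union_comm]) (by rwa [inter_comm v u]) h1)

theorem closure_cut (h : IsMBC S D) (hc : c ∈ S) (hp : p ∈ c.carrier)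
    (hs : IsSmall S D c p ρ) (hr : 0 < r) (hrρ : r < ρ) :
    closure (cut D p r) = closure D \ Metric.ball p r := by
  apply Subset.antisymm
  · intro x hx
    refine ⟨closure_mono sdiff_subset hx, fun hxb => ?_⟩
    obtain ⟨y, hy, hyD⟩ := mem_closure_iff.1 hx _ Metric.isOpen_ball hxb
    exact hyD.2 (Metric.ball_subset_closedBall hy)
  · rintro x ⟨hx, hxb⟩
    have hxr : r ≤ dist x p := not_lt.1 hxb
    rcases hxr.eq_or_lt with hxr | hxr
    swap
    · rw [mem_closure_iff]
      intro o ho hxo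
      have hxo' : x ∈ o ∩ (Metric.closedBall p r)ᶜ := ⟨hxo, fun hc => absurd hc (not_le.2 hxr)⟩
      obtain ⟨y, hy, hyD⟩ := mem_closure_iff.1 hx _
        (ho.inter Metric.isClosed_closedBall.isOpen_compl) hxo'
      exact ⟨y, hy.1, hyD, hy.2⟩
    · -- move away from `p` and into the side of `D`
      have hrR : r < c.radius := hrρ.trans (hs.radius_le c hc)
      have hε := sideSign_eq D c
      set ε := sideSign D c with hεdef
      have hF0 : 0 ≤ ε * c.pow x := h.sidePow_nonneg hc hx
      set n := p - c.center with hn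
      have hnn : ‖n‖ = c.radius := by rw [hn, ← dist_eq_norm]; exact hp
      have hyn : ‖x - p‖ = r := by rw [← dist_eq_norm, hxr]
      have hpow : c.pow x = 2 * inner ℝ n (x - p) + r ^ 2 := by
        unfold PlaneCircle.pow
        rw [dist_eq_norm, show x - c.center = n + (x - p) by rw [hn]; abel, norm_add_sq_real, hnn,
          hyn]
        ring
      set v := ε • n + (x - p) with hv
      have hxp : inner ℝ (x - p) v = ε * inner ℝ n (x - p) + r ^ 2 := by
        rw [hv, inner_add_right, inner_smul_right, real_inner_self_eq_norm_sq, hyn,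
          real_inner_comm]
      have hxc : ε * inner ℝ (x - c.center) v = c.radius ^ 2 + (ε + 1) * inner ℝ n (x - p) +
          ε * r ^ 2 := by
        rw [show x - c.center = n + (x - p) by rw [hn]; abel, inner_add_left, hxp, hv,
          inner_add_right, inner_smul_right, real_inner_self_eq_norm_sq, hnn]
        rcases hε with e | e <;> rw [e] <;> ring
      have hpos1 : 0 < inner ℝ (x - p) v := by
        rw [hxp]
        rw [hpow] at hF0
        have : 0 < r ^ 2 := by positivity
        rcases hε with e | e <;> rw [e] at hF0 ⊢ <;> nlinarith
      have hpos2 : 0 < ε * inner ℝ (x - c.center) v := by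
        rw [hxc]
        rw [hpow] at hF0
        have : r ^ 2 < c.radius ^ 2 := by nlinarith
        rcases hε with e | e <;> rw [e] at hF0 ⊢ <;> nlinarith
      have hlim : Tendsto (fun τ : ℝ => x + τ • v) (𝓝[>] 0) (𝓝 x) := by
        have : Continuous fun τ : ℝ => x + τ • v := by fun_prop
        have h1 := this.tendsto 0
        rw [zero_smul, add_zero] at h1
        exact h1.mono_left nhdsWithin_le_nhds
      have hball : ∀ᶠ τ : ℝ in 𝓝[>] 0, x + τ • v ∈ Metric.ball p ρ :=
        hlim (Metric.isOpen_ball.mem_nhds (show dist x p < ρ by rw [← hxr]; exact hrρ))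
      have hinc : ∀ᶠ τ : ℝ in 𝓝[>] 0, 0 < ε * (2 * inner ℝ (x - c.center) v + τ * ‖v‖ ^ 2) := by
        have hcont : Continuous fun τ : ℝ => ε * (2 * inner ℝ (x - c.center) v + τ * ‖v‖ ^ 2) := by
          fun_prop
        have h1 := hcont.tendsto 0
        refine nhdsWithin_le_nhds (h1.eventually (Ioi_mem_nhds ?_))
        linarith
      refine mem_closure_of_tendsto hlim ?_
      filter_upwards [hball, hinc, self_mem_nhdsWithin] with τ hτ1 hτ2 hτ0
      have hτ0 : 0 < τ := hτ0
      refine ⟨hs.mem _ hτ1 ?_, fun hcb => ?_⟩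
      · have h1 := c.pow_add x v τ
        have h2 := mul_pos hτ0 hτ2
        have h3 : ε * c.pow (x + τ • v) = ε * c.pow x +
            τ * (ε * (2 * inner ℝ (x - c.center) v + τ * ‖v‖ ^ 2)) := by
          linear_combination ε * h1
        show 0 < ε * c.pow (x + τ • v)
        linarith
      · have h1 : dist (x + τ • v) p ^ 2 ≤ r ^ 2 := pow_le_pow_left₀ dist_nonneg hcb 2
        rw [dist_eq_norm, show x + τ • v - p = (x - p) + τ • v by abel, norm_add_sq_real, hyn,
          inner_smul_right] at h1
        have h2 := mul_pos hτ0 hpos1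
        nlinarith [sq_nonneg ‖τ • v‖]

/-- A point where the new circle meets `c`. -/
theorem exists_new_crossing (c : PlaneCircle) (hij : i ≠ j) (hp : p ∈ c.carrier) (hr : 0 < r)
    (hrR : r < c.radius) : ∃ x, dist x p = r ∧ x ∈ c.carrier := by
  have hR := c.radius_pos
  have hpR : (p i - c.center i) ^ 2 + (p j - c.center j) ^ 2 = c.radius ^ 2 := by
    have := (c.pow_eq_zero_iff p).2 hp
    rw [c.pow_coord hij] at this
    linarith
  -- rotate `p` around the centre by the angle with this cosine
  set C := 1 - r ^ 2 / (2 * c.radius ^ 2) with hC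
  have hC' : 2 * c.radius ^ 2 * (1 - C) = r ^ 2 := by rw [hC]; field_simp; ring
  have hrr : r ^ 2 < c.radius ^ 2 := by nlinarith
  have hC0 : 0 ≤ C := by nlinarith
  have hC1 : C ≤ 1 := by nlinarith [sq_nonneg r, sq_nonneg c.radius]
  set s := Real.sqrt (1 - C ^ 2) with hs
  have hs2 : s ^ 2 = 1 - C ^ 2 := Real.sq_sqrt (by nlinarith)
  refine ⟨pnt i (c.center i + C * (p i - c.center i) - s * (p j - c.center j))
    (c.center j + C * (p j - c.center j) + s * (p i - c.center i)), ?_, ?_⟩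
  · have h1 : dist (pnt i (c.center i + C * (p i - c.center i) - s * (p j - c.center j))
        (c.center j + C * (p j - c.center j) + s * (p i - c.center i))) p ^ 2 = r ^ 2 := by
      rw [dist_sq hij, pnt_same, pnt_other hij]
      linear_combination hC' + ((1 - C) ^ 2 + s ^ 2) * hpR + c.radius ^ 2 * hs2
    exact (pow_left_inj₀ dist_nonneg hr.le two_ne_zero).1 h1
  · rw [← c.pow_eq_zero_iff, c.pow_pnt hij]
    linear_combination (C ^ 2 + s ^ 2) * hpR + c.radius ^ 2 * hs2

theorem tangent_transversal (c : PlaneCircle) (hp : p ∈ c.carrier) (hr : 0 < r)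
    (hrR : r < c.radius) {x : Plane} (hx : dist x p = r) (hxc : x ∈ c.carrier) :
    c.tangentSpace x ⊔ (PlaneCircle.mk p r hr).tangentSpace x = ⊤ := by
  rw [← Submodule.orthogonal_eq_bot_iff, ← Submodule.inf_orthogonal]
  unfold PlaneCircle.tangentSpace
  rw [Submodule.orthogonal_orthogonal, Submodule.orthogonal_orthogonal, eq_bot_iff]
  rintro y ⟨hy1, hy2⟩
  obtain ⟨α, rfl⟩ := Submodule.mem_span_singleton.1 hy1
  obtain ⟨β, hβ⟩ := Submodule.mem_span_singleton.1 hy2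
  have hβ : β • (x - p) = α • (x - c.center) := hβ
  by_cases hα : α = 0
  · simp [hα]
  exfalso
  have h1 : x - c.center = (β / α) • (x - p) := by
    rw [div_eq_inv_mul, mul_smul, hβ, smul_smul, inv_mul_cancel₀ hα, one_smul]
  set γ := β / α
  have h2 : p - c.center = (γ - 1) • (x - p) := by
    rw [sub_smul, ← h1, one_smul]; abel
  have h3 : c.radius = |γ| * r := by
    rw [← hx, dist_eq_norm, ← Real.norm_eq_abs, ← norm_smul, ← h1, ← dist_eq_norm]
    exact hxc.symm
  have h4 : c.radius = |γ - 1| * r := by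
    rw [← hx, dist_eq_norm, ← Real.norm_eq_abs, ← norm_smul, ← h2, ← dist_eq_norm]
    exact hp.symm
  have h5 : |γ| = |γ - 1| := by
    have := h3.symm.trans h4
    exact mul_right_cancel₀ hr.ne' this
  rcases abs_eq_abs.1 h5 with h6 | h6
  · linarith
  · have h7 : γ = 1 / 2 := by linarith
    rw [h7, abs_of_pos (by norm_num)] at h3
    linarith

/-- The new pair is again an arrangement. -/
theorem isMBC_cut (h : IsMBC S D) (hij : i ≠ j) (hc : c ∈ S) (hp : p ∈ c.carrier)
    (hpD : p ∈ closure D) (hs : IsSmall S D c p ρ) (hr : 0 < r) (hrρ : r < ρ) :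
    IsMBC (insert ⟨p, r, hr⟩ S) (cut D p r) := by
  have hrR : r < c.radius := hrρ.trans (hs.radius_le c hc)
  have hcl := h.closure_cut hc hp hs hr hrρ
  have hclsub : closure (cut D p r) ⊆ closure D := closure_mono sdiff_subset
  obtain ⟨y, hyr, hyc⟩ := exists_new_crossing c hij hp hr hrR
  have hyK : y ∈ closure (cut D p r) := by
    rw [hcl]
    refine ⟨hs.mem_closure y (by rw [hyr]; exact hrρ) ?_, fun hyb => hyb.ne hyr⟩
    rw [(sidePow_eq_zero_iff D c y).2 hyc]
  have hsingle : ∀ x, dist x p = r → ∀ d ∈ S, x ∈ d.carrier → d = c := fun x hx =>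
    hs.single x (by rw [hx]; exact hrρ)
  have hne : (cut D p r).Nonempty := by
    rw [← closure_nonempty_iff]; exact ⟨y, hyK⟩
  have hdisj : ∀ x ∈ cut D p r, x ∈ (⋃ d ∈ insert (⟨p, r, hr⟩ : PlaneCircle) S, d.carrier)ᶜ := by
    intro x hx hxc
    obtain ⟨d, hd, hxd⟩ := mem_iUnion₂.1 hxc
    rcases hd with rfl | hd
    · exact hx.2 (le_of_eq hxd)
    · exact h.notMem_carrier hd hx.1 hxd
  constructor
  · exact h.finite.insert _
  · obtain ⟨x, hx⟩ := hne
    refine ⟨x, hdisj x hx, Subset.antisymm ?_ ?_⟩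
    · exact (h.isPreconnected_cut hij hc hp hpD hs hr hrρ).subset_connectedComponentIn hx hdisj
    · have hpre := isPreconnected_connectedComponentIn (x := x)
        (F := (⋃ d ∈ insert (⟨p, r, hr⟩ : PlaneCircle) S, d.carrier)ᶜ)
      have hself := mem_connectedComponentIn (hdisj x hx)
      have hav : ∀ z ∈ connectedComponentIn (⋃ d ∈ insert (⟨p, r, hr⟩ : PlaneCircle) S, d.carrier)ᶜ x,
          ∀ d ∈ insert (⟨p, r, hr⟩ : PlaneCircle) S, z ∉ d.carrier := fun z hz d hd hzd =>
        connectedComponentIn_subset _ _ hz (mem_biUnion hd hzd)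
      intro z hz
      refine ⟨h.subset_of_isPreconnected hpre (fun z hz d hd => hav z hz d (Or.inr hd))
        ⟨x, hself, hx.1⟩ hz, ?_⟩
      have hsub : connectedComponentIn (⋃ d ∈ insert (⟨p, r, hr⟩ : PlaneCircle) S, d.carrier)ᶜ x ⊆
          Metric.ball p r ∪ (Metric.closedBall p r)ᶜ := by
        intro w hw
        rcases lt_trichotomy (dist w p) r with h1 | h1 | h1
        · exact Or.inl h1
        · have h2 : w ∉ (PlaneCircle.mk p r hr).carrier := hav w hw _ (mem_insert _ _)
          exact absurd h1 h2
        · exact Or.inr fun h2 => absurd (Metric.mem_closedBall.1 h2) (not_le.2 h1)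
      rcases hpre.subset_or_subset Metric.isOpen_ball Metric.isClosed_closedBall.isOpen_compl
        (disjoint_compl_right.mono_left Metric.ball_subset_closedBall) hsub with h1 | h1
      · exact absurd (Metric.ball_subset_closedBall (h1 hself)) hx.2
      · exact h1 hz
  · exact h.bounded.subset sdiff_subset
  · rintro d (rfl | hd)
    · exact ⟨y, hyK, hyr⟩
    · by_cases hdc : d = c
      · rw [hdc]; exact ⟨y, hyK, hyc⟩
      · obtain ⟨x, hxK, hxd⟩ := h.meets d hd
        refine ⟨x, ?_, hxd⟩
        rw [hcl]
        exact ⟨hxK, fun hxb => hdc (hs.single x ((Metric.mem_ball.1 hxb).trans hrρ) d hd hxd)⟩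
  · rintro d (rfl | hd) e (rfl | he) hde x hx hxd hxe
    · exact absurd rfl hde
    · have hec := hsingle x hxd e he hxe
      rw [hec] at hxe ⊢
      rw [sup_comm]
      exact tangent_transversal c hp hr hrR hxd hxe
    · have hdc := hsingle x hxe d hd hxd
      rw [hdc] at hxd ⊢
      exact tangent_transversal c hp hr hrR hxe hxd
    · exact h.transversal d hd e he hde x (hclsub hx) hxd hxe
  · rintro d hd e he f hf hde hdf hef x hx ⟨hxd, hxe, hxf⟩
    rcases hd with rfl | hd
    · have he := mem_of_mem_insert_of_ne he (Ne.symm hde)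
      have hf := mem_of_mem_insert_of_ne hf (Ne.symm hdf)
      exact hef ((hsingle x hxd e he hxe).trans (hsingle x hxd f hf hxf).symm)
    rcases he with rfl | he
    · have hf := mem_of_mem_insert_of_ne hf (Ne.symm hef)
      exact hdf ((hsingle x hxe d hd hxd).trans (hsingle x hxe f hf hxf).symm)
    rcases hf with rfl | hf
    · exact hde ((hsingle x hxf d hd hxd).trans (hsingle x hxf e he hxe).symm)
    exact h.no_triple d hd e he f hf hde hdf hef x (hclsub hx) ⟨hxd, hxe, hxf⟩
  · rintro x hx ⟨d, hd, e, he, hde, hxd, hxe⟩ f hf k hk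
    obtain ⟨l, hkl⟩ : ∃ l : Fin 2, k ≠ l := ⟨1 - k, by omega⟩
    by_cases hxr : dist x p = r
    · have hxc : x ∈ c.carrier := by
        rcases hd with rfl | hd
        · have he := mem_of_mem_insert_of_ne he (Ne.symm hde)
          rw [← hsingle x hxr e he hxe]; exact hxe
        · rw [← hsingle x hxr d hd hxd]; exact hxd
      rcases hf with rfl | hf
      · -- `c` does not pass through the poles of the new circle
        have h1 := ((PlaneCircle.mk p r hr).isPole_iff hkl x).1 hk
        have h2 : x l = p l := h1.2
        have h3 : (x k - p k) ^ 2 = r ^ 2 := by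
          rw [← hxr, dist_sq hkl, h2]; ring
        have h4 := (c.pow_eq_zero_iff x).2 hxc
        have h5 := (c.pow_eq_zero_iff p).2 hp
        rw [c.pow_coord hkl] at h4 h5
        rw [h2] at h4
        have h6 : 2 * (x k - p k) * (p k - c.center k) = -r ^ 2 := by
          linear_combination h4 - h5 - h3
        have h7 : |x k - p k| = r := by
          rw [← abs_of_pos hr]
          exact (sq_eq_sq_iff_abs_eq_abs _ _).1 h3
        by_cases h8 : p k - c.center k = 0
        · rw [h8] at h6
          nlinarith
        · have h9 := hs.coord k h8
          have h10 := congrArg abs h6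
          rw [abs_mul, abs_mul, h7, abs_neg, abs_of_pos (by positivity : (0 : ℝ) < r ^ 2),
            abs_of_pos (by norm_num : (0 : ℝ) < 2)] at h10
          nlinarith
      · refine hs.no_pole x (by rw [hxr]; exact hrρ) ?_ f hf k hk
        rintro rfl
        rw [dist_self] at hxr
        exact hr.ne hxr
    · have hd : d ∈ S := mem_of_mem_insert_of_ne hd (by rintro rfl; exact hxr hxd)
      have he : e ∈ S := mem_of_mem_insert_of_ne he (by rintro rfl; exact hxr hxe)
      have hf : f ∈ S := mem_of_mem_insert_of_ne hf (by
        rintro rfl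
        exact hxr (((PlaneCircle.mk p r hr).isPole_iff hkl x).1 hk).1)
      exact h.no_pole x (hclsub hx) ⟨d, hd, e, he, hde, hxd, hxe⟩ f hf k hk

end IsMBC

/-! ### The upper and the lower arc of the new circle -/

/-- Half the length of the chord at height `s` of the disc of radius `r` centred at height `t`. -/
noncomputable def chord (r t s : ℝ) : ℝ := Real.sqrt (r ^ 2 - (s - t) ^ 2)

theorem chord_nonneg (r t s : ℝ) : 0 ≤ chord r t s := Real.sqrt_nonneg _

theorem chord_sq {r t s : ℝ} (hs : |s - t| ≤ r) : chord r t s ^ 2 = r ^ 2 - (s - t) ^ 2 := by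
  refine Real.sq_sqrt ?_
  have := sq_le_sq' (neg_le_of_abs_le hs) (le_of_abs_le hs)
  linarith

theorem chord_le {r : ℝ} (hr : 0 ≤ r) (t s : ℝ) : chord r t s ≤ r := by
  refine Real.sqrt_le_iff.2 ⟨hr, by nlinarith [sq_nonneg (s - t)]⟩

theorem continuous_chord (r t : ℝ) : Continuous (chord r t) := by
  unfold chord
  fun_prop

theorem chord_self {r : ℝ} (hr : 0 ≤ r) (t : ℝ) : chord r t t = r := by
  simp [chord, Real.sqrt_sq hr]

theorem chord_end {r t s : ℝ} (hs : |s - t| = r) : chord r t s = 0 := by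
  simp [chord, ← hs]

theorem chord_pos {r t s : ℝ} (hs : |s - t| < r) : 0 < chord r t s := by
  refine Real.sqrt_pos.2 ?_
  have := sq_lt_sq' (neg_lt_of_abs_lt hs) (lt_of_abs_lt hs)
  linarith

/-- The point at height `s` of the arc of the circle of radius `r` around `p` which lies on the side
`η` of `p`. -/
noncomputable def arcPt (i j : Fin 2) (p : Plane) (r η s : ℝ) : Plane :=
  pnt i s (p j + η * chord r (p i) s)

section Arc

variable {i j : Fin 2} {p : Plane} {r η : ℝ}

@[simp] theorem arcPt_same (s : ℝ) : arcPt i j p r η s i = s := pnt_same _ _ _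

theorem arcPt_other (hij : i ≠ j) (s : ℝ) : arcPt i j p r η s j = p j + η * chord r (p i) s :=
  pnt_other hij _ _

theorem continuous_arcPt : Continuous (arcPt i j p r η) := by
  have := continuous_chord r (p i)
  unfold arcPt
  fun_prop

theorem dist_arcPt (hij : i ≠ j) (hr : 0 ≤ r) (hη : η = 1 ∨ η = -1) {s : ℝ} (hs : |s - p i| ≤ r) :
    dist (arcPt i j p r η s) p = r := by
  have h1 : dist (arcPt i j p r η s) p ^ 2 = r ^ 2 := by
    rw [dist_sq hij, arcPt_same, arcPt_other hij]
    have h2 := chord_sq hs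
    rcases hη with rfl | rfl <;> linear_combination h2
  exact (pow_left_inj₀ dist_nonneg hr two_ne_zero).1 h1

theorem abs_le_of_dist_le {x : Plane} (hx : dist x p ≤ r) : |x i - p i| ≤ r :=
  (abs_coord_sub_le i x p).trans hx

/-- A point of the new circle lies on one of the two arcs. -/
theorem eq_arcPt_of_dist (hij : i ≠ j) (hη : η = 1 ∨ η = -1) {x : Plane} (hx : dist x p = r) :
    x = arcPt i j p r η (x i) ∨ x = arcPt i j p r (-η) (x i) := by
  have h1 := chord_sq (abs_le_of_dist_le (i := i) hx.le)
  have h2 : (x j - p j) ^ 2 = chord r (p i) (x i) ^ 2 := by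
    rw [h1, ← hx, dist_sq hij]; ring
  have h3 : x j = p j + chord r (p i) (x i) ∨ x j = p j - chord r (p i) (x i) := by
    rcases sq_eq_sq_iff_eq_or_eq_neg.1 h2 with h | h
    · left; linarith
    · right; linarith
  have key : ∀ η' : ℝ, x j = p j + η' * chord r (p i) (x i) → x = arcPt i j p r η' (x i) :=
    fun η' h => plane_ext hij (arcPt_same _).symm (by rw [arcPt_other hij, h])
  rcases hη with rfl | rfl <;> rcases h3 with h | h
  · exact Or.inl (key _ (by rw [h]; ring))
  · exact Or.inr (key _ (by rw [h]; ring))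
  · exact Or.inr (key _ (by rw [h]; ring))
  · exact Or.inl (key _ (by rw [h]; ring))

theorem arcPt_end {s : ℝ} (η' : ℝ) (hs : |s - p i| = r) : arcPt i j p r η s = arcPt i j p r η' s := by
  rw [arcPt, arcPt, chord_end hs, mul_zero, mul_zero]

theorem sidePow_arcPt (hij : i ≠ j) (D : Set Plane) (c : PlaneCircle) (hp : p ∈ c.carrier)
    (hη : η = 1 ∨ η = -1) {s : ℝ} (hs : |s - p i| ≤ r) :
    sidePow D c (arcPt i j p r η s) = 2 * (sideSign D c * (p i - c.center i)) * (s - p i) +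
      2 * (η * (sideSign D c * (p j - c.center j))) * chord r (p i) s + sideSign D c * r ^ 2 := by
  have h1 := (c.pow_eq_zero_iff p).2 hp
  rw [c.pow_coord hij] at h1
  have h2 := chord_sq hs
  rw [sidePow, c.pow_coord hij, arcPt_same, arcPt_other hij]
  rcases hη with rfl | rfl <;> linear_combination sideSign D c * h1 + sideSign D c * h2

end Arc

/-- At an end at which the new circle has its pole outside `D`, the signed power of `c` along the
upper arc has one zero, and it is negative on the lower arc. Here `A` and `B` are the components of
the normal of `c`, and `σ` is the distance from the central height. -/
theorem arc_end_crossing {A B ε r : ℝ} (hB : 0 < B) (hr : 0 < r) (hrB : r < B)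
    (hε : ε = 1 ∨ ε = -1) (hrA : A ≠ 0 → r < |A|) (hA : A < 0 ∨ A = 0 ∧ ε = -1) :
    ∃ σ₁ ∈ Ioo 0 r, ∀ σ ∈ Icc 0 r,
      (0 ≤ 2 * A * σ + 2 * B * Real.sqrt (r ^ 2 - σ ^ 2) + ε * r ^ 2 ↔ σ ≤ σ₁) ∧
      (2 * A * σ + 2 * B * Real.sqrt (r ^ 2 - σ ^ 2) + ε * r ^ 2 = 0 ↔ σ = σ₁) ∧
      2 * A * σ - 2 * B * Real.sqrt (r ^ 2 - σ ^ 2) + ε * r ^ 2 < 0 := by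
  set U : ℝ → ℝ := fun σ => 2 * A * σ + 2 * B * Real.sqrt (r ^ 2 - σ ^ 2) + ε * r ^ 2 with hU
  have hA0 : A ≤ 0 := by rcases hA with h | h <;> linarith
  have hrr : 0 < r ^ 2 := by positivity
  have hanti : StrictAntiOn U (Icc 0 r) := by
    intro σ hσ σ' hσ' hlt
    have h1 : Real.sqrt (r ^ 2 - σ' ^ 2) < Real.sqrt (r ^ 2 - σ ^ 2) :=
      Real.sqrt_lt_sqrt (by nlinarith [hσ'.1, hσ'.2]) (by nlinarith [hσ.1, hσ'.1])
    simp only [hU]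
    nlinarith
  have hcont : ContinuousOn U (Icc 0 r) := by
    simp only [hU]; fun_prop
  have hU0 : 0 < U 0 := by
    simp only [hU, mul_zero, zero_add, ne_eq, OfNat.ofNat_ne_zero, not_false_eq_true, zero_pow,
      sub_zero, Real.sqrt_sq hr.le]
    rcases hε with h | h <;> rw [h] <;> nlinarith
  have hUr : U r < 0 := by
    simp only [hU, sub_self, Real.sqrt_zero, mul_zero, add_zero]
    rcases hA with h | ⟨h, h'⟩
    · have h1 := hrA h.ne
      rw [abs_of_neg h] at h1
      rcases hε with h | h <;> rw [h] <;> nlinarith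
    · rw [h, h']; nlinarith
  obtain ⟨σ₁, hσ₁, h0⟩ := intermediate_value_Ioo' hr.le hcont (show (0 : ℝ) ∈ Ioo (U r) (U 0) from
    ⟨hUr, hU0⟩)
  refine ⟨σ₁, hσ₁, fun σ hσ => ⟨?_, ?_, ?_⟩⟩
  · show 0 ≤ U σ ↔ _
    rw [← h0]
    exact hanti.le_iff_ge (Ioo_subset_Icc_self hσ₁) hσ
  · show U σ = 0 ↔ _
    rw [← h0]
    exact hanti.injOn.eq_iff hσ (Ioo_subset_Icc_self hσ₁)
  · have hs0 := Real.sqrt_nonneg (r ^ 2 - σ ^ 2)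
    rcases hA with h | ⟨h, h'⟩
    · have h1 := hrA h.ne
      rw [abs_of_neg h] at h1
      have h2 : r ≤ σ + Real.sqrt (r ^ 2 - σ ^ 2) := by
        have := Real.sq_sqrt (show 0 ≤ r ^ 2 - σ ^ 2 by nlinarith [hσ.1, hσ.2])
        nlinarith [hσ.1]
      have h3 : r * σ ≤ -A * σ := mul_le_mul_of_nonneg_right h1.le hσ.1
      have h4 : r * Real.sqrt (r ^ 2 - σ ^ 2) ≤ B * Real.sqrt (r ^ 2 - σ ^ 2) :=
        mul_le_mul_of_nonneg_right hrB.le hs0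
      have h5 : r * r ≤ r * (σ + Real.sqrt (r ^ 2 - σ ^ 2)) := mul_le_mul_of_nonneg_left h2 hr.le
      rcases hε with h | h <;> rw [h] <;> nlinarith
    · rw [h, h']; nlinarith

/-- At an end at which the new circle has its pole in `D`, the signed power of `c` is positive along
the upper arc, and it has one zero on the lower arc. -/
theorem arc_end_pole {A B ε r : ℝ} (hB : 0 < B) (hr : 0 < r) (hrB : r < B)
    (hε : ε = 1 ∨ ε = -1) (hrA : A ≠ 0 → r < |A|) (hA : 0 < A ∨ A = 0 ∧ ε = 1) :
    ∃ α ∈ Ioo 0 r, ∀ σ ∈ Icc 0 r,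
      0 < 2 * A * σ + 2 * B * Real.sqrt (r ^ 2 - σ ^ 2) + ε * r ^ 2 ∧
      (0 ≤ 2 * A * σ - 2 * B * Real.sqrt (r ^ 2 - σ ^ 2) + ε * r ^ 2 ↔ α ≤ σ) ∧
      (2 * A * σ - 2 * B * Real.sqrt (r ^ 2 - σ ^ 2) + ε * r ^ 2 = 0 ↔ σ = α) := by
  obtain ⟨α, hα, h⟩ := arc_end_crossing (A := -A) (ε := -ε) hB hr hrB
    (by rcases hε with rfl | rfl <;> simp) (fun hne => by
      rw [abs_neg]; exact hrA (neg_ne_zero.1 hne))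
    (by rcases hA with h | ⟨h, h'⟩
        · exact Or.inl (by linarith)
        · exact Or.inr ⟨by linarith, by rw [h']⟩)
  refine ⟨α, hα, fun σ hσ => ?_⟩
  obtain ⟨h1, h2, h3⟩ := h σ hσ
  refine ⟨by linarith, ⟨fun h4 => ?_, fun h4 => ?_⟩, ⟨fun h4 => h2.1 (by linarith), fun h4 => ?_⟩⟩
  · rcases lt_trichotomy σ α with h5 | h5 | h5
    · have h6 := h1.2 h5.le
      have h7 := mt h2.1 h5.ne
      exact absurd (by linarith) h7
    · exact h5.ge
    · exact h5.le
  · rcases eq_or_lt_of_le h4 with rfl | h5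
    · linarith [h2.2 rfl]
    · have := mt h1.1 (not_le.2 h5)
      linarith
  · linarith [h2.2 h4]

/-! ### The map between the quotient spaces -/

section Project

variable {D D' : Set Plane} {i j : Fin 2}

/-- The map of quotient spaces induced by an inclusion of sets. -/
noncomputable def prProj (hij : i ≠ j) (hD : D' ⊆ D) : PRSpace D' i → PRSpace D i :=
  Quotient.lift (fun x : closure D' => prMk D i ⟨x, closure_mono hD x.2⟩) fun x y hxy => by
    have h1 := (prMk_eq_iff hij x y).1 (Quotient.sound hxy)
    exact (prMk_eq_iff hij _ _).2 ⟨h1.1, h1.2.mono (closure_mono hD)⟩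

theorem continuous_prProj (hij : i ≠ j) (hD : D' ⊆ D) : Continuous (prProj (i := i) hij hD) := by
  refine Continuous.quotient_lift ?_ _
  exact continuous_prMk.comp (by fun_prop)

theorem prProj_prAt [Nonempty (closure D)] [Nonempty (closure D')] (hij : i ≠ j) (hD : D' ⊆ D)
    {x : Plane} (hx : x ∈ closure D') : prProj hij hD (prAt D' i x) = prAt D i x := by
  rw [prAt_of_mem hx, prAt_of_mem (closure_mono hD hx)]
  rfl

theorem prHeight_prProj (hij : i ≠ j) (hD : D' ⊆ D) (z : PRSpace D' i) :
    prHeight D i (prProj hij hD z) = prHeight D' i z := by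
  obtain ⟨x, rfl⟩ := surjective_prMk z
  rfl

/-- A section of a closed map is continuous at the points over which the map is injective. -/
theorem continuousWithinAt_of_fibre {X X' : Type*} [TopologicalSpace X] [TopologicalSpace X']
    {φ : X' → X} (hφ : IsClosedMap φ) {ψ : X → X'} {Y : Set X} (hψ : ∀ y ∈ Y, φ (ψ y) = y) {z : X}
    (hz : ∀ w, φ w = z → w = ψ z) : ContinuousWithinAt ψ Y z := by
  intro U hU
  have h1 := hφ.eventually_nhds_fiber (p := fun w => w ∈ U) z fun w hw => by
    rw [hz w hw]
    exact mem_of_superset (mem_interior_iff_mem_nhds.2 hU |> isOpen_interior.mem_nhds)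
      interior_subset |> eventually_mem_nhds_iff.2 |>.self_of_nhds
  rw [mem_map]
  filter_upwards [nhdsWithin_le_nhds h1, self_mem_nhdsWithin] with y hy hyY
  exact hy _ (hψ y hyY)

end Project

/-! ### Marking points on a drawing -/

namespace LabelledDigraph

/-- A label `a` and a height `s` of the same vertex: either they agree, and are `t` or are at
distance at least `δ` from `t`, or they are one of four given pairs near `t`. -/
def IsLabelPair (t δ a₁ a₃ a₄ a₂ s₁ s₃ s₄ s₂ a s : ℝ) : Prop :=
  (a = s ∧ (s = t ∨ δ ≤ |s - t|)) ∨ (a = a₁ ∧ s = s₁) ∨ (a = a₃ ∧ s = s₃) ∨ (a = a₄ ∧ s = s₄) ∨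
    (a = a₂ ∧ s = s₂)

theorem IsLabelPair.lt_iff {t δ a₁ a₃ a₄ a₂ s₁ s₃ s₄ s₂ a s a' s' : ℝ}
    (ha : t - δ < a₁ ∧ a₁ < a₃ ∧ a₃ < t ∧ t < a₄ ∧ a₄ < a₂ ∧ a₂ < t + δ)
    (hs : t - δ < s₁ ∧ s₁ < s₃ ∧ s₃ < t ∧ t < s₄ ∧ s₄ < s₂ ∧ s₂ < t + δ)
    (h : IsLabelPair t δ a₁ a₃ a₄ a₂ s₁ s₃ s₄ s₂ a s)
    (h' : IsLabelPair t δ a₁ a₃ a₄ a₂ s₁ s₃ s₄ s₂ a' s') : a < a' ↔ s < s' := by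
  obtain ⟨b1, b2, b3, b4, b5, b6⟩ := ha
  obtain ⟨c1, c2, c3, c4, c5, c6⟩ := hs
  unfold IsLabelPair at h h'
  rw [le_abs] at h h'
  rcases h with ⟨e1, e2 | e2 | e2⟩ | ⟨e1, e2⟩ | ⟨e1, e2⟩ | ⟨e1, e2⟩ | ⟨e1, e2⟩ <;>
    rcases h' with ⟨f1, f2 | f2 | f2⟩ | ⟨f1, f2⟩ | ⟨f1, f2⟩ | ⟨f1, f2⟩ | ⟨f1, f2⟩ <;>
    constructor <;> intro <;> linarith

namespace Realization

variable {Γ Γ' : LabelledDigraph} {X : Type} [TopologicalSpace X] {h : X → ℝ} {Vs O : Set X}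

/-- A section of the height function over an interval that avoids the vertices runs in one open
edge. -/
theorem exists_edge_of_section [T2Space X] (hd : Disjoint Vs O)
    (hinj : ∀ z ∈ O, ∃ N ∈ 𝓝 z, InjOn h N) (R : Realization Γ h Vs O) {J : Set ℝ}
    (hJ : OrdConnected J) {ζ : ℝ → X} (hζ : ContinuousOn ζ J) (hh : ∀ s ∈ J, h (ζ s) = s)
    (hO : ∀ s ∈ J, ζ s ∈ O) (hne : J.Nonempty) :
    ∃ e, ∀ s ∈ J, s ∈ Ioo (R.lo e) (R.hi e) ∧ R.sec e s = ζ s := by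
  obtain ⟨u, hu⟩ := hne
  obtain ⟨e, ⟨h1, h2⟩, -⟩ := R.cover _ (hO u hu)
  rw [hh u hu] at h1 h2
  have h1 : u ∈ Ioo (R.lo e) (R.hi e) := h1
  have hc : ContinuousOn (R.sec e) (Icc (R.lo e) (R.hi e)) := R.continuousOn e
  have hht : ∀ s ∈ Icc (R.lo e) (R.hi e), h (R.sec e s) = s := R.height e
  have hagree : ∀ A : Set ℝ, IsPreconnected A → A ⊆ J → A ⊆ Ioo (R.lo e) (R.hi e) → u ∈ A →
      EqOn ζ (R.sec e) A := fun A hA hAJ hAe huA =>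
    sections_agree hinj hA (hζ.mono hAJ) (hc.mono (hAe.trans Ioo_subset_Icc_self))
      (fun s hs => hh s (hAJ hs)) (fun s hs => hht s (Ioo_subset_Icc_self (hAe hs)))
      (fun s hs => hO s (hAJ hs)) huA h2.symm
  have hup : ∀ s ∈ J, s < R.hi e := by
    intro s hs
    by_contra! hle
    have hsub : Icc u (R.hi e) ⊆ J := (Icc_subset_Icc_right hle).trans (hJ.out hu hs)
    have h3 := hagree (Ico u (R.hi e)) isPreconnected_Ico (Ico_subset_Icc_self.trans hsub)
      (fun x hx => ⟨h1.1.trans_le hx.1, hx.2⟩) (left_mem_Ico.2 h1.2)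
    have h4 := h3.of_subset_closure (t := Icc u (R.hi e)) (hζ.mono hsub)
      (hc.mono (Icc_subset_Icc_left h1.1.le)) Ico_subset_Icc_self (by rw [closure_Ico h1.2.ne])
    have h5 := h4 (right_mem_Icc.2 h1.2.le)
    have h6 : R.sec e (R.hi e) = R.pt (Γ.tgt e) := R.sec_tgt e
    have h7 := hO _ (hsub (right_mem_Icc.2 h1.2.le))
    rw [h5, h6] at h7
    exact hd.le_bot ⟨R.pt_mem _, h7⟩
  have hlo : ∀ s ∈ J, R.lo e < s := by
    intro s hs
    by_contra! hle
    have hsub : Icc (R.lo e) u ⊆ J := (Icc_subset_Icc_left hle).trans (hJ.out hs hu)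
    have h3 := hagree (Ioc (R.lo e) u) isPreconnected_Ioc (Ioc_subset_Icc_self.trans hsub)
      (fun x hx => ⟨hx.1, hx.2.trans_lt h1.2⟩) (right_mem_Ioc.2 h1.1)
    have h4 := h3.of_subset_closure (t := Icc (R.lo e) u) (hζ.mono hsub)
      (hc.mono (Icc_subset_Icc_right h1.2.le)) Ioc_subset_Icc_self (by rw [closure_Ioc h1.1.ne])
    have h5 := h4 (left_mem_Icc.2 h1.1.le)
    have h6 : R.sec e (R.lo e) = R.pt (Γ.src e) := R.sec_src e
    have h7 := hO _ (hsub (left_mem_Icc.2 h1.1.le))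
    rw [h5, h6] at h7
    exact hd.le_bot ⟨R.pt_mem _, h7⟩
  refine ⟨e, fun s hs => ⟨⟨hlo s hs, hup s hs⟩, ?_⟩⟩
  exact (hagree J hJ.isPreconnected subset_rfl (fun x hx => ⟨hlo x hx, hup x hx⟩) hu hs).symm

/-- A section that runs into a vertex at its upper end gives an edge that enters that vertex. -/
theorem exists_edge_tgt [T2Space X] (hd : Disjoint Vs O)
    (hinj : ∀ z ∈ O, ∃ N ∈ 𝓝 z, InjOn h N) (R : Realization Γ h Vs O) {s₁ t : ℝ} (hlt : s₁ < t)
    {ζ : ℝ → X} (hζ : ContinuousOn ζ (Icc s₁ t)) (hh : ∀ s ∈ Icc s₁ t, h (ζ s) = s)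
    (hO : ∀ s ∈ Ico s₁ t, ζ s ∈ O) (ht : ζ t ∉ O) :
    ∃ e, R.pt (Γ.tgt e) = ζ t ∧ R.hi e = t ∧ R.lo e < s₁ ∧ ∀ s ∈ Icc s₁ t, R.sec e s = ζ s := by
  obtain ⟨e, he⟩ := R.exists_edge_of_section hd hinj (J := Ico s₁ t) ordConnected_Ico
    (hζ.mono Ico_subset_Icc_self) (fun s hs => hh s (Ico_subset_Icc_self hs)) hO
    ⟨s₁, left_mem_Ico.2 hlt⟩
  have hlo := (he s₁ (left_mem_Ico.2 hlt)).1.1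
  have hle : t ≤ R.hi e := by
    by_contra! h1
    have h2 : s₁ < R.hi e := (he s₁ (left_mem_Ico.2 hlt)).1.2
    exact (he (R.hi e) ⟨h2.le, h1⟩).1.2.false
  have hc : ContinuousOn (R.sec e) (Icc (R.lo e) (R.hi e)) := R.continuousOn e
  have hEq : EqOn (R.sec e) ζ (Ico s₁ t) := fun s hs => (he s hs).2
  have h4 := hEq.of_subset_closure (t := Icc s₁ t) (hc.mono (Icc_subset_Icc hlo.le hle)) hζ
    Ico_subset_Icc_self (by rw [closure_Ico hlt.ne])
  have h5 := h4 (right_mem_Icc.2 hlt.le)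
  have hhi : R.hi e = t := by
    refine (eq_or_lt_of_le hle).elim Eq.symm fun h6 => absurd ?_ ht
    rw [← h5]
    exact R.sec_mem e t ⟨hlo.trans hlt, h6⟩
  refine ⟨e, ?_, hhi, hlo, h4⟩
  rw [← h5, ← R.sec_tgt e]
  exact congrArg _ hhi

/-- A section that runs into a vertex at its lower end gives an edge that departs from that
vertex. -/
theorem exists_edge_src [T2Space X] (hd : Disjoint Vs O)
    (hinj : ∀ z ∈ O, ∃ N ∈ 𝓝 z, InjOn h N) (R : Realization Γ h Vs O) {s₂ t : ℝ} (hlt : t < s₂)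
    {ζ : ℝ → X} (hζ : ContinuousOn ζ (Icc t s₂)) (hh : ∀ s ∈ Icc t s₂, h (ζ s) = s)
    (hO : ∀ s ∈ Ioc t s₂, ζ s ∈ O) (ht : ζ t ∉ O) :
    ∃ e, R.pt (Γ.src e) = ζ t ∧ R.lo e = t ∧ s₂ < R.hi e ∧ ∀ s ∈ Icc t s₂, R.sec e s = ζ s := by
  obtain ⟨e, he⟩ := R.exists_edge_of_section hd hinj (J := Ioc t s₂) ordConnected_Ioc
    (hζ.mono Ioc_subset_Icc_self) (fun s hs => hh s (Ioc_subset_Icc_self hs)) hO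
    ⟨s₂, right_mem_Ioc.2 hlt⟩
  have hhi := (he s₂ (right_mem_Ioc.2 hlt)).1.2
  have hle : R.lo e ≤ t := by
    by_contra! h1
    have h2 : R.lo e < s₂ := (he s₂ (right_mem_Ioc.2 hlt)).1.1
    exact (he (R.lo e) ⟨h1, h2.le⟩).1.1.false
  have hc : ContinuousOn (R.sec e) (Icc (R.lo e) (R.hi e)) := R.continuousOn e
  have hEq : EqOn (R.sec e) ζ (Ioc t s₂) := fun s hs => (he s hs).2
  have h4 := hEq.of_subset_closure (t := Icc t s₂) (hc.mono (Icc_subset_Icc hle hhi.le)) hζ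
    Ioc_subset_Icc_self (by rw [closure_Ioc hlt.ne])
  have h5 := h4 (left_mem_Icc.2 hlt.le)
  have hlo : R.lo e = t := by
    refine (eq_or_lt_of_le hle).elim id fun h6 => absurd ?_ ht
    rw [← h5]
    exact R.sec_mem e t ⟨h6, hlt.trans hhi⟩
  refine ⟨e, ?_, hlo, hhi, h4⟩
  rw [← h5, ← R.sec_src e]
  exact congrArg _ hlo

theorem mark_hi_some (R : Realization Γ h Vs O) (hd : Disjoint Vs O) (e : Γ.E) (s : ℝ)
    (hs : s ∈ Ioo (R.lo e) (R.hi e)) (a : ℝ) {f : Γ.E} (hf : f ≠ e) :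
    (R.mark hd e s hs a).hi (some f) = R.hi f := by
  have : (Γ.subdivide e a).tgt (some f) = some (Γ.tgt f) := by simp [subdivide, hf]
  unfold hi
  rw [this]
  rfl

/-- The digraph `Γ₂` is drawn like `Γ`, but with the points `z₁` and `z₂` as additional vertices
`v₁` and `v₂`, which have the labels `a₁` and `a₂`. -/
def IsMarking (R : Realization Γ h Vs O) (Γ₂ : LabelledDigraph) (v₁ v₂ : Γ₂.V) (z₁ z₂ : X)
    (a₁ a₂ : ℝ) : Prop :=
  ∃ B : Realization Γ₂ h (insert z₂ (insert z₁ Vs)) ((O \ {z₁}) \ {z₂}),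
    B.pt v₁ = z₁ ∧ B.pt v₂ = z₂ ∧ Γ₂.label v₁ = a₁ ∧ Γ₂.label v₂ = a₂ ∧
    ∀ v, v = v₁ ∨ v = v₂ ∨ ∃ w, B.pt v = R.pt w ∧ Γ₂.label v = Γ.label w

theorem disjoint_mark {Y : Type*} {A B : Set Y} {z : Y} (hd : Disjoint A B) :
    Disjoint (insert z A) (B \ {z}) := by
  rw [Set.disjoint_left] at hd ⊢
  rintro x (rfl | hx) ⟨h1, h2⟩
  · exact h2 rfl
  · exact hd hx h1

theorem isMarking_subdivideTwice (R : Realization Γ h Vs O) (hd : Disjoint Vs O) {e : Γ.E}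
    {s₁ s₂ : ℝ} (hlt : s₁ < s₂) (h1 : s₁ ∈ Ioo (R.lo e) (R.hi e)) (h2 : s₂ ∈ Ioo (R.lo e) (R.hi e))
    (a₁ a₂ : ℝ) : R.IsMarking (Γ.subdivideTwice e a₁ a₂) (some none) none (R.sec e s₁) (R.sec e s₂)
      a₁ a₂ := by
  have hlo : (R.mark hd e s₁ h1 a₁).lo none = s₁ := R.height e s₁ (Ioo_subset_Icc_self h1)
  refine ⟨(R.mark hd e s₁ h1 a₁).mark (disjoint_mark hd) none s₂
    ⟨hlo.le.trans_lt hlt, h2.2⟩ a₂,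
    rfl, rfl, rfl, rfl, ?_⟩
  rintro (_ | _ | v)
  · exact Or.inr (Or.inl rfl)
  · exact Or.inl rfl
  · exact Or.inr (Or.inr ⟨v, rfl, rfl⟩)

theorem isMarking_subdividePair (R : Realization Γ h Vs O) (hd : Disjoint Vs O) {e f : Γ.E}
    (hne : f ≠ e) {s₁ s₂ : ℝ} (h1 : s₁ ∈ Ioo (R.lo e) (R.hi e)) (h2 : s₂ ∈ Ioo (R.lo f) (R.hi f))
    (a₁ a₂ : ℝ) : R.IsMarking (Γ.subdividePair e f a₁ a₂) (some none) none (R.sec e s₁) (R.sec f s₂)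
      a₁ a₂ := by
  have hhi := R.mark_hi_some hd e s₁ h1 a₁ hne
  refine ⟨(R.mark hd e s₁ h1 a₁).mark (disjoint_mark hd) (some f) s₂
    ⟨h2.1, h2.2.trans_le hhi.ge⟩ a₂,
    rfl, rfl, rfl, rfl, ?_⟩
  rintro (_ | _ | v)
  · exact Or.inr (Or.inl rfl)
  · exact Or.inl rfl
  · exact Or.inr (Or.inr ⟨v, rfl, rfl⟩)

end Realization

end LabelledDigraph

/-! ### Fibres over the new quotient space -/

section Cut

variable {D : Set Plane} {i j : Fin 2} {p : Plane} {r η : ℝ}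

theorem notMem_ball_of_chord_le (hij : i ≠ j) {x : Plane} (hs : |x i - p i| ≤ r)
    (h : chord r (p i) (x i) ≤ |x j - p j|) : x ∉ Metric.ball p r := by
  intro hx
  have h1 := pow_le_pow_left₀ (chord_nonneg _ _ _) h 2
  rw [chord_sq hs, sq_abs] at h1
  have h2 : dist x p ^ 2 < r ^ 2 := pow_lt_pow_left₀ hx dist_nonneg two_ne_zero
  rw [dist_sq hij] at h2
  linarith

theorem chord_le_of_notMem_ball (hij : i ≠ j) (hr : 0 ≤ r) {x : Plane} (hs : |x i - p i| ≤ r)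
    (hx : x ∉ Metric.ball p r) : chord r (p i) (x i) ≤ |x j - p j| := by
  by_contra! hlt
  refine hx (lt_of_pow_lt_pow_left₀ 2 hr ?_)
  rw [dist_sq hij]
  have h4 := sq_lt_sq' (neg_lt_of_abs_lt hlt) (lt_of_abs_lt hlt)
  rw [chord_sq hs] at h4
  linarith

theorem arcPt_mem_cut (hij : i ≠ j) (hr : 0 ≤ r) (hη : η = 1 ∨ η = -1)
    (hcl : closure (cut D p r) = closure D \ Metric.ball p r) {s : ℝ} (hs : |s - p i| ≤ r)
    (h : arcPt i j p r η s ∈ closure D) : arcPt i j p r η s ∈ closure (cut D p r) := by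
  rw [hcl]
  exact ⟨h, fun hb => (Metric.mem_ball.1 hb).ne (dist_arcPt hij hr hη hs)⟩

theorem isClosedMap_prProj (hij : i ≠ j) (hb : Bornology.IsBounded D) :
    IsClosedMap (prProj (i := i) hij (sdiff_subset : cut D p r ⊆ D)) := by
  have := t2Space_prSpace (D := D) hij hb
  have := compactSpace_closure (D := cut D p r) (hb.subset sdiff_subset)
  have : CompactSpace (PRSpace (cut D p r) i) := Quotient.compactSpace
  exact (continuous_prProj hij _).isClosedMap

variable [Nonempty (closure (cut D p r))]

/-- If a segment in `K` stays far enough from the level of `p`, then it avoids the disc. -/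
theorem prAt_cut_eq_of_vertConn (hij : i ≠ j)
    (hcl : closure (cut D p r) = closure D \ Metric.ball p r) {x : Plane} (hs : |x i - p i| ≤ r)
    {y : ℝ} (hy : VertConn (closure D) i (x i) (x j) y)
    (hav : ∀ z ∈ uIcc (x j) y, chord r (p i) (x i) ≤ |z - p j|) :
    prAt (cut D p r) i x = prAt (cut D p r) i (pnt i (x i) y) := by
  have h1 : VertConn (closure (cut D p r)) i (x i) (x j) y := fun z hz => by
    rw [hcl]
    refine ⟨hy z hz, notMem_ball_of_chord_le hij (by rwa [pnt_same]) ?_⟩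
    rw [pnt_same, pnt_other hij]
    exact hav z hz
  rw [← h1.prAt_eq hij, pnt_eta hij]

/-- A point outside the disc that is joined in `K` to the upper arc has the same image in the new
quotient space as the upper or as the lower arc. -/
theorem prAt_cut_eq_arcPt (hij : i ≠ j) (hr : 0 ≤ r)
    (hη : η = 1 ∨ η = -1) (hcl : closure (cut D p r) = closure D \ Metric.ball p r) {x : Plane}
    (hx : x ∈ closure (cut D p r)) (hs : |x i - p i| ≤ r)
    (hconn : VertConn (closure D) i (x i) (x j) (p j + η * chord r (p i) (x i))) :
    prAt (cut D p r) i x = prAt (cut D p r) i (arcPt i j p r η (x i)) ∨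
    (arcPt i j p r (-η) (x i) ∈ closure D ∧
      prAt (cut D p r) i x = prAt (cut D p r) i (arcPt i j p r (-η) (x i))) := by
  rw [hcl] at hx
  have habs := chord_le_of_notMem_ball hij hr hs hx.2
  have hw0 := chord_nonneg r (p i) (x i)
  have key : ∀ y, VertConn (closure D) i (x i) (x j) y →
      (∀ z ∈ uIcc (x j) y, chord r (p i) (x i) ≤ |z - p j|) →
      prAt (cut D p r) i x = prAt (cut D p r) i (pnt i (x i) y) :=
    fun y => prAt_cut_eq_of_vertConn hij hcl hs
  unfold arcPt
  set w := chord r (p i) (x i) with hw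
  rcases hη with rfl | rfl <;> rcases le_abs.1 habs with h1 | h1
  · left
    refine key _ hconn fun z hz => le_abs.2 (Or.inl ?_)
    rcases mem_uIcc.1 hz with h | h <;> linarith [h.1, h.2]
  · right
    have h2 : p j + -1 * w ∈ uIcc (x j) (p j + 1 * w) :=
      mem_uIcc.2 (Or.inl ⟨by linarith, by linarith⟩)
    refine ⟨hconn _ h2, key _ (hconn.sub left_mem_uIcc h2) fun z hz => le_abs.2 (Or.inr ?_)⟩
    rcases mem_uIcc.1 hz with h | h <;> linarith [h.1, h.2]
  · right
    have h2 : p j + - -1 * w ∈ uIcc (x j) (p j + -1 * w) :=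
      mem_uIcc.2 (Or.inr ⟨by linarith, by linarith⟩)
    refine ⟨hconn _ h2, key _ (hconn.sub left_mem_uIcc h2) fun z hz => le_abs.2 (Or.inl ?_)⟩
    rcases mem_uIcc.1 hz with h | h <;> linarith [h.1, h.2]
  · left
    refine key _ hconn fun z hz => le_abs.2 (Or.inr ?_)
    rcases mem_uIcc.1 hz with h | h <;> linarith [h.1, h.2]

/-- The two arcs have different images in the new quotient space, since the disc separates them. -/
theorem prAt_arcPt_ne (hij : i ≠ j) (hr : 0 ≤ r) (hη : η = 1 ∨ η = -1)
    (hcl : closure (cut D p r) = closure D \ Metric.ball p r) {s : ℝ} (hs : |s - p i| < r)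
    (h1 : arcPt i j p r η s ∈ closure D) (h2 : arcPt i j p r (-η) s ∈ closure D) :
    prAt (cut D p r) i (arcPt i j p r η s) ≠ prAt (cut D p r) i (arcPt i j p r (-η) s) := by
  have hη' : -η = 1 ∨ -η = -1 := by rcases hη with rfl | rfl <;> simp
  intro h
  have h1' := arcPt_mem_cut hij hr hη hcl hs.le h1
  have h2' := arcPt_mem_cut hij hr hη' hcl hs.le h2
  unfold arcPt at h h1' h2'
  rw [prAt_pnt_eq_iff hij h1' h2'] at h
  have hw0 := chord_nonneg r (p i) s
  have h3 := h (p j) (mem_uIcc.2 (by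
    rcases hη with rfl | rfl
    · right; constructor <;> linarith
    · left; constructor <;> linarith))
  rw [hcl] at h3
  refine h3.2 (lt_of_pow_lt_pow_left₀ 2 hr ?_)
  rw [dist_sq hij, pnt_same, pnt_other hij]
  have := sq_lt_sq' (neg_lt_of_abs_lt hs) (lt_of_abs_lt hs)
  linarith

variable [Nonempty (closure D)]

/-- The projection between the quotient spaces is injective over the fibres that miss the disc. -/
theorem prAt_cut_eq_of_fibre (hij : i ≠ j)
    (hcl : closure (cut D p r) = closure D \ Metric.ball p r) {x y : Plane}
    (hx : x ∈ closure (cut D p r)) (hy : y ∈ closure (cut D p r)) (hxy : prAt D i x = prAt D i y)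
    (hmiss : ∀ w ∈ closure D, prAt D i w = prAt D i x → w ∉ Metric.ball p r) :
    prAt (cut D p r) i x = prAt (cut D p r) i y := by
  have hx' : x ∈ closure D := by rw [hcl] at hx; exact hx.1
  have hy' : y ∈ closure D := by rw [hcl] at hy; exact hy.1
  obtain ⟨h1, h2⟩ := (prAt_eq_iff hij hx' hy').1 hxy
  refine (prAt_eq_iff hij hx hy).2 ⟨h1, fun z hz => ?_⟩
  rw [hcl]
  refine ⟨h2 z hz, hmiss _ (h2 z hz) ?_⟩
  rw [← (h2.sub left_mem_uIcc hz).prAt_eq hij, pnt_eta hij]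

end Cut

/-! ### Removing a disc whose centre is not a pole for the height -/

/-- The situation near a point `p` of the circle `c` that is not a pole for the coordinate `i`. Here
`η` is the side of `p` on which `D` lies in the direction of the coordinate `j`; the arc of the new
circle on this side, the upper arc, lies in the closure of `D` exactly between the heights `s₁` and
`s₂`. At each of these ends it either ends in a pole of the new circle or on the circle `c`. -/
structure Dent (S : Set PlaneCircle) (D : Set Plane) (i j : Fin 2) (c : PlaneCircle) (p : Plane)
    (ρ r η s₁ s₂ : ℝ) : Prop where
  mbc : IsMBC S D
  ne : i ≠ j
  circle_mem : c ∈ S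
  center_mem : p ∈ c.carrier
  center_closure : p ∈ closure D
  not_pole : ¬ c.IsPole i p
  small : IsSmall S D c p ρ
  gap : ∀ z ∈ prVertices S D i, |prHeight D i z - p i| < ρ → prHeight D i z = p i
  up : UpSlices D i (p i) (p j) ρ η
  side : η = 1 ∨ η = -1
  pos : 0 < r
  lt : r < ρ
  left : s₁ ∈ Ico (p i - r) (p i)
  right : s₂ ∈ Ioc (p i) (p i + r)
  upper : ∀ s, |s - p i| ≤ r → (arcPt i j p r η s ∈ closure D ↔ s ∈ Icc s₁ s₂)
  upper_carrier : ∀ s, |s - p i| ≤ r → arcPt i j p r η s ∈ c.carrier → s = s₁ ∨ s = s₂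
  left_end : s₁ = p i - r ∨ arcPt i j p r η s₁ ∈ c.carrier ∧ arcPt i j p r (-η) s₁ ∉ closure D
  right_end : s₂ = p i + r ∨ arcPt i j p r η s₂ ∈ c.carrier ∧ arcPt i j p r (-η) s₂ ∉ closure D
  lower_center : arcPt i j p r (-η) (p i) ∉ closure D

namespace Dent

variable {S : Set PlaneCircle} {D : Set Plane} {i j : Fin 2} {c : PlaneCircle} {p : Plane}
  {ρ r η s₁ s₂ : ℝ}

theorem abs_le (d : Dent S D i j c p ρ r η s₁ s₂) {s : ℝ} (hs : s ∈ Icc s₁ s₂) : |s - p i| ≤ r := by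
  have h1 := d.left.1
  have h2 := d.right.2
  rw [abs_sub_le_iff]
  constructor <;> linarith [hs.1, hs.2]

theorem mem_Icc_left (d : Dent S D i j c p ρ r η s₁ s₂) : s₁ ∈ Icc s₁ s₂ :=
  ⟨le_rfl, (d.left.2.trans d.right.1).le⟩

theorem mem_Icc_right (d : Dent S D i j c p ρ r η s₁ s₂) : s₂ ∈ Icc s₁ s₂ :=
  ⟨(d.left.2.trans d.right.1).le, le_rfl⟩

theorem closure_eq (d : Dent S D i j c p ρ r η s₁ s₂) :
    closure (cut D p r) = closure D \ Metric.ball p r :=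
  d.mbc.closure_cut d.circle_mem d.center_mem d.small d.pos d.lt

theorem isMBC (d : Dent S D i j c p ρ r η s₁ s₂) : IsMBC (insert ⟨p, r, d.pos⟩ S) (cut D p r) :=
  d.mbc.isMBC_cut d.ne d.circle_mem d.center_mem d.center_closure d.small d.pos d.lt

theorem neg_side (d : Dent S D i j c p ρ r η s₁ s₂) : -η = 1 ∨ -η = -1 := by
  rcases d.side with h | h <;> rw [h] <;> simp

/-- The points of `K` below the upper arc and in the new disc are joined to the upper arc. -/
theorem vertConn_upper (d : Dent S D i j c p ρ r η s₁ s₂) {x : Plane} (hx : x ∈ closure D)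
    (hxp : dist x p ≤ r) (hlt : η * (x j - p j) < chord r (p i) (x i)) :
    x i ∈ Ioo s₁ s₂ ∧ VertConn (closure D) i (x i) (x j) (p j + η * chord r (p i) (x i)) := by
  have hij := d.ne
  have hs : |x i - p i| ≤ r := abs_le_of_dist_le hxp
  have hxj : |x j - p j| ≤ r := abs_le_of_dist_le hxp
  have hw0 := chord_nonneg r (p i) (x i)
  have hwr := chord_le d.pos.le (p i) (x i)
  have hηη : η * η = 1 := by rcases d.side with h | h <;> rw [h] <;> norm_num
  have hx' : pnt i (x i) (x j) ∈ closure D := by rw [pnt_eta hij]; exact hx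
  have hup : ∀ y, |y - p j| ≤ r → η * x j < η * y → pnt i (x i) y ∈ D := fun y hy hlt =>
    d.up (x i) (x j) y (hs.trans_lt d.lt) (hxj.trans_lt d.lt) (hy.trans_lt d.lt) hlt hx'
  have hηw : η * (p j + η * chord r (p i) (x i)) = η * p j + chord r (p i) (x i) := by
    linear_combination chord r (p i) (x i) * hηη
  have huD : arcPt i j p r η (x i) ∈ D := by
    refine hup _ ?_ (by rw [hηw]; linarith)
    rw [add_sub_cancel_left]
    rcases d.side with h | h <;> rw [h]
    · rwa [one_mul, abs_of_nonneg hw0]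
    · rwa [neg_one_mul, abs_neg, abs_of_nonneg hw0]
  have hIcc := (d.upper _ hs).1 (subset_closure huD)
  have hne : |x i - p i| ≠ r := by
    intro hr
    rw [chord_end hr] at hlt
    have h1 : dist x p ^ 2 ≤ r ^ 2 := pow_le_pow_left₀ dist_nonneg hxp 2
    rw [dist_sq hij, ← hr, sq_abs] at h1
    have h2 : x j - p j = 0 := by nlinarith [sq_nonneg (x j - p j)]
    rw [h2] at hlt
    linarith
  refine ⟨⟨lt_of_le_of_ne hIcc.1 fun h => ?_, lt_of_le_of_ne hIcc.2 fun h => ?_⟩, fun y hy => ?_⟩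
  · rcases d.left_end with h1 | ⟨h1, -⟩
    · refine hne ?_
      rw [← h, h1, abs_of_nonpos] <;> linarith [d.pos]
    · rw [h] at h1
      exact d.mbc.notMem_carrier d.circle_mem huD h1
  · rcases d.right_end with h1 | ⟨h1, -⟩
    · refine hne ?_
      rw [h, h1, abs_of_nonneg] <;> linarith [d.pos]
    · rw [← h] at h1
      exact d.mbc.notMem_carrier d.circle_mem huD h1
  · by_cases hyx : y = x j
    · rw [hyx]; exact hx'
    · refine subset_closure (hup y ?_ ?_)
      · have h1 := abs_sub_le_iff.1 hxj
        rw [abs_sub_le_iff]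
        rcases d.side with h | h <;> rw [h] at hy <;> rcases mem_uIcc.1 hy with h2 | h2 <;>
          constructor <;> linarith [h2.1, h2.2]
      · rcases d.side with h | h <;> rw [h] at hy hlt ⊢
        · rw [uIcc_of_le (by linarith)] at hy
          linarith [lt_of_le_of_ne hy.1 (Ne.symm hyx)]
        · rw [uIcc_of_ge (by linarith)] at hy
          linarith [lt_of_le_of_ne hy.2 hyx]

theorem upper_mem_cut (d : Dent S D i j c p ρ r η s₁ s₂) {s : ℝ} (hs : s ∈ Icc s₁ s₂) :
    arcPt i j p r η s ∈ closure (cut D p r) :=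
  arcPt_mem_cut d.ne d.pos.le d.side d.closure_eq (d.abs_le hs) ((d.upper s (d.abs_le hs)).2 hs)

theorem upper_mem (d : Dent S D i j c p ρ r η s₁ s₂) {s : ℝ} (hs : s ∈ Icc s₁ s₂) :
    arcPt i j p r η s ∈ closure D := (d.upper s (d.abs_le hs)).2 hs

theorem lower_mem_cut (d : Dent S D i j c p ρ r η s₁ s₂) {s : ℝ} (hs : |s - p i| ≤ r)
    (hl : arcPt i j p r (-η) s ∈ closure D) : arcPt i j p r (-η) s ∈ closure (cut D p r) :=
  arcPt_mem_cut d.ne d.pos.le d.neg_side d.closure_eq hs hl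

theorem mem_of_cut (d : Dent S D i j c p ρ r η s₁ s₂) {x : Plane}
    (hx : x ∈ closure (cut D p r)) : x ∈ closure D ∧ x ∉ Metric.ball p r := by
  rwa [d.closure_eq] at hx

section Quotient

variable [Nonempty (closure D)]

theorem prAt_eq_upper (d : Dent S D i j c p ρ r η s₁ s₂) {x : Plane} (hx : x ∈ closure D)
    (hxp : dist x p ≤ r) (hlt : η * (x j - p j) < chord r (p i) (x i)) :
    x i ∈ Ioo s₁ s₂ ∧ prAt D i x = prAt D i (arcPt i j p r η (x i)) := by
  obtain ⟨h1, h2⟩ := d.vertConn_upper hx hxp hlt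
  refine ⟨h1, ?_⟩
  have := h2.prAt_eq d.ne
  rwa [pnt_eta d.ne] at this

theorem prAt_ball (d : Dent S D i j c p ρ r η s₁ s₂) {x : Plane} (hx : x ∈ closure D)
    (hxp : x ∈ Metric.ball p r) :
    x i ∈ Ioo s₁ s₂ ∧ prAt D i x = prAt D i (arcPt i j p r η (x i)) := by
  refine d.prAt_eq_upper hx (Metric.mem_ball.1 hxp).le ?_
  have hs : |x i - p i| ≤ r := abs_le_of_dist_le (Metric.mem_ball.1 hxp).le
  have h1 : |x j - p j| < chord r (p i) (x i) := by
    by_contra! hle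
    exact notMem_ball_of_chord_le d.ne hs hle hxp
  refine (le_abs_self _).trans_lt ?_
  rw [abs_mul]
  rcases d.side with h | h <;> rw [h] <;> simpa using h1

theorem prAt_lower (d : Dent S D i j c p ρ r η s₁ s₂) {s : ℝ} (hs : |s - p i| < r)
    (hl : arcPt i j p r (-η) s ∈ closure D) :
    s ∈ Ioo s₁ s₂ ∧ prAt D i (arcPt i j p r (-η) s) = prAt D i (arcPt i j p r η s) := by
  have h1 := chord_pos hs
  have h2 := d.prAt_eq_upper hl (dist_arcPt d.ne d.pos.le d.neg_side hs.le).le (by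
    rw [arcPt_same, arcPt_other d.ne]
    rcases d.side with h | h <;> rw [h] <;> linarith)
  rwa [arcPt_same] at h2

variable [Nonempty (closure (cut D p r))]

/-- The old quotient space embeds in the new one: over the upper arc, a fibre that has been cut by
the disc is replaced by its upper part. The rest of the new quotient space comes from the lower
arc. -/
theorem exists_embedding (d : Dent S D i j c p ρ r η s₁ s₂) :
    ∃ ψ : PRSpace D i → PRSpace (cut D p r) i, Continuous ψ ∧
      (∀ z, prProj d.ne sdiff_subset (ψ z) = z) ∧
      (∀ s ∈ Icc s₁ s₂, ψ (prAt D i (arcPt i j p r η s)) = prAt (cut D p r) i (arcPt i j p r η s)) ∧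
      (∀ w, w = ψ (prProj d.ne sdiff_subset w) ∨ ∃ s, |s - p i| < r ∧
        arcPt i j p r (-η) s ∈ closure D ∧ w = prAt (cut D p r) i (arcPt i j p r (-η) s)) := by
  have hij := d.ne
  set φ := prProj (i := i) hij (sdiff_subset : cut D p r ⊆ D) with hφ
  set ζ : ℝ → PRSpace D i := fun s => prAt D i (arcPt i j p r η s) with hζ
  have hζh : ∀ s ∈ Icc s₁ s₂, prHeight D i (ζ s) = s := fun s hs => by
    rw [hζ]
    simp only
    rw [prHeight_prAt (d.upper_mem hs), arcPt_same]
  have hex : ∀ z : PRSpace D i, ∃ w : PRSpace (cut D p r) i, φ w = z ∧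
      ∀ s ∈ Icc s₁ s₂, z = ζ s → w = prAt (cut D p r) i (arcPt i j p r η s) := by
    intro z
    by_cases hz : ∃ s ∈ Icc s₁ s₂, z = ζ s
    · obtain ⟨s, hs, rfl⟩ := hz
      refine ⟨prAt (cut D p r) i (arcPt i j p r η s), prProj_prAt hij _ (d.upper_mem_cut hs), ?_⟩
      intro s' hs' hss'
      rw [← hζh s hs, hss', hζh s' hs']
    · obtain ⟨x, hx, rfl⟩ := exists_prAt z
      have hxK : x ∈ closure (cut D p r) := by
        rw [d.closure_eq]
        refine ⟨hx, fun hxb => hz ?_⟩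
        obtain ⟨h1, h2⟩ := d.prAt_ball hx hxb
        exact ⟨x i, Ioo_subset_Icc_self h1, h2⟩
      exact ⟨_, prProj_prAt hij _ hxK, fun s hs hxs => absurd ⟨s, hs, hxs⟩ hz⟩
  choose ψ hψ1 hψ2 using hex
  have hψζ : ∀ s ∈ Icc s₁ s₂, ψ (ζ s) = prAt (cut D p r) i (arcPt i j p r η s) :=
    fun s hs => hψ2 _ s hs rfl
  have hfib : ∀ w, w = ψ (φ w) ∨ ∃ s, |s - p i| < r ∧ arcPt i j p r (-η) s ∈ closure D ∧
      w = prAt (cut D p r) i (arcPt i j p r (-η) s) := by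
    intro w
    obtain ⟨x, hx, rfl⟩ := exists_prAt w
    obtain ⟨hxK, hxb⟩ := d.mem_of_cut hx
    rw [show φ (prAt (cut D p r) i x) = prAt D i x from prProj_prAt hij _ hx]
    by_cases hz : ∃ s ∈ Icc s₁ s₂, prAt D i x = ζ s
    · obtain ⟨s, hs, hxs⟩ := hz
      have hxs' := (prAt_eq_iff hij hxK (d.upper_mem hs)).1 hxs
      rw [arcPt_same, arcPt_other hij] at hxs'
      obtain ⟨rfl, hconn⟩ := hxs'
      rw [hxs, hψζ _ hs]
      rcases prAt_cut_eq_arcPt hij d.pos.le d.side d.closure_eq hx (d.abs_le hs) hconn with h1 | h1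
      · exact Or.inl h1
      · rcases eq_or_lt_of_le (d.abs_le hs) with h2 | h2
        · left
          rw [h1.2, arcPt_end η h2]
        · exact Or.inr ⟨x i, h2, h1.1, h1.2⟩
    · left
      obtain ⟨y, hy, hyw⟩ := exists_prAt (ψ (prAt D i x))
      rw [← hyw]
      have h1 : prAt D i y = prAt D i x := by
        rw [← hψ1 (prAt D i x), ← hyw]
        exact (prProj_prAt hij _ hy).symm
      refine prAt_cut_eq_of_fibre hij d.closure_eq hx hy h1.symm fun w hw hwx hwb => hz ?_
      obtain ⟨h1, h2⟩ := d.prAt_ball hw hwb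
      exact ⟨w i, Ioo_subset_Icc_self h1, hwx.symm.trans h2⟩
  refine ⟨ψ, ?_, hψ1, hψζ, hfib⟩
  have hclosed : IsClosedMap φ := isClosedMap_prProj hij d.mbc.bounded
  rw [continuous_iff_continuousAt]
  intro z
  by_cases hz : ∃ s, |s - p i| < r ∧ arcPt i j p r (-η) s ∈ closure D ∧
      z = prAt D i (arcPt i j p r (-η) s)
  swap
  · rw [← continuousWithinAt_univ]
    refine continuousWithinAt_of_fibre hclosed (fun y _ => hψ1 y) fun w hw => ?_
    rcases hfib w with h1 | ⟨s, hs, hl, rfl⟩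
    · rw [← hw]; exact h1
    · refine absurd ⟨s, hs, hl, ?_⟩ hz
      rw [← hw]
      exact prProj_prAt hij _ (d.lower_mem_cut hs.le hl)
  · -- near such a point, the old quotient space is an open arc
    obtain ⟨s, hs, hl, hzs⟩ := hz
    obtain ⟨hs12, hlu⟩ := d.prAt_lower hs hl
    have hzζ : z = ζ s := hzs.trans hlu
    have hhz : prHeight D i z = s := by rw [hzζ, hζh s (Ioo_subset_Icc_self hs12)]
    have hst : s ≠ p i := by
      rintro rfl
      exact d.lower_center hl
    have hzv : z ∈ (prVertices S D i)ᶜ := fun hv => hst (by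
      rw [← hhz]
      exact d.gap z hv (by rw [hhz]; exact hs.trans d.lt))
    obtain ⟨N, hN, hNi⟩ := (d.mbc.hasLocalSection hij hzv).exists_injOn
    have hζc : ContinuousOn ζ (Icc s₁ s₂) :=
      continuousOn_prAt.comp continuous_arcPt.continuousOn fun u hu => d.upper_mem hu
    have hnear : ∀ᶠ w in 𝓝 z, prHeight D i w ∈ Ioo s₁ s₂ := by
      refine continuous_prHeight.continuousAt.eventually_mem (isOpen_Ioo.mem_nhds ?_)
      rw [hhz]; exact hs12
    have hζz : ContinuousAt (fun w => ζ (prHeight D i w)) z := by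
      refine ContinuousAt.comp (g := ζ) ?_ continuous_prHeight.continuousAt
      rw [hhz]
      exact hζc.continuousAt (Icc_mem_nhds hs12.1 hs12.2)
    have hev : ∀ᶠ w in 𝓝 z, w = ζ (prHeight D i w) := by
      have h1 := hζz.eventually_mem (s := N) (by
        simp only [hhz]
        rw [← hzζ]; exact hN)
      filter_upwards [hN, h1, hnear] with w hw1 hw2 hw3
      exact hNi hw1 hw2 (hζh _ (Ioo_subset_Icc_self hw3)).symm
    have hψc : ContinuousAt (fun w => prAt (cut D p r) i (arcPt i j p r η (prHeight D i w))) z := by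
      refine ContinuousAt.comp (g := fun s => prAt (cut D p r) i (arcPt i j p r η s)) ?_
        continuous_prHeight.continuousAt
      rw [hhz]
      exact (continuousOn_prAt.comp continuous_arcPt.continuousOn
        fun u hu => d.upper_mem_cut hu).continuousAt (Icc_mem_nhds hs12.1 hs12.2)
    refine hψc.congr ?_
    filter_upwards [hev, hnear] with w hw1 hw2
    rw [← hψζ _ (Ioo_subset_Icc_self hw2)]
    exact congrArg ψ hw1.symm

end Quotient

end Dent

/-! ### The old V-digraph in the new quotient space -/

namespace LabelledDigraph.Realization

variable {Γ : LabelledDigraph} {X : Type} [TopologicalSpace X] {h : X → ℝ} {Vs O : Set X}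

theorem exists_addOut (R : Realization Γ h Vs O) (hd : Disjoint Vs O) (v : Γ.V) (γ : ℝ → X)
    {a b : ℝ} (hv : R.pt v = γ a) (hab : a < b) (hγ : ContinuousOn γ (Icc a b))
    (hh : ∀ s ∈ Icc a b, h (γ s) = s) (hnew : ∀ s ∈ Ioc a b, γ s ∉ Vs ∪ O) (l : ℝ) :
    Disjoint (insert (γ b) Vs) (O ∪ γ '' Ioo a b) ∧
    ∃ R' : Realization (Γ.addOut v l) h (insert (γ b) Vs) (O ∪ γ '' Ioo a b),
      ∀ w : Option Γ.V, R'.pt w = w.elim (γ b) R.pt := by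
  have ha : h (R.pt v) = a := by rw [hv, hh a (left_mem_Icc.2 hab.le)]
  constructor
  · rw [Set.disjoint_left] at hd ⊢
    rintro x (rfl | hx) (hx' | ⟨s, hs, hsx⟩)
    · exact hnew b (right_mem_Ioc.2 hab) (Or.inr hx')
    · have := hh s (Ioo_subset_Icc_self hs)
      rw [hsx, hh b (right_mem_Icc.2 hab.le)] at this
      exact hs.2.ne this.symm
    · exact hd hx hx'
    · exact hnew s (Ioo_subset_Ioc_self hs) (Or.inl (hsx ▸ hx))
  · subst ha
    exact ⟨R.attachOut v γ b hab hγ hh hv.symm hnew l, fun w => rfl⟩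

theorem exists_addIn (R : Realization Γ h Vs O) (hd : Disjoint Vs O) (v : Γ.V) (γ : ℝ → X)
    {a b : ℝ} (hv : R.pt v = γ a) (hab : b < a) (hγ : ContinuousOn γ (Icc b a))
    (hh : ∀ s ∈ Icc b a, h (γ s) = s) (hnew : ∀ s ∈ Ico b a, γ s ∉ Vs ∪ O) (l : ℝ) :
    Disjoint (insert (γ b) Vs) (O ∪ γ '' Ioo b a) ∧
    ∃ R' : Realization (Γ.addIn v l) h (insert (γ b) Vs) (O ∪ γ '' Ioo b a),
      ∀ w : Option Γ.V, R'.pt w = w.elim (γ b) R.pt := by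
  have ha : h (R.pt v) = a := by rw [hv, hh a (right_mem_Icc.2 hab.le)]
  constructor
  · rw [Set.disjoint_left] at hd ⊢
    rintro x (rfl | hx) (hx' | ⟨s, hs, hsx⟩)
    · exact hnew b (left_mem_Ico.2 hab) (Or.inr hx')
    · have := hh s (Ioo_subset_Icc_self hs)
      rw [hsx, hh b (left_mem_Icc.2 hab.le)] at this
      exact hs.1.ne this
    · exact hd hx hx'
    · exact hnew s (Ioo_subset_Ico_self hs) (Or.inl (hsx ▸ hx))
  · subst ha
    exact ⟨R.attachIn v γ b hab hγ hh hv.symm hnew l, fun w => rfl⟩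

end LabelledDigraph.Realization

/-- A digraph drawn in the quotient space with the right vertices is the Poincaré–Reeb V-digraph,
if its labels are ordered like the heights. -/
theorem PoincareReebGraph.isomorphic_of_realization {S : Set PlaneCircle} {D : Set Plane}
    {i j : Fin 2} (h : IsMBC S D) (hij : i ≠ j) (W : PoincareReebGraph S D i) {Γ : LabelledDigraph}
    {V O : Set (PRSpace D i)} (R : Γ.Realization (prHeight D i) V O) (hd : Disjoint V O)
    (hu : V ∪ O = univ) (hV : V = prVertices S D i)
    (hl : ∀ v w, Γ.label v < Γ.label w ↔ prHeight D i (R.pt v) < prHeight D i (R.pt w)) :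
    W.toLabelledDigraph.Isomorphic Γ := by
  have := t2Space_prSpace (D := D) hij h.bounded
  subst hV
  have hO : O = (prVertices S D i)ᶜ := (IsCompl.of_eq (disjoint_iff.1 hd)
    (by simpa using hu)).compl_eq.symm
  subst hO
  obtain ⟨R', hR', -⟩ := W.exists_realization continuous_prHeight
  refine R'.isomorphic hd (fun z hz => (h.hasLocalSection hij hz).exists_injOn) R (fun v w => ?_) hl
  rw [hR', W.label_eq, W.label_eq]

namespace Dent

variable {S : Set PlaneCircle} {D : Set Plane} {i j : Fin 2} {c : PlaneCircle} {p : Plane}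
  {ρ r η s₁ s₂ : ℝ} [Nonempty (closure D)] [Nonempty (closure (cut D p r))]

/-- The part of the new quotient space that comes from the lower arc. -/
def low (_ : Dent S D i j c p ρ r η s₁ s₂) : Set (PRSpace (cut D p r) i) :=
  {w | ∃ s, |s - p i| < r ∧ arcPt i j p r (-η) s ∈ closure D ∧
    w = prAt (cut D p r) i (arcPt i j p r (-η) s)}

/-- The new vertices on the lower arc. -/
def tips (_ : Dent S D i j c p ρ r η s₁ s₂) : Set (PRSpace (cut D p r) i) :=
  {w | ∃ s, |s - p i| < r ∧ arcPt i j p r (-η) s ∈ closure D ∧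
    arcPt i j p r (-η) s ∈ c.carrier ∧ w = prAt (cut D p r) i (arcPt i j p r (-η) s)}

theorem prVertices_eq (d : Dent S D i j c p ρ r η s₁ s₂)
    {ψ : PRSpace D i → PRSpace (cut D p r) i}
    (hψ2 : ∀ w, w = ψ (prProj d.ne sdiff_subset w) ∨ w ∈ d.low) :
    prVertices (insert ⟨p, r, d.pos⟩ S) (cut D p r) i = insert (prAt (cut D p r) i
      (arcPt i j p r η s₂)) (insert (prAt (cut D p r) i (arcPt i j p r η s₁))
        (ψ '' prVertices S D i)) ∪ d.tips := by
  have hij := d.ne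
  -- an old vertex does not lie below the upper arc
  have hold : ∀ x ∈ closure (cut D p r), ¬ IsOrdinary S i x →
      prAt D i x ∈ prVertices S D i ∧ prAt (cut D p r) i x = ψ (prAt D i x) := by
    intro x hx hn
    obtain ⟨hxK, -⟩ := d.mem_of_cut hx
    have hv : prAt D i x ∈ prVertices S D i := mem_prVertices_iff.2 ⟨x, hxK, rfl, not_not.1 hn⟩
    refine ⟨hv, ?_⟩
    have hφ : prProj d.ne sdiff_subset (prAt (cut D p r) i x) = prAt D i x := prProj_prAt hij _ hx
    rcases hψ2 (prAt (cut D p r) i x) with h1 | ⟨s, hs, hl, hw⟩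
    · rwa [hφ] at h1
    · have h2 : prAt D i x = prAt D i (arcPt i j p r (-η) s) := by
        rw [← hφ, hw, prProj_prAt hij _ (d.lower_mem_cut hs.le hl)]
      have h3 : prHeight D i (prAt D i x) = s := by rw [h2, prHeight_prAt hl, arcPt_same]
      have h4 := d.gap _ hv (by rw [h3]; exact hs.trans d.lt)
      rw [h3] at h4
      rw [h4] at hl
      exact absurd hl d.lower_center
  ext w
  constructor
  · intro hw
    obtain ⟨x, hx, rfl, hn⟩ := mem_prVertices_iff.1 hw
    obtain ⟨hxK, hxb⟩ := d.mem_of_cut hx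
    by_cases hnS : IsOrdinary S i x
    swap
    · obtain ⟨h1, h2⟩ := hold x hx hnS
      left; right; right
      exact ⟨_, h1, h2.symm⟩
    -- a point of the new circle that is a pole of it, or lies on an old circle
    have hcase : dist x p = r ∧ (x j = p j ∨ x ∈ c.carrier) := by
      rcases hn with ⟨e, he, hpole⟩ | ⟨e, he, f, hf, hef, hxe, hxf⟩
      · rcases he with rfl | he
        · have := (PlaneCircle.isPole_iff hij _ x).1 hpole
          exact ⟨this.1, Or.inl this.2⟩
        · exact absurd (Or.inl ⟨e, he, hpole⟩) hnS
      · rcases he with rfl | he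
        · have hf := mem_of_mem_insert_of_ne hf (Ne.symm hef)
          have hxr : dist x p = r := hxe
          exact ⟨hxr, Or.inr (d.small.single x (by rw [hxr]; exact d.lt) f hf hxf ▸ hxf)⟩
        · rcases hf with rfl | hf
          · have hxr : dist x p = r := hxf
            exact ⟨hxr, Or.inr (d.small.single x (by rw [hxr]; exact d.lt) e he hxe ▸ hxe)⟩
          · exact absurd (Or.inr ⟨e, he, f, hf, hef, hxe, hxf⟩) hnS
    obtain ⟨hxr, hcase⟩ := hcase
    have hs : |x i - p i| ≤ r := abs_le_of_dist_le hxr.le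
    have hend : |x i - p i| = r → x = arcPt i j p r η (x i) → x i = s₁ ∨ x i = s₂ := by
      intro h1 h2
      have h3 := (d.upper (x i) hs).1 (h2 ▸ hxK)
      rcases abs_eq d.pos.le |>.1 h1 with h4 | h4
      · right; linarith [d.right.2, h3.2]
      · left; linarith [d.left.1, h3.1]
    have huppercase : x = arcPt i j p r η (x i) → (x i = s₁ ∨ x i = s₂) → prAt (cut D p r) i x ∈
        insert (prAt (cut D p r) i (arcPt i j p r η s₂)) (insert (prAt (cut D p r) i
          (arcPt i j p r η s₁)) (ψ '' prVertices S D i)) ∪ d.tips := by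
      intro h1 h2
      rcases h2 with h2 | h2
      · left; right; left
        rw [← h2, ← h1]
      · left; left
        rw [← h2, ← h1]
    rcases hcase with hj | hxc
    · have h1 : |x i - p i| = r := by
        have := dist_sq hij x p
        rw [hxr, hj, sub_self, zero_pow two_ne_zero, add_zero] at this
        rw [← abs_of_pos d.pos]
        exact (sq_eq_sq_iff_abs_eq_abs _ _).1 this.symm
      have h2 : x = arcPt i j p r η (x i) := plane_ext hij (by simp) (by
        rw [arcPt_other hij, chord_end h1, mul_zero, add_zero, hj])
      exact huppercase h2 (hend h1 h2)
    · rcases eq_arcPt_of_dist hij d.side hxr with h1 | h1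
      · exact huppercase h1 (d.upper_carrier (x i) hs (h1 ▸ hxc))
      · rcases eq_or_lt_of_le hs with h2 | h2
        · have h3 : x = arcPt i j p r η (x i) := h1.trans (arcPt_end η h2)
          exact huppercase h3 (hend h2 h3)
        · exact Or.inr ⟨x i, h2, h1 ▸ hxK, h1 ▸ hxc, by rw [← h1]⟩
  · have hcross : ∀ x ∈ closure (cut D p r), dist x p = r → x ∈ c.carrier →
        prAt (cut D p r) i x ∈ prVertices (insert ⟨p, r, d.pos⟩ S) (cut D p r) i := by
      intro x hx hxr hxc
      refine mem_prVertices_iff.2 ⟨x, hx, rfl, Or.inr ⟨⟨p, r, d.pos⟩, mem_insert _ _, c,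
        mem_insert_of_mem _ d.circle_mem, ?_, hxr, hxc⟩⟩
      intro hpc
      have h0 := d.center_mem
      rw [← hpc] at h0
      have h0 : dist p p = r := h0
      rw [dist_self] at h0
      exact d.pos.ne h0
    have hpole : ∀ s ∈ Icc s₁ s₂, |s - p i| = r → prAt (cut D p r) i (arcPt i j p r η s) ∈
        prVertices (insert ⟨p, r, d.pos⟩ S) (cut D p r) i := by
      intro s hs hsr
      refine mem_prVertices_iff.2 ⟨_, d.upper_mem_cut hs, rfl, Or.inl ⟨⟨p, r, d.pos⟩,
        mem_insert _ _, ?_⟩⟩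
      rw [PlaneCircle.isPole_iff hij]
      refine ⟨dist_arcPt hij d.pos.le d.side hsr.le, ?_⟩
      rw [arcPt_other hij, chord_end hsr, mul_zero, add_zero]
    rintro ((rfl | rfl | ⟨z, hz, rfl⟩) | ⟨s, hs, hl, hlc, rfl⟩)
    · rcases d.right_end with h1 | ⟨h1, -⟩
      · exact hpole s₂ d.mem_Icc_right (by rw [h1, add_sub_cancel_left, abs_of_pos d.pos])
      · exact hcross _ (d.upper_mem_cut d.mem_Icc_right)
          (dist_arcPt hij d.pos.le d.side (d.abs_le d.mem_Icc_right)) h1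
    · rcases d.left_end with h1 | ⟨h1, -⟩
      · refine hpole s₁ d.mem_Icc_left ?_
        rw [h1, sub_sub_cancel_left, abs_neg, abs_of_pos d.pos]
      · exact hcross _ (d.upper_mem_cut d.mem_Icc_left)
          (dist_arcPt hij d.pos.le d.side (d.abs_le d.mem_Icc_left)) h1
    · obtain ⟨x, hx, rfl, hn⟩ := mem_prVertices_iff.1 hz
      have hxK : x ∈ closure (cut D p r) := by
        rw [d.closure_eq]
        refine ⟨hx, fun hxb => ?_⟩
        have hxρ := (Metric.mem_ball.1 hxb).trans d.lt
        rcases hn with ⟨e, he, hpole⟩ | ⟨e, he, f, hf, hef, hxe, hxf⟩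
        · by_cases hxp : x = p
          · rw [hxp] at hpole
            have := d.small.single p (by rw [dist_self]; exact d.small.pos) e he
              ((PlaneCircle.isPole_iff hij e p).1 hpole).1
            exact d.not_pole (this ▸ hpole)
          · exact d.small.no_pole x hxρ hxp e he i hpole
        · exact hef ((d.small.single x hxρ e he hxe).trans (d.small.single x hxρ f hf hxf).symm)
      rw [← (hold x hxK (not_not.2 hn)).2]
      refine mem_prVertices_iff.2 ⟨x, hxK, rfl, ?_⟩
      rcases hn with ⟨e, he, hpole⟩ | ⟨e, he, f, hf, h⟩
      · exact Or.inl ⟨e, Or.inr he, hpole⟩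
      · exact Or.inr ⟨e, Or.inr he, f, Or.inr hf, h⟩
    · exact hcross _ (d.lower_mem_cut hs.le hl) (dist_arcPt hij d.pos.le d.neg_side hs.le) hlc

/-- The drawing of the old V-digraph, with two additional vertices at the ends of the upper arc, in
the new quotient space. -/
theorem exists_base (d : Dent S D i j c p ρ r η s₁ s₂) (W : PoincareReebGraph S D i)
    {R : W.toLabelledDigraph.Realization (prHeight D i) (prVertices S D i) (prVertices S D i)ᶜ}
    (hR : R.pt = W.pt) {Γ₂ : LabelledDigraph} {v₁ v₂ : Γ₂.V} {a₁ a₂ : ℝ}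
    (hM : R.IsMarking Γ₂ v₁ v₂ (prAt D i (arcPt i j p r η s₁)) (prAt D i (arcPt i j p r η s₂))
      a₁ a₂) :
    ∃ (V O : Set (PRSpace (cut D p r) i)) (B : Γ₂.Realization (prHeight (cut D p r) i) V O),
      Disjoint V O ∧ V ∪ O ∪ d.low = univ ∧ Disjoint d.low (V ∪ O) ∧
      prVertices (insert ⟨p, r, d.pos⟩ S) (cut D p r) i = V ∪ d.tips ∧
      B.pt v₁ = prAt (cut D p r) i (arcPt i j p r η s₁) ∧
      B.pt v₂ = prAt (cut D p r) i (arcPt i j p r η s₂) ∧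
      ∀ s₃ s₄ a₃ a₄, ∀ v, LabelledDigraph.IsLabelPair (p i) ρ a₁ a₃ a₄ a₂ s₁ s₃ s₄ s₂ (Γ₂.label v)
        (prHeight (cut D p r) i (B.pt v)) := by
  obtain ⟨ψ, hψc, hψ1, hψ2, hψ3⟩ := d.exists_embedding
  have hψh : ∀ z, prHeight (cut D p r) i (ψ z) = prHeight D i z := fun z => by
    rw [← prHeight_prProj d.ne sdiff_subset, hψ1]
  have hψi : Function.Injective ψ := Function.LeftInverse.injective hψ1
  have hζ1 := hψ2 s₁ d.mem_Icc_left
  have hζ2 := hψ2 s₂ d.mem_Icc_right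
  have hh1 : prHeight D i (prAt D i (arcPt i j p r η s₁)) = s₁ := by
    rw [prHeight_prAt (d.upper_mem d.mem_Icc_left), arcPt_same]
  have hh2 : prHeight D i (prAt D i (arcPt i j p r η s₂)) = s₂ := by
    rw [prHeight_prAt (d.upper_mem d.mem_Icc_right), arcPt_same]
  generalize prAt D i (arcPt i j p r η s₁) = ζ₁ at hM hζ1 hh1
  generalize prAt D i (arcPt i j p r η s₂) = ζ₂ at hM hζ2 hh2
  obtain ⟨B, hv1, hv2, hl1, hl2, hv⟩ := hM
  have hAc : ((prVertices S D i)ᶜ \ {ζ₁}) \ {ζ₂} =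
      (insert ζ₂ (insert ζ₁ (prVertices S D i)))ᶜ := by
    ext z
    simp only [Set.mem_sdiff, mem_compl_iff, mem_singleton_iff, mem_insert_iff]
    tauto
  have hrange : ψ '' (insert ζ₂ (insert ζ₁ (prVertices S D i))) ∪
      ψ '' (((prVertices S D i)ᶜ \ {ζ₁}) \ {ζ₂}) = range ψ := by
    rw [hAc, ← image_union, union_compl_self, image_univ]
  refine ⟨_, _, B.map ψ hψc hψi hψh, ?_, ?_, ?_, ?_, ?_, ?_, ?_⟩
  · rw [hAc]
    exact (disjoint_image_iff hψi).2 disjoint_compl_right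
  · rw [hrange]
    refine eq_univ_of_forall fun w => ?_
    rcases hψ3 w with h1 | h1
    · exact Or.inl ⟨_, h1.symm⟩
    · exact Or.inr h1
  · rw [hrange, Set.disjoint_left]
    rintro w ⟨s, hs, hl, hw⟩ ⟨z, rfl⟩
    obtain ⟨h1, h2⟩ := d.prAt_lower hs hl
    have h3 : z = prAt D i (arcPt i j p r η s) := by
      rw [← hψ1 z, hw, prProj_prAt d.ne _ (d.lower_mem_cut hs.le hl), h2]
    rw [h3, hψ2 s (Ioo_subset_Icc_self h1)] at hw
    exact prAt_arcPt_ne d.ne d.pos.le d.side d.closure_eq hs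
      (d.upper_mem (Ioo_subset_Icc_self h1)) hl hw
  · rw [d.prVertices_eq hψ3, image_insert_eq, image_insert_eq, hζ1, hζ2]
  · show ψ (B.pt v₁) = _
    rw [hv1, hζ1]
  · show ψ (B.pt v₂) = _
    rw [hv2, hζ2]
  · intro s₃ s₄ a₃ a₄ v
    show LabelledDigraph.IsLabelPair _ _ _ _ _ _ _ _ _ _ _ (prHeight _ _ (ψ (B.pt v)))
    rw [hψh]
    rcases hv v with rfl | rfl | ⟨w, hw1, hw2⟩
    · right; left
      exact ⟨hl1, by rw [hv1, hh1]⟩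
    · right; right; right; right
      exact ⟨hl2, by rw [hv2, hh2]⟩
    · left
      have hwv : B.pt v ∈ prVertices S D i := by rw [hw1]; exact R.pt_mem w
      refine ⟨?_, ?_⟩
      · rw [hw2, W.label_eq, hw1, hR]
      · rcases lt_or_ge |prHeight D i (B.pt v) - p i| ρ with h1 | h1
        · exact Or.inl (d.gap _ hwv h1)
        · exact Or.inr h1

end Dent

/-! ### Branches along the lower arc -/

namespace Dent

variable {S : Set PlaneCircle} {D : Set Plane} {i j : Fin 2} {c : PlaneCircle} {p : Plane}
  {ρ r η s₁ s₂ s₃ s₄ : ℝ}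

/-- The lower arc misses the closure of `D` to the left of `p`. -/
def NoLeftWhisker (_ : Dent S D i j c p ρ r η s₁ s₂) : Prop :=
  ∀ s ∈ Icc (p i - r) (p i), arcPt i j p r (-η) s ∉ closure D

/-- The left pole of the new circle lies in the closure of `D`, and from there, the lower arc runs
in the closure of `D` up to a point of `c` at height `s₃`. -/
structure LeftWhisker (d : Dent S D i j c p ρ r η s₁ s₂) (s₃ : ℝ) : Prop where
  eq : s₁ = p i - r
  mem : s₃ ∈ Ioo (p i - r) (p i)
  lower : ∀ s ∈ Icc (p i - r) (p i), arcPt i j p r (-η) s ∈ closure D ↔ s ≤ s₃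
  carrier : ∀ s ∈ Icc (p i - r) (p i), arcPt i j p r (-η) s ∈ c.carrier ↔ s = s₃

/-- The lower arc misses the closure of `D` to the right of `p`. -/
def NoRightWhisker (_ : Dent S D i j c p ρ r η s₁ s₂) : Prop :=
  ∀ s ∈ Icc (p i) (p i + r), arcPt i j p r (-η) s ∉ closure D

/-- The right pole of the new circle lies in the closure of `D`, and from there, the lower arc runs
in the closure of `D` down to a point of `c` at height `s₄`. -/
structure RightWhisker (d : Dent S D i j c p ρ r η s₁ s₂) (s₄ : ℝ) : Prop where
  eq : s₂ = p i + r
  mem : s₄ ∈ Ioo (p i) (p i + r)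
  lower : ∀ s ∈ Icc (p i) (p i + r), arcPt i j p r (-η) s ∈ closure D ↔ s₄ ≤ s
  carrier : ∀ s ∈ Icc (p i) (p i + r), arcPt i j p r (-η) s ∈ c.carrier ↔ s = s₄

theorem LeftWhisker.mem_closure {d : Dent S D i j c p ρ r η s₁ s₂} (L : d.LeftWhisker s₃) {s : ℝ}
    (hs : s ∈ Icc s₁ s₃) : |s - p i| ≤ r ∧ arcPt i j p r (-η) s ∈ closure D := by
  have h1 := L.eq
  have h2 := L.mem
  have h3 : s ∈ Icc (p i - r) (p i) := ⟨by linarith [hs.1], by linarith [hs.2, h2.2]⟩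
  refine ⟨?_, (L.lower s h3).2 hs.2⟩
  rw [abs_sub_le_iff]
  constructor <;> linarith [h3.1, h3.2, d.pos]

theorem RightWhisker.mem_closure {d : Dent S D i j c p ρ r η s₁ s₂} (L : d.RightWhisker s₄) {s : ℝ}
    (hs : s ∈ Icc s₄ s₂) : |s - p i| ≤ r ∧ arcPt i j p r (-η) s ∈ closure D := by
  have h1 := L.eq
  have h2 := L.mem
  have h3 : s ∈ Icc (p i) (p i + r) := ⟨by linarith [hs.1, h2.1], by linarith [hs.2]⟩
  refine ⟨?_, (L.lower s h3).2 hs.1⟩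
  rw [abs_sub_le_iff]
  constructor <;> linarith [h3.1, h3.2, d.pos]

variable [Nonempty (closure (cut D p r))]

theorem prHeight_lower (d : Dent S D i j c p ρ r η s₁ s₂) {s : ℝ} (hs : |s - p i| ≤ r)
    (hl : arcPt i j p r (-η) s ∈ closure D) :
    prHeight (cut D p r) i (prAt (cut D p r) i (arcPt i j p r (-η) s)) = s := by
  rw [prHeight_prAt (d.lower_mem_cut hs hl), arcPt_same]

/-- Attaching the left whisker to a drawing. -/
theorem LeftWhisker.exists_addOut {d : Dent S D i j c p ρ r η s₁ s₂} (L : d.LeftWhisker s₃)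
    {Γ : LabelledDigraph} {V O : Set (PRSpace (cut D p r) i)}
    (B : Γ.Realization (prHeight (cut D p r) i) V O) (hd : Disjoint V O) {v₁ : Γ.V}
    (hv : B.pt v₁ = prAt (cut D p r) i (arcPt i j p r η s₁)) (hlow : Disjoint d.low (V ∪ O))
    (l : ℝ) :
    Disjoint (insert (prAt (cut D p r) i (arcPt i j p r (-η) s₃)) V)
      (O ∪ (fun s => prAt (cut D p r) i (arcPt i j p r (-η) s)) '' Ioo s₁ s₃) ∧
    ∃ B' : (Γ.addOut v₁ l).Realization (prHeight (cut D p r) i)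
      (insert (prAt (cut D p r) i (arcPt i j p r (-η) s₃)) V)
      (O ∪ (fun s => prAt (cut D p r) i (arcPt i j p r (-η) s)) '' Ioo s₁ s₃),
      ∀ w : Option Γ.V, B'.pt w = w.elim (prAt (cut D p r) i (arcPt i j p r (-η) s₃)) B.pt := by
  have h1 := L.eq
  have h2 := L.mem
  refine B.exists_addOut hd v₁ (fun s => prAt (cut D p r) i (arcPt i j p r (-η) s)) ?_ ?_ ?_ ?_ ?_ l
  · rw [hv]
    have : |s₁ - p i| = r := by rw [h1, sub_sub_cancel_left, abs_neg, abs_of_pos d.pos]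
    rw [arcPt_end (-η) this]
  · rw [h1]; exact h2.1
  · exact continuousOn_prAt.comp continuous_arcPt.continuousOn
      fun s hs => d.lower_mem_cut (L.mem_closure hs).1 (L.mem_closure hs).2
  · exact fun s hs => d.prHeight_lower (L.mem_closure hs).1 (L.mem_closure hs).2
  · intro s hs
    have h3 := L.mem_closure (Ioc_subset_Icc_self hs)
    refine Set.disjoint_left.1 hlow ⟨s, lt_of_le_of_ne h3.1 fun h4 => ?_, h3.2, rfl⟩
    rw [abs_of_neg (by linarith [hs.2, h2.2])] at h4
    linarith [hs.1]

/-- Attaching the right whisker to a drawing. -/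
theorem RightWhisker.exists_addIn {d : Dent S D i j c p ρ r η s₁ s₂} (L : d.RightWhisker s₄)
    {Γ : LabelledDigraph} {V O : Set (PRSpace (cut D p r) i)}
    (B : Γ.Realization (prHeight (cut D p r) i) V O) (hd : Disjoint V O) {v₂ : Γ.V}
    (hv : B.pt v₂ = prAt (cut D p r) i (arcPt i j p r η s₂))
    (hlow : ∀ s ∈ Ico s₄ s₂, prAt (cut D p r) i (arcPt i j p r (-η) s) ∉ V ∪ O) (l : ℝ) :
    Disjoint (insert (prAt (cut D p r) i (arcPt i j p r (-η) s₄)) V)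
      (O ∪ (fun s => prAt (cut D p r) i (arcPt i j p r (-η) s)) '' Ioo s₄ s₂) ∧
    ∃ B' : (Γ.addIn v₂ l).Realization (prHeight (cut D p r) i)
      (insert (prAt (cut D p r) i (arcPt i j p r (-η) s₄)) V)
      (O ∪ (fun s => prAt (cut D p r) i (arcPt i j p r (-η) s)) '' Ioo s₄ s₂),
      ∀ w : Option Γ.V, B'.pt w = w.elim (prAt (cut D p r) i (arcPt i j p r (-η) s₄)) B.pt := by
  have h1 := L.eq
  have h2 := L.mem
  refine B.exists_addIn hd v₂ (fun s => prAt (cut D p r) i (arcPt i j p r (-η) s)) ?_ ?_ ?_ ?_ hlow l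
  · rw [hv]
    have : |s₂ - p i| = r := by rw [h1, add_sub_cancel_left, abs_of_pos d.pos]
    rw [arcPt_end (-η) this]
  · rw [h1]; exact h2.2
  · exact continuousOn_prAt.comp continuous_arcPt.continuousOn
      fun s hs => d.lower_mem_cut (L.mem_closure hs).1 (L.mem_closure hs).2
  · exact fun s hs => d.prHeight_lower (L.mem_closure hs).1 (L.mem_closure hs).2

theorem RightWhisker.mem_low {d : Dent S D i j c p ρ r η s₁ s₂} (L : d.RightWhisker s₄) {s : ℝ}
    (hs : s ∈ Ico s₄ s₂) : prAt (cut D p r) i (arcPt i j p r (-η) s) ∈ d.low := by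
  have h1 := L.eq
  have h2 := L.mem
  have h3 := L.mem_closure (Ico_subset_Icc_self hs)
  refine ⟨s, lt_of_le_of_ne h3.1 fun h4 => ?_, h3.2, rfl⟩
  rw [abs_of_pos (by linarith [hs.1, h2.1])] at h4
  linarith [hs.2]

section Isomorphic

variable [Nonempty (closure D)]

variable (d : Dent S D i j c p ρ r η s₁ s₂) (W : PoincareReebGraph S D i)
  (W' : PoincareReebGraph (insert ⟨p, r, d.pos⟩ S) (cut D p r) i)
  {R : W.toLabelledDigraph.Realization (prHeight D i) (prVertices S D i) (prVertices S D i)ᶜ}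
  {Γ₂ : LabelledDigraph} {v₁ v₂ : Γ₂.V} {a₁ a₂ : ℝ}

theorem isomorphic_of_noWhisker (hR : R.pt = W.pt)
    (hM : R.IsMarking Γ₂ v₁ v₂ (prAt D i (arcPt i j p r η s₁)) (prAt D i (arcPt i j p r η s₂)) a₁ a₂)
    (hL : d.NoLeftWhisker) (hR' : d.NoRightWhisker)
    (h1 : p i - ρ < a₁) (h2 : a₁ < p i) (h3 : p i < a₂) (h4 : a₂ < p i + ρ) :
    W'.toLabelledDigraph.Isomorphic Γ₂ := by
  obtain ⟨V, O, B, hd, hu, -, hV, -, -, hlab⟩ := d.exists_base W hR hM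
  have hno : ∀ s, |s - p i| < r → arcPt i j p r (-η) s ∉ closure D := by
    intro s hs
    obtain ⟨h5, h6⟩ := abs_lt.1 hs
    rcases le_total s (p i) with h | h
    · exact hL s ⟨by linarith, h⟩
    · exact hR' s ⟨h, by linarith⟩
  have hlow : d.low = ∅ := eq_empty_of_forall_notMem fun w ⟨s, hs, hl, _⟩ => hno s hs hl
  have htips : d.tips = ∅ := eq_empty_of_forall_notMem fun w ⟨s, hs, hl, _⟩ => hno s hs hl
  rw [hlow, union_empty] at hu
  rw [htips, union_empty] at hV
  refine W'.isomorphic_of_realization d.isMBC d.ne B hd hu hV.symm fun v w => ?_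
  have e1 := d.left
  have e2 := d.right
  have e3 := d.lt
  exact LabelledDigraph.IsLabelPair.lt_iff (a₃ := (a₁ + p i) / 2) (a₄ := (a₂ + p i) / 2)
    (s₃ := (s₁ + p i) / 2) (s₄ := (s₂ + p i) / 2) ⟨by linarith, by linarith, by linarith,
      by linarith, by linarith, by linarith⟩ ⟨by linarith [e1.1], by linarith [e1.2],
      by linarith [e1.2], by linarith [e2.1], by linarith [e2.1], by linarith [e2.2]⟩
    (hlab _ _ _ _ v) (hlab _ _ _ _ w)

theorem isomorphic_of_leftWhisker (hR : R.pt = W.pt)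
    (hM : R.IsMarking Γ₂ v₁ v₂ (prAt D i (arcPt i j p r η s₁)) (prAt D i (arcPt i j p r η s₂)) a₁ a₂)
    (hL : d.LeftWhisker s₃) (hR' : d.NoRightWhisker) {a : ℝ}
    (h1 : p i - ρ < a₁) (h2 : a₁ < a) (h2' : a < p i) (h3 : p i < a₂) (h4 : a₂ < p i + ρ) :
    W'.toLabelledDigraph.Isomorphic (Γ₂.addOut v₁ a) := by
  obtain ⟨V, O, B, hd, hu, hlow, hV, hv1, -, hlab⟩ := d.exists_base W hR hM
  obtain ⟨hd', B', hB'⟩ := hL.exists_addOut B hd hv1 hlow a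
  have e0 := hL.eq
  have e0' := hL.mem
  have e1 := d.left
  have e2 := d.right
  have e3 := d.lt
  have hcase : ∀ s, |s - p i| < r → arcPt i j p r (-η) s ∈ closure D →
      s ∈ Ioc s₁ s₃ ∧ s ∈ Icc (p i - r) (p i) := by
    intro s hs hl
    obtain ⟨h5, h6⟩ := abs_lt.1 hs
    rcases le_total s (p i) with h | h
    · have h7 : s ∈ Icc (p i - r) (p i) := ⟨by linarith, h⟩
      exact ⟨⟨by linarith, (hL.lower s h7).1 hl⟩, h7⟩
    · exact absurd hl (hR' s ⟨h, by linarith⟩)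
  have hm := hL.mem_closure ⟨by linarith [e0'.1], le_rfl⟩
  refine W'.isomorphic_of_realization d.isMBC d.ne B' hd' ?_ ?_ fun v w => ?_
  · refine eq_univ_of_forall fun w => ?_
    rcases (hu ▸ mem_univ w : w ∈ V ∪ O ∪ d.low) with (h | h) | ⟨s, hs, hl, rfl⟩
    · exact Or.inl (Or.inr h)
    · exact Or.inr (Or.inl h)
    · rcases eq_or_lt_of_le (hcase s hs hl).1.2 with rfl | h6
      · exact Or.inl (mem_insert _ _)
      · exact Or.inr (Or.inr ⟨s, ⟨(hcase s hs hl).1.1, h6⟩, rfl⟩)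
  · rw [hV, insert_eq, union_comm]
    congr 1
    refine (Subset.antisymm ?_ ?_).symm
    · rintro w ⟨s, hs, hl, hc, rfl⟩
      rw [(hL.carrier s (hcase s hs hl).2).1 hc]
      exact mem_singleton _
    · rintro w rfl
      refine ⟨s₃, abs_lt.2 ⟨by linarith [e0'.1], by linarith [e0'.2, d.pos]⟩, hm.2, ?_, rfl⟩
      exact (hL.carrier s₃ (Ioo_subset_Icc_self e0')).2 rfl
  have hpair : ∀ v, LabelledDigraph.IsLabelPair (p i) ρ a₁ a ((a₂ + p i) / 2) a₂ s₁ s₃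
      ((s₂ + p i) / 2) s₂ ((Γ₂.addOut v₁ a).label v) (prHeight (cut D p r) i (B'.pt v)) := by
    rintro (_ | v)
    · rw [hB']
      exact Or.inr (Or.inr (Or.inl ⟨rfl, d.prHeight_lower hm.1 hm.2⟩))
    · rw [hB']
      exact hlab _ _ _ _ v
  exact LabelledDigraph.IsLabelPair.lt_iff ⟨by linarith, by linarith, by linarith,
      by linarith, by linarith, by linarith⟩ ⟨by linarith [e1.1], by linarith [e0'.1],
      by linarith [e0'.2], by linarith [e2.1], by linarith [e2.1], by linarith [e2.2]⟩
    (hpair v) (hpair w)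

theorem isomorphic_of_rightWhisker (hR : R.pt = W.pt)
    (hM : R.IsMarking Γ₂ v₁ v₂ (prAt D i (arcPt i j p r η s₁)) (prAt D i (arcPt i j p r η s₂)) a₁ a₂)
    (hL : d.NoLeftWhisker) (hR' : d.RightWhisker s₄) {a : ℝ}
    (h1 : p i - ρ < a₁) (h2 : a₁ < p i) (h3 : p i < a) (h3' : a < a₂) (h4 : a₂ < p i + ρ) :
    W'.toLabelledDigraph.Isomorphic (Γ₂.addIn v₂ a) := by
  obtain ⟨V, O, B, hd, hu, hlow, hV, -, hv2, hlab⟩ := d.exists_base W hR hM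
  obtain ⟨hd', B', hB'⟩ := hR'.exists_addIn B hd hv2
    (fun s hs => Set.disjoint_left.1 hlow (hR'.mem_low hs)) a
  have e0 := hR'.eq
  have e0' := hR'.mem
  have e1 := d.left
  have e2 := d.right
  have e3 := d.lt
  have hcase : ∀ s, |s - p i| < r → arcPt i j p r (-η) s ∈ closure D →
      s ∈ Ico s₄ s₂ ∧ s ∈ Icc (p i) (p i + r) := by
    intro s hs hl
    obtain ⟨h5, h6⟩ := abs_lt.1 hs
    rcases le_total s (p i) with h | h
    · exact absurd hl (hL s ⟨by linarith, h⟩)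
    · have h7 : s ∈ Icc (p i) (p i + r) := ⟨h, by linarith⟩
      exact ⟨⟨(hR'.lower s h7).1 hl, by linarith⟩, h7⟩
  have hm := hR'.mem_closure ⟨le_rfl, by linarith [e0'.2]⟩
  refine W'.isomorphic_of_realization d.isMBC d.ne B' hd' ?_ ?_ fun v w => ?_
  · refine eq_univ_of_forall fun w => ?_
    rcases (hu ▸ mem_univ w : w ∈ V ∪ O ∪ d.low) with (h | h) | ⟨s, hs, hl, rfl⟩
    · exact Or.inl (Or.inr h)
    · exact Or.inr (Or.inl h)
    · rcases eq_or_lt_of_le (hcase s hs hl).1.1 with rfl | h6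
      · exact Or.inl (mem_insert _ _)
      · exact Or.inr (Or.inr ⟨s, ⟨h6, (hcase s hs hl).1.2⟩, rfl⟩)
  · rw [hV, insert_eq, union_comm]
    congr 1
    refine (Subset.antisymm ?_ ?_).symm
    · rintro w ⟨s, hs, hl, hc, rfl⟩
      rw [(hR'.carrier s (hcase s hs hl).2).1 hc]
      exact mem_singleton _
    · rintro w rfl
      refine ⟨s₄, abs_lt.2 ⟨by linarith [e0'.1, d.pos], by linarith [e0'.2]⟩, hm.2, ?_, rfl⟩
      exact (hR'.carrier s₄ (Ioo_subset_Icc_self e0')).2 rfl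
  have hpair : ∀ v, LabelledDigraph.IsLabelPair (p i) ρ a₁ ((a₁ + p i) / 2) a a₂ s₁
      ((s₁ + p i) / 2) s₄ s₂ ((Γ₂.addIn v₂ a).label v) (prHeight (cut D p r) i (B'.pt v)) := by
    rintro (_ | v)
    · rw [hB']
      exact Or.inr (Or.inr (Or.inr (Or.inl ⟨rfl, d.prHeight_lower hm.1 hm.2⟩)))
    · rw [hB']
      exact hlab _ _ _ _ v
  exact LabelledDigraph.IsLabelPair.lt_iff ⟨by linarith, by linarith, by linarith,
      by linarith, by linarith, by linarith⟩ ⟨by linarith [e1.1], by linarith [e1.2],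
      by linarith [e1.2], by linarith [e0'.1], by linarith [e0'.2], by linarith [e2.2]⟩
    (hpair v) (hpair w)

theorem isomorphic_of_twoWhiskers (hR : R.pt = W.pt)
    (hM : R.IsMarking Γ₂ v₁ v₂ (prAt D i (arcPt i j p r η s₁)) (prAt D i (arcPt i j p r η s₂)) a₁ a₂)
    (hL : d.LeftWhisker s₃) (hR' : d.RightWhisker s₄) {a₃ a₄ : ℝ}
    (h1 : p i - ρ < a₁) (h2 : a₁ < a₃) (h2' : a₃ < p i) (h3 : p i < a₄) (h3' : a₄ < a₂)
    (h4 : a₂ < p i + ρ) :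
    W'.toLabelledDigraph.Isomorphic ((Γ₂.addOut v₁ a₃).addIn (some v₂ : Option Γ₂.V) a₄) := by
  obtain ⟨V, O, B, hd, hu, hlow, hV, hv1, hv2, hlab⟩ := d.exists_base W hR hM
  obtain ⟨hd', B', hB'⟩ := hL.exists_addOut B hd hv1 hlow a₃
  have e0 := hL.eq
  have e0' := hL.mem
  have f0 := hR'.eq
  have f0' := hR'.mem
  have e1 := d.left
  have e2 := d.right
  have e3 := d.lt
  have hm := hL.mem_closure ⟨by linarith [e0'.1], le_rfl⟩
  have hm' := hR'.mem_closure ⟨le_rfl, by linarith [f0'.2]⟩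
  -- the two whiskers have different heights
  have hne : ∀ s ∈ Ico s₄ s₂, ∀ s' ∈ Icc s₁ s₃, prAt (cut D p r) i (arcPt i j p r (-η) s) ≠
      prAt (cut D p r) i (arcPt i j p r (-η) s') := by
    intro s hs s' hs' heq
    have h5 := hR'.mem_closure (Ico_subset_Icc_self hs)
    have h6 := hL.mem_closure hs'
    have h7 := congrArg (prHeight (cut D p r) i) heq
    rw [d.prHeight_lower h5.1 h5.2, d.prHeight_lower h6.1 h6.2] at h7
    linarith [hs.1, hs'.2, e0'.2, f0'.1]
  obtain ⟨hd'', B'', hB''⟩ := hR'.exists_addIn B' hd' (v₂ := (some v₂ : Option Γ₂.V))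
    (by rw [hB']; exact hv2) (fun s hs => by
      rintro ((h5 | h5) | (h5 | ⟨s', hs', h5⟩))
      · exact hne s hs s₃ ⟨by linarith [e0'.1], le_rfl⟩ h5
      · exact Set.disjoint_left.1 hlow (hR'.mem_low hs) (Or.inl h5)
      · exact Set.disjoint_left.1 hlow (hR'.mem_low hs) (Or.inr h5)
      · exact hne s hs s' (Ioo_subset_Icc_self hs') h5.symm) a₄
  have hcase : ∀ s, |s - p i| < r → arcPt i j p r (-η) s ∈ closure D →
      (s ∈ Ioc s₁ s₃ ∧ s ∈ Icc (p i - r) (p i)) ∨ (s ∈ Ico s₄ s₂ ∧ s ∈ Icc (p i) (p i + r)) := by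
    intro s hs hl
    obtain ⟨h5, h6⟩ := abs_lt.1 hs
    rcases le_total s (p i) with h | h
    · have h7 : s ∈ Icc (p i - r) (p i) := ⟨by linarith, h⟩
      exact Or.inl ⟨⟨by linarith, (hL.lower s h7).1 hl⟩, h7⟩
    · have h7 : s ∈ Icc (p i) (p i + r) := ⟨h, by linarith⟩
      exact Or.inr ⟨⟨(hR'.lower s h7).1 hl, by linarith⟩, h7⟩
  refine W'.isomorphic_of_realization d.isMBC d.ne B'' hd'' ?_ ?_ fun v w => ?_
  · refine eq_univ_of_forall fun w => ?_
    rcases (hu ▸ mem_univ w : w ∈ V ∪ O ∪ d.low) with (h | h) | ⟨s, hs, hl, rfl⟩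
    · exact Or.inl (Or.inr (Or.inr h))
    · exact Or.inr (Or.inl (Or.inl h))
    · rcases hcase s hs hl with ⟨h5, -⟩ | ⟨h5, -⟩
      · rcases eq_or_lt_of_le h5.2 with rfl | h6
        · exact Or.inl (Or.inr (mem_insert _ _))
        · exact Or.inr (Or.inl (Or.inr ⟨s, ⟨h5.1, h6⟩, rfl⟩))
      · rcases eq_or_lt_of_le h5.1 with rfl | h6
        · exact Or.inl (mem_insert _ _)
        · exact Or.inr (Or.inr ⟨s, ⟨h6, h5.2⟩, rfl⟩)
  · rw [hV]
    refine Subset.antisymm ?_ ?_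
    · rintro w (rfl | rfl | hw)
      · refine Or.inr ⟨s₄, abs_lt.2 ⟨by linarith [f0'.1, d.pos], by linarith [f0'.2]⟩, hm'.2, ?_,
          rfl⟩
        exact (hR'.carrier s₄ (Ioo_subset_Icc_self f0')).2 rfl
      · refine Or.inr ⟨s₃, abs_lt.2 ⟨by linarith [e0'.1], by linarith [e0'.2, d.pos]⟩, hm.2, ?_,
          rfl⟩
        exact (hL.carrier s₃ (Ioo_subset_Icc_self e0')).2 rfl
      · exact Or.inl hw
    · rintro w (hw | ⟨s, hs, hl, hc, rfl⟩)
      · exact Or.inr (Or.inr hw)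
      · rcases hcase s hs hl with ⟨-, h5⟩ | ⟨-, h5⟩
        · rw [(hL.carrier s h5).1 hc]
          exact Or.inr (mem_insert _ _)
        · rw [(hR'.carrier s h5).1 hc]
          exact mem_insert _ _
  have hpair : ∀ v, LabelledDigraph.IsLabelPair (p i) ρ a₁ a₃ a₄ a₂ s₁ s₃ s₄ s₂
      (((Γ₂.addOut v₁ a₃).addIn (some v₂ : Option Γ₂.V) a₄).label v)
      (prHeight (cut D p r) i (B''.pt v)) := by
    rintro (_ | _ | v)
    · rw [hB'']
      exact Or.inr (Or.inr (Or.inr (Or.inl ⟨rfl, d.prHeight_lower hm'.1 hm'.2⟩)))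
    · rw [hB'']
      show LabelledDigraph.IsLabelPair _ _ _ _ _ _ _ _ _ _ _ (prHeight _ _ (B'.pt none))
      rw [hB']
      exact Or.inr (Or.inr (Or.inl ⟨rfl, d.prHeight_lower hm.1 hm.2⟩))
    · rw [hB'']
      show LabelledDigraph.IsLabelPair _ _ _ _ _ _ _ _ _ _ _ (prHeight _ _ (B'.pt (some v)))
      rw [hB']
      exact hlab _ _ _ _ v
  exact LabelledDigraph.IsLabelPair.lt_iff ⟨by linarith, by linarith, by linarith,
      by linarith, by linarith, by linarith⟩ ⟨by linarith [e1.1], by linarith [e0'.1],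
      by linarith [e0'.2], by linarith [f0'.1], by linarith [f0'.2], by linarith [e2.2]⟩
    (hpair v) (hpair w)

end Isomorphic

end Dent

/-! ### The ends of the upper arc -/

section Ends

variable {S : Set PlaneCircle} {D : Set Plane} {i j : Fin 2} {c : PlaneCircle} {p : Plane} {ρ r η : ℝ}

theorem IsSmall.mem_closure_iff (h : IsMBC S D) (hc : c ∈ S) (hs : IsSmall S D c p ρ) {x : Plane}
    (hx : dist x p < ρ) : x ∈ closure D ↔ 0 ≤ sidePow D c x :=
  ⟨h.sidePow_nonneg hc, hs.mem_closure x hx⟩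

/-- The position of the two arcs on the side `ϑ` of `p`. The upper arc lies in the closure of `D` up
to the distance `σ₁`. The sign of the component of the normal of `c` in the direction `ϑ`, and if it
vanishes, the side of `c` on which `D` lies, decide whether the pole of the new circle is in the
closure of `D`. -/
theorem exists_arc_end (h : IsMBC S D) (hij : i ≠ j) (hc : c ∈ S) (hp : p ∈ c.carrier)
    (hs : IsSmall S D c p ρ) (hη : η = 1 ∨ η = -1)
    (hB : 0 < η * (sideSign D c * (p j - c.center j))) (hr : 0 < r) (hrρ : r < ρ) {ϑ A : ℝ}
    (hϑ : ϑ = 1 ∨ ϑ = -1) (hA : A = ϑ * (sideSign D c * (p i - c.center i))) :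
    ∃ σ₁ ∈ Ioc 0 r,
      (∀ σ ∈ Icc 0 r, (arcPt i j p r η (p i + ϑ * σ) ∈ closure D ↔ σ ≤ σ₁) ∧
        (arcPt i j p r η (p i + ϑ * σ) ∈ c.carrier → σ = σ₁)) ∧
      (σ₁ = r ∨ arcPt i j p r η (p i + ϑ * σ₁) ∈ c.carrier ∧
        arcPt i j p r (-η) (p i + ϑ * σ₁) ∉ closure D) ∧
      arcPt i j p r (-η) (p i) ∉ closure D ∧
      (A < 0 ∨ A = 0 ∧ sideSign D c = -1 →
        ∀ σ ∈ Icc 0 r, arcPt i j p r (-η) (p i + ϑ * σ) ∉ closure D) ∧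
      (0 < A ∨ A = 0 ∧ sideSign D c = 1 → σ₁ = r ∧ ∃ α ∈ Ioo 0 r, ∀ σ ∈ Icc 0 r,
        (arcPt i j p r (-η) (p i + ϑ * σ) ∈ closure D ↔ α ≤ σ) ∧
        (arcPt i j p r (-η) (p i + ϑ * σ) ∈ c.carrier ↔ σ = α)) := by
  have hε := sideSign_eq D c
  set B := η * (sideSign D c * (p j - c.center j)) with hBdef
  have hη' : -η = 1 ∨ -η = -1 := by rcases hη with h | h <;> rw [h] <;> simp
  have habsB : |p j - c.center j| = B := by
    rw [← abs_of_pos hB, hBdef, abs_mul, abs_mul]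
    rcases hη with h | h <;> rcases hε with h' | h' <;> rw [h, h'] <;> simp
  have habsA : |p i - c.center i| = |A| := by
    rw [hA, abs_mul, abs_mul]
    rcases hϑ with h | h <;> rcases hε with h' | h' <;> rw [h, h'] <;> simp
  have hrB : r < B := by
    rw [← habsB]
    refine hrρ.trans (hs.coord j fun h0 => ?_)
    rw [h0, abs_zero] at habsB
    exact hB.ne habsB
  have hrA : A ≠ 0 → r < |A| := fun hne => by
    rw [← habsA]
    refine hrρ.trans (hs.coord i fun h0 => hne ?_)
    rw [hA, h0, mul_zero, mul_zero]
  have habs : ∀ σ ∈ Icc 0 r, |p i + ϑ * σ - p i| ≤ r := by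
    intro σ hσ
    rw [add_sub_cancel_left, abs_mul, abs_of_nonneg hσ.1]
    rcases hϑ with h | h <;> rw [h] <;> simpa using hσ.2
  have hpow : ∀ σ ∈ Icc 0 r, sidePow D c (arcPt i j p r η (p i + ϑ * σ)) =
      2 * A * σ + 2 * B * Real.sqrt (r ^ 2 - σ ^ 2) + sideSign D c * r ^ 2 := by
    intro σ hσ
    rw [sidePow_arcPt hij D c hp hη (habs σ hσ), hA, chord, add_sub_cancel_left, mul_pow, hBdef]
    rcases hϑ with h | h <;> rw [h] <;> ring_nf
  have hpow' : ∀ σ ∈ Icc 0 r, sidePow D c (arcPt i j p r (-η) (p i + ϑ * σ)) =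
      2 * A * σ - 2 * B * Real.sqrt (r ^ 2 - σ ^ 2) + sideSign D c * r ^ 2 := by
    intro σ hσ
    rw [sidePow_arcPt hij D c hp hη' (habs σ hσ), hA, chord, add_sub_cancel_left, mul_pow, hBdef]
    rcases hϑ with h | h <;> rw [h] <;> ring_nf
  have hK : ∀ η', (η' = 1 ∨ η' = -1) → ∀ σ ∈ Icc 0 r, (arcPt i j p r η' (p i + ϑ * σ) ∈ closure D ↔
      0 ≤ sidePow D c (arcPt i j p r η' (p i + ϑ * σ))) := fun η' h' σ hσ =>
    hs.mem_closure_iff h hc (by rw [dist_arcPt hij hr.le h' (habs σ hσ)]; exact hrρ)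
  have hC : ∀ x, x ∈ c.carrier ↔ sidePow D c x = 0 := fun x => (sidePow_eq_zero_iff D c x).symm
  have h0r : (0 : ℝ) ∈ Icc 0 r := ⟨le_rfl, hr.le⟩
  have hpi : arcPt i j p r (-η) (p i) = arcPt i j p r (-η) (p i + ϑ * 0) := by
    rw [mul_zero, add_zero]
  by_cases hcase : A < 0 ∨ A = 0 ∧ sideSign D c = -1
  · obtain ⟨σ₁, hσ₁, hall⟩ := arc_end_crossing hB hr hrB hε hrA hcase
    have hno : ∀ σ ∈ Icc 0 r, arcPt i j p r (-η) (p i + ϑ * σ) ∉ closure D := fun σ hσ => by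
      rw [hK _ hη' σ hσ, hpow' σ hσ, not_le]
      exact (hall σ hσ).2.2
    refine ⟨σ₁, Ioo_subset_Ioc_self hσ₁, fun σ hσ => ⟨?_, ?_⟩, Or.inr ⟨?_, ?_⟩, ?_, fun _ => hno,
      fun hcase' => ?_⟩
    · rw [hK _ hη σ hσ, hpow σ hσ]
      exact (hall σ hσ).1
    · rw [hC, hpow σ hσ]
      exact (hall σ hσ).2.1.1
    · rw [hC, hpow σ₁ (Ioo_subset_Icc_self hσ₁)]
      exact (hall σ₁ (Ioo_subset_Icc_self hσ₁)).2.1.2 rfl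
    · exact hno σ₁ (Ioo_subset_Icc_self hσ₁)
    · rw [hpi]; exact hno 0 h0r
    · rcases hcase with h1 | ⟨h1, h2⟩ <;> rcases hcase' with h3 | ⟨h3, h4⟩ <;> linarith
  · have hcase' : 0 < A ∨ A = 0 ∧ sideSign D c = 1 := by
      push Not at hcase
      rcases eq_or_lt_of_le hcase.1 with h1 | h1
      · exact Or.inr ⟨h1.symm, hε.resolve_right (hcase.2 h1.symm)⟩
      · exact Or.inl h1
    obtain ⟨α, hα, hall⟩ := arc_end_pole hB hr hrB hε hrA hcase'
    refine ⟨r, ⟨hr, le_rfl⟩, fun σ hσ => ⟨?_, ?_⟩, Or.inl rfl, ?_, fun h => absurd h hcase,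
      fun _ => ⟨rfl, α, hα, fun σ hσ => ⟨?_, ?_⟩⟩⟩
    · rw [hK _ hη σ hσ, hpow σ hσ]
      exact ⟨fun _ => hσ.2, fun _ => (hall σ hσ).1.le⟩
    · rw [hC, hpow σ hσ]
      exact fun h0 => absurd h0 (hall σ hσ).1.ne'
    · rw [hpi, hK _ hη' 0 h0r, hpow' 0 h0r, (hall 0 h0r).2.1, not_le]
      exact hα.1
    · rw [hK _ hη' σ hσ, hpow' σ hσ]
      exact (hall σ hσ).2.1
    · rw [hC, hpow' σ hσ]
      exact (hall σ hσ).2.2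

theorem exists_dent (h : IsMBC S D) (hij : i ≠ j) (hc : c ∈ S) (hp : p ∈ c.carrier)
    (hpD : p ∈ closure D) (hs : IsSmall S D c p ρ)
    (gap : ∀ z ∈ prVertices S D i, |prHeight D i z - p i| < ρ → prHeight D i z = p i)
    (hup : UpSlices D i (p i) (p j) ρ η) (hη : η = 1 ∨ η = -1)
    (hB : 0 < η * (sideSign D c * (p j - c.center j))) (hr : 0 < r) (hrρ : r < ρ) {A : ℝ}
    (hA : A = sideSign D c * (p i - c.center i)) :
    ∃ s₁ s₂, ∃ d : Dent S D i j c p ρ r η s₁ s₂,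
      (0 < A ∨ A = 0 ∧ sideSign D c = -1 → d.NoLeftWhisker) ∧
      (A < 0 ∨ A = 0 ∧ sideSign D c = 1 → ∃ s₃, d.LeftWhisker s₃) ∧
      (A < 0 ∨ A = 0 ∧ sideSign D c = -1 → d.NoRightWhisker) ∧
      (0 < A ∨ A = 0 ∧ sideSign D c = 1 → ∃ s₄, d.RightWhisker s₄) := by
  obtain ⟨σL, hL1, hL2, hL3, hL4, hL5, hL6⟩ := exists_arc_end h hij hc hp hs hη hB hr hrρ
    (Or.inr rfl) (show -A = -1 * _ by rw [hA]; ring)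
  obtain ⟨σR, hR1, hR2, hR3, hR4, hR5, hR6⟩ := exists_arc_end h hij hc hp hs hη hB hr hrρ
    (Or.inl rfl) (show A = 1 * _ by rw [hA]; ring)
  have eL : ∀ σ, p i + -1 * σ = p i - σ := fun σ => by ring
  have eR : ∀ σ, p i + 1 * σ = p i + σ := fun σ => by ring
  simp only [eL] at hL2 hL3 hL5 hL6
  simp only [eR] at hR2 hR3 hR5 hR6
  -- a height near `p i` is on one of the two sides
  have hside : ∀ s, |s - p i| ≤ r → (∃ σ ∈ Icc 0 r, s = p i - σ) ∨ ∃ σ ∈ Icc 0 r, s = p i + σ := by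
    intro s hs
    obtain ⟨h1, h2⟩ := abs_le.1 hs
    rcases le_total s (p i) with h3 | h3
    · exact Or.inl ⟨p i - s, ⟨by linarith, by linarith⟩, by ring⟩
    · exact Or.inr ⟨s - p i, ⟨by linarith, by linarith⟩, by ring⟩
  have d : Dent S D i j c p ρ r η (p i - σL) (p i + σR) :=
    { mbc := h
      ne := hij
      circle_mem := hc
      center_mem := hp
      center_closure := hpD
      not_pole := fun hpole => by
        rw [((PlaneCircle.isPole_iff hij c p).1 hpole).2, sub_self, mul_zero, mul_zero] at hB
        exact hB.false
      small := hs
      gap := gap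
      up := hup
      side := hη
      pos := hr
      lt := hrρ
      left := ⟨by linarith [hL1.2], by linarith [hL1.1]⟩
      right := ⟨by linarith [hR1.1], by linarith [hR1.2]⟩
      upper := fun s hs => by
        rcases hside s hs with ⟨σ, hσ, rfl⟩ | ⟨σ, hσ, rfl⟩
        · rw [(hL2 σ hσ).1]
          exact ⟨fun h1 => ⟨by linarith, by linarith [hσ.1, hR1.1]⟩, fun h1 => by linarith [h1.1]⟩
        · rw [(hR2 σ hσ).1]
          exact ⟨fun h1 => ⟨by linarith [hσ.1, hL1.1], by linarith⟩, fun h1 => by linarith [h1.2]⟩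
      upper_carrier := fun s hs hsc => by
        rcases hside s hs with ⟨σ, hσ, rfl⟩ | ⟨σ, hσ, rfl⟩
        · left; rw [(hL2 σ hσ).2 hsc]
        · right; rw [(hR2 σ hσ).2 hsc]
      left_end := hL3.imp (fun h => by rw [h]) id
      right_end := hR3.imp (fun h => by rw [h]) id
      lower_center := hL4 }
  refine ⟨_, _, d, fun hA' s hs => ?_, fun hA' => ?_, fun hA' s hs => ?_, fun hA' => ?_⟩
  · have := hL5 (hA'.imp (fun h => by linarith) fun h => ⟨by linarith [h.1], h.2⟩) (p i - s)
      ⟨by linarith [hs.2], by linarith [hs.1]⟩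
    rwa [sub_sub_cancel] at this
  · obtain ⟨hσ, α, hα, hall⟩ :=
      hL6 (hA'.imp (fun h => by linarith) fun h => ⟨by linarith [h.1], h.2⟩)
    refine ⟨p i - α, by rw [hσ], ⟨by linarith [hα.2], by linarith [hα.1]⟩, fun s hs => ?_,
      fun s hs => ?_⟩
    · have := (hall (p i - s) ⟨by linarith [hs.2], by linarith [hs.1]⟩).1
      rw [sub_sub_cancel] at this
      rw [this]
      constructor <;> intro <;> linarith
    · have := (hall (p i - s) ⟨by linarith [hs.2], by linarith [hs.1]⟩).2
      rw [sub_sub_cancel] at this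
      rw [this]
      constructor <;> intro <;> linarith
  · have := hR5 hA' (s - p i) ⟨by linarith [hs.1], by linarith [hs.2]⟩
    rwa [add_sub_cancel] at this
  · obtain ⟨hσ, α, hα, hall⟩ := hR6 hA'
    refine ⟨p i + α, by rw [hσ], ⟨by linarith [hα.1], by linarith [hα.2]⟩, fun s hs => ?_,
      fun s hs => ?_⟩
    · have := (hall (s - p i) ⟨by linarith [hs.1], by linarith [hs.2]⟩).1
      rw [add_sub_cancel] at this
      rw [this]
      constructor <;> intro <;> linarith
    · have := (hall (s - p i) ⟨by linarith [hs.1], by linarith [hs.2]⟩).2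
      rw [add_sub_cancel] at this
      rw [this]
      constructor <;> intro <;> linarith

end Ends

namespace Dent

variable {S : Set PlaneCircle} {D : Set Plane} {i j : Fin 2} {c : PlaneCircle} {p : Plane}
  {ρ r η s₁ s₂ : ℝ} [Nonempty (closure D)]

theorem prAt_center (d : Dent S D i j c p ρ r η s₁ s₂) :
    prAt D i p = prAt D i (arcPt i j p r η (p i)) :=
  (d.prAt_eq_upper d.center_closure (by rw [dist_self]; exact d.pos.le) (by
    rw [sub_self, mul_zero, chord_self d.pos.le]; exact d.pos)).2

theorem continuousOn_upper (d : Dent S D i j c p ρ r η s₁ s₂) :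
    ContinuousOn (fun s => prAt D i (arcPt i j p r η s)) (Icc s₁ s₂) :=
  continuousOn_prAt.comp continuous_arcPt.continuousOn fun _ hs => d.upper_mem hs

theorem prHeight_upper (d : Dent S D i j c p ρ r η s₁ s₂) {s : ℝ} (hs : s ∈ Icc s₁ s₂) :
    prHeight D i (prAt D i (arcPt i j p r η s)) = s := by
  rw [prHeight_prAt (d.upper_mem hs), arcPt_same]

theorem upper_notMem (d : Dent S D i j c p ρ r η s₁ s₂) {s : ℝ} (hs : s ∈ Icc s₁ s₂)
    (hne : s ≠ p i) : prAt D i (arcPt i j p r η s) ∈ (prVertices S D i)ᶜ := fun hv => hne (by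
  have := d.gap _ hv (by rw [d.prHeight_upper hs]; exact (d.abs_le hs).trans_lt d.lt)
  rwa [d.prHeight_upper hs] at this)

/-- If the image of `p` is not a vertex, then the upper arc runs in the interior of an edge. -/
theorem exists_edge (d : Dent S D i j c p ρ r η s₁ s₂) (W : PoincareReebGraph S D i)
    (hz : prAt D i p ∉ prVertices S D i) :
    ∃ R : W.toLabelledDigraph.Realization (prHeight D i) (prVertices S D i) (prVertices S D i)ᶜ,
      R.pt = W.pt ∧ ∃ e₀ : W.E, W.InEdge e₀ (prAt D i p) ∧ ∀ a₁ a₂,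
        R.IsMarking (W.subdivideTwice e₀ a₁ a₂) (some none) none (prAt D i (arcPt i j p r η s₁))
          (prAt D i (arcPt i j p r η s₂)) a₁ a₂ := by
  have := t2Space_prSpace (D := D) d.ne d.mbc.bounded
  obtain ⟨R, hR, hpath⟩ := W.exists_realization continuous_prHeight
  have hinj : ∀ z ∈ (prVertices S D i)ᶜ, ∃ N ∈ 𝓝 z, InjOn (prHeight D i) N :=
    fun z hz => (d.mbc.hasLocalSection d.ne hz).exists_injOn
  have hlt : s₁ < s₂ := d.left.2.trans d.right.1
  have hp : p i ∈ Icc s₁ s₂ := ⟨d.left.2.le, d.right.1.le⟩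
  obtain ⟨e, he⟩ := R.exists_edge_of_section disjoint_compl_right hinj (J := Icc s₁ s₂)
    ordConnected_Icc d.continuousOn_upper (fun s hs => d.prHeight_upper hs) (fun s hs => by
      by_cases hsp : s = p i
      · rw [hsp, ← d.prAt_center]; exact hz
      · exact d.upper_notMem hs hsp) ⟨s₁, d.mem_Icc_left⟩
  refine ⟨R, hR, e, ?_, fun a₁ a₂ => ?_⟩
  · obtain ⟨⟨f, u⟩, ⟨hu0, hu1, hfu⟩, -⟩ := W.path_cover _ hz
    have h1 := hpath f u
    have h2 : prHeight D i (prAt D i p) = p i := prHeight_prAt d.center_closure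
    have h3 : R.lo f < p i ∧ p i < R.hi f := by
      rw [← h2, ← hfu]
      unfold LabelledDigraph.Realization.lo LabelledDigraph.Realization.hi
      rw [hR, ← W.path_zero, ← W.path_one]
      exact ⟨W.path_strictMono f hu0, W.path_strictMono f hu1⟩
    have h4 : f = e := by
      refine R.edge_unique h3 (he _ hp).1 ?_
      rw [(he _ hp).2, ← d.prAt_center, ← h2, ← hfu]
      exact h1
    subst h4
    exact ⟨u, hu0, hu1, hfu⟩
  · have := R.isMarking_subdivideTwice disjoint_compl_right hlt (he _ d.mem_Icc_left).1
      (he _ d.mem_Icc_right).1 a₁ a₂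
    rwa [(he _ d.mem_Icc_left).2, (he _ d.mem_Icc_right).2] at this

/-- If the image of `p` is a vertex, then the upper arc runs in the union of an edge that enters
this vertex and an edge that departs from it. -/
theorem exists_edge_pair (d : Dent S D i j c p ρ r η s₁ s₂) (W : PoincareReebGraph S D i)
    (hz : prAt D i p ∈ prVertices S D i) :
    ∃ R : W.toLabelledDigraph.Realization (prHeight D i) (prVertices S D i) (prVertices S D i)ᶜ,
      R.pt = W.pt ∧ ∃ (v₀ : W.V) (e₁ e₂ : W.E), W.pt v₀ = prAt D i p ∧ W.tgt e₁ = v₀ ∧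
        W.src e₂ = v₀ ∧ ∀ a₁ a₂,
        R.IsMarking (W.subdividePair e₁ e₂ a₁ a₂) (some none) none (prAt D i (arcPt i j p r η s₁))
          (prAt D i (arcPt i j p r η s₂)) a₁ a₂ := by
  have := t2Space_prSpace (D := D) d.ne d.mbc.bounded
  obtain ⟨R, hR, -⟩ := W.exists_realization continuous_prHeight
  have hinj : ∀ z ∈ (prVertices S D i)ᶜ, ∃ N ∈ 𝓝 z, InjOn (prHeight D i) N :=
    fun z hz => (d.mbc.hasLocalSection d.ne hz).exists_injOn
  have hz' : prAt D i (arcPt i j p r η (p i)) ∉ (prVertices S D i)ᶜ := by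
    rw [← d.prAt_center]; exact not_not.2 hz
  have hl : Icc s₁ (p i) ⊆ Icc s₁ s₂ := Icc_subset_Icc_right d.right.1.le
  have hr : Icc (p i) s₂ ⊆ Icc s₁ s₂ := Icc_subset_Icc_left d.left.2.le
  obtain ⟨e₁, h1, h2, h3, h4⟩ := R.exists_edge_tgt disjoint_compl_right hinj d.left.2
    (d.continuousOn_upper.mono hl) (fun s hs => d.prHeight_upper (hl hs))
    (fun s hs => d.upper_notMem (hl (Ico_subset_Icc_self hs)) hs.2.ne) hz'
  obtain ⟨e₂, g1, g2, g3, g4⟩ := R.exists_edge_src disjoint_compl_right hinj d.right.1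
    (d.continuousOn_upper.mono hr) (fun s hs => d.prHeight_upper (hr hs))
    (fun s hs => d.upper_notMem (hr (Ioc_subset_Icc_self hs)) hs.1.ne') hz'
  have hne : e₂ ≠ e₁ := by
    rintro rfl
    have := R.lt e₂
    have e : R.lo e₂ < R.hi e₂ := this
    rw [h2, g2] at e
    exact e.false
  refine ⟨R, hR, W.tgt e₁, e₁, e₂, ?_, rfl, ?_, fun a₁ a₂ => ?_⟩
  · rw [d.prAt_center, ← h1, hR]
  · exact R.pt_injective (g1.trans h1.symm)
  · have := R.isMarking_subdividePair disjoint_compl_right hne (s₁ := s₁) (s₂ := s₂)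
      ⟨h3, h2 ▸ d.left.2⟩ ⟨g2 ▸ d.right.1, g3⟩ a₁ a₂
    rwa [h4 _ ⟨le_rfl, d.left.2.le⟩, g4 _ ⟨d.right.1.le, le_rfl⟩] at this

end Dent

/-! ### The changes at a point that is not a pole for the height -/

namespace IsMBC

variable {S : Set PlaneCircle} {D : Set Plane} {i j : Fin 2} {c : PlaneCircle} {p : Plane}
  {ρ r η : ℝ} [Nonempty (closure D)]

theorem change_generic (h : IsMBC S D) (hij : i ≠ j) (hc : c ∈ S) (hp : p ∈ c.carrier)
    (hpD : p ∈ closure D) (hs : IsSmall S D c p ρ)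
    (gap : ∀ z ∈ prVertices S D i, |prHeight D i z - p i| < ρ → prHeight D i z = p i)
    (hup : UpSlices D i (p i) (p j) ρ η) (hη : η = 1 ∨ η = -1)
    (hB : 0 < η * (sideSign D c * (p j - c.center j))) (hr : 0 < r) (hrρ : r < ρ)
    (hpole : ¬ c.IsPole j p) (W : PoincareReebGraph S D i)
    (W' : PoincareReebGraph (insert ⟨p, r, hr⟩ S) (cut D p r) i) :
    (prAt D i p ∉ prVertices S D i → W.ChangeGenericEdge (prAt D i p) ρ W'.toLabelledDigraph) ∧
    (prAt D i p ∈ prVertices S D i →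
      W.ChangeGenericVertex (prAt D i p) ρ W'.toLabelledDigraph) := by
  have := (h.isMBC_cut hij hc hp hpD hs hr hrρ).nonempty_closure
  have hh : prHeight D i (prAt D i p) = p i := prHeight_prAt hpD
  obtain ⟨s₁, s₂, d, hL, hLW, hR, hRW⟩ :=
    exists_dent h hij hc hp hpD hs gap hup hη hB hr hrρ rfl
  have hA : sideSign D c * (p i - c.center i) ≠ 0 := mul_ne_zero (sideSign_ne_zero D c) fun h0 =>
    hpole ((PlaneCircle.isPole_iff hij.symm c p).2 ⟨hp, by linarith⟩)
  set A := sideSign D c * (p i - c.center i)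
  constructor
  · intro hz
    obtain ⟨R, hRpt, e₀, he₀, hM⟩ := d.exists_edge W hz
    refine ⟨e₀, he₀, ?_⟩
    rw [hh]
    rcases lt_or_gt_of_ne hA with h1 | h1
    · left
      intro a₁ a a₂ b1 b2 b3 b4 b5
      obtain ⟨s₃, hw⟩ := hLW (Or.inl h1)
      exact d.isomorphic_of_leftWhisker W W' hRpt (hM a₁ a₂) hw (hR (Or.inl h1)) b1 b2 b3 b4 b5
    · right
      intro a₁ a a₂ b1 b2 b3 b4 b5
      obtain ⟨s₄, hw⟩ := hRW (Or.inl h1)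
      exact d.isomorphic_of_rightWhisker W W' hRpt (hM a₂ a₁) (hL (Or.inl h1)) hw b1 b2 b3 b4 b5
  · intro hz
    obtain ⟨R, hRpt, v₀, e₁, e₂, hv₀, he₁, he₂, hM⟩ := d.exists_edge_pair W hz
    refine ⟨v₀, e₁, e₂, hv₀, he₁, he₂, ?_⟩
    rw [hh]
    rcases lt_or_gt_of_ne hA with h1 | h1
    · left
      intro a₁ a a₂ b1 b2 b3 b4 b5
      obtain ⟨s₃, hw⟩ := hLW (Or.inl h1)
      exact d.isomorphic_of_leftWhisker W W' hRpt (hM a₁ a₂) hw (hR (Or.inl h1)) b1 b2 b3 b4 b5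
    · right
      intro a₁ a a₂ b1 b2 b3 b4 b5
      obtain ⟨s₄, hw⟩ := hRW (Or.inl h1)
      exact d.isomorphic_of_rightWhisker W W' hRpt (hM a₁ a₂) (hL (Or.inl h1)) hw b1 b2 b3 b4 b5

theorem change_other_pole (h : IsMBC S D) (hij : i ≠ j) (hc : c ∈ S) (hp : p ∈ c.carrier)
    (hpD : p ∈ closure D) (hs : IsSmall S D c p ρ)
    (gap : ∀ z ∈ prVertices S D i, |prHeight D i z - p i| < ρ → prHeight D i z = p i)
    (hup : UpSlices D i (p i) (p j) ρ η) (hη : η = 1 ∨ η = -1)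
    (hB : 0 < η * (sideSign D c * (p j - c.center j))) (hr : 0 < r) (hrρ : r < ρ)
    (hpole : c.IsPole j p) (W : PoincareReebGraph S D i)
    (W' : PoincareReebGraph (insert ⟨p, r, hr⟩ S) (cut D p r) i) :
    (prAt D i p ∉ prVertices S D i →
      W.ChangeOtherPoleEdge (prAt D i p) ρ W'.toLabelledDigraph ∨
      W.ChangeOtherPoleEdgeBranch (prAt D i p) ρ W'.toLabelledDigraph) ∧
    (prAt D i p ∈ prVertices S D i →
      W.ChangeOtherPoleVertex (prAt D i p) ρ W'.toLabelledDigraph ∨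
      W.ChangeOtherPoleVertexBranch (prAt D i p) ρ W'.toLabelledDigraph) := by
  have := (h.isMBC_cut hij hc hp hpD hs hr hrρ).nonempty_closure
  have hh : prHeight D i (prAt D i p) = p i := prHeight_prAt hpD
  have hA : sideSign D c * (p i - c.center i) = 0 := by
    rw [((PlaneCircle.isPole_iff hij.symm c p).1 hpole).2, sub_self, mul_zero]
  obtain ⟨s₁, s₂, d, hL, hLW, hR, hRW⟩ :=
    exists_dent h hij hc hp hpD hs gap hup hη hB hr hrρ hA.symm
  constructor
  · intro hz
    obtain ⟨R, hRpt, e₀, he₀, hM⟩ := d.exists_edge W hz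
    rcases sideSign_eq D c with h1 | h1
    · right
      obtain ⟨s₃, hw⟩ := hLW (Or.inr ⟨rfl, h1⟩)
      obtain ⟨s₄, hw'⟩ := hRW (Or.inr ⟨rfl, h1⟩)
      refine ⟨e₀, he₀, fun a₁ a₂ a₃ a₄ b1 b2 b3 b4 b5 b6 => ?_⟩
      rw [hh] at b1 b3 b4 b6
      exact d.isomorphic_of_twoWhiskers W W' hRpt (hM a₁ a₂) hw hw' b1 b2 b3 b4 b5 b6
    · left
      refine ⟨e₀, he₀, fun a₁ a₂ b1 b2 b3 b4 => ?_⟩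
      rw [hh] at b1 b2 b3 b4
      exact d.isomorphic_of_noWhisker W W' hRpt (hM a₁ a₂) (hL (Or.inr ⟨rfl, h1⟩))
        (hR (Or.inr ⟨rfl, h1⟩)) b1 b2 b3 b4
  · intro hz
    obtain ⟨R, hRpt, v₀, e₁, e₂, hv₀, he₁, he₂, hM⟩ := d.exists_edge_pair W hz
    rcases sideSign_eq D c with h1 | h1
    · right
      obtain ⟨s₃, hw⟩ := hLW (Or.inr ⟨rfl, h1⟩)
      obtain ⟨s₄, hw'⟩ := hRW (Or.inr ⟨rfl, h1⟩)
      refine ⟨v₀, e₁, e₂, hv₀, he₁, he₂, fun a₁ a₂ a₃ a₄ b1 b2 b3 b4 b5 b6 => ?_⟩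
      rw [hh] at b1 b3 b4 b6
      exact d.isomorphic_of_twoWhiskers W W' hRpt (hM a₁ a₂) hw hw' b1 b2 b3 b4 b5 b6
    · left
      refine ⟨v₀, e₁, e₂, hv₀, he₁, he₂, fun a₁ a₂ b1 b2 b3 b4 => ?_⟩
      rw [hh] at b1 b2 b3 b4
      exact d.isomorphic_of_noWhisker W W' hRpt (hM a₁ a₂) (hL (Or.inr ⟨rfl, h1⟩))
        (hR (Or.inr ⟨rfl, h1⟩)) b1 b2 b3 b4

end IsMBC

/-! ### Changing a drawing near a vertex -/

namespace LabelledDigraph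

/-- The digraph with all edges reversed. -/
def reverse (Γ : LabelledDigraph) : LabelledDigraph where
  V := Γ.V
  E := Γ.E
  src := Γ.tgt
  tgt := Γ.src
  label := Γ.label

namespace Realization

variable {Γ : LabelledDigraph} {X : Type} [TopologicalSpace X] {h h₁ : X → ℝ} {Vs O : Set X}

/-- A drawing for a height function is a drawing for a translated one. -/
def translate (R : Realization Γ h Vs O) (t : ℝ) (hh : ∀ z, h₁ z = h z - t) :
    Realization Γ h₁ Vs O where
  pt := R.pt
  pt_injective := R.pt_injective
  range_pt := R.range_pt
  sec e s := R.sec e (s + t)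
  lt e := by rw [hh, hh]; exact sub_lt_sub_right (R.lt e) t
  continuousOn e := by
    refine (R.continuousOn e).comp (by fun_prop) fun s hs => ?_
    rw [hh, hh] at hs
    exact ⟨by linarith [hs.1], by linarith [hs.2]⟩
  height e s hs := by
    rw [hh, hh] at hs
    rw [hh, R.height e _ ⟨by linarith [hs.1], by linarith [hs.2]⟩, add_sub_cancel_right]
  sec_src e := by rw [hh, sub_add_cancel, R.sec_src]
  sec_tgt e := by rw [hh, sub_add_cancel, R.sec_tgt]
  sec_mem e s hs := by
    rw [hh, hh] at hs
    exact R.sec_mem e _ ⟨by linarith [hs.1], by linarith [hs.2]⟩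
  cover z hz := by
    obtain ⟨e, ⟨h1, h2⟩, h3⟩ := R.cover z hz
    refine ⟨e, ⟨?_, ?_⟩, fun f ⟨hf1, hf2⟩ => h3 f ⟨?_, ?_⟩⟩
    · rw [hh, hh, hh]; exact ⟨sub_lt_sub_right h1.1 t, sub_lt_sub_right h1.2 t⟩
    · rw [hh, sub_add_cancel, h2]
    · rw [hh, hh, hh] at hf1
      exact ⟨by linarith [hf1.1], by linarith [hf1.2]⟩
    · rwa [hh, sub_add_cancel] at hf2

/-- A drawing of a digraph is a drawing of the reversed digraph for the reflected height. -/
def reflect (R : Realization Γ h Vs O) (t : ℝ) (hh : ∀ z, h₁ z = t - h z) :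
    Realization Γ.reverse h₁ Vs O where
  pt := R.pt
  pt_injective := R.pt_injective
  range_pt := R.range_pt
  sec e s := R.sec e (t - s)
  lt e := by rw [hh, hh]; exact sub_lt_sub_left (R.lt e) t
  continuousOn e := by
    refine (R.continuousOn e).comp (by fun_prop) fun s hs => ?_
    rw [hh, hh] at hs
    exact ⟨le_sub_comm.1 hs.2, sub_le_comm.1 hs.1⟩
  height e s hs := by
    rw [hh, hh] at hs
    rw [hh, R.height e _ ⟨le_sub_comm.1 hs.2, sub_le_comm.1 hs.1⟩, sub_sub_cancel]
  sec_src e := by rw [hh, sub_sub_cancel]; exact R.sec_tgt e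
  sec_tgt e := by rw [hh, sub_sub_cancel]; exact R.sec_src e
  sec_mem e s hs := by
    rw [hh, hh] at hs
    exact R.sec_mem e _ ⟨lt_sub_comm.1 hs.2, sub_lt_comm.1 hs.1⟩
  cover z hz := by
    obtain ⟨e, ⟨h1, h2⟩, h3⟩ := R.cover z hz
    refine ⟨e, ⟨?_, ?_⟩, fun f ⟨hf1, hf2⟩ => h3 f ⟨?_, ?_⟩⟩
    · rw [hh, hh, hh]; exact ⟨sub_lt_sub_left h1.2 t, sub_lt_sub_left h1.1 t⟩
    · rw [hh, sub_sub_cancel, h2]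
    · rw [hh, hh, hh] at hf1
      exact ⟨(sub_lt_sub_iff_left t).1 hf1.2, (sub_lt_sub_iff_left t).1 hf1.1⟩
    · rwa [hh, sub_sub_cancel] at hf2

/-- A vertex `v₀` with one departing edge `e₀` is moved up along this edge to the height `τ`, while
the drawing is transported by a map `ψ` which is defined only outside a neighbourhood of the part
that is given up. The entering edges are cut at the height `σ` below `v₀`, and continued by new
sections `γ`. -/
theorem exists_relocate {X' : Type} [TopologicalSpace X'] {h' : X' → ℝ}
    (R : Realization Γ h Vs Vsᶜ) {v₀ : Γ.V} {e₀ : Γ.E} {G : Set Γ.E} {σ τ : ℝ}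
    (hsrc : ∀ e, Γ.src e = v₀ ↔ e = e₀) (htgt : ∀ e, Γ.tgt e = v₀ ↔ e ∈ G)
    (hτ : τ ∈ Ioo (R.lo e₀) (R.hi e₀)) (hσ : ∀ g ∈ G, σ ∈ Ioo (R.lo g) (R.hi g))
    {Y : Set X} (hYv : ∀ v, R.pt v ∈ Y ↔ v ≠ v₀)
    (hYe : ∀ e, ∀ s ∈ Ioo (R.lo e) (R.hi e), (R.sec e s ∈ Y ↔ (e = e₀ → τ ≤ s) ∧ (e ∈ G → s ≤ σ)))
    {ψ : X → X'} (hψc : ContinuousOn ψ Y) (hψi : InjOn ψ Y) (hψh : ∀ y ∈ Y, h' (ψ y) = h y)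
    (γ : Γ.E → ℝ → X') (hγc : ∀ g ∈ G, ContinuousOn (γ g) (Icc σ τ))
    (hγh : ∀ g ∈ G, ∀ s ∈ Icc σ τ, h' (γ g s) = s) (hγσ : ∀ g ∈ G, γ g σ = ψ (R.sec g σ))
    (hγτ : ∀ g ∈ G, γ g τ = ψ (R.sec e₀ τ)) (hγY : ∀ g ∈ G, ∀ s ∈ Ioo σ τ, γ g s ∉ ψ '' Y)
    (hγd : ∀ g ∈ G, ∀ g' ∈ G, ∀ s ∈ Ioo σ τ, γ g s = γ g' s → g = g') :
    ∃ R' : Realization Γ h' (insert (ψ (R.sec e₀ τ)) (ψ '' (Vs \ {R.pt v₀})))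
      ((ψ '' Y \ insert (ψ (R.sec e₀ τ)) (ψ '' (Vs \ {R.pt v₀}))) ∪ ⋃ g ∈ G, γ g '' Ioo σ τ),
      R'.pt v₀ = ψ (R.sec e₀ τ) ∧ (∀ v, v ≠ v₀ → R'.pt v = ψ (R.pt v)) ∧
      ∀ g ∈ G, R'.sec g σ = ψ (R.sec g σ) := by
  classical
  have hlo : ∀ g ∈ G, R.hi g = R.lo e₀ := fun g hg => by
    unfold hi lo
    rw [(htgt g).2 hg, (hsrc e₀).2 rfl]
  have hst : ∀ g ∈ G, σ < τ := fun g hg => (hσ g hg).2.trans ((hlo g hg).trans_lt hτ.1)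
  have he₀ : e₀ ∉ G := fun h0 => by
    have h1 : R.lo e₀ < R.hi e₀ := R.lt e₀
    rw [hlo e₀ h0] at h1
    exact h1.false
  have hY : ∀ e s, s ∈ Icc (R.lo e) (R.hi e) → (e = e₀ → τ ≤ s) → (e ∈ G → s ≤ σ) →
      R.sec e s ∈ Y := by
    intro e s hs h1 h2
    rcases eq_or_lt_of_le hs.1 with h3 | h3
    · have h4 : R.sec e s = R.pt (Γ.src e) := by rw [← h3]; exact R.sec_src e
      rw [h4, hYv]
      intro h5
      have h6 := (hsrc e).1 h5
      have h7 := h1 h6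
      rw [h6] at h3
      linarith [hτ.1]
    rcases eq_or_lt_of_le hs.2 with h4 | h4
    · have h5 : R.sec e s = R.pt (Γ.tgt e) := by rw [h4]; exact R.sec_tgt e
      rw [h5, hYv]
      intro h6
      have h7 := (htgt e).1 h6
      linarith [h2 h7, (hσ e h7).2]
    · exact (hYe e s ⟨h3, h4⟩).2 ⟨h1, h2⟩
  have hY₀ : R.sec e₀ τ ∈ Y := hY _ _ (Ioo_subset_Icc_self hτ) (fun _ => le_rfl)
    fun h0 => absurd h0 he₀
  have hhτ : h' (ψ (R.sec e₀ τ)) = τ := by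
    rw [hψh _ hY₀]; exact R.height e₀ τ (Ioo_subset_Icc_self hτ)
  let pt' : Γ.V → X' := fun v => if v = v₀ then ψ (R.sec e₀ τ) else ψ (R.pt v)
  have hpt₀ : pt' v₀ = ψ (R.sec e₀ τ) := if_pos rfl
  have hpt : ∀ v, v ≠ v₀ → pt' v = ψ (R.pt v) := fun v hv => if_neg hv
  have hpth : ∀ v, v ≠ v₀ → h' (pt' v) = h (R.pt v) := fun v hv => by
    rw [hpt v hv, hψh _ ((hYv v).2 hv)]
  let sec' : Γ.E → ℝ → X' := fun e s => if e ∈ G ∧ σ < s then γ e s else ψ (R.sec e s)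
  have hsec : ∀ e s, (e ∈ G → s ≤ σ) → sec' e s = ψ (R.sec e s) := fun e s hs =>
    if_neg fun h0 => (hs h0.1).not_gt h0.2
  have hsecγ : ∀ e ∈ G, ∀ s, σ < s → sec' e s = γ e s := fun e he s hs => if_pos ⟨he, hs⟩
  have hlo₀ : h' (pt' (Γ.src e₀)) = τ := by rw [(hsrc e₀).2 rfl, hpt₀, hhτ]
  have hlo' : ∀ e, e ≠ e₀ → h' (pt' (Γ.src e)) = R.lo e := fun e he =>
    hpth _ fun h0 => he ((hsrc e).1 h0)
  have hhi₀ : ∀ e ∈ G, h' (pt' (Γ.tgt e)) = τ := fun e he => by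
    rw [(htgt e).2 he, hpt₀, hhτ]
  have hhi' : ∀ e, e ∉ G → h' (pt' (Γ.tgt e)) = R.hi e := fun e he =>
    hpth _ fun h0 => he ((htgt e).1 h0)
  have hge : ∀ e, (e = e₀ ∧ h' (pt' (Γ.src e)) = τ) ∨ (e ≠ e₀ ∧ h' (pt' (Γ.src e)) = R.lo e) := by
    intro e
    by_cases he : e = e₀
    · left; exact ⟨he, he ▸ hlo₀⟩
    · right; exact ⟨he, hlo' e he⟩
  -- the part of an edge that is kept
  have hkeep : ∀ e s, s ∈ Icc (h' (pt' (Γ.src e))) (h' (pt' (Γ.tgt e))) → (e ∈ G → s ≤ σ) →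
      s ∈ Icc (R.lo e) (R.hi e) ∧ R.sec e s ∈ Y := by
    intro e s hs hsσ
    have h1 : R.lo e ≤ s ∧ (e = e₀ → τ ≤ s) := by
      rcases hge e with ⟨h1, h2⟩ | ⟨h1, h2⟩
      · rw [h2] at hs
        exact ⟨by rw [h1]; exact hτ.1.le.trans hs.1, fun _ => hs.1⟩
      · rw [h2] at hs
        exact ⟨hs.1, fun h0 => absurd h0 h1⟩
    have h2 : s ≤ R.hi e := by
      by_cases he : e ∈ G
      · exact (hsσ he).trans (hσ e he).2.le
      · rw [hhi' e he] at hs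
        exact hs.2
    exact ⟨⟨h1.1, h2⟩, hY e s ⟨h1.1, h2⟩ h1.2 hsσ⟩
  have hsech : ∀ e s, s ∈ Icc (h' (pt' (Γ.src e))) (h' (pt' (Γ.tgt e))) → h' (sec' e s) = s := by
    intro e s hs
    by_cases hG : e ∈ G ∧ σ < s
    · rw [hsecγ e hG.1 s hG.2]
      refine hγh e hG.1 s ⟨hG.2.le, ?_⟩
      rw [hhi₀ e hG.1] at hs
      exact hs.2
    · have hG' : e ∈ G → s ≤ σ := fun h0 => not_lt.1 fun h1 => hG ⟨h0, h1⟩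
      obtain ⟨h1, h2⟩ := hkeep e s hs hG'
      rw [hsec e s hG', hψh _ h2]
      exact R.height e s h1
  have hmark : ∀ v, ∀ y ∈ Y, pt' v = ψ y → (v = v₀ ∧ y = R.sec e₀ τ) ∨ (v ≠ v₀ ∧ y = R.pt v) := by
    intro v y hy hvy
    by_cases hv : v = v₀
    · rw [hv, hpt₀] at hvy
      exact Or.inl ⟨hv, (hψi hY₀ hy hvy).symm⟩
    · rw [hpt v hv] at hvy
      exact Or.inr ⟨hv, (hψi ((hYv v).2 hv) hy hvy).symm⟩
  have hrange : Set.range pt' = insert (ψ (R.sec e₀ τ)) (ψ '' (Vs \ {R.pt v₀})) := by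
    ext z
    constructor
    · rintro ⟨v, rfl⟩
      by_cases hv : v = v₀
      · rw [hv, hpt₀]; exact mem_insert _ _
      · rw [hpt v hv]
        exact Or.inr ⟨_, ⟨R.pt_mem v, fun h0 => hv (R.pt_injective h0)⟩, rfl⟩
    · rintro (rfl | ⟨x, ⟨hx, hx0⟩, rfl⟩)
      · exact ⟨v₀, hpt₀⟩
      · obtain ⟨v, rfl⟩ := R.exists_pt hx
        exact ⟨v, hpt v fun h0 => hx0 (by rw [h0]; rfl)⟩
  have hsrc_eq : ∀ e, sec' e (h' (pt' (Γ.src e))) = pt' (Γ.src e) := by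
    intro e
    rcases hge e with ⟨rfl, h2⟩ | ⟨h1, h2⟩
    · rw [h2, hsec _ _ fun h0 => absurd h0 he₀, (hsrc e).2 rfl, hpt₀]
    · rw [h2, hsec _ _ fun h0 => (hσ e h0).1.le, hpt _ fun h0 => h1 ((hsrc e).1 h0)]
      exact congrArg ψ (R.sec_src e)
  have htgt_eq : ∀ e, sec' e (h' (pt' (Γ.tgt e))) = pt' (Γ.tgt e) := by
    intro e
    by_cases he : e ∈ G
    · rw [hhi₀ e he, hsecγ e he _ (hst e he), hγτ e he, (htgt e).2 he, hpt₀]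
    · rw [hhi' e he, hsec _ _ fun h0 => absurd h0 he, hpt _ fun h0 => he ((htgt e).1 h0)]
      exact congrArg ψ (R.sec_tgt e)
  refine ⟨{ pt := pt'
            pt_injective := ?_
            range_pt := hrange
            sec := sec'
            lt := ?_
            continuousOn := ?_
            height := hsech
            sec_src := hsrc_eq
            sec_tgt := htgt_eq
            sec_mem := ?_
            cover := ?_ }, hpt₀, hpt, fun g _ => hsec g σ fun _ => le_rfl⟩
  · intro v w hvw
    by_cases hv : v = v₀
    · rcases hmark w _ hY₀ (by rw [← hvw, hv, hpt₀]) with ⟨h1, -⟩ | ⟨h1, h2⟩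
      · rw [hv, h1]
      · exact absurd (h2 ▸ R.pt_mem w) (R.sec_mem e₀ τ hτ)
    · rcases hmark w _ ((hYv v).2 hv) (by rw [← hvw, hpt v hv]) with ⟨-, h2⟩ | ⟨-, h2⟩
      · exact absurd (h2 ▸ R.pt_mem v) (R.sec_mem e₀ τ hτ)
      · exact R.pt_injective h2
  · intro e
    rcases hge e with ⟨rfl, h2⟩ | ⟨h1, h2⟩
    · rw [h2, hhi' e he₀]; exact hτ.2
    · rw [h2]
      by_cases he : e ∈ G
      · rw [hhi₀ e he]; exact (hσ e he).1.trans (hst e he)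
      · rw [hhi' e he]; exact R.lt e
  · intro e
    by_cases he : e ∈ G
    · have h1 : h' (pt' (Γ.src e)) = R.lo e := hlo' e fun h0 => he₀ (h0 ▸ he)
      rw [h1, hhi₀ e he, ← Icc_union_Icc_eq_Icc (hσ e he).1.le (hst e he).le]
      refine ContinuousOn.union_of_isClosed ?_ ?_ isClosed_Icc isClosed_Icc
      · refine ContinuousOn.congr (f := fun s => ψ (R.sec e s)) ?_ fun s hs => hsec e s fun _ => hs.2
        refine hψc.comp ((R.continuousOn e).mono fun s hs => ⟨hs.1, hs.2.trans (hσ e he).2.le⟩)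
          fun s hs => (hkeep e s ?_ fun _ => hs.2).2
        rw [h1, hhi₀ e he]
        exact ⟨hs.1, hs.2.trans (hst e he).le⟩
      · refine (hγc e he).congr fun s hs => ?_
        rcases eq_or_lt_of_le hs.1 with rfl | h2
        · rw [hsec e _ fun _ => le_rfl, hγσ e he]
        · exact hsecγ e he s h2
    · refine ContinuousOn.congr (f := fun s => ψ (R.sec e s)) ?_
        fun s hs => hsec e s fun h0 => absurd h0 he
      exact hψc.comp ((R.continuousOn e).mono fun s hs =>
        (hkeep e s hs fun h0 => absurd h0 he).1) fun s hs =>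
          (hkeep e s hs fun h0 => absurd h0 he).2
  · intro e s hs
    by_cases hG : e ∈ G ∧ σ < s
    · right
      rw [hsecγ e hG.1 s hG.2]
      refine mem_biUnion hG.1 ⟨s, ⟨hG.2, ?_⟩, rfl⟩
      rw [hhi₀ e hG.1] at hs
      exact hs.2
    · have hG' : e ∈ G → s ≤ σ := fun h0 => not_lt.1 fun h1 => hG ⟨h0, h1⟩
      obtain ⟨h1, h2⟩ := hkeep e s (Ioo_subset_Icc_self hs) hG'
      left
      rw [hsec e s hG']
      refine ⟨mem_image_of_mem _ h2, ?_⟩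
      rw [← hrange]
      rintro ⟨v, hv⟩
      have hv' : h' (pt' v) = s := by
        rw [← hsech e s (Ioo_subset_Icc_self hs), hsec e s hG', hv]
      rcases hmark v _ h2 hv with ⟨h3, h4⟩ | ⟨h3, h4⟩
      · have h5 : s = τ := by rw [← hv', h3, hpt₀, hhτ]
        have hse : s < R.hi e := by
          by_cases he : e ∈ G
          · exact (hG' he).trans_lt (hσ e he).2
          · have := hs.2
            rwa [hhi' e he] at this
        have hel : R.lo e < s := by
          rcases hge e with ⟨h6, h7⟩ | ⟨h6, h7⟩
          · rw [h6, h5]; exact hτ.1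
          · have := hs.1
            rwa [h7] at this
        have h6 : e = e₀ := R.edge_unique ⟨hel, hse⟩ (h5 ▸ hτ) (by rw [h4, h5])
        have h7 := hs.1
        rw [h6, hlo₀, h5] at h7
        exact h7.false
      · have h5 : R.lo e < s := by
          rcases hge e with ⟨h6, h7⟩ | ⟨h6, h7⟩
          · have := hs.1
            rw [h7] at this
            rw [h6]
            exact hτ.1.trans this
          · have := hs.1
            rwa [h7] at this
        have h6 : s < R.hi e := by
          by_cases he : e ∈ G
          · exact (hG' he).trans_lt (hσ e he).2
          · have := hs.2
            rwa [hhi' e he] at this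
        exact R.sec_mem e s ⟨h5, h6⟩ (h4 ▸ R.pt_mem v)
  · rintro z (⟨⟨y, hy, rfl⟩, hz⟩ | hz)
    · rw [← hrange] at hz
      have hyV : y ∉ Vs := fun h0 => by
        obtain ⟨v, rfl⟩ := R.exists_pt h0
        exact hz ⟨v, hpt v ((hYv v).1 hy)⟩
      obtain ⟨e, ⟨h1, h2⟩, h3⟩ := R.cover y hyV
      have h1' : h y ∈ Ioo (R.lo e) (R.hi e) := h1
      have h4 := (hYe e _ h1').1 (by rw [h2]; exact hy)
      have h5 : sec' e (h' (ψ y)) = ψ y := by rw [hψh y hy, hsec e _ h4.2, h2]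
      refine ⟨e, ⟨?_, h5⟩, fun f ⟨hf1, hf2⟩ => h3 f ?_⟩
      · rw [hψh y hy]
        constructor
        · rcases hge e with ⟨h6, h7⟩ | ⟨h6, h7⟩
          · rw [h7]
            refine lt_of_le_of_ne (h4.1 h6) fun h8 => hz ⟨v₀, ?_⟩
            rw [hpt₀, ← h6, h8, h2]
          · rw [h7]; exact h1'.1
        · by_cases he : e ∈ G
          · rw [hhi₀ e he]; exact (h4.2 he).trans_lt (hst e he)
          · rw [hhi' e he]; exact h1'.2
      · rw [hψh y hy] at hf1 hf2
        have hG' : f ∈ G → h y ≤ σ := fun h0 => not_lt.1 fun h6 => by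
          rw [hsecγ f h0 _ h6] at hf2
          refine hγY f h0 (h y) ⟨h6, ?_⟩ (hf2 ▸ mem_image_of_mem ψ hy)
          rw [hhi₀ f h0] at hf1
          exact hf1.2
        obtain ⟨h6, h7⟩ := hkeep f _ (Ioo_subset_Icc_self hf1) hG'
        rw [hsec f _ hG'] at hf2
        have h8 := hψi h7 hy hf2
        refine ⟨⟨lt_of_le_of_ne h6.1 fun h9 => ?_, lt_of_le_of_ne h6.2 fun h9 => ?_⟩, h8⟩
        · rw [← h9] at h8
          exact hyV (h8 ▸ (R.sec_src f).symm ▸ R.pt_mem _)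
        · rw [h9] at h8
          exact hyV (h8 ▸ (R.sec_tgt f).symm ▸ R.pt_mem _)
    · obtain ⟨g, hg, s, hs, rfl⟩ := mem_iUnion₂.1 hz
      have hhs := hγh g hg s (Ioo_subset_Icc_self hs)
      refine ⟨g, ⟨?_, ?_⟩, fun f ⟨hf1, hf2⟩ => ?_⟩
      · rw [hhs, hhi₀ g hg, hlo' g fun h0 => he₀ (h0 ▸ hg)]
        exact ⟨(hσ g hg).1.trans hs.1, hs.2⟩
      · rw [hhs, hsecγ g hg s hs.1]
      · rw [hhs] at hf1 hf2
        by_cases hG : f ∈ G ∧ σ < s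
        · rw [hsecγ f hG.1 s hG.2] at hf2
          exact hγd f hG.1 g hg s hs hf2
        · have hG' : f ∈ G → s ≤ σ := fun h0 => not_lt.1 fun h1 => hG ⟨h0, h1⟩
          obtain ⟨h6, h7⟩ := hkeep f s (Ioo_subset_Icc_self hf1) hG'
          rw [hsec f s hG'] at hf2
          exact absurd ⟨_, h7, hf2⟩ (hγY g hg s hs)

end Realization

end LabelledDigraph

/-! ### Removing a disc centred at a pole for the height -/

/-- The point at distance `σ` from the height of `p` in the direction `ϑ`, and at distance `y` in the
direction of the other axis. -/
noncomputable def offsetPt (i j : Fin 2) (p : Plane) (ϑ σ y : ℝ) : Plane :=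
  pnt i (p i + ϑ * σ) (p j + y)

section Offset

variable {D : Set Plane} {i j : Fin 2} {p : Plane} {ϑ σ y y' r η : ℝ}

@[simp] theorem offsetPt_same : offsetPt i j p ϑ σ y i = p i + ϑ * σ := pnt_same _ _ _

theorem offsetPt_other (hij : i ≠ j) : offsetPt i j p ϑ σ y j = p j + y := pnt_other hij _ _

theorem offsetPt_zero_zero (hij : i ≠ j) : offsetPt i j p ϑ 0 0 = p := by
  rw [offsetPt, mul_zero, add_zero, add_zero, pnt_eta hij]

theorem continuous_offsetPt : Continuous fun s => offsetPt i j p ϑ s y := by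
  unfold offsetPt
  fun_prop

theorem dist_sq_offsetPt (hij : i ≠ j) (hϑ : ϑ = 1 ∨ ϑ = -1) :
    dist (offsetPt i j p ϑ σ y) p ^ 2 = σ ^ 2 + y ^ 2 := by
  rw [dist_sq hij, offsetPt_same, offsetPt_other hij]
  rcases hϑ with rfl | rfl <;> ring

theorem exists_offsetPt (hij : i ≠ j) (hϑ : ϑ = 1 ∨ ϑ = -1) (x : Plane) :
    ∃ σ y, x = offsetPt i j p ϑ σ y := by
  refine ⟨ϑ * (x i - p i), x j - p j, plane_ext hij ?_ ?_⟩
  · rw [offsetPt_same]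
    rcases hϑ with rfl | rfl <;> ring
  · rw [offsetPt_other hij, add_sub_cancel]

theorem prAt_offsetPt_eq_iff [Nonempty (closure D)] (hij : i ≠ j)
    (h1 : offsetPt i j p ϑ σ y ∈ closure D) (h2 : offsetPt i j p ϑ σ y' ∈ closure D) :
    prAt D i (offsetPt i j p ϑ σ y) = prAt D i (offsetPt i j p ϑ σ y') ↔
      ∀ u ∈ uIcc y y', offsetPt i j p ϑ σ u ∈ closure D := by
  unfold offsetPt at h1 h2 ⊢
  rw [prAt_pnt_eq_iff hij h1 h2]
  constructor
  · intro h u hu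
    refine h _ ?_
    rw [mem_uIcc] at hu ⊢
    exact hu.imp (fun h => ⟨by linarith [h.1], by linarith [h.2]⟩)
      fun h => ⟨by linarith [h.1], by linarith [h.2]⟩
  · intro h u hu
    rw [show u = p j + (u - p j) by ring]
    refine h _ ?_
    rw [mem_uIcc] at hu ⊢
    exact hu.imp (fun h => ⟨by linarith [h.1], by linarith [h.2]⟩)
      fun h => ⟨by linarith [h.1], by linarith [h.2]⟩

theorem prAt_offsetPt_eq [Nonempty (closure D)] (hij : i ≠ j)
    (h : ∀ u ∈ uIcc y y', offsetPt i j p ϑ σ u ∈ closure D) :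
    prAt D i (offsetPt i j p ϑ σ y) = prAt D i (offsetPt i j p ϑ σ y') :=
  (prAt_offsetPt_eq_iff hij (h _ left_mem_uIcc) (h _ right_mem_uIcc)).2 h

theorem arcPt_eq_offsetPt (hϑ : ϑ = 1 ∨ ϑ = -1) :
    arcPt i j p r η (p i + ϑ * σ) = offsetPt i j p ϑ σ (η * Real.sqrt (r ^ 2 - σ ^ 2)) := by
  rw [arcPt, offsetPt, chord, add_sub_cancel_left, mul_pow]
  rcases hϑ with rfl | rfl <;> norm_num

end Offset

/-- The signed distance, in the direction of `D`, between the height of a pole of `c` and the height of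
the two points of `c` at distance `r` from that pole. -/
noncomputable def tipDist (D : Set Plane) (c : PlaneCircle) (r : ℝ) : ℝ :=
  -(sideSign D c * r ^ 2 / (2 * c.radius))

/-- The situation near a pole `p` of the circle `c` for the coordinate `i` which is alone in its
fibre. Here `ϑ` is the direction in which `D` leaves `p`. -/
structure PoleCut (S : Set PlaneCircle) (D : Set Plane) (i j : Fin 2) (c : PlaneCircle) (p : Plane)
    (ρ r ϑ : ℝ) : Prop where
  mbc : IsMBC S D
  ne : i ≠ j
  circle_mem : c ∈ S
  center_mem : p ∈ c.carrier
  center_closure : p ∈ closure D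
  pole : c.IsPole i p
  small : IsSmall S D c p ρ
  gap : ∀ z ∈ prVertices S D i, |prHeight D i z - p i| < ρ → prHeight D i z = p i
  alone : ∀ x ∈ closure D, x i = p i → VertConn (closure D) i (p i) (p j) (x j) → x ≠ p →
    IsOrdinary S i x
  side : ϑ = 1 ∨ ϑ = -1
  normal : sideSign D c * (p i - c.center i) = ϑ * c.radius
  pos : 0 < r
  lt : r < ρ

namespace PoleCut

variable {S : Set PlaneCircle} {D : Set Plane} {i j : Fin 2} {c : PlaneCircle} {p : Plane}
  {ρ r ϑ σ y η : ℝ}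

theorem lt_radius (d : PoleCut S D i j c p ρ r ϑ) : r < c.radius :=
  d.lt.trans (d.small.radius_le c d.circle_mem)

theorem sidePow_offsetPt (d : PoleCut S D i j c p ρ r ϑ) (σ y : ℝ) :
    sidePow D c (offsetPt i j p ϑ σ y) = 2 * c.radius * σ + sideSign D c * (σ ^ 2 + y ^ 2) := by
  have h1 := ((PlaneCircle.isPole_iff d.ne c p).1 d.pole).2
  have h2 := (c.pow_eq_zero_iff p).2 d.center_mem
  have h3 := d.normal
  rw [c.pow_coord d.ne, h1] at h2
  rw [sidePow, c.pow_coord d.ne, offsetPt_same, offsetPt_other d.ne, h1]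
  rcases d.side with h | h <;> rw [h] at h3 ⊢
  · linear_combination sideSign D c * h2 + 2 * σ * h3
  · linear_combination sideSign D c * h2 - 2 * σ * h3

theorem dist_lt (d : PoleCut S D i j c p ρ r ϑ) {a : ℝ} (ha : 0 < a) :
    dist (offsetPt i j p ϑ σ y) p < a ↔ σ ^ 2 + y ^ 2 < a ^ 2 := by
  rw [← dist_sq_offsetPt d.ne d.side (p := p)]
  exact (pow_lt_pow_iff_left₀ dist_nonneg ha.le two_ne_zero).symm

theorem mem_ball_iff (d : PoleCut S D i j c p ρ r ϑ) :
    offsetPt i j p ϑ σ y ∈ Metric.ball p r ↔ σ ^ 2 + y ^ 2 < r ^ 2 := by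
  rw [Metric.mem_ball, d.dist_lt d.pos]

theorem mem_closure_iff (d : PoleCut S D i j c p ρ r ϑ) (h : σ ^ 2 + y ^ 2 ≤ r ^ 2) :
    offsetPt i j p ϑ σ y ∈ closure D ↔ 0 ≤ 2 * c.radius * σ + sideSign D c * (σ ^ 2 + y ^ 2) := by
  rw [d.small.mem_closure_iff d.mbc d.circle_mem, d.sidePow_offsetPt]
  rw [d.dist_lt d.small.pos]
  exact h.trans_lt (pow_lt_pow_left₀ d.lt d.pos.le two_ne_zero)

theorem two_mul_tip (_ : PoleCut S D i j c p ρ r ϑ) :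
    2 * c.radius * tipDist D c r = -(sideSign D c * r ^ 2) := by
  have := c.radius_pos
  unfold tipDist
  field_simp

theorem tip_abs (d : PoleCut S D i j c p ρ r ϑ) : |tipDist D c r| < r := by
  have h1 := d.two_mul_tip
  have h2 := d.pos
  have h3 := d.lt_radius
  rw [abs_lt]
  rcases sideSign_eq D c with h | h <;> rw [h] at h1 <;> constructor <;> nlinarith

theorem tip_neg (d : PoleCut S D i j c p ρ r ϑ) (h : sideSign D c = 1) : tipDist D c r < 0 := by
  have h1 := d.two_mul_tip
  have h2 := d.pos
  have h3 := d.lt_radius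
  rw [h] at h1
  by_contra! h4
  nlinarith

theorem tip_pos (d : PoleCut S D i j c p ρ r ϑ) (h : sideSign D c = -1) : 0 < tipDist D c r := by
  have h1 := d.two_mul_tip
  have h2 := d.pos
  have h3 := d.lt_radius
  rw [h] at h1
  by_contra! h4
  nlinarith

theorem mid_mem (d : PoleCut S D i j c p ρ r ϑ) (hσ : σ ∈ Icc 0 r) :
    offsetPt i j p ϑ σ 0 ∈ closure D := by
  have h1 := d.lt_radius
  rw [d.mem_closure_iff (by nlinarith [hσ.1, hσ.2])]
  rcases sideSign_eq D c with h | h <;> rw [h] <;> nlinarith [hσ.1, hσ.2]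

theorem side_of_neg (d : PoleCut S D i j c p ρ r ϑ) (h : σ ^ 2 + y ^ 2 ≤ r ^ 2)
    (hx : offsetPt i j p ϑ σ y ∈ closure D) (hσ : σ < 0) : sideSign D c = 1 := by
  refine (sideSign_eq D c).resolve_right fun h1 => ?_
  rw [d.mem_closure_iff h, h1] at hx
  nlinarith [c.radius_pos, sq_nonneg σ, sq_nonneg y]

theorem sq_add_sq_arc {r σ η : ℝ} (hη : η = 1 ∨ η = -1) (hσ : |σ| ≤ r) :
    σ ^ 2 + (η * Real.sqrt (r ^ 2 - σ ^ 2)) ^ 2 = r ^ 2 := by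
  rw [mul_pow, Real.sq_sqrt (by nlinarith [abs_nonneg σ, sq_abs σ])]
  rcases hη with rfl | rfl <;> ring

theorem arc_mem_iff (d : PoleCut S D i j c p ρ r ϑ) (hη : η = 1 ∨ η = -1) (hσ : |σ| ≤ r) :
    arcPt i j p r η (p i + ϑ * σ) ∈ closure D ↔ tipDist D c r ≤ σ := by
  have h1 := sq_add_sq_arc hη hσ
  have h2 := d.two_mul_tip
  have h3 := c.radius_pos
  rw [arcPt_eq_offsetPt d.side, d.mem_closure_iff h1.le, h1]
  constructor <;> intro <;> nlinarith

theorem arc_mem_carrier_iff (d : PoleCut S D i j c p ρ r ϑ) (hη : η = 1 ∨ η = -1) (hσ : |σ| ≤ r) :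
    arcPt i j p r η (p i + ϑ * σ) ∈ c.carrier ↔ σ = tipDist D c r := by
  have h1 := sq_add_sq_arc hη hσ
  have h2 := d.two_mul_tip
  have h3 := c.radius_pos
  rw [← sidePow_eq_zero_iff D, arcPt_eq_offsetPt d.side, d.sidePow_offsetPt, h1]
  constructor
  · intro h4
    have h5 : 2 * c.radius * (σ - tipDist D c r) = 0 := by linear_combination h4 - h2
    rcases mul_eq_zero.1 h5 with h6 | h6 <;> linarith
  · rintro rfl
    linear_combination h2

theorem abs_le_of_mem (d : PoleCut S D i j c p ρ r ϑ) (hσ : σ ∈ Icc (tipDist D c r) r) : |σ| ≤ r := by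
  have h1 := (abs_lt.1 d.tip_abs).1
  exact abs_le.2 ⟨by linarith [hσ.1], hσ.2⟩

theorem abs_dir (d : PoleCut S D i j c p ρ r ϑ) (σ : ℝ) : |p i + ϑ * σ - p i| = |σ| := by
  rw [add_sub_cancel_left, abs_mul]
  rcases d.side with h | h <;> rw [h] <;> simp

theorem arc_mem (d : PoleCut S D i j c p ρ r ϑ) (hη : η = 1 ∨ η = -1)
    (hσ : σ ∈ Icc (tipDist D c r) r) : arcPt i j p r η (p i + ϑ * σ) ∈ closure D :=
  (d.arc_mem_iff hη (d.abs_le_of_mem hσ)).2 hσ.1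

section Quotient

variable [Nonempty (closure D)]

/-- In the direction of `D`, the points near `p` are joined to the line through `p`. -/
theorem prAt_eq_mid (d : PoleCut S D i j c p ρ r ϑ) (h : σ ^ 2 + y ^ 2 ≤ r ^ 2) (hσ : 0 ≤ σ)
    (hx : offsetPt i j p ϑ σ y ∈ closure D) :
    prAt D i (offsetPt i j p ϑ σ y) = prAt D i (offsetPt i j p ϑ σ 0) := by
  refine prAt_offsetPt_eq d.ne fun u hu => ?_
  have hu2 : u ^ 2 ≤ y ^ 2 := by
    rcases mem_uIcc.1 hu with h1 | h1 <;> nlinarith [h1.1, h1.2]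
  rw [d.mem_closure_iff h] at hx
  rw [d.mem_closure_iff (by linarith)]
  rcases sideSign_eq D c with h1 | h1 <;> rw [h1] at hx ⊢ <;> nlinarith [c.radius_pos, sq_nonneg u]

/-- If `D` is outside `c`, then the points near `p` are joined to one of the arcs. -/
theorem prAt_eq_arc (d : PoleCut S D i j c p ρ r ϑ) (hε : sideSign D c = 1)
    (h : σ ^ 2 + y ^ 2 ≤ r ^ 2) (hη : η = 1 ∨ η = -1) (hy : 0 ≤ η * y)
    (hx : offsetPt i j p ϑ σ y ∈ closure D) :
    prAt D i (offsetPt i j p ϑ σ y) = prAt D i (arcPt i j p r η (p i + ϑ * σ)) := by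
  have hσ : |σ| ≤ r := abs_le_of_sq_le_sq (by nlinarith [sq_nonneg y]) d.pos.le
  have h1 := sq_add_sq_arc hη hσ
  have h0 := Real.sqrt_nonneg (r ^ 2 - σ ^ 2)
  rw [arcPt_eq_offsetPt d.side]
  refine prAt_offsetPt_eq d.ne fun u hu => ?_
  have h2 : η * y ≤ Real.sqrt (r ^ 2 - σ ^ 2) := Real.le_sqrt_of_sq_le (by
    rw [mul_pow]
    rcases hη with h | h <;> rw [h] <;> linarith)
  have hu2 : y ^ 2 ≤ u ^ 2 ∧ u ^ 2 ≤ (η * Real.sqrt (r ^ 2 - σ ^ 2)) ^ 2 := by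
    rcases hη with rfl | rfl
    · rw [uIcc_of_le (by linarith)] at hu
      constructor <;> nlinarith [hu.1, hu.2]
    · rw [uIcc_of_ge (by linarith)] at hu
      constructor <;> nlinarith [hu.1, hu.2]
  rw [d.mem_closure_iff h, hε] at hx
  rw [d.mem_closure_iff (by linarith), hε]
  linarith

/-- The part of the old quotient space whose fibres do not meet the removed disc. -/
def away (_ : PoleCut S D i j c p ρ r ϑ) : Set (PRSpace D i) :=
  {z | ∀ x ∈ closure D, prAt D i x = z → x ∉ Metric.ball p r}

theorem notMem_away (d : PoleCut S D i j c p ρ r ϑ) {x : Plane} (hx : x ∈ closure D)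
    (hb : x ∈ Metric.ball p r) : prAt D i x ∉ d.away := fun h => h x hx rfl hb

theorem mid_notMem_away (d : PoleCut S D i j c p ρ r ϑ) (hσ : σ ∈ Ico 0 r) :
    prAt D i (offsetPt i j p ϑ σ 0) ∉ d.away := by
  refine d.notMem_away (d.mid_mem (Ico_subset_Icc_self hσ)) ?_
  rw [d.mem_ball_iff]
  nlinarith [hσ.1, hσ.2]

/-- Over the heights of the disc, the arcs are joined to the middle line. -/
theorem prAt_arc_eq_mid (d : PoleCut S D i j c p ρ r ϑ) (hη : η = 1 ∨ η = -1)
    (hσ : σ ∈ Icc (tipDist D c r) r) (hσ0 : 0 ≤ σ) :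
    prAt D i (arcPt i j p r η (p i + ϑ * σ)) = prAt D i (offsetPt i j p ϑ σ 0) := by
  have h1 := d.arc_mem hη hσ
  rw [arcPt_eq_offsetPt d.side] at h1 ⊢
  exact d.prAt_eq_mid (sq_add_sq_arc hη (d.abs_le_of_mem hσ)).le hσ0 h1

theorem arc_notMem_away (d : PoleCut S D i j c p ρ r ϑ) (hη : η = 1 ∨ η = -1)
    (hσ : σ ∈ Ioo (tipDist D c r) r) :
    prAt D i (arcPt i j p r η (p i + ϑ * σ)) ∉ d.away := by
  have hσ' := Ioo_subset_Icc_self hσ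
  rcases le_or_gt 0 σ with h0 | h0
  · rw [d.prAt_arc_eq_mid hη hσ' h0]
    exact d.mid_notMem_away ⟨h0, hσ.2⟩
  · have h1 := d.arc_mem hη hσ'
    rw [arcPt_eq_offsetPt d.side] at h1
    have hε := d.side_of_neg (sq_add_sq_arc hη (d.abs_le_of_mem hσ')).le h1 h0
    have h2 := d.two_mul_tip
    have h3 : 0 ≤ -(2 * c.radius * σ) - σ ^ 2 := by
      nlinarith [d.lt_radius, (abs_lt.1 d.tip_abs).1, hσ.1]
    -- the point of `c` at this height lies in the disc
    have h4 := Real.sq_sqrt h3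
    have hηη : η ^ 2 = 1 := by rcases hη with rfl | rfl <;> norm_num
    have h5 : σ ^ 2 + (η * Real.sqrt (-(2 * c.radius * σ) - σ ^ 2)) ^ 2 < r ^ 2 := by
      rw [mul_pow, hηη, h4]
      rw [hε] at h2
      nlinarith [c.radius_pos, hσ.1]
    have h6 : offsetPt i j p ϑ σ (η * Real.sqrt (-(2 * c.radius * σ) - σ ^ 2)) ∈ closure D := by
      rw [d.mem_closure_iff h5.le, hε, mul_pow, hηη, h4]
      linarith
    rw [← d.prAt_eq_arc hε h5.le hη (by rw [← mul_assoc, ← sq, hηη]; positivity) h6]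
    exact d.notMem_away h6 (d.mem_ball_iff.2 h5)

theorem mid_end_mem_away (d : PoleCut S D i j c p ρ r ϑ) :
    prAt D i (offsetPt i j p ϑ r 0) ∈ d.away := by
  intro x hx hxz hb
  have h1 := ((prAt_eq_iff d.ne hx (d.mid_mem ⟨d.pos.le, le_rfl⟩)).1 hxz).1
  have h2 := abs_coord_sub_le i x p
  rw [h1, offsetPt_same, d.abs_dir, abs_of_pos d.pos] at h2
  exact (Metric.mem_ball.1 hb).not_ge h2

theorem tip_mem_away (d : PoleCut S D i j c p ρ r ϑ) (hη : η = 1 ∨ η = -1)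
    (hε : sideSign D c = 1) :
    prAt D i (arcPt i j p r η (p i + ϑ * tipDist D c r)) ∈ d.away := by
  intro x hx hxz hb
  have h1 := ((prAt_eq_iff d.ne hx (d.arc_mem hη ⟨le_rfl, (abs_lt.1 d.tip_abs).2.le⟩)).1 hxz).1
  obtain ⟨σ, y, rfl⟩ := exists_offsetPt (p := p) d.ne d.side x
  rw [offsetPt_same, arcPt_same] at h1
  have h2 : σ = tipDist D c r := by rcases d.side with h | h <;> rw [h] at h1 <;> linarith
  rw [d.mem_ball_iff] at hb
  rw [d.mem_closure_iff hb.le, hε, h2, d.two_mul_tip, hε] at hx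
  rw [h2] at hb
  linarith

/-- The part of the old quotient space which is affected by the removal of the disc: an arc in the
direction of `D`, and if `D` is outside `c`, two arcs in the opposite direction. -/
theorem notMem_away_iff (d : PoleCut S D i j c p ρ r ϑ) {z : PRSpace D i} :
    z ∉ d.away ↔ (∃ σ ∈ Ico 0 r, z = prAt D i (offsetPt i j p ϑ σ 0)) ∨
      sideSign D c = 1 ∧ ∃ η : ℝ, (η = 1 ∨ η = -1) ∧ ∃ σ ∈ Ioo (tipDist D c r) 0,
        z = prAt D i (arcPt i j p r η (p i + ϑ * σ)) := by
  constructor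
  · intro hz
    unfold away at hz
    simp only [Set.mem_ofPred_eq, not_forall, not_not] at hz
    obtain ⟨x, hx, rfl, hb⟩ := hz
    obtain ⟨σ, y, rfl⟩ := exists_offsetPt (p := p) d.ne d.side x
    rw [d.mem_ball_iff] at hb
    have hσ : |σ| < r := abs_lt_of_sq_lt_sq (by nlinarith [sq_nonneg y]) d.pos.le
    rcases le_or_gt 0 σ with h0 | h0
    · exact Or.inl ⟨σ, ⟨h0, (abs_lt.1 hσ).2⟩, d.prAt_eq_mid hb.le h0 hx⟩
    · right
      have hε := d.side_of_neg hb.le hx h0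
      have h1 := (d.mem_closure_iff hb.le).1 hx
      have h2 := d.two_mul_tip
      have h3 : tipDist D c r < σ := by
        rw [hε] at h1 h2
        nlinarith [c.radius_pos]
      rcases le_total 0 y with h4 | h4
      · exact ⟨hε, 1, Or.inl rfl, σ, ⟨h3, h0⟩, d.prAt_eq_arc hε hb.le (Or.inl rfl) (by linarith) hx⟩
      · exact ⟨hε, -1, Or.inr rfl, σ, ⟨h3, h0⟩,
          d.prAt_eq_arc hε hb.le (Or.inr rfl) (by linarith) hx⟩
  · rintro (⟨σ, hσ, rfl⟩ | ⟨-, η, hη, σ, hσ, rfl⟩)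
    · exact d.mid_notMem_away hσ
    · exact d.arc_notMem_away hη ⟨hσ.1, hσ.2.trans d.pos⟩

/-- All fibres near the fibre of `p` meet the disc: away from `p`, this fibre consists of points of
`D` and perhaps ordinary ends, and from there one can move towards `p`. -/
theorem eventually_notMem_away (d : PoleCut S D i j c p ρ r ϑ) :
    ∀ᶠ w in 𝓝 (prAt D i p), w ∉ d.away := by
  have hij := d.ne
  have h := d.mbc
  have hr := d.pos
  have key : ∀ᶠ w in 𝓝 (prAt D i p), ∀ y : closure D, prMk D i y = w →
      prAt D i (y : Plane) ∉ d.away := by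
    refine eventually_fibre hij h.bounded (P := fun y => prAt D i y ∉ d.away) fun x hxz => ?_
    by_cases hxb : (x : Plane) ∈ Metric.ball p r
    · filter_upwards [nhdsWithin_le_nhds (Metric.isOpen_ball.mem_nhds hxb), self_mem_nhdsWithin]
        with y hy hyK
      exact d.notMem_away hyK hy
    obtain ⟨hxi, hconn⟩ := (prAt_eq_iff hij x.2 d.center_closure).1 ((prAt_coe x).trans hxz)
    rw [hxi] at hconn
    have hdist : r ≤ |(x : Plane) j - p j| := by
      by_contra! hlt
      refine hxb (lt_of_pow_lt_pow_left₀ 2 hr.le ?_)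
      rw [dist_sq hij, hxi, sub_self, ← sq_abs ((x : Plane) j - p j)]
      nlinarith [abs_nonneg ((x : Plane) j - p j)]
    have hxeta : (x : Plane) = pnt i (p i) ((x : Plane) j) := by rw [← hxi, pnt_eta hij]
    -- it suffices to reach a level in the disc
    have reach : ∀ ym, |ym - p j| = r / 2 → (∀ᶠ y in 𝓝[closure D] (x : Plane),
        VertConn (closure D) i (y i) (y j) ym) →
        ∀ᶠ y in 𝓝[closure D] (x : Plane), prAt D i y ∉ d.away := by
      intro ym hym hev
      have h1 : ∀ᶠ y in 𝓝[closure D] (x : Plane), |y i - p i| < r / 2 := by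
        have hc : Continuous fun y : Plane => |y i - p i| := by fun_prop
        refine nhdsWithin_le_nhds (hc.continuousAt.eventually_mem (isOpen_Iio.mem_nhds ?_))
        rw [hxi, sub_self, abs_zero]
        exact half_pos hr
      filter_upwards [h1, hev] with y hy1 hy2
      have h2 := hy2.prAt_eq hij
      rw [pnt_eta hij] at h2
      rw [h2]
      refine d.notMem_away (hy2 _ right_mem_uIcc) (lt_of_pow_lt_pow_left₀ 2 hr.le ?_)
      rw [dist_sq hij, pnt_same, pnt_other hij, ← sq_abs (y i - p i), ← sq_abs (ym - p j), hym]
      nlinarith [abs_nonneg (y i - p i)]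
    have hxK : pnt i (p i) ((x : Plane) j) ∈ closure D := by rw [← hxeta]; exact x.2
    obtain ⟨a, b, ha, hb, hab, haD, hbD⟩ := h.exists_interval hij hxK
    have hK : ∀ y ∈ Icc a b, pnt i (p i) y ∈ closure D := fun y hy => (hab y).2 hy y right_mem_uIcc
    have hpab := (hab (p j)).1 hconn
    have hord : ∀ y ∈ Icc a b, y ≠ p j → IsOrdinary S i (pnt i (p i) y) := by
      intro y hy hyp
      refine d.alone _ (hK y hy) (pnt_same _ _ _) ?_ fun h0 => hyp ?_
      · rw [pnt_other hij]
        exact hconn.symm.trans ((hab y).2 hy)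
      · rw [← h0, pnt_other hij]
    have hint : ∀ y ∈ Ioo a b, y ≠ p j → pnt i (p i) y ∈ D := fun y hy hyp =>
      h.mem_of_interior hij hK hy (hord y (Ioo_subset_Icc_self hy) hyp)
    rw [hxeta] at reach ⊢
    rcases le_abs.1 hdist with h1 | h1
    · refine reach (p j + r / 2) (by rw [add_sub_cancel_left, abs_of_pos (half_pos hr)]) ?_
      rcases eq_or_lt_of_le hb with h2 | h2
      · obtain ⟨ρ₂, hρ₂, hup₂⟩ := h.upSlices_of_end hij (Or.inr rfl) hxK (h2 ▸ hbD)
          (fun ε hε hc => by linarith [((hab _).1 hc).2]) (hord _ ⟨ha, hb⟩ (by intro h0; linarith))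
        refine h.eventually_vertConn_of_upSlices hij (Or.inr rfl) hρ₂ hup₂ (by linarith)
          fun y hy hyb => ?_
        rw [uIcc_of_ge (by linarith)] at hy
        exact hint y ⟨by linarith [hpab.1, hy.1], by linarith [lt_of_le_of_ne hy.2 hyb]⟩
          (by intro h0; linarith [hy.1])
      · refine nhdsWithin_le_nhds (h.eventually_vertConn_of_mem hij fun y hy => ?_)
        rw [uIcc_of_ge (by linarith)] at hy
        exact hint y ⟨by linarith [hpab.1, hy.1], by linarith [hy.2]⟩ (by intro h0; linarith [hy.1])
    · refine reach (p j - r / 2)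
        (by rw [sub_sub_cancel_left, abs_neg, abs_of_pos (half_pos hr)]) ?_
      rcases eq_or_lt_of_le ha with h2 | h2
      · obtain ⟨ρ₂, hρ₂, hup₂⟩ := h.upSlices_of_end hij (Or.inl rfl) hxK (h2 ▸ haD)
          (fun ε hε hc => by linarith [((hab _).1 hc).1]) (hord _ ⟨ha, hb⟩ (by intro h0; linarith))
        refine h.eventually_vertConn_of_upSlices hij (Or.inl rfl) hρ₂ hup₂ (by linarith)
          fun y hy hyb => ?_
        rw [uIcc_of_le (by linarith)] at hy
        exact hint y ⟨by linarith [lt_of_le_of_ne hy.1 (Ne.symm hyb)], by linarith [hpab.2, hy.2]⟩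
          (by intro h0; linarith [hy.2])
      · refine nhdsWithin_le_nhds (h.eventually_vertConn_of_mem hij fun y hy => ?_)
        rw [uIcc_of_le (by linarith)] at hy
        exact hint y ⟨by linarith [hy.1], by linarith [hpab.2, hy.2]⟩ (by intro h0; linarith [hy.2])
  filter_upwards [key] with w hw
  obtain ⟨y, rfl⟩ := surjective_prMk w
  rw [← prAt_coe]
  exact hw y rfl

end Quotient

end PoleCut

/-! ### The edges at a pole -/

/-- The height in the direction `ϑ`, measured from the height of `p`. -/
def dirHeight (D : Set Plane) (i : Fin 2) (p : Plane) (ϑ : ℝ) (z : PRSpace D i) : ℝ :=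
  ϑ * (prHeight D i z - p i)

namespace PoleCut

open LabelledDigraph

variable {S : Set PlaneCircle} {D : Set Plane} {i j : Fin 2} {c : PlaneCircle} {p : Plane}
  {ρ r ϑ σ y η : ℝ}

theorem abs_dirHeight (d : PoleCut S D i j c p ρ r ϑ) (z : PRSpace D i) :
    |dirHeight D i p ϑ z| = |prHeight D i z - p i| := by
  rw [dirHeight, abs_mul]
  rcases d.side with h | h <;> rw [h] <;> simp

theorem dir_mul_dir (d : PoleCut S D i j c p ρ r ϑ) (σ : ℝ) : ϑ * (p i + ϑ * σ - p i) = σ := by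
  rcases d.side with h | h <;> rw [h] <;> ring

theorem dirHeight_eq_zero (d : PoleCut S D i j c p ρ r ϑ) {z : PRSpace D i}
    (hz : z ∈ prVertices S D i) (h : |dirHeight D i p ϑ z| < ρ) : dirHeight D i p ϑ z = 0 := by
  rw [d.abs_dirHeight] at h
  rw [dirHeight, d.gap z hz h, sub_self, mul_zero]

theorem injOn_dirHeight (d : PoleCut S D i j c p ρ r ϑ) :
    ∀ z ∈ (prVertices S D i)ᶜ, ∃ N ∈ 𝓝 z, InjOn (dirHeight D i p ϑ) N := by
  intro z hz
  obtain ⟨N, hN, hNi⟩ := (d.mbc.hasLocalSection d.ne hz).exists_injOn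
  refine ⟨N, hN, fun x hx y hy hxy => hNi hx hy ?_⟩
  unfold dirHeight at hxy
  rcases d.side with h | h <;> rw [h] at hxy <;> linarith

variable [Nonempty (closure D)]

theorem dirHeight_mid (d : PoleCut S D i j c p ρ r ϑ) (hσ : σ ∈ Icc 0 r) :
    dirHeight D i p ϑ (prAt D i (offsetPt i j p ϑ σ 0)) = σ := by
  rw [dirHeight, prHeight_prAt (d.mid_mem hσ), offsetPt_same, d.dir_mul_dir]

theorem dirHeight_arc (d : PoleCut S D i j c p ρ r ϑ) (hη : η = 1 ∨ η = -1)
    (hσ : σ ∈ Icc (tipDist D c r) r) :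
    dirHeight D i p ϑ (prAt D i (arcPt i j p r η (p i + ϑ * σ))) = σ := by
  rw [dirHeight, prHeight_prAt (d.arc_mem hη hσ), arcPt_same, d.dir_mul_dir]

theorem center_mem_prVertices (d : PoleCut S D i j c p ρ r ϑ) :
    prAt D i p ∈ prVertices S D i :=
  mem_prVertices_iff.2 ⟨p, d.center_closure, rfl, Or.inl ⟨c, d.circle_mem, d.pole⟩⟩

theorem arc_ne (d : PoleCut S D i j c p ρ r ϑ) (hσ : σ ∈ Ico (tipDist D c r) 0) :
    prAt D i (arcPt i j p r 1 (p i + ϑ * σ)) ≠ prAt D i (arcPt i j p r (-1) (p i + ϑ * σ)) := by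
  have hσ' : σ ∈ Icc (tipDist D c r) r := ⟨hσ.1, hσ.2.le.trans d.pos.le⟩
  have h1 := d.arc_mem (Or.inl rfl) hσ'
  have h2 := d.arc_mem (Or.inr rfl) hσ'
  have h3 := abs_le.1 (d.abs_le_of_mem hσ')
  rw [arcPt_eq_offsetPt d.side] at h1 h2 ⊢
  rw [arcPt_eq_offsetPt d.side]
  intro h
  have h0 := Real.sqrt_nonneg (r ^ 2 - σ ^ 2)
  have h4 := (prAt_offsetPt_eq_iff d.ne h1 h2).1 h 0 (mem_uIcc.2 (Or.inr ⟨by linarith, by linarith⟩))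
  have h5 : σ ^ 2 + 0 ^ 2 ≤ r ^ 2 := by nlinarith [h3.1, h3.2]
  have hε := d.side_of_neg h5 h4 hσ.2
  rw [d.mem_closure_iff h5, hε] at h4
  nlinarith [d.lt_radius, hσ.2, h3.1]

theorem continuousOn_mid (_ : PoleCut S D i j c p ρ r ϑ) {J : Set ℝ}
    (hJ : ∀ σ ∈ J, offsetPt i j p ϑ σ 0 ∈ closure D) :
    ContinuousOn (fun σ => prAt D i (offsetPt i j p ϑ σ 0)) J :=
  continuousOn_prAt.comp continuous_offsetPt.continuousOn hJ

theorem continuousOn_arc {D' : Set Plane} [Nonempty (closure D')] {J : Set ℝ}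
    (hJ : ∀ σ ∈ J, arcPt i j p r η (p i + ϑ * σ) ∈ closure D') :
    ContinuousOn (fun σ => prAt D' i (arcPt i j p r η (p i + ϑ * σ))) J :=
  continuousOn_prAt.comp
    (continuous_arcPt.comp (by fun_prop : Continuous fun σ => p i + ϑ * σ)).continuousOn hJ

/-- The edges at the image of `p`. One edge departs in the direction of `D`. If `D` is outside `c`,
there are two edges that come from the opposite direction, along the two arcs. Outside the parts
of these edges that lie over the disc, the drawing is not affected by its removal. -/
theorem exists_star (d : PoleCut S D i j c p ρ r ϑ) {Γ : LabelledDigraph}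
    (R : Γ.Realization (dirHeight D i p ϑ) (prVertices S D i) (prVertices S D i)ᶜ) :
    ∃ (v₀ : Γ.V) (e₀ : Γ.E), R.pt v₀ = prAt D i p ∧ (∀ e, Γ.src e = v₀ ↔ e = e₀) ∧
      r ∈ Ioo (R.lo e₀) (R.hi e₀) ∧ R.sec e₀ r = prAt D i (offsetPt i j p ϑ r 0) ∧
      (∀ g, Γ.tgt g = v₀ → tipDist D c r ∈ Ioo (R.lo g) (R.hi g) ∧ sideSign D c = 1 ∧
        ∃ η : ℝ, (η = 1 ∨ η = -1) ∧ ∀ σ ∈ Icc (tipDist D c r) 0,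
          R.sec g σ = prAt D i (arcPt i j p r η (p i + ϑ * σ))) ∧
      (sideSign D c = 1 → ∀ η : ℝ, (η = 1 ∨ η = -1) → ∃ g, Γ.tgt g = v₀ ∧
        ∀ g', (Γ.tgt g' = v₀ ∧ ∃ σ ∈ Ico (tipDist D c r) 0,
          R.sec g' σ = prAt D i (arcPt i j p r η (p i + ϑ * σ))) ↔ g' = g) ∧
      (∀ v, R.pt v ∈ d.away ↔ v ≠ v₀) ∧
      ∀ e, ∀ s ∈ Ioo (R.lo e) (R.hi e),
        (R.sec e s ∈ d.away ↔ (e = e₀ → r ≤ s) ∧ (e ∈ {g | Γ.tgt g = v₀} → s ≤ tipDist D c r)) := by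
  have := t2Space_prSpace (D := D) d.ne d.mbc.bounded
  have hr := d.pos
  have htip := abs_lt.1 d.tip_abs
  have hd : Disjoint (prVertices S D i) (prVertices S D i)ᶜ := disjoint_compl_right
  have h0r : (0 : ℝ) ∈ Icc 0 r := ⟨le_rfl, hr.le⟩
  have hmid0 : prAt D i (offsetPt i j p ϑ 0 0) = prAt D i p := by rw [offsetPt_zero_zero d.ne]
  have hz0 : prAt D i (offsetPt i j p ϑ 0 0) ∉ (prVertices S D i)ᶜ := by
    rw [hmid0]; exact not_not.2 d.center_mem_prVertices
  have hh0 : dirHeight D i p ϑ (prAt D i p) = 0 := by rw [← hmid0, d.dirHeight_mid h0r]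
  obtain ⟨e₀, he1, he2, he3, he4⟩ := R.exists_edge_src hd d.injOn_dirHeight hr
    (d.continuousOn_mid fun σ hσ => d.mid_mem hσ) (fun σ hσ => d.dirHeight_mid hσ)
    (fun σ hσ hv => hσ.1.ne' (by
      have h1 := d.dirHeight_mid (Ioc_subset_Icc_self hσ)
      rw [← h1]
      refine d.dirHeight_eq_zero hv ?_
      rw [h1, abs_of_pos hσ.1]
      exact hσ.2.trans_lt d.lt)) hz0
  rw [hmid0] at he1
  -- the arcs give edges that enter the vertex
  have hin : sideSign D c = 1 → ∀ η : ℝ, (η = 1 ∨ η = -1) → ∃ g, R.pt (Γ.tgt g) = prAt D i p ∧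
      R.hi g = 0 ∧ R.lo g < tipDist D c r ∧ ∀ σ ∈ Icc (tipDist D c r) 0,
        R.sec g σ = prAt D i (arcPt i j p r η (p i + ϑ * σ)) := by
    intro hε η hη
    have hsub : ∀ {σ}, σ ∈ Icc (tipDist D c r) 0 → σ ∈ Icc (tipDist D c r) r :=
      fun hσ => ⟨hσ.1, hσ.2.trans hr.le⟩
    have h1 : prAt D i (arcPt i j p r η (p i + ϑ * 0)) = prAt D i p := by
      rw [d.prAt_arc_eq_mid hη ⟨(d.tip_neg hε).le, hr.le⟩ le_rfl, hmid0]
    have h2 := R.exists_edge_tgt hd d.injOn_dirHeight (d.tip_neg hε)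
      (ζ := fun σ => prAt D i (arcPt i j p r η (p i + ϑ * σ)))
      (continuousOn_arc fun σ hσ => d.arc_mem hη (hsub hσ)) (fun σ hσ => d.dirHeight_arc hη (hsub hσ))
      (fun σ hσ hv => hσ.2.ne (by
        have h2 := d.dirHeight_arc hη (hsub (Ico_subset_Icc_self hσ))
        rw [← h2]
        refine d.dirHeight_eq_zero hv ?_
        rw [h2]
        exact (d.abs_le_of_mem (hsub (Ico_subset_Icc_self hσ))).trans_lt d.lt))
      (by simp only [h1]; exact not_not.2 d.center_mem_prVertices)
    simpa only [h1] using h2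
  set v₀ := Γ.src e₀ with hv₀
  have hsec_unique : ∀ e, ∀ s ∈ Ioo (R.lo e) (R.hi e), R.sec e s ∉ d.away →
      (e = e₀ ∧ s < r ∧ 0 < s) ∨ (s < 0 ∧ tipDist D c r < s ∧ sideSign D c = 1 ∧
        ∃ η : ℝ, (η = 1 ∨ η = -1) ∧ R.sec e s = prAt D i (arcPt i j p r η (p i + ϑ * s))) := by
    intro e s hs hn
    have hhs : dirHeight D i p ϑ (R.sec e s) = s := R.height e s (Ioo_subset_Icc_self hs)
    rcases d.notMem_away_iff.1 hn with ⟨σ, hσ, h1⟩ | ⟨hε, η, hη, σ, hσ, h1⟩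
    · have h2 : σ = s := by rw [← hhs, h1, d.dirHeight_mid (Ico_subset_Icc_self hσ)]
      rw [h2] at h1 hσ
      rcases eq_or_lt_of_le hσ.1 with h3 | h3
      · rw [← h3, hmid0] at h1
        exact absurd (h1 ▸ d.center_mem_prVertices) (h3 ▸ R.sec_mem e s hs)
      · left
        refine ⟨R.edge_unique hs ⟨he2 ▸ h3, hσ.2.trans he3⟩ ?_, hσ.2, h3⟩
        rw [h1, he4 s (Ico_subset_Icc_self hσ)]
    · have h2 : σ = s := by
        rw [← hhs, h1, d.dirHeight_arc hη ⟨hσ.1.le, hσ.2.le.trans hr.le⟩]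
      rw [h2] at h1 hσ
      exact Or.inr ⟨hσ.2, hσ.1, hε, η, hη, h1⟩
  have hev := d.eventually_notMem_away
  have hsrc : ∀ e, Γ.src e = v₀ ↔ e = e₀ := by
    refine fun e => ⟨fun h => ?_, fun h => by rw [h]⟩
    have h1 : R.lo e = 0 := by unfold Realization.lo; rw [h, he1, hh0]
    have h2 : R.lo e < R.hi e := R.lt e
    have h3 : R.sec e (R.lo e) = prAt D i p := by rw [← he1, ← h]; exact R.sec_src e
    have hc : ContinuousWithinAt (R.sec e) (Icc (R.lo e) (R.hi e)) (R.lo e) :=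
      R.continuousOn e _ (left_mem_Icc.2 h2.le)
    have h4 : ∀ᶠ s in 𝓝[>] R.lo e, R.sec e s ∉ d.away := by
      have h5 := hc.mono_left (nhdsWithin_mono _ (Ioo_subset_Icc_self))
      rw [nhdsWithin_Ioo_eq_nhdsGT h2, h3] at h5
      exact h5 hev
    obtain ⟨s, hs1, hs2⟩ := (h4.and (Ioo_mem_nhdsGT h2)).exists
    rcases hsec_unique e s hs2 hs1 with h5 | h5
    · exact h5.1
    · rw [h1] at hs2
      linarith [hs2.1, h5.1]
  have htgt : ∀ g, Γ.tgt g = v₀ → R.hi g = 0 ∧ tipDist D c r ∈ Ioo (R.lo g) (R.hi g) ∧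
      sideSign D c = 1 ∧ ∃ η : ℝ, (η = 1 ∨ η = -1) ∧ ∀ σ ∈ Icc (tipDist D c r) 0,
        R.sec g σ = prAt D i (arcPt i j p r η (p i + ϑ * σ)) := by
    intro e h
    have h1 : R.hi e = 0 := by unfold Realization.hi; rw [h, he1, hh0]
    have h2 : R.lo e < R.hi e := R.lt e
    have h3 : R.sec e (R.hi e) = prAt D i p := by rw [← he1, ← h]; exact R.sec_tgt e
    have hc : ContinuousWithinAt (R.sec e) (Icc (R.lo e) (R.hi e)) (R.hi e) :=
      R.continuousOn e _ (right_mem_Icc.2 h2.le)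
    have h4 : ∀ᶠ s in 𝓝[<] R.hi e, R.sec e s ∉ d.away := by
      have h5 := hc.mono_left (nhdsWithin_mono _ (Ioo_subset_Icc_self))
      rw [nhdsWithin_Ioo_eq_nhdsLT h2, h3] at h5
      exact h5 hev
    obtain ⟨s, hs1, hs2⟩ := (h4.and (Ioo_mem_nhdsLT h2)).exists
    rcases hsec_unique e s hs2 hs1 with ⟨-, -, h5⟩ | ⟨h5, h6, hε, η, hη, h7⟩
    · rw [h1] at hs2
      linarith [hs2.2]
    · obtain ⟨g, hg1, hg2, hg3, hg4⟩ := hin hε η hη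
      have h8 : e = g := by
        refine R.edge_unique hs2 ⟨hg3.trans h6, hg2 ▸ h5⟩ ?_
        rw [h7, hg4 s ⟨h6.le, h5.le⟩]
      subst h8
      exact ⟨h1, ⟨hg3, h1 ▸ d.tip_neg hε⟩, hε, η, hη, hg4⟩
  refine ⟨v₀, e₀, he1, hsrc, ⟨he2 ▸ hr, he3⟩, he4 r ⟨hr.le, le_rfl⟩, fun g hg => (htgt g hg).2,
    fun hε η hη => ?_, fun v => ⟨?_, fun hv => ?_⟩, fun e s hs => ⟨fun h => ⟨?_, ?_⟩, fun h => ?_⟩⟩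
  · obtain ⟨g, hg1, hg2, hg3, hg4⟩ := hin hε η hη
    refine ⟨g, R.pt_injective (hg1.trans he1.symm), fun g' => ⟨fun ⟨h1, σ, hσ, h2⟩ => ?_, ?_⟩⟩
    · obtain ⟨h3, h4, -⟩ := htgt g' h1
      refine R.edge_unique ⟨h4.1.trans_le hσ.1, h3 ▸ hσ.2⟩ ⟨hg3.trans_le hσ.1, hg2 ▸ hσ.2⟩ ?_
      rw [h2, hg4 σ (Ico_subset_Icc_self hσ)]
    · rintro rfl
      exact ⟨R.pt_injective (hg1.trans he1.symm), _, left_mem_Ico.2 (d.tip_neg hε),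
        hg4 _ (left_mem_Icc.2 (d.tip_neg hε).le)⟩
  · rintro h rfl
    rw [he1, ← hmid0] at h
    exact d.mid_notMem_away (left_mem_Ico.2 hr) h
  · by_contra hn
    rcases d.notMem_away_iff.1 hn with ⟨σ, hσ, h1⟩ | ⟨hε, η, hη, σ, hσ, h1⟩
    · have h2 := d.dirHeight_mid (Ico_subset_Icc_self hσ)
      have h3 := d.dirHeight_eq_zero (R.pt_mem v) (by
        rw [h1, h2, abs_of_nonneg hσ.1]; exact hσ.2.trans d.lt)
      rw [h1, h2] at h3
      rw [h3, hmid0, ← he1] at h1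
      exact hv (R.pt_injective h1)
    · have h4 : σ ∈ Icc (tipDist D c r) r := ⟨hσ.1.le, hσ.2.le.trans hr.le⟩
      have h2 := d.dirHeight_arc hη h4
      have h3 := d.dirHeight_eq_zero (R.pt_mem v) (by
        rw [h1, h2]; exact (d.abs_le_of_mem h4).trans_lt d.lt)
      rw [h1, h2] at h3
      exact hσ.2.ne h3
  · rintro rfl
    by_contra! hlt
    rw [he2] at hs
    rw [he4 s ⟨hs.1.le, hlt.le⟩] at h
    exact d.mid_notMem_away ⟨hs.1.le, hlt⟩ h
  · intro hg
    by_contra! hlt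
    obtain ⟨h1, -, -, η, hη, h2⟩ := htgt e hg
    rw [h1] at hs
    rw [h2 s ⟨hlt.le, hs.2.le⟩] at h
    exact d.arc_notMem_away hη ⟨hlt, hs.2.trans hr⟩ h
  · by_contra hn
    rcases hsec_unique e s hs hn with ⟨h1, h2, -⟩ | ⟨h1, h2, hε, η, hη, h3⟩
    · exact absurd (h.1 h1) (not_le.2 h2)
    · obtain ⟨g, hg1, hg2, hg3, hg4⟩ := hin hε η hη
      have h4 : e = g := by
        refine R.edge_unique hs ⟨hg3.trans h2, hg2 ▸ h1⟩ ?_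
        rw [h3, hg4 s ⟨h2.le, h1.le⟩]
      exact absurd (h.2 (by rw [h4]; exact R.pt_injective (hg1.trans he1.symm))) (not_le.2 h2)

end PoleCut

/-! ### The transport of the drawing at a pole -/

namespace PoleCut

open LabelledDigraph

variable {S : Set PlaneCircle} {D : Set Plane} {i j : Fin 2} {c : PlaneCircle} {p : Plane}
  {ρ r ϑ σ y η : ℝ}

theorem closure_eq (d : PoleCut S D i j c p ρ r ϑ) :
    closure (cut D p r) = closure D \ Metric.ball p r :=
  d.mbc.closure_cut d.circle_mem d.center_mem d.small d.pos d.lt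

theorem isMBC (d : PoleCut S D i j c p ρ r ϑ) : IsMBC (insert ⟨p, r, d.pos⟩ S) (cut D p r) :=
  d.mbc.isMBC_cut d.ne d.circle_mem d.center_mem d.center_closure d.small d.pos d.lt

theorem abs_dir_le (d : PoleCut S D i j c p ρ r ϑ) (hσ : σ ∈ Icc (tipDist D c r) r) :
    |p i + ϑ * σ - p i| ≤ r := by
  rw [d.abs_dir]; exact d.abs_le_of_mem hσ

theorem arc_mem_cut (d : PoleCut S D i j c p ρ r ϑ) (hη : η = 1 ∨ η = -1)
    (hσ : σ ∈ Icc (tipDist D c r) r) : arcPt i j p r η (p i + ϑ * σ) ∈ closure (cut D p r) :=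
  arcPt_mem_cut d.ne d.pos.le hη d.closure_eq (d.abs_dir_le hσ) (d.arc_mem hη hσ)

theorem arc_end_eq (d : PoleCut S D i j c p ρ r ϑ) (η η' : ℝ) :
    arcPt i j p r η (p i + ϑ * r) = arcPt i j p r η' (p i + ϑ * r) :=
  arcPt_end η' (by rw [d.abs_dir, abs_of_pos d.pos])

theorem arc_end_eq_mid (d : PoleCut S D i j c p ρ r ϑ) (η : ℝ) :
    arcPt i j p r η (p i + ϑ * r) = offsetPt i j p ϑ r 0 := by
  rw [arcPt_eq_offsetPt d.side, sub_self, Real.sqrt_zero, mul_zero]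

section Cut

variable [Nonempty (closure (cut D p r))]

theorem dirHeight_arc_cut (d : PoleCut S D i j c p ρ r ϑ) (hη : η = 1 ∨ η = -1)
    (hσ : σ ∈ Icc (tipDist D c r) r) :
    dirHeight (cut D p r) i p ϑ (prAt (cut D p r) i (arcPt i j p r η (p i + ϑ * σ))) = σ := by
  rw [dirHeight, prHeight_prAt (d.arc_mem_cut hη hσ), arcPt_same, d.dir_mul_dir]

variable [Nonempty (closure D)]

/-- The part of the old quotient space away from the disc is embedded in the new one, and the
remaining points of the new quotient space come from the two arcs. -/
theorem exists_transport (d : PoleCut S D i j c p ρ r ϑ) :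
    ∃ ψ : PRSpace D i → PRSpace (cut D p r) i, ContinuousOn ψ d.away ∧ InjOn ψ d.away ∧
      (∀ z ∈ d.away, dirHeight (cut D p r) i p ϑ (ψ z) = dirHeight D i p ϑ z) ∧
      (∀ x ∈ closure D, prAt D i x ∈ d.away →
        x ∈ closure (cut D p r) ∧ ψ (prAt D i x) = prAt (cut D p r) i x) ∧
      (∀ w, w ∈ ψ '' d.away ∨ ∃ η : ℝ, (η = 1 ∨ η = -1) ∧ ∃ σ ∈ Icc (tipDist D c r) r,
        w = prAt (cut D p r) i (arcPt i j p r η (p i + ϑ * σ))) ∧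
      ∀ η : ℝ, (η = 1 ∨ η = -1) → ∀ σ ∈ Icc (tipDist D c r) r,
        prAt D i (arcPt i j p r η (p i + ϑ * σ)) ∉ d.away →
        prAt (cut D p r) i (arcPt i j p r η (p i + ϑ * σ)) ∉ ψ '' d.away := by
  have hij := d.ne
  have hcut : ∀ x ∈ closure D, prAt D i x ∈ d.away → x ∈ closure (cut D p r) := fun x hx hxa => by
    rw [d.closure_eq]; exact ⟨hx, hxa x hx rfl⟩
  choose x hxK hx using fun z : PRSpace D i => exists_prAt z
  set φ := prProj (i := i) hij (sdiff_subset : cut D p r ⊆ D) with hφ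
  have hφψ : ∀ z ∈ d.away, φ (prAt (cut D p r) i (x z)) = z := fun z hz => by
    rw [hφ, prProj_prAt hij _ (hcut _ (hxK z) (by rw [hx]; exact hz)), hx]
  have hψ : ∀ y ∈ closure D, prAt D i y ∈ d.away →
      prAt (cut D p r) i (x (prAt D i y)) = prAt (cut D p r) i y := fun y hy hya =>
    prAt_cut_eq_of_fibre hij d.closure_eq (hcut _ (hxK _) (by rw [hx]; exact hya)) (hcut y hy hya)
      (hx _) fun w hw hwx => hya w hw (by rw [hwx, hx])
  refine ⟨fun z => prAt (cut D p r) i (x z), fun z hz => ?_, fun z hz w hw hzw => ?_, fun z hz => ?_,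
    fun y hy hya => ⟨hcut y hy hya, hψ y hy hya⟩, fun w => ?_, fun η hη σ hσ hn => ?_⟩
  · refine continuousWithinAt_of_fibre (isClosedMap_prProj hij d.mbc.bounded) hφψ fun w hw => ?_
    obtain ⟨y, hy, rfl⟩ := exists_prAt w
    rw [prProj_prAt hij _ hy] at hw
    have hyK : y ∈ closure D := closure_mono sdiff_subset hy
    rw [← hw] at hz ⊢
    exact (hψ y hyK hz).symm
  · rw [← hφψ z hz, ← hφψ w hw]
    exact congrArg φ hzw
  · have h1 : prHeight D i (φ (prAt (cut D p r) i (x z))) =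
        prHeight (cut D p r) i (prAt (cut D p r) i (x z)) := prHeight_prProj hij _ _
    rw [hφψ z hz] at h1
    show ϑ * (prHeight (cut D p r) i (prAt (cut D p r) i (x z)) - p i) =
      ϑ * (prHeight D i z - p i)
    rw [h1]
  · obtain ⟨y, hy, rfl⟩ := exists_prAt w
    have hyK : y ∈ closure D := closure_mono sdiff_subset hy
    by_cases hya : prAt D i y ∈ d.away
    · exact Or.inl ⟨_, hya, hψ y hyK hya⟩
    right
    unfold away at hya
    simp only [Set.mem_ofPred_eq, not_forall, not_not] at hya
    obtain ⟨y', hy', hyy, hb⟩ := hya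
    have hyb : y ∉ Metric.ball p r := by rw [d.closure_eq] at hy; exact hy.2
    obtain ⟨h1, h2⟩ := (prAt_eq_iff hij hyK hy').1 hyy.symm
    have hs' : |y' i - p i| ≤ r := abs_le_of_dist_le (Metric.mem_ball.1 hb).le
    have hs : |y i - p i| ≤ r := by rw [h1]; exact hs'
    have h3 := chord_le_of_notMem_ball hij d.pos.le hs hyb
    have h4 : |y' j - p j| < chord r (p i) (y i) := by
      by_contra! hle
      rw [h1] at hle
      exact notMem_ball_of_chord_le hij hs' hle hb
    obtain ⟨h5, h6⟩ := abs_lt.1 h4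
    -- the segment that runs into the disc crosses the arc on its side
    obtain ⟨η, hη, h7, h8⟩ : ∃ η : ℝ, (η = 1 ∨ η = -1) ∧
        p j + η * chord r (p i) (y i) ∈ uIcc (y j) (y' j) ∧
        ∀ z ∈ uIcc (y j) (p j + η * chord r (p i) (y i)), chord r (p i) (y i) ≤ |z - p j| := by
      rcases le_abs.1 h3 with h | h
      · refine ⟨1, Or.inl rfl, mem_uIcc.2 (Or.inr ⟨by linarith, by linarith⟩), fun z hz => ?_⟩
        rw [uIcc_of_ge (by linarith)] at hz
        exact le_abs.2 (Or.inl (by linarith [hz.1]))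
      · refine ⟨-1, Or.inr rfl, mem_uIcc.2 (Or.inl ⟨by linarith, by linarith⟩), fun z hz => ?_⟩
        rw [uIcc_of_le (by linarith)] at hz
        exact le_abs.2 (Or.inr (by linarith [hz.2]))
    have h9 := prAt_cut_eq_of_vertConn hij d.closure_eq hs (h2.sub left_mem_uIcc h7) h8
    have h10 : arcPt i j p r η (y i) ∈ closure D := h2 _ h7
    have h11 : y i = p i + ϑ * (ϑ * (y i - p i)) := by
      rcases d.side with h | h <;> rw [h] <;> ring
    have h12 : |ϑ * (y i - p i)| ≤ r := by rwa [← d.abs_dir, ← h11]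
    rw [h11] at h10
    refine ⟨η, hη, ϑ * (y i - p i), ⟨(d.arc_mem_iff hη h12).1 h10, (abs_le.1 h12).2⟩, ?_⟩
    rw [← h11]
    exact h9
  · rintro ⟨z, hz, hzw⟩
    have h1 := congrArg φ hzw
    rw [hφψ z hz, hφ, prProj_prAt hij _ (d.arc_mem_cut hη hσ)] at h1
    exact hn (h1 ▸ hz)

/-- The vertex at the pole moves to the pole of the new circle, and the points in which the new
circle meets `c` become vertices. -/
theorem prVertices_eq (d : PoleCut S D i j c p ρ r ϑ) {ψ : PRSpace D i → PRSpace (cut D p r) i}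
    (hψ : ∀ x ∈ closure D, prAt D i x ∈ d.away →
        x ∈ closure (cut D p r) ∧ ψ (prAt D i x) = prAt (cut D p r) i x)
    (hV : ∀ z ∈ prVertices S D i, z ≠ prAt D i p → z ∈ d.away) :
    prVertices (insert ⟨p, r, d.pos⟩ S) (cut D p r) i =
      insert (prAt (cut D p r) i (arcPt i j p r 1 (p i + ϑ * r)))
        (ψ '' (prVertices S D i \ {prAt D i p})) ∪
      {prAt (cut D p r) i (arcPt i j p r 1 (p i + ϑ * tipDist D c r)),
        prAt (cut D p r) i (arcPt i j p r (-1) (p i + ϑ * tipDist D c r))} := by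
  have hij := d.ne
  have htip := abs_lt.1 d.tip_abs
  have hend : r ∈ Icc (tipDist D c r) r := ⟨htip.2.le, le_rfl⟩
  have hbeg : tipDist D c r ∈ Icc (tipDist D c r) r := ⟨le_rfl, htip.2.le⟩
  ext w
  constructor
  · intro hw
    obtain ⟨x, hx, rfl, hn⟩ := mem_prVertices_iff.1 hw
    have hxK : x ∈ closure D := closure_mono sdiff_subset hx
    have hxb : x ∉ Metric.ball p r := by rw [d.closure_eq] at hx; exact hx.2
    have hxp : x ≠ p := by
      rintro rfl
      exact hxb (Metric.mem_ball_self d.pos)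
    by_cases hnS : IsOrdinary S i x
    swap
    · have h1 : prAt D i x ≠ prAt D i p := fun h1 => by
        obtain ⟨h2, h3⟩ := (prAt_eq_iff hij hxK d.center_closure).1 h1
        exact hnS (d.alone x hxK h2 (h2 ▸ h3.symm) hxp)
      have h2 : prAt D i x ∈ prVertices S D i :=
        mem_prVertices_iff.2 ⟨x, hxK, rfl, not_not.1 hnS⟩
      exact Or.inl (Or.inr ⟨_, ⟨h2, h1⟩, (hψ x hxK (hV _ h2 h1)).2⟩)
    -- a point of the new circle that is a pole of it, or lies on an old circle
    have hcase : dist x p = r ∧ (x j = p j ∨ x ∈ c.carrier) := by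
      rcases hn with ⟨e, he, hpole⟩ | ⟨e, he, f, hf, hef, hxe, hxf⟩
      · rcases he with rfl | he
        · have := (PlaneCircle.isPole_iff hij _ x).1 hpole
          exact ⟨this.1, Or.inl this.2⟩
        · exact absurd (Or.inl ⟨e, he, hpole⟩) hnS
      · rcases he with rfl | he
        · have hf := mem_of_mem_insert_of_ne hf (Ne.symm hef)
          have hxr : dist x p = r := hxe
          exact ⟨hxr, Or.inr (d.small.single x (by rw [hxr]; exact d.lt) f hf hxf ▸ hxf)⟩
        · rcases hf with rfl | hf
          · have hxr : dist x p = r := hxf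
            exact ⟨hxr, Or.inr (d.small.single x (by rw [hxr]; exact d.lt) e he hxe ▸ hxe)⟩
          · exact absurd (Or.inr ⟨e, he, f, hf, hef, hxe, hxf⟩) hnS
    obtain ⟨hxr, hcase⟩ := hcase
    have h11 : x i = p i + ϑ * (ϑ * (x i - p i)) := by
      rcases d.side with h | h <;> rw [h] <;> ring
    have h12 : |ϑ * (x i - p i)| ≤ r := by
      rw [← d.abs_dir, ← h11]; exact abs_le_of_dist_le hxr.le
    obtain ⟨η, hη, h1⟩ : ∃ η : ℝ, (η = 1 ∨ η = -1) ∧ x = arcPt i j p r η (x i) := by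
      rcases eq_arcPt_of_dist hij (Or.inl rfl) hxr with h | h
      · exact ⟨1, Or.inl rfl, h⟩
      · exact ⟨-1, Or.inr rfl, h⟩
    generalize ϑ * (x i - p i) = σ at h11 h12
    rw [h11] at h1
    rcases hcase with hj | hxc
    · have h2 : |σ| = r := by
        have := dist_sq hij x p
        rw [hxr, hj, sub_self, zero_pow two_ne_zero, add_zero, h11, ← sq_abs (_ - _), d.abs_dir]
          at this
        exact ((pow_left_inj₀ d.pos.le (abs_nonneg σ) two_ne_zero).1 this).symm
      have h3 : σ = r := by
        rcases abs_eq d.pos.le |>.1 h2 with h | h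
        · exact h
        · have := (d.arc_mem_iff hη h12).1 (h1 ▸ hxK)
          linarith
      rw [h1, h3, d.arc_end_eq η 1]
      exact Or.inl (mem_insert _ _)
    · have h2 := (d.arc_mem_carrier_iff hη h12).1 (h1 ▸ hxc)
      right
      rw [h1, h2]
      rcases hη with rfl | rfl
      · exact mem_insert _ _
      · exact Or.inr rfl
  · have hcross : ∀ η : ℝ, (η = 1 ∨ η = -1) → prAt (cut D p r) i
        (arcPt i j p r η (p i + ϑ * tipDist D c r)) ∈
        prVertices (insert ⟨p, r, d.pos⟩ S) (cut D p r) i := by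
      intro η hη
      refine mem_prVertices_iff.2 ⟨_, d.arc_mem_cut hη hbeg, rfl, Or.inr ⟨⟨p, r, d.pos⟩,
        mem_insert _ _, c, mem_insert_of_mem _ d.circle_mem, ?_,
        dist_arcPt hij d.pos.le hη (d.abs_dir_le hbeg),
        (d.arc_mem_carrier_iff hη d.tip_abs.le).2 rfl⟩⟩
      intro hpc
      have h0 := d.center_mem
      rw [← hpc] at h0
      have h0 : dist p p = r := h0
      rw [dist_self] at h0
      exact d.pos.ne h0
    rintro ((rfl | ⟨z, ⟨hz, hzp⟩, rfl⟩) | (rfl | rfl))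
    · refine mem_prVertices_iff.2 ⟨_, d.arc_mem_cut (Or.inl rfl) hend, rfl, Or.inl ⟨⟨p, r, d.pos⟩,
        mem_insert _ _, ?_⟩⟩
      rw [PlaneCircle.isPole_iff hij]
      refine ⟨dist_arcPt hij d.pos.le (Or.inl rfl) (d.abs_dir_le hend), ?_⟩
      rw [d.arc_end_eq_mid, offsetPt_other hij, add_zero]
    · have hza := hV z hz hzp
      obtain ⟨x, hx, rfl, hn⟩ := mem_prVertices_iff.1 hz
      obtain ⟨h1, h2⟩ := hψ x hx hza
      rw [h2]
      refine mem_prVertices_iff.2 ⟨x, h1, rfl, ?_⟩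
      rcases hn with ⟨e, he, hpole⟩ | ⟨e, he, f, hf, h⟩
      · exact Or.inl ⟨e, Or.inr he, hpole⟩
      · exact Or.inr ⟨e, Or.inr he, f, Or.inr hf, h⟩
    · exact hcross 1 (Or.inl rfl)
    · exact hcross (-1) (Or.inr rfl)

/-- The drawing of the old V-digraph in the new quotient space. The vertex at the pole has moved to
the pole of the new circle. If `D` is inside `c`, only the two arcs are not covered. If `D` is
outside `c`, the two edges that enter the vertex now run along the arcs. -/
theorem exists_relocated (d : PoleCut S D i j c p ρ r ϑ) {Γ : LabelledDigraph}
    (R : Γ.Realization (dirHeight D i p ϑ) (prVertices S D i) (prVertices S D i)ᶜ) :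
    ∃ (v₀ : Γ.V) (e₀ : Γ.E) (V O : Set (PRSpace (cut D p r) i))
      (R' : Γ.Realization (dirHeight (cut D p r) i p ϑ) V O),
      R.pt v₀ = prAt D i p ∧ (∀ e, Γ.src e = v₀ ↔ e = e₀) ∧ Disjoint V O ∧
      prVertices (insert ⟨p, r, d.pos⟩ S) (cut D p r) i = V ∪
        {prAt (cut D p r) i (arcPt i j p r 1 (p i + ϑ * tipDist D c r)),
          prAt (cut D p r) i (arcPt i j p r (-1) (p i + ϑ * tipDist D c r))} ∧
      R'.pt v₀ = prAt (cut D p r) i (arcPt i j p r 1 (p i + ϑ * r)) ∧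
      (∀ v, v ≠ v₀ → dirHeight (cut D p r) i p ϑ (R'.pt v) = dirHeight D i p ϑ (R.pt v)) ∧
      (sideSign D c = -1 → (∀ e, Γ.tgt e ≠ v₀) ∧
        (∀ w, w ∈ V ∪ O ∨ ∃ η : ℝ, (η = 1 ∨ η = -1) ∧ ∃ σ ∈ Ico (tipDist D c r) r,
          w = prAt (cut D p r) i (arcPt i j p r η (p i + ϑ * σ))) ∧
        ∀ η : ℝ, (η = 1 ∨ η = -1) → ∀ σ ∈ Ico (tipDist D c r) r,
          prAt (cut D p r) i (arcPt i j p r η (p i + ϑ * σ)) ∉ V ∪ O) ∧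
      (sideSign D c = 1 → V ∪ O = univ ∧ ∃ e₁ e₂, e₁ ≠ e₂ ∧
        (∀ e, Γ.tgt e = v₀ ↔ e = e₁ ∨ e = e₂) ∧
        (tipDist D c r ∈ Ioo (R'.lo e₁) (R'.hi e₁) ∧ R'.sec e₁ (tipDist D c r) =
          prAt (cut D p r) i (arcPt i j p r 1 (p i + ϑ * tipDist D c r))) ∧
        (tipDist D c r ∈ Ioo (R'.lo e₂) (R'.hi e₂) ∧ R'.sec e₂ (tipDist D c r) =
          prAt (cut D p r) i (arcPt i j p r (-1) (p i + ϑ * tipDist D c r)))) := by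
  obtain ⟨ψ, hψc, hψi, hψh, hψ, hcov, hnew⟩ := d.exists_transport
  obtain ⟨v₀, e₀, hv₀, hsrc, hτ, hsecτ, htgt, hexists, hYv, hYe⟩ := d.exists_star R
  have htip := abs_lt.1 d.tip_abs
  have hend : r ∈ Icc (tipDist D c r) r := ⟨htip.2.le, le_rfl⟩
  have hbeg : tipDist D c r ∈ Icc (tipDist D c r) r := ⟨le_rfl, htip.2.le⟩
  have hIoo : ∀ {σ}, σ ∈ Ioo (tipDist D c r) r → σ ∈ Icc (tipDist D c r) r :=
    fun h => Ioo_subset_Icc_self h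
  choose! η hη hsec using fun g hg => (htgt g hg).2.2
  have hψr : ∀ η', ψ (R.sec e₀ r) = prAt (cut D p r) i (arcPt i j p r η' (p i + ϑ * r)) := by
    intro η'
    rw [hsecτ, d.arc_end_eq_mid]
    exact (hψ _ (d.mid_mem ⟨d.pos.le, le_rfl⟩) d.mid_end_mem_away).2
  have hψtip : ∀ η : ℝ, (η = 1 ∨ η = -1) → sideSign D c = 1 →
      ψ (prAt D i (arcPt i j p r η (p i + ϑ * tipDist D c r))) =
        prAt (cut D p r) i (arcPt i j p r η (p i + ϑ * tipDist D c r)) := fun η hη hε =>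
    (hψ _ (d.arc_mem hη hbeg) (d.tip_mem_away hη hε)).2
  have htip0 : ∀ g, Γ.tgt g = v₀ → tipDist D c r ∈ Icc (tipDist D c r) 0 := fun g hg =>
    ⟨le_rfl, (d.tip_neg (htgt g hg).2.1).le⟩
  obtain ⟨R', hR1, hR2, hR3⟩ := R.exists_relocate (G := {g | Γ.tgt g = v₀}) (ψ := ψ)
    (h' := dirHeight (cut D p r) i p ϑ) hsrc (fun _ => Iff.rfl) hτ (fun g hg => (htgt g hg).1)
    hYv hYe hψc hψi hψh
    (fun g s => prAt (cut D p r) i (arcPt i j p r (η g) (p i + ϑ * s)))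
    (fun g hg => continuousOn_arc fun s hs => d.arc_mem_cut (hη g hg) hs)
    (fun g hg s hs => d.dirHeight_arc_cut (hη g hg) hs)
    (fun g hg => by
      rw [hsec g hg _ (htip0 g hg)]
      exact (hψtip _ (hη g hg) (htgt g hg).2.1).symm)
    (fun g _ => (hψr _).symm)
    (fun g hg s hs => hnew _ (hη g hg) s (hIoo hs) (d.arc_notMem_away (hη g hg) hs))
    (fun g hg g' hg' s hs hgg => by
      -- the disc separates the two arcs
      have h1 : η g = η g' := by
        have habs : |p i + ϑ * s - p i| < r := by
          rw [d.abs_dir, abs_lt]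
          exact ⟨htip.1.trans hs.1, hs.2⟩
        by_contra hne
        have h2 : η g' = -η g := by
          rcases hη g hg with h | h <;> rcases hη g' hg' with h' | h' <;> rw [h, h'] at hne ⊢ <;>
            simp at hne ⊢
        rw [h2] at hgg
        refine prAt_arcPt_ne d.ne d.pos.le (hη g hg) d.closure_eq habs
          (d.arc_mem (hη g hg) (hIoo hs)) ?_ hgg
        rw [← h2]
        exact d.arc_mem (hη g' hg') (hIoo hs)
      have h2 := (htgt g hg).1
      refine ((hexists (htgt g hg).2.1 (η g) (hη g hg)).choose_spec.2 g).1 ⟨hg, _,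
        left_mem_Ico.2 (d.tip_neg (htgt g hg).2.1), hsec g hg _ (htip0 g hg)⟩ |>.trans
        (((hexists (htgt g hg).2.1 (η g) (hη g hg)).choose_spec.2 g').1 ⟨hg', _,
        left_mem_Ico.2 (d.tip_neg (htgt g hg).2.1), h1 ▸ hsec g' hg' _ (htip0 g' hg')⟩).symm)
  replace hR1 := hR1.trans (hψr 1)
  have hVa : ∀ z ∈ prVertices S D i, z ≠ prAt D i p → z ∈ d.away := by
    intro z hz hzp
    obtain ⟨v, rfl⟩ := R.exists_pt hz
    refine (hYv v).2 fun h0 => hzp ?_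
    rw [h0, hv₀]
  have hVeq := d.prVertices_eq hψ hVa
  have hr_mem : R.sec e₀ r ∈ d.away := by rw [hsecτ]; exact d.mid_end_mem_away
  have hVsub : insert (ψ (R.sec e₀ r)) (ψ '' (prVertices S D i \ {R.pt v₀})) ⊆ ψ '' d.away := by
    rintro w (rfl | ⟨z, ⟨hz, hz0⟩, rfl⟩)
    · exact mem_image_of_mem ψ hr_mem
    · exact mem_image_of_mem ψ (hVa z hz fun h0 => hz0 (by rw [hv₀, h0]; rfl))
  refine ⟨v₀, e₀, _, _, R', hv₀, hsrc, ?_, ?_, hR1, fun v hv => ?_, fun hε => ?_, fun hε => ?_⟩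
  · rw [Set.disjoint_left]
    rintro w hw (⟨-, h1⟩ | h1)
    · exact h1 hw
    · obtain ⟨g, hg, s, hs, rfl⟩ := mem_iUnion₂.1 h1
      exact hnew _ (hη g hg) s (hIoo hs) (d.arc_notMem_away (hη g hg) hs) (hVsub hw)
  · rw [hVeq, hψr 1, hv₀]
  · rw [hR2 v hv, hψh _ ((hYv v).2 hv)]
  · have hno : ∀ e, Γ.tgt e ≠ v₀ := fun e he => by
      have := (htgt e he).2.1
      rw [hε] at this
      norm_num at this
    refine ⟨hno, fun w => ?_, fun η' hη' σ hσ h => ?_⟩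
    · by_cases hw : w ∈ ψ '' d.away
      · left
        by_cases hwV : w ∈ insert (ψ (R.sec e₀ r)) (ψ '' (prVertices S D i \ {R.pt v₀}))
        · exact Or.inl hwV
        · exact Or.inr (Or.inl ⟨hw, hwV⟩)
      · obtain ⟨η', hη', σ, hσ, hwσ⟩ := (hcov w).resolve_left hw
        refine Or.inr ⟨η', hη', σ, ⟨hσ.1, lt_of_le_of_ne hσ.2 fun h => hw ?_⟩, hwσ⟩
        rw [hwσ, h, ← hψr η']
        exact mem_image_of_mem ψ hr_mem
    · have h1 : prAt (cut D p r) i (arcPt i j p r η' (p i + ϑ * σ)) ∈ ψ '' d.away := by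
        rcases h with h | h | h
        · exact hVsub h
        · exact h.1
        · obtain ⟨g, hg, -⟩ := mem_iUnion₂.1 h
          exact absurd hg (hno g)
      have h0 := (d.tip_pos hε).le.trans hσ.1
      refine hnew η' hη' σ (Ico_subset_Icc_self hσ) ?_ h1
      rw [d.prAt_arc_eq_mid hη' (Ico_subset_Icc_self hσ) h0]
      exact d.mid_notMem_away ⟨h0, hσ.2⟩
  · obtain ⟨e₁, h11, h12⟩ := hexists hε 1 (Or.inl rfl)
    obtain ⟨e₂, h21, h22⟩ := hexists hε (-1) (Or.inr rfl)
    have htip' := d.tip_neg hε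
    have hmem : tipDist D c r ∈ Ico (tipDist D c r) 0 := left_mem_Ico.2 htip'
    have hs1 : R.sec e₁ (tipDist D c r) = prAt D i (arcPt i j p r 1 (p i + ϑ * tipDist D c r)) := by
      rcases hη e₁ h11 with h | h
      · rw [← h]; exact hsec e₁ h11 _ (htip0 e₁ h11)
      · obtain ⟨-, σ, hσ, h2⟩ := (h12 e₁).2 rfl
        have h3 := hsec e₁ h11 σ (Ico_subset_Icc_self hσ)
        rw [h] at h3
        exact absurd (h2.symm.trans h3) (d.arc_ne hσ)
    have hs2 : R.sec e₂ (tipDist D c r) =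
        prAt D i (arcPt i j p r (-1) (p i + ϑ * tipDist D c r)) := by
      rcases hη e₂ h21 with h | h
      · obtain ⟨-, σ, hσ, h2⟩ := (h22 e₂).2 rfl
        have h3 := hsec e₂ h21 σ (Ico_subset_Icc_self hσ)
        rw [h] at h3
        exact absurd (h3.symm.trans h2) (d.arc_ne hσ)
      · rw [← h]; exact hsec e₂ h21 _ (htip0 e₂ h21)
    have hrange : ∀ g, Γ.tgt g = v₀ → tipDist D c r ∈ Ioo (R'.lo g) (R'.hi g) := by
      intro g hg
      have hne : Γ.src g ≠ v₀ := fun h0 => by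
        have := R.lt g
        rw [h0, hg] at this
        exact this.false
      have hl : R'.lo g = R.lo g := by
        unfold Realization.lo
        rw [hR2 _ hne, hψh _ ((hYv _).2 hne)]
      have hh : R'.hi g = r := by
        unfold Realization.hi
        rw [hg, hR1, d.dirHeight_arc_cut (Or.inl rfl) hend]
      rw [hl, hh]
      exact ⟨(htgt g hg).1.1, htip.2⟩
    refine ⟨eq_univ_of_forall fun w => ?_, e₁, e₂, fun h => ?_, fun e => ⟨fun he => ?_, ?_⟩,
      ⟨hrange e₁ h11, ?_⟩, ⟨hrange e₂ h21, ?_⟩⟩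
    · by_cases hw : w ∈ ψ '' d.away
      · by_cases hwV : w ∈ insert (ψ (R.sec e₀ r)) (ψ '' (prVertices S D i \ {R.pt v₀}))
        · exact Or.inl hwV
        · exact Or.inr (Or.inl ⟨hw, hwV⟩)
      · obtain ⟨η', hη', σ, hσ, hwσ⟩ := (hcov w).resolve_left hw
        right; right
        have hσ1 : tipDist D c r < σ := lt_of_le_of_ne hσ.1 fun h => hw (by
          rw [hwσ, ← h, ← hψtip η' hη' hε]
          exact mem_image_of_mem ψ (d.tip_mem_away hη' hε))
        have hσ2 : σ < r := lt_of_le_of_ne hσ.2 fun h => hw (by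
          rw [hwσ, h, ← hψr η']
          exact mem_image_of_mem ψ hr_mem)
        have hg : ∃ g, Γ.tgt g = v₀ ∧ η g = η' := by
          obtain ⟨g, hg1, hg2⟩ := hexists hε η' hη'
          refine ⟨g, hg1, ?_⟩
          obtain ⟨-, s, hs, h2⟩ := (hg2 g).2 rfl
          have h3 := hsec g hg1 s (Ico_subset_Icc_self hs)
          rcases hη g hg1 with h | h <;> rcases hη' with h' | h' <;> rw [h, h'] <;>
            rw [h'] at h2 <;> rw [h] at h3
          · exact absurd (h3.symm.trans h2) (d.arc_ne hs)
          · exact absurd (h2.symm.trans h3) (d.arc_ne hs)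
        obtain ⟨g, hg1, hg2⟩ := hg
        refine mem_biUnion hg1 ⟨σ, ⟨hσ1, hσ2⟩, ?_⟩
        simp only [hg2]
        exact hwσ.symm
    · rw [h, hs2] at hs1
      exact d.arc_ne hmem hs1.symm
    · rcases hη e he with h | h
      · exact Or.inl ((h12 e).1 ⟨he, _, hmem, h ▸ hsec e he _ (htip0 e he)⟩)
      · exact Or.inr ((h22 e).1 ⟨he, _, hmem, h ▸ hsec e he _ (htip0 e he)⟩)
    · rintro (rfl | rfl)
      · exact h11
      · exact h21
    · rw [hR3 e₁ h11, hs1, hψtip 1 (Or.inl rfl) hε]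
    · rw [hR3 e₂ h21, hs2, hψtip (-1) (Or.inr rfl) hε]

end Cut

end PoleCut

/-! ### The change at a pole for the height -/

theorem LabelledDigraph.degree_reverse (Γ : LabelledDigraph) (v : Γ.V) :
    Γ.reverse.degree v = Γ.degree v := by
  unfold LabelledDigraph.degree
  exact congrArg Set.ncard (Set.ext fun _ => or_comm)

theorem LabelledDigraph.relabel_label_self (Γ : LabelledDigraph) (v : Γ.V) (a : ℝ) :
    (Γ.relabel v a).label v = a := by
  simp [LabelledDigraph.relabel]

theorem LabelledDigraph.relabel_label_of_ne (Γ : LabelledDigraph) {v w : Γ.V} (h : w ≠ v) (a : ℝ) :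
    (Γ.relabel v a).label w = Γ.label w := by
  simp [LabelledDigraph.relabel, h]

namespace PoleCut

open LabelledDigraph

variable {S : Set PlaneCircle} {D : Set Plane} {i j : Fin 2} {c : PlaneCircle} {p : Plane}
  {ρ r ϑ a₀ b : ℝ}

/-- A label `a` and a height `s` in the direction of `D` of the same vertex after the removal of
the disc: those of an old vertex, or of the vertex that has moved from `p` to the pole of the new
circle and has the label `a₀`, or of a new vertex at an end of an arc, which has the label `b`. -/
def IsMovedPair (_ : PoleCut S D i j c p ρ r ϑ) (a₀ b a s : ℝ) : Prop :=
  (∃ z ∈ prVertices S D i, a = prHeight D i z ∧ s = dirHeight D i p ϑ z) ∨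
    (a = a₀ ∧ s = r) ∨ (a = b ∧ s = tipDist D c r)

/-- The labels `a₀` and `b` are near `p i`, and are ordered, in the direction of `D`, like the
heights of the pole of the new circle and of the ends of the arcs. -/
def AreAdmissible (_ : PoleCut S D i j c p ρ r ϑ) (a₀ b : ℝ) : Prop :=
  0 < ϑ * (a₀ - p i) ∧ ϑ * (a₀ - p i) < ρ ∧
    (0 < tipDist D c r ∧ 0 < ϑ * (b - p i) ∧ ϑ * (b - p i) < ϑ * (a₀ - p i) ∨
      tipDist D c r < 0 ∧ -ρ < ϑ * (b - p i) ∧ ϑ * (b - p i) < 0)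

theorem isMovedPair_lt_iff (d : PoleCut S D i j c p ρ r ϑ) (hab : d.AreAdmissible a₀ b)
    {a a' s s' : ℝ} (h : d.IsMovedPair a₀ b a s) (h' : d.IsMovedPair a₀ b a' s') :
    ϑ * (a - p i) < ϑ * (a' - p i) ↔ s < s' := by
  obtain ⟨h1, h2, h3⟩ := hab
  have htip := abs_lt.1 d.tip_abs
  have hρ := d.lt
  have hr := d.pos
  have hold : ∀ z ∈ prVertices S D i, ∀ {a s : ℝ}, a = prHeight D i z →
      s = dirHeight D i p ϑ z → ϑ * (a - p i) = s ∧ (s = 0 ∨ ρ ≤ |s - 0|) := by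
    rintro z hz a s rfl rfl
    refine ⟨rfl, ?_⟩
    rw [sub_zero]
    rcases lt_or_ge |dirHeight D i p ϑ z| ρ with h | h
    · exact Or.inl (d.dirHeight_eq_zero hz h)
    · exact Or.inr h
  rcases h3 with ⟨h3, h4, h5⟩ | ⟨h3, h4, h5⟩
  · have key : ∀ {a s}, d.IsMovedPair a₀ b a s → IsLabelPair 0 ρ (-(2 * ρ / 3)) (-(ρ / 3))
        (ϑ * (b - p i)) (ϑ * (a₀ - p i)) (-(2 * ρ / 3)) (-(ρ / 3)) (tipDist D c r) r
        (ϑ * (a - p i)) s := by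
      rintro a s (⟨z, hz, ha, hs⟩ | ⟨rfl, rfl⟩ | ⟨rfl, rfl⟩)
      · exact Or.inl (hold z hz ha hs)
      · exact Or.inr (Or.inr (Or.inr (Or.inr ⟨rfl, rfl⟩)))
      · exact Or.inr (Or.inr (Or.inr (Or.inl ⟨rfl, rfl⟩)))
    refine IsLabelPair.lt_iff ?_ ?_ (key h) (key h') <;> refine ⟨?_, ?_, ?_, ?_, ?_, ?_⟩ <;> linarith
  · have key : ∀ {a s}, d.IsMovedPair a₀ b a s → IsLabelPair 0 ρ ((ϑ * (b - p i) - ρ) / 2)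
        (ϑ * (b - p i)) (ϑ * (a₀ - p i) / 2) (ϑ * (a₀ - p i)) ((tipDist D c r - ρ) / 2)
        (tipDist D c r) (r / 2) r (ϑ * (a - p i)) s := by
      rintro a s (⟨z, hz, ha, hs⟩ | ⟨rfl, rfl⟩ | ⟨rfl, rfl⟩)
      · exact Or.inl (hold z hz ha hs)
      · exact Or.inr (Or.inr (Or.inr (Or.inr ⟨rfl, rfl⟩)))
      · exact Or.inr (Or.inr (Or.inl ⟨rfl, rfl⟩))
    refine IsLabelPair.lt_iff ?_ ?_ (key h) (key h') <;> refine ⟨?_, ?_, ?_, ?_, ?_, ?_⟩ <;> linarith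

theorem label_lt_iff (d : PoleCut S D i j c p ρ r ϑ) (hab : d.AreAdmissible a₀ b)
    {a a' : ℝ} {z z' : PRSpace (cut D p r) i}
    (h : d.IsMovedPair a₀ b a (dirHeight (cut D p r) i p ϑ z))
    (h' : d.IsMovedPair a₀ b a' (dirHeight (cut D p r) i p ϑ z')) :
    a < a' ↔ prHeight (cut D p r) i z < prHeight (cut D p r) i z' := by
  have h1 := d.isMovedPair_lt_iff hab h h'
  have h2 := d.isMovedPair_lt_iff hab h' h
  unfold dirHeight at h1 h2
  rcases d.side with h0 | h0
  · rw [h0] at h1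
    simpa using h1
  · rw [h0] at h2
    simpa using h2

theorem isMovedPair_relabel (d : PoleCut S D i j c p ρ r ϑ) {Γ : LabelledDigraph} {v₀ : Γ.V}
    {pt : Γ.V → PRSpace D i} {s : Γ.V → ℝ} (hpt : ∀ v, pt v ∈ prVertices S D i)
    (hl : ∀ v, Γ.label v = prHeight D i (pt v)) (h₀ : s v₀ = r)
    (hs : ∀ v, v ≠ v₀ → s v = dirHeight D i p ϑ (pt v)) (a₀ b : ℝ) (v : Γ.V) :
    d.IsMovedPair a₀ b ((Γ.relabel v₀ a₀).label v) (s v) := by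
  by_cases hv : v = v₀
  · subst hv
    exact Or.inr (Or.inl ⟨Γ.relabel_label_self v a₀, h₀⟩)
  · exact Or.inl ⟨pt v, hpt v, (Γ.relabel_label_of_ne hv a₀).trans (hl v), hs v hv⟩

theorem isomorphic_subdividePair (d : PoleCut S D i j c p ρ r ϑ)
    (W' : PoincareReebGraph (insert ⟨p, r, d.pos⟩ S) (cut D p r) i)
    (hab : d.AreAdmissible a₀ b) {Γ : LabelledDigraph} {V O : Set (PRSpace (cut D p r) i)}
    (B : Γ.Realization (prHeight (cut D p r) i) V O) (hd : Disjoint V O) (hu : V ∪ O = univ)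
    {e₁ e₂ : Γ.E} (hne : e₁ ≠ e₂) {s : ℝ} (h1 : s ∈ Ioo (B.lo e₁) (B.hi e₁))
    (h2 : s ∈ Ioo (B.lo e₂) (B.hi e₂))
    (hV : insert (B.sec e₂ s) (insert (B.sec e₁ s) V) =
      prVertices (insert ⟨p, r, d.pos⟩ S) (cut D p r) i)
    (hs : ∀ e ∈ ({e₁, e₂} : Set Γ.E), dirHeight (cut D p r) i p ϑ (B.sec e s) = tipDist D c r)
    (hl : ∀ v, d.IsMovedPair a₀ b (Γ.label v) (dirHeight (cut D p r) i p ϑ (B.pt v))) :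
    W'.toLabelledDigraph.Isomorphic (Γ.subdividePair e₁ e₂ b b) := by
  obtain ⟨Q, hv1, hv2, hl1, hl2, hv⟩ := B.isMarking_subdividePair hd hne.symm h1 h2 b b
  have key : ∀ v, d.IsMovedPair a₀ b ((Γ.subdividePair e₁ e₂ b b).label v)
      (dirHeight (cut D p r) i p ϑ (Q.pt v)) := by
    intro v
    rcases hv v with rfl | rfl | ⟨w, hw1, hw2⟩
    · exact Or.inr (Or.inr ⟨hl1, by rw [hv1, hs _ (Or.inl rfl)]⟩)
    · exact Or.inr (Or.inr ⟨hl2, by rw [hv2, hs _ (Or.inr rfl)]⟩)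
    · rw [hw1, hw2]
      exact hl w
  refine PoincareReebGraph.isomorphic_of_realization d.isMBC d.ne W' Q
    (Realization.disjoint_mark (Realization.disjoint_mark hd)) ?_ hV fun v w => d.label_lt_iff hab (key v) (key w)
  refine eq_univ_of_forall fun w => ?_
  have hw : w ∈ V ∪ O := by rw [hu]; trivial
  simp only [mem_union, mem_insert_iff, Set.mem_sdiff, mem_singleton_iff] at hw ⊢
  tauto

variable [Nonempty (closure D)] [Nonempty (closure (cut D p r))]

/-- If `D` is inside `c`, the two arcs become new edges that enter the vertex which has moved to
the pole of the new circle. -/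
theorem exists_relocated_arcs (d : PoleCut S D i j c p ρ r ϑ) (hε : sideSign D c = -1)
    {Γ : LabelledDigraph}
    (R : Γ.Realization (dirHeight D i p ϑ) (prVertices S D i) (prVertices S D i)ᶜ)
    (hR : ∀ v, Γ.label v = prHeight D i (R.pt v)) :
    ∃ (v₀ : Γ.V) (e₀ : Γ.E), R.pt v₀ = prAt D i p ∧ Γ.src e₀ = v₀ ∧ Γ.degree v₀ = 1 ∧
      ∀ a₀ b : ℝ, ∃ (V O : Set (PRSpace (cut D p r) i))
        (B : (((Γ.relabel v₀ a₀).addIn v₀ b).addIn (some v₀) b).Realization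
          (dirHeight (cut D p r) i p ϑ) V O),
        Disjoint V O ∧ V ∪ O = univ ∧
        V = prVertices (insert ⟨p, r, d.pos⟩ S) (cut D p r) i ∧
        ∀ w, d.IsMovedPair a₀ b ((((Γ.relabel v₀ a₀).addIn v₀ b).addIn (some v₀) b).label w)
          (dirHeight (cut D p r) i p ϑ (B.pt w)) := by
  obtain ⟨v₀, e₀, V, O, R', hv₀, hsrc, hd, hV, hR1, hR2, h3, -⟩ := d.exists_relocated R
  obtain ⟨htgt, hcov, hnew⟩ := h3 hε
  have htip := (abs_lt.1 d.tip_abs).2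
  have hend : r ∈ Icc (tipDist D c r) r := ⟨htip.le, le_rfl⟩
  refine ⟨v₀, e₀, hv₀, (hsrc e₀).2 rfl, ?_, fun a₀ b => ?_⟩
  · unfold LabelledDigraph.degree
    rw [Set.ncard_eq_one]
    refine ⟨e₀, Set.ext fun e => ?_⟩
    rw [Set.mem_ofPred_eq, hsrc, mem_singleton_iff]
    exact or_iff_left (htgt e)
  set β : ℝ → ℝ → PRSpace (cut D p r) i := fun η σ =>
    prAt (cut D p r) i (arcPt i j p r η (p i + ϑ * σ)) with hβ
  have hβc : ∀ {η : ℝ}, (η = 1 ∨ η = -1) → ContinuousOn (β η) (Icc (tipDist D c r) r) :=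
    fun hη => continuousOn_arc fun s hs => d.arc_mem_cut hη hs
  have hβh : ∀ {η : ℝ}, (η = 1 ∨ η = -1) → ∀ s ∈ Icc (tipDist D c r) r,
      dirHeight (cut D p r) i p ϑ (β η s) = s := fun hη s hs => d.dirHeight_arc_cut hη hs
  have hβr : β 1 r = β (-1) r := by
    rw [hβ]; exact congrArg _ (d.arc_end_eq 1 (-1))
  have hβne : ∀ s ∈ Ico (tipDist D c r) r, β 1 s ≠ β (-1) s := fun s hs =>
    prAt_arcPt_ne d.ne d.pos.le (Or.inl rfl) d.closure_eq
      (by rw [d.abs_dir, abs_lt]; exact ⟨(abs_lt.1 d.tip_abs).1.trans_le hs.1, hs.2⟩)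
      (d.arc_mem (Or.inl rfl) (Ico_subset_Icc_self hs))
      (d.arc_mem (Or.inr rfl) (Ico_subset_Icc_self hs))
  have hbeg : tipDist D c r ∈ Ico (tipDist D c r) r := ⟨le_rfl, htip⟩
  -- equal points on the two arcs have the same height
  have hβne' : ∀ s ∈ Ico (tipDist D c r) r, ∀ s' ∈ Ico (tipDist D c r) r, β 1 s' ≠ β (-1) s := by
    intro s hs s' hs' h
    have h1 := congrArg (dirHeight (cut D p r) i p ϑ) h
    rw [hβh (Or.inl rfl) _ (Ico_subset_Icc_self hs'), hβh (Or.inr rfl) _ (Ico_subset_Icc_self hs)]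
      at h1
    exact hβne s hs (h1 ▸ h)
  obtain ⟨hd₁, R₁, hR₁⟩ := (R'.relabel v₀ a₀).exists_addIn hd v₀ (β 1) hR1 htip
    (hβc (Or.inl rfl)) (hβh (Or.inl rfl)) (fun s hs => hnew 1 (Or.inl rfl) s hs) b
  obtain ⟨hd₂, R₂, hR₂⟩ := R₁.exists_addIn hd₁ (some v₀) (β (-1))
    (by rw [hR₁]; exact hR1.trans hβr) htip (hβc (Or.inr rfl)) (hβh (Or.inr rfl))
    (fun s hs => by
      rintro ((h | h) | (h | ⟨s', hs', h⟩))
      · exact hβne' s hs _ hbeg h.symm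
      · exact hnew (-1) (Or.inr rfl) s hs (Or.inl h)
      · exact hnew (-1) (Or.inr rfl) s hs (Or.inr h)
      · exact hβne' s hs s' (Ioo_subset_Ico_self hs') h) b
  refine ⟨_, _, R₂, hd₂, eq_univ_of_forall fun w => ?_, ?_, ?_⟩
  · rcases hcov w with (h | h) | ⟨η, hη, σ, hσ, rfl⟩
    · exact Or.inl (Or.inr (Or.inr h))
    · exact Or.inr (Or.inl (Or.inl h))
    · rcases hσ.1.eq_or_lt with h | h
      · subst h
        rcases hη with rfl | rfl
        · exact Or.inl (Or.inr (Or.inl rfl))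
        · exact Or.inl (Or.inl rfl)
      · rcases hη with rfl | rfl
        · exact Or.inr (Or.inl (Or.inr ⟨σ, ⟨h, hσ.2⟩, rfl⟩))
        · exact Or.inr (Or.inr ⟨σ, ⟨h, hσ.2⟩, rfl⟩)
  · rw [hV]
    ext w
    simp only [mem_insert_iff, mem_union, mem_singleton_iff, hβ]
    tauto
  · rintro (_ | _ | v)
    · refine Or.inr (Or.inr ⟨rfl, ?_⟩)
      rw [hR₂]
      exact hβh (Or.inr rfl) _ (Ico_subset_Icc_self hbeg)
    · refine Or.inr (Or.inr ⟨rfl, ?_⟩)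
      rw [hR₂]
      show dirHeight _ _ _ _ (R₁.pt none) = _
      rw [hR₁]
      exact hβh (Or.inl rfl) _ (Ico_subset_Icc_self hbeg)
    · have h1 : R₂.pt (some (some v)) = R'.pt v := (hR₂ _).trans (hR₁ _)
      rw [h1]
      exact d.isMovedPair_relabel (s := fun v => dirHeight (cut D p r) i p ϑ (R'.pt v)) R.pt_mem hR
        ((congrArg _ hR1).trans (hβh (Or.inl rfl) _ hend)) hR2 a₀ b v

/-- If `D` is outside `c`, the two edges that run along the arcs are subdivided at the ends of the
arcs. -/
theorem exists_relocated_edges (d : PoleCut S D i j c p ρ r ϑ) (hε : sideSign D c = 1)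
    {Γ : LabelledDigraph}
    (R : Γ.Realization (dirHeight D i p ϑ) (prVertices S D i) (prVertices S D i)ᶜ)
    (hR : ∀ v, Γ.label v = prHeight D i (R.pt v)) :
    ∃ (v₀ : Γ.V) (e₀ e₁ e₂ : Γ.E), R.pt v₀ = prAt D i p ∧ Γ.degree v₀ = 3 ∧ e₁ ≠ e₂ ∧
      Γ.src e₀ = v₀ ∧ Γ.tgt e₁ = v₀ ∧ Γ.tgt e₂ = v₀ ∧
      ∃ (V O : Set (PRSpace (cut D p r) i)) (B : Γ.Realization (dirHeight (cut D p r) i p ϑ) V O),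
        Disjoint V O ∧ V ∪ O = univ ∧
        tipDist D c r ∈ Ioo (B.lo e₁) (B.hi e₁) ∧ tipDist D c r ∈ Ioo (B.lo e₂) (B.hi e₂) ∧
        insert (B.sec e₂ (tipDist D c r)) (insert (B.sec e₁ (tipDist D c r)) V) =
          prVertices (insert ⟨p, r, d.pos⟩ S) (cut D p r) i ∧
        (∀ e ∈ ({e₁, e₂} : Set Γ.E), dirHeight (cut D p r) i p ϑ (B.sec e (tipDist D c r)) =
          tipDist D c r) ∧
        ∀ a₀ b v, d.IsMovedPair a₀ b ((Γ.relabel v₀ a₀).label v)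
          (dirHeight (cut D p r) i p ϑ (B.pt v)) := by
  obtain ⟨v₀, e₀, V, O, R', hv₀, hsrc, hd, hV, hR1, hR2, -, h3⟩ := d.exists_relocated R
  obtain ⟨hu, e₁, e₂, hne, htgt, ⟨hm1, hs1⟩, ⟨hm2, hs2⟩⟩ := h3 hε
  have hend : r ∈ Icc (tipDist D c r) r := ⟨(abs_lt.1 d.tip_abs).2.le, le_rfl⟩
  have h0 : ∀ e, Γ.tgt e = v₀ → e₀ ≠ e := by
    rintro e he rfl
    have := R.lt e₀
    rw [he, (hsrc e₀).2 rfl] at this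
    exact this.false
  have ht1 : Γ.tgt e₁ = v₀ := (htgt e₁).2 (Or.inl rfl)
  have ht2 : Γ.tgt e₂ = v₀ := (htgt e₂).2 (Or.inr rfl)
  refine ⟨v₀, e₀, e₁, e₂, hv₀, ?_, hne, (hsrc e₀).2 rfl, ht1, ht2, V, O, R', hd, hu, hm1, hm2,
    ?_, ?_, fun a₀ b v => ?_⟩
  · unfold LabelledDigraph.degree
    rw [Set.ncard_eq_three]
    refine ⟨e₀, e₁, e₂, h0 e₁ ht1, h0 e₂ ht2, hne, Set.ext fun e => ?_⟩
    rw [Set.mem_ofPred_eq, hsrc, htgt, mem_insert_iff, mem_insert_iff, mem_singleton_iff]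
  · rw [hV, hs1, hs2]
    ext w
    simp only [mem_insert_iff, mem_union, mem_singleton_iff]
    tauto
  · rintro e (rfl | rfl)
    · exact R'.height _ _ (Ioo_subset_Icc_self hm1)
    · exact R'.height _ _ (Ioo_subset_Icc_self hm2)
  · exact d.isMovedPair_relabel (s := fun v => dirHeight (cut D p r) i p ϑ (R'.pt v)) R.pt_mem hR
      ((congrArg _ hR1).trans (d.dirHeight_arc_cut (Or.inl rfl) hend)) hR2 a₀ b v

theorem change_of_pos (d : PoleCut S D i j c p ρ r 1) (W : PoincareReebGraph S D i)
    (W' : PoincareReebGraph (insert ⟨p, r, d.pos⟩ S) (cut D p r) i) :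
    W.ChangePoleDegreeOne (prAt D i p) ρ W'.toLabelledDigraph ∨
      W.ChangePoleDegreeThree (prAt D i p) ρ W'.toLabelledDigraph := by
  have hh : prHeight D i (prAt D i p) = p i := prHeight_prAt d.center_closure
  obtain ⟨R₀, hR₀, -⟩ := W.exists_realization continuous_prHeight
  have hup : ∀ z, dirHeight D i p 1 z = prHeight D i z - p i := fun z => one_mul _
  have hdown : ∀ z, prHeight (cut D p r) i z = dirHeight (cut D p r) i p 1 z - -(p i) := fun z => by
    unfold dirHeight; ring
  have hlab : ∀ v, W.label v = prHeight D i ((R₀.translate (p i) hup).pt v) := fun v => by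
    exact (W.label_eq v).trans (congrArg _ (congrFun hR₀ v).symm)
  rcases sideSign_eq D c with hε | hε
  · right
    obtain ⟨v₀, e₀, e₁, e₂, hv₀, hdeg, hne, hs, ht1, ht2, V, O, B, hd, hu, hm1, hm2, hV, hsec, hl⟩ :=
      d.exists_relocated_edges hε _ hlab
    refine ⟨v₀, e₀, e₁, e₂, (congrFun hR₀ v₀).symm.trans hv₀, hdeg, hne,
      Or.inr ⟨hs, ht1, ht2, fun a₀ b b1 b2 b3 b4 => ?_⟩⟩
    rw [hh] at b1 b2 b3 b4
    have hab : d.AreAdmissible a₀ b :=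
      ⟨by linarith, by linarith, Or.inr ⟨d.tip_neg hε, by linarith, by linarith⟩⟩
    have hmem : ∀ e, tipDist D c r ∈ Ioo (B.lo e) (B.hi e) → tipDist D c r - -(p i) ∈
        Ioo (((B.relabel v₀ a₀).translate (-(p i)) hdown).lo e)
          (((B.relabel v₀ a₀).translate (-(p i)) hdown).hi e) := fun e he => by
      show _ ∈ Ioo (prHeight (cut D p r) i (B.pt _)) (prHeight (cut D p r) i (B.pt _))
      rw [hdown, hdown]
      exact ⟨sub_lt_sub_right he.1 _, sub_lt_sub_right he.2 _⟩
    have hsec' : ∀ e, ((B.relabel v₀ a₀).translate (-(p i)) hdown).sec e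
        (tipDist D c r - -(p i)) = B.sec e (tipDist D c r) := fun e => by
      show B.sec e _ = _
      rw [sub_add_cancel]
    exact d.isomorphic_subdividePair W' hab _ hd hu hne (hmem e₁ hm1) (hmem e₂ hm2)
      ((congrArg₂ (fun z w => insert z (insert w V)) (hsec' e₂) (hsec' e₁)).trans hV)
      (fun e he => (congrArg _ (hsec' e)).trans (hsec e he)) (hl a₀ b)
  · left
    obtain ⟨v₀, e₀, hv₀, hs, hdeg, hB⟩ := d.exists_relocated_arcs hε _ hlab
    refine ⟨v₀, e₀, (congrFun hR₀ v₀).symm.trans hv₀, hdeg, Or.inr ⟨hs, fun a₀ b b1 b2 b3 => ?_⟩⟩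
    rw [hh] at b1 b3
    have hab : d.AreAdmissible a₀ b :=
      ⟨by linarith, by linarith, Or.inl ⟨d.tip_pos hε, by linarith, by linarith⟩⟩
    obtain ⟨V, O, B, hd, hu, hV, hl⟩ := hB a₀ b
    exact PoincareReebGraph.isomorphic_of_realization d.isMBC d.ne W' (B.translate (-(p i)) hdown)
      hd hu hV fun v w => d.label_lt_iff hab (hl v) (hl w)

theorem change_of_neg (d : PoleCut S D i j c p ρ r (-1)) (W : PoincareReebGraph S D i)
    (W' : PoincareReebGraph (insert ⟨p, r, d.pos⟩ S) (cut D p r) i) :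
    W.ChangePoleDegreeOne (prAt D i p) ρ W'.toLabelledDigraph ∨
      W.ChangePoleDegreeThree (prAt D i p) ρ W'.toLabelledDigraph := by
  have hh : prHeight D i (prAt D i p) = p i := prHeight_prAt d.center_closure
  obtain ⟨R₀, hR₀, -⟩ := W.exists_realization continuous_prHeight
  have hup : ∀ z, dirHeight D i p (-1) z = p i - prHeight D i z := fun z => by
    unfold dirHeight; ring
  have hdown : ∀ z, prHeight (cut D p r) i z = p i - dirHeight (cut D p r) i p (-1) z := fun z => by
    unfold dirHeight; ring
  have hlab : ∀ v, W.reverse.label v = prHeight D i ((R₀.reflect (p i) hup).pt v) := fun v => by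
    exact (W.label_eq v).trans (congrArg _ (congrFun hR₀ v).symm)
  rcases sideSign_eq D c with hε | hε
  · right
    obtain ⟨v₀, e₀, e₁, e₂, hv₀, hdeg, hne, hs, ht1, ht2, V, O, B, hd, hu, hm1, hm2, hV, hsec, hl⟩ :=
      d.exists_relocated_edges hε _ hlab
    have hdeg := (degree_reverse W.toLabelledDigraph v₀).symm.trans hdeg
    refine ⟨v₀, e₀, e₁, e₂, (congrFun hR₀ v₀).symm.trans hv₀, hdeg, hne,
      Or.inl ⟨hs, ht1, ht2, fun a₀ b b1 b2 b3 b4 => ?_⟩⟩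
    rw [hh] at b1 b2 b3 b4
    have hab : d.AreAdmissible a₀ b :=
      ⟨by linarith, by linarith, Or.inr ⟨d.tip_neg hε, by linarith, by linarith⟩⟩
    let Q : (W.relabel v₀ a₀).Realization (prHeight (cut D p r) i) V O :=
      (B.relabel v₀ a₀).reflect (p i) hdown
    have hmem : ∀ e, tipDist D c r ∈ Ioo (B.lo e) (B.hi e) → p i - tipDist D c r ∈
        Ioo (Q.lo e) (Q.hi e) := fun e he => by
      show _ ∈ Ioo (prHeight (cut D p r) i (B.pt _)) (prHeight (cut D p r) i (B.pt _))
      rw [hdown, hdown]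
      exact ⟨sub_lt_sub_left he.2 _, sub_lt_sub_left he.1 _⟩
    have hsec' : ∀ e, Q.sec e (p i - tipDist D c r) = B.sec e (tipDist D c r) := fun e => by
      show B.sec e _ = _
      rw [sub_sub_cancel]
    exact d.isomorphic_subdividePair W' hab Q hd hu hne (hmem e₁ hm1) (hmem e₂ hm2)
      ((congrArg₂ (fun z w => insert z (insert w V)) (hsec' e₂) (hsec' e₁)).trans hV)
      (fun e he => (congrArg _ (hsec' e)).trans (hsec e he)) (hl a₀ b)
  · left
    obtain ⟨v₀, e₀, hv₀, hs, hdeg, hB⟩ := d.exists_relocated_arcs hε _ hlab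
    have hdeg := (degree_reverse W.toLabelledDigraph v₀).symm.trans hdeg
    refine ⟨v₀, e₀, (congrFun hR₀ v₀).symm.trans hv₀, hdeg, Or.inl ⟨hs, fun a₀ b b1 b2 b3 => ?_⟩⟩
    rw [hh] at b1 b3
    have hab : d.AreAdmissible a₀ b :=
      ⟨by linarith, by linarith, Or.inl ⟨d.tip_pos hε, by linarith, by linarith⟩⟩
    obtain ⟨V, O, B, hd, hu, hV, hl⟩ := hB a₀ b
    let Q : (((W.relabel v₀ a₀).addOut v₀ b).addOut (some v₀) b).Realization
      (prHeight (cut D p r) i) V O := B.reflect (p i) hdown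
    exact PoincareReebGraph.isomorphic_of_realization d.isMBC d.ne W' Q hd hu hV
      fun v w => d.label_lt_iff hab (hl v) (hl w)

end PoleCut

/-! ### Small discs -/

namespace IsMBC

variable {S : Set PlaneCircle} {D : Set Plane} {i j : Fin 2} {c : PlaneCircle} {p : Plane} {ρ r : ℝ}

/-- The radii below `ρ` are small enough for all the changes of the V-digraph. -/
theorem exists_scale (h : IsMBC S D) (hij : i ≠ j) (hc : c ∈ S) (hp : p ∈ c.carrier)
    (hpD : p ∈ closure D) (huniq : ∀ d ∈ S, p ∈ d.carrier → d = c) :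
    ∃ ρ, IsSmall S D c p ρ ∧
      (∀ z ∈ prVertices S D i, |prHeight D i z - p i| < ρ → prHeight D i z = p i) ∧
      (¬ c.IsPole i p → ∃ η : ℝ, (η = 1 ∨ η = -1) ∧
        0 < η * (sideSign D c * (p j - c.center j)) ∧ UpSlices D i (p i) (p j) ρ η) := by
  obtain ⟨ρ₁, h1⟩ := h.exists_isSmall hpD huniq
  obtain ⟨ρ₂, h2p, h2⟩ : ∃ ρ > 0, ∀ z ∈ prVertices S D i, |prHeight D i z - p i| < ρ →
      prHeight D i z = p i := by
    have : ∀ᶠ ρ : ℝ in 𝓝[>] 0, ∀ z ∈ prVertices S D i, |prHeight D i z - p i| < ρ →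
        prHeight D i z = p i := by
      refine (eventually_all_finite (finite_prVertices h.finite D i)).2 fun z _ => ?_
      by_cases hz : prHeight D i z - p i = 0
      · exact Eventually.of_forall fun _ _ => sub_eq_zero.1 hz
      · filter_upwards [nhdsWithin_le_nhds (Iio_mem_nhds (abs_pos.2 hz))] with ρ hρ hlt
        exact absurd (hlt.trans hρ) (lt_irrefl _)
    obtain ⟨ρ, hρ, hρ0⟩ := (this.and self_mem_nhdsWithin).exists
    exact ⟨ρ, hρ0, hρ⟩
  obtain ⟨ρ₃, h3p, h3⟩ : ∃ ρ > 0, ¬ c.IsPole i p → ∃ η : ℝ, (η = 1 ∨ η = -1) ∧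
      0 < η * (sideSign D c * (p j - c.center j)) ∧ UpSlices D i (p i) (p j) ρ η := by
    by_cases hpole : c.IsPole i p
    · exact ⟨1, one_pos, fun hn => absurd hpole hn⟩
    have hB : sideSign D c * (p j - c.center j) ≠ 0 := mul_ne_zero (sideSign_ne_zero D c)
      fun h0 => hpole ((PlaneCircle.isPole_iff hij c p).2 ⟨hp, by linarith⟩)
    obtain ⟨η, hη, hpos⟩ : ∃ η : ℝ, (η = 1 ∨ η = -1) ∧
        0 < η * (sideSign D c * (p j - c.center j)) := by
      rcases lt_or_gt_of_ne hB with hB | hB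
      · exact ⟨-1, Or.inr rfl, by linarith⟩
      · exact ⟨1, Or.inl rfl, by linarith⟩
    obtain ⟨ρ, hρ, hup⟩ := h.exists_upSlices hij hc (t := p i) (y₀ := p j)
      (by rwa [pnt_eta hij]) (by rwa [pnt_eta hij]) hη hpos
    exact ⟨ρ, hρ, fun _ => ⟨η, hη, hpos, hup⟩⟩
  have le1 : min ρ₁ (min ρ₂ ρ₃) ≤ ρ₁ := min_le_left _ _
  have le2 : min ρ₁ (min ρ₂ ρ₃) ≤ ρ₂ := (min_le_right _ _).trans (min_le_left _ _)
  have le3 : min ρ₁ (min ρ₂ ρ₃) ≤ ρ₃ := (min_le_right _ _).trans (min_le_right _ _)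
  refine ⟨min ρ₁ (min ρ₂ ρ₃), h1.mono (lt_min h1.pos (lt_min h2p h3p)) le1,
    fun z hz hlt => h2 z hz (hlt.trans_le le2), fun hn => ?_⟩
  obtain ⟨η, hη, hpos, hup⟩ := h3 hn
  exact ⟨η, hη, hpos, fun s y y' hs hy hy' =>
    hup s y y' (hs.trans_le le3) (hy.trans_le le3) (hy'.trans_le le3)⟩

theorem change_pole [Nonempty (closure D)] (h : IsMBC S D) (hij : i ≠ j) (hc : c ∈ S)
    (hp : p ∈ c.carrier) (hpD : p ∈ closure D) (hs : IsSmall S D c p ρ)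
    (gap : ∀ z ∈ prVertices S D i, |prHeight D i z - p i| < ρ → prHeight D i z = p i)
    (hpole : c.IsPole i p)
    (halone : ∀ x ∈ levelComponent D i p, x ≠ p → ¬ IsCrossing S x ∧ ∀ d ∈ S, ¬ d.IsPole i x)
    (hr : 0 < r) (hrρ : r < ρ) (W : PoincareReebGraph S D i)
    (W' : PoincareReebGraph (insert ⟨p, r, hr⟩ S) (cut D p r) i) :
    W.ChangePoleDegreeOne (prAt D i p) ρ W'.toLabelledDigraph ∨
      W.ChangePoleDegreeThree (prAt D i p) ρ W'.toLabelledDigraph := by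
  have := (h.isMBC_cut hij hc hp hpD hs hr hrρ).nonempty_closure
  have hd : ∀ ϑ : ℝ, (ϑ = 1 ∨ ϑ = -1) → sideSign D c * (p i - c.center i) = ϑ * c.radius →
      PoleCut S D i j c p ρ r ϑ := fun ϑ hϑ hn =>
    { mbc := h, ne := hij, circle_mem := hc, center_mem := hp, center_closure := hpD
      pole := hpole, small := hs, gap := gap, side := hϑ, normal := hn, pos := hr, lt := hrρ
      alone := fun x hx hxi hconn hxp => by
        have h1 : prMk D i ⟨p, hpD⟩ = prMk D i ⟨x, hx⟩ := (prMk_eq_iff hij _ _).2 ⟨hxi.symm, hconn⟩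
        have h2 : levelComponent D i p = levelComponent D i x := Quotient.exact h1
        have h3 : x ∈ levelComponent D i p := by
          rw [h2]; exact mem_connectedComponentIn ⟨hx, rfl⟩
        obtain ⟨h4, h5⟩ := halone x h3 hxp
        rintro (⟨d, hd, h6⟩ | h6)
        · exact h5 d hd h6
        · exact h4 h6 }
  have hcoord : p i - c.center i = c.radius ∨ p i - c.center i = -c.radius := by
    rcases hpole with h | h <;> rw [h]
    · left; simp
    · right; simp
  rcases sideSign_eq D c with hε | hε <;> rcases hcoord with h0 | h0
  · exact (hd 1 (Or.inl rfl) (by rw [hε, h0])).change_of_pos W W'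
  · exact (hd (-1) (Or.inr rfl) (by rw [hε, h0]; ring)).change_of_neg W W'
  · exact (hd (-1) (Or.inr rfl) (by rw [hε, h0])).change_of_neg W W'
  · exact (hd 1 (Or.inl rfl) (by rw [hε, h0]; ring)).change_of_pos W W'

end IsMBC

theorem theorem2 (i j : Fin 2) (hij : i ≠ j) (S : Set PlaneCircle) (D : Set Plane)
    (hSD : IsMBC S D) (c : PlaneCircle) (hc : c ∈ S) (p : Plane) (hpc : p ∈ c.carrier)
    (hpD : p ∈ closure D) (huniq : ∀ d ∈ S, p ∈ d.carrier → d = c) :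
    Nonempty (PoincareReebGraph S D i) ∧
    ∀ W : PoincareReebGraph S D i, ∃ δ : ℝ, 0 < δ ∧ ∀ (r : ℝ) (hr : 0 < r), r < δ →
      IsMBC (insert ⟨p, r, hr⟩ S) (D \ Metric.closedBall p r) ∧
      Nonempty (PoincareReebGraph (insert ⟨p, r, hr⟩ S) (D \ Metric.closedBall p r) i) ∧
      ∀ W' : PoincareReebGraph (insert ⟨p, r, hr⟩ S) (D \ Metric.closedBall p r) i,
        -- the centre is not a pole
        (¬ c.IsPole i p → ¬ c.IsPole j p →
          (prMk D i ⟨p, hpD⟩ ∉ prVertices S D i →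
            W.ChangeGenericEdge (prMk D i ⟨p, hpD⟩) δ W'.toLabelledDigraph) ∧
          (prMk D i ⟨p, hpD⟩ ∈ prVertices S D i →
            W.ChangeGenericVertex (prMk D i ⟨p, hpD⟩) δ W'.toLabelledDigraph)) ∧
        -- the centre is a pole for the coordinate `i`, alone in its level component
        (c.IsPole i p →
          (∀ x ∈ levelComponent D i p, x ≠ p →
            ¬ IsCrossing S x ∧ ∀ d ∈ S, ¬ d.IsPole i x) →
          W.ChangePoleDegreeOne (prMk D i ⟨p, hpD⟩) δ W'.toLabelledDigraph ∨
          W.ChangePoleDegreeThree (prMk D i ⟨p, hpD⟩) δ W'.toLabelledDigraph) ∧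
        -- the centre is a pole for the other coordinate
        (c.IsPole j p →
          (prMk D i ⟨p, hpD⟩ ∉ prVertices S D i →
            W.ChangeOtherPoleEdge (prMk D i ⟨p, hpD⟩) δ W'.toLabelledDigraph ∨
            W.ChangeOtherPoleEdgeBranch (prMk D i ⟨p, hpD⟩) δ W'.toLabelledDigraph) ∧
          (prMk D i ⟨p, hpD⟩ ∈ prVertices S D i →
            W.ChangeOtherPoleVertex (prMk D i ⟨p, hpD⟩) δ W'.toLabelledDigraph ∨
            W.ChangeOtherPoleVertexBranch (prMk D i ⟨p, hpD⟩) δ W'.toLabelledDigraph)) := by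
  have := hSD.nonempty_closure
  refine ⟨hSD.nonempty_poincareReebGraph hij, fun W => ?_⟩
  obtain ⟨ρ, hs, gap, hup⟩ := hSD.exists_scale hij hc hpc hpD huniq
  refine ⟨ρ, hs.pos, fun r hr hrρ => ?_⟩
  have hM := hSD.isMBC_cut hij hc hpc hpD hs hr hrρ
  refine ⟨hM, hM.nonempty_poincareReebGraph hij, fun W' => ?_⟩
  rw [← prAt_of_mem hpD]
  refine ⟨fun hi hj => ?_, fun hi halone => ?_, fun hj => ?_⟩
  · obtain ⟨η, hη, hB, hu⟩ := hup hi
    exact hSD.change_generic hij hc hpc hpD hs gap hu hη hB hr hrρ hj W W'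
  · exact hSD.change_pole hij hc hpc hpD hs gap hi halone hr hrρ W W'
  · -- the two kinds of poles are disjoint
    have hi : ¬ c.IsPole i p := by
      intro hi
      have h1 := ((PlaneCircle.isPole_iff hij c p).1 hi).2
      have h2 := ((PlaneCircle.isPole_iff hij.symm c p).1 hj).2
      have h3 : p = c.center := plane_ext hij h2 h1
      have h4 : dist p c.center = c.radius := hpc
      rw [h3, dist_self] at h4
      exact c.radius_pos.ne h4
    obtain ⟨η, hη, hB, hu⟩ := hup hi
    exact hSD.change_other_pole hij hc hpc hpD hs gap hu hη hB hr hrρ hj W W'
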